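/- **Setting.** Let $g\in C^\infty(\mathbb R)$ be odd and $2\pi$-periodic with $g(0)=g(\pi)=0$, $g>0$ on $(0,\pi)$, $g'(0)=1$, $g'(\pi)=-1$, and put $f=gg'$. Let $\Lambda=y\partial_y$, let $Q$ be the solution of $\Lambda Q=g(Q)$ on $(0,\infty)$ with $Q(0)=0$, $Q\to\pi$ at infinity, scaled so that $Q(y)=\pi-\frac2y+o(\frac1y)$. Let $(u,v)=\int_0^\infty uv\,y\,dy$ and $\int u=\int_0^\infty u\,y\,dy$. Let $H=-\partial_y^2-\frac1y\partial_y+\frac{f'(Q)}{y^2}$, $\Gamma(y)=\Lambda Q(y)\int_1^y\frac{dx}{x(\Lambda Q(x))^2}$, and $H^{-1}F=-\Gamma\int_0^yF\,\Lambda Q\,x\,dx+\Lambda Q\int_0^yF\,\Gamma\,x\,dx$. Let $\chi$ be a smooth nonincreasing cut-off with $\chi=1$ on $y\le1$ and $\chi=0$ on $y\ge2$, $\chi_B(y)=\chi(y/B)$. For $b_1>0$ let $B_0=b_1^{-1/2}$, $B_1=|\log b_1|\,b_1^{-1/2}$, and $$c_{b_1}=\frac4{\int\chi_{B_0/4}(\Lambda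 Q)^2},\qquad d_{b_1}=c_{b_1}\int_0^{B_0}\chi_{B_0/4}\,\Lambda Q\,\Gamma\,y\,dy,\qquad \Sigma_{b_1}=H^{-1}\{-c_{b_1}\chi_{B_0/4}\Lambda Q+d_{b_1}H[(1-\chi_{B_0})\Lambda Q]\}.$$ **Profile.** Fix an integer $L\ge1$ and write $b=(b_1,\dots,b_L)$, $b_i=0$ for $i>L$. Let $T_i=(-1)^iH^{-i}\Lambda Q$ and $\Theta_i=\Lambda T_i-(2i-1)T_i-(-1)^{i+1}H^{-i+1}\Sigma_{b_1}$. Define $S_1=0$ and, for $1\le i\le L+1$, $S_{i+1}=-H^{-1}\Phi_{i+1}$ with $$\Phi_{i+1}=b_1b_i\Theta_i+b_1\Lambda S_i+\frac{P_{i+1}}{y^2}-\sum_{j=1}^{i-1}\big((2j-1+c_{b_1})b_1b_j-b_{j+1}\big)\frac{\partial S_i}{\partial b_j},$$ where $P_m$ is the part of weight $m$ of $\sum_{j=2}^{L+2}\frac{f^{(j)}(Q)}{j!}\big(\sum_{k=1}^Lb_kT_k+\sum_{k=2}^{L+2}S_k\big)^j$ when $b_kT_k$ and $S_k$ are given weight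 $k$ (only $S_1,\dots,S_i$ enter $P_{i+1}$). Let $\tilde Q_b=Q+\chi_{B_1}\big(\sum_{i=1}^Lb_iT_i+\sum_{i=2}^{L+2}S_i\big)$. For $M>0$ let $\Phi_M=\sum_{p=0}^Lc_{p,M}H^p(\chi_M\Lambda Q)$ with $c_{0,M}=1$ and $$c_{k,M}=(-1)^{k+1}\frac{\sum_{p=0}^{k-1}c_{p,M}(H^p(\chi_M\Lambda Q),T_k)}{(\chi_M\Lambda Q,\Lambda Q)},\qquad 1\le k\le L.$$ **Trapped regime.** Let $c_1=\frac L{2L-1}$, $c_{k+1}=-\frac{L-k}{2L-1}c_k$, $d_1=-\frac{2L}{(2L-1)^2}$, $d_{k+1}=-\frac{L-k}{2L-1}d_k+\frac{4L(L-k)}{(2L-1)^2}c_k$, and $b_k^e(s)=\frac{c_k}{s^k}+\frac{d_k}{s^k\log s}$ for $1\le k\le L$. Let $A_L$ be the $L\times L$ matrix $(A_LU)_k=-(2k-1)c_kU_1+\frac{L-k}{2L-1}U_k+U_{k+1}$ ($U_{L+1}=0$) and let $P_L$ be a fixed invertible matrix with $P_LA_LP_L^{-1}=\mathrm{diag}(-1,\frac2{2L-1},\frac3{2L-1},\dots,\frac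 L{2L-1})$. Given $M,K,s_0>0$, a trapped solution is a smooth solution $u(t,r)$, with smooth odd extension in $r$, of $$\partial_tu-\partial_r^2u-\frac{\partial_ru}r+\frac{f(u)}{r^2}=0\quad\text{on }[0,T)\times(0,\infty),$$ together with $C^1$ functions $b:[0,T)\to\mathbb R^L$ and $\lambda:[0,T)\to(0,\infty)$ such that, with $$u(t,r)=(\tilde Q_{b(t)}+\varepsilon(t,\cdot))\Big(\frac r{\lambda(t)}\Big),\qquad s(t)=s_0+\int_0^t\frac{d\tau}{\lambda^2(\tau)},\qquad \mathcal E_{2k}=\int|H^k\varepsilon|^2,$$ $b_k=b_k^e(s)+\frac{U_k}{s^k(\log s)^{5/4}}$ and $V=P_LU$, the following hold at every time: $(\varepsilon,H^k\Phi_M)=0$ for $0\le k\le L$; $\int|\partial_y\varepsilon|^2+\int|\varepsilon/y|^2\le10\,b_1(t=0)^{1/4}$; $\mathcal E_{2k}\le b_1^{(2k-1)\frac{2L}{2L-1}}|\log b_1|^K$ for $1\le k\le L$; $\mathcal E_{2L+2}\le K\frac{b_1^{2L+2}}{|\log b_1|^2}$; $|V_1|\le2$ and $\sum_{i=2}^LV_i^2\le4$.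 **Lemma (improved control of $b_L$).** There are $\delta_0,M_0,C_0>0$ such that for all $0<\delta<\delta_0$ and $M\ge M_0$ there is $C=C(M,\delta)>0$ such that for every $K>0$ and all $s_0$ large enough (depending on $\delta,M,K$) the following holds for every trapped solution, at every time. All constants may also depend on $L,g,\chi,P_L$. Put $$\tilde b_L=b_L+\frac{(-1)^L(H^L\varepsilon,\chi_{B_\delta}\Lambda Q)}{4\delta|\log b_1|},\qquad B_\delta=b_1^{-\delta}=B_0^{2\delta}.$$ Then $$|\tilde b_L-b_L|\le C_0\,b_1^{L+\frac12},$$ and $\tilde b_L$ is differentiable in $s$ with $$\left|(\tilde b_L)_s+(2L-1+c_{b_1})b_1\tilde b_L\right|\le\frac{C}{\sqrt{|\log b_1|}}\left[\sqrt{\mathcal E_{2L+2}}+\frac{b_1^{L+1}}{|\log b_1|}\right].$$ -/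

import Mathlib

open Set Filter Topology MeasureTheory
open scoped ContDiff

noncomputable section

namespace HeatFlow

/-- The function `g` generating the target surface of revolution: smooth, odd, `2π`-periodic,
`g(0) = g(π) = 0`, `g > 0` on `(0, π)`, `g'(0) = 1`, `g'(π) = -1`. -/
structure IsTargetProfile (g : ℝ → ℝ) : Prop where
  smooth : ContDiff ℝ ∞ g
  odd : ∀ u, g (-u) = -g u
  periodic : ∀ u, g (u + 2 * Real.pi) = g u
  map_zero : g 0 = 0
  map_pi : g Real.pi = 0
  pos : ∀ u, 0 < u → u < Real.pi → 0 < g u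
  deriv_zero : deriv g 0 = 1
  deriv_pi : deriv g Real.pi = -1

/-- The degree one harmonic map: the solution of `y Q' = g(Q)` on `(0, ∞)` with `Q(0) = 0` and
`Q → π` at infinity. It is unique up to scaling, and the scaling is fixed by
`Q(y) = π - 2 / y + o(1 / y)`. Values at negative arguments play no role. -/
structure IsGroundState (g Q : ℝ → ℝ) : Prop where
  ode : ∀ y, 0 < y → HasDerivAt Q (g (Q y) / y) y
  map_zero : Q 0 = 0
  tendsto_zero : Tendsto Q (𝓝[>] 0) (𝓝 0)
  tendsto_pi : Tendsto Q atTop (𝓝 Real.pi)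
  normalized : Tendsto (fun y => y * (Real.pi - Q y)) atTop (𝓝 2)

/-- A smooth nonincreasing cut-off, equal to `1` on `y ≤ 1` and to `0` on `y ≥ 2`. -/
structure IsCutoff (χ : ℝ → ℝ) : Prop where
  smooth : ContDiff ℝ ∞ χ
  antitone : Antitone χ
  eq_one : ∀ y, y ≤ 1 → χ y = 1
  eq_zero : ∀ y, 2 ≤ y → χ y = 0

/-- The rescaled cut-off `χ_B(y) = χ(y / B)`. -/
def cut (χ : ℝ → ℝ) (B y : ℝ) : ℝ := χ (y / B)

/-- The scaling generator `Λf = y ∂_y f`. -/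
def Lam (f : ℝ → ℝ) (y : ℝ) : ℝ := y * deriv f y

/-- The nonlinearity `f = g g'` of the flow. -/
def nonlin (g : ℝ → ℝ) (u : ℝ) : ℝ := g u * deriv g u

/-- The radial pairing `(u, v) = ∫_0^∞ u v y dy`. -/
def pair (u v : ℝ → ℝ) : ℝ := ∫ y in Ioi (0 : ℝ), u y * v y * y

/-- The linearized operator `H = -∂_y² - ∂_y / y + f'(Q) / y²`. -/
def H (g Q u : ℝ → ℝ) (y : ℝ) : ℝ :=
  -deriv (deriv u) y - deriv u y / y + deriv (nonlin g) (Q y) / y ^ 2 * u y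

/-- The second (singular at the origin) element `Γ` of the kernel of `H`. -/
def Gam (Q : ℝ → ℝ) (y : ℝ) : ℝ :=
  Lam Q y * ∫ x in (1 : ℝ)..y, 1 / (x * Lam Q x ^ 2)

/-- The inverse of `H` given by
`H⁻¹f = -Γ(y) ∫_0^y f ΛQ x dx + ΛQ(y) ∫_0^y f Γ x dx`. -/
def Hinv (Q f : ℝ → ℝ) (y : ℝ) : ℝ :=
  -Gam Q y * (∫ x in (0 : ℝ)..y, f x * Lam Q x * x)
    + Lam Q y * ∫ x in (0 : ℝ)..y, f x * Gam Q x * x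

/-- `T_i = (-1)^i H^{-i} ΛQ`, so that `T_0 = ΛQ` and `H T_{i+1} = -T_i`. -/
def T (Q : ℝ → ℝ) (i : ℕ) (y : ℝ) : ℝ := (-1) ^ i * (Hinv Q)^[i] (Lam Q) y

def B0 (b₁ : ℝ) : ℝ := 1 / √b₁

def B1 (b₁ : ℝ) : ℝ := |Real.log b₁| / √b₁

/-- `c_{b₁} = 4 / ∫ χ_{B₀/4} (ΛQ)²`. -/
def cb (Q χ : ℝ → ℝ) (b₁ : ℝ) : ℝ :=
  4 / ∫ y in Ioi (0 : ℝ), cut χ (B0 b₁ / 4) y * Lam Q y ^ 2 * y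

/-- `d_{b₁} = c_{b₁} ∫_0^{B₀} χ_{B₀/4} ΛQ Γ y dy`. -/
def db (Q χ : ℝ → ℝ) (b₁ : ℝ) : ℝ :=
  cb Q χ b₁ * ∫ y in (0 : ℝ)..B0 b₁, cut χ (B0 b₁ / 4) y * Lam Q y * Gam Q y * y

/-- The radiation `Σ_{b₁} = H⁻¹{-c_{b₁} χ_{B₀/4} ΛQ + d_{b₁} H[(1 - χ_{B₀}) ΛQ]}`. -/
def radiation (g Q χ : ℝ → ℝ) (b₁ : ℝ) : ℝ → ℝ :=
  Hinv Q fun y =>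
    -cb Q χ b₁ * cut χ (B0 b₁ / 4) y * Lam Q y
      + db Q χ b₁ * H g Q (fun x => (1 - cut χ (B0 b₁) x) * Lam Q x) y

/-- `Θ_i = ΛT_i - (2i-1) T_i - (-1)^{i+1} H^{-(i-1)} Σ_{b₁}`, for `i ≥ 1`. -/
def Theta (g Q χ : ℝ → ℝ) (i : ℕ) (b₁ y : ℝ) : ℝ :=
  Lam (T Q i) y - (2 * (i : ℝ) - 1) * T Q i y
    - (-1) ^ (i + 1) * (Hinv Q)^[i - 1] (radiation g Q χ b₁) y

/-- The component `b_i` of `b = (b_1, …, b_L)`, with `b_i = 0` unless `1 ≤ i ≤ L`. -/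
def par {L : ℕ} (b : Fin L → ℝ) (i : ℕ) : ℝ :=
  if h : 1 ≤ i ∧ i ≤ L then b ⟨i - 1, by omega⟩ else 0

/-- The partial derivative of `S(b, y)` in the parameter with (zero-based) index `j`,
that is `∂S / ∂b_{j+1}`. -/
def parDeriv {L : ℕ} (S : (Fin L → ℝ) → ℝ → ℝ) (j : Fin L) (b : Fin L → ℝ) (y : ℝ) : ℝ :=
  deriv (fun x => S (Function.update b j x) y) (b j)

/-- The part `P_i` of weight `i` of the Taylor polynomial
`∑_{j=2}^{L+2} f^{(j)}(Q) / j! (∑_k b_k T_k + ∑_k S_k)^j`, where `b_k T_k` and `S_k` have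
weight `k`: the weight is recorded by the power of the indeterminate. -/
def taylorPart (g Q : ℝ → ℝ) {L : ℕ} (S : ℕ → (Fin L → ℝ) → ℝ → ℝ) (i : ℕ)
    (b : Fin L → ℝ) (y : ℝ) : ℝ :=
  ∑ j ∈ Finset.Icc 2 (L + 2), iteratedDeriv j (nonlin g) (Q y) / (Nat.factorial j : ℝ) *
    ((∑ k ∈ Finset.Icc 1 (L + 2),
      Polynomial.C (par b k * T Q k y + S k b y) * Polynomial.X ^ k) ^ j).coeff i

/-- The source term `Φ_{i+1}`, for `1 ≤ i ≤ L + 1`, built on the profiles `S_1, …, S_i`: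
`Φ_{i+1} = b_1 b_i Θ_i + b_1 ΛS_i + P_{i+1} / y²
  - ∑_{1 ≤ j < i, j ≤ L} ((2j - 1 + c_{b₁}) b_1 b_j - b_{j+1}) ∂S_i / ∂b_j`.
For `i = L + 1` the first term vanishes since `b_{L+1} = 0`. -/
def source (g Q χ : ℝ → ℝ) {L : ℕ} (S : ℕ → (Fin L → ℝ) → ℝ → ℝ) (i : ℕ)
    (b : Fin L → ℝ) (y : ℝ) : ℝ :=
  par b 1 * par b i * Theta g Q χ i (par b 1) y + par b 1 * Lam (S i b) y
    + taylorPart g Q S (i + 1) b y / y ^ 2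
    - ∑ j : Fin L, if (j : ℕ) + 1 < i then
        ((2 * ((j : ℝ) + 1) - 1 + cb Q χ (par b 1)) * par b 1 * par b (j + 1) - par b (j + 2))
          * parDeriv (S i) j b y
      else 0

/-- `profiles n` holds `S_1, …, S_n` (and `0` at the other indices), where `S_1 = 0` and
`S_{i+1} = -H⁻¹ Φ_{i+1}` for `i ≥ 1`. -/
def profiles (g Q χ : ℝ → ℝ) (L : ℕ) : ℕ → ℕ → (Fin L → ℝ) → ℝ → ℝ
  | 0 => fun _ _ _ => 0
  | 1 => fun _ _ _ => 0
  | n + 2 => Function.update (profiles g Q χ L (n + 1)) (n + 2) fun b y =>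
      -Hinv Q (source g Q χ (profiles g Q χ L (n + 1)) (n + 1) b) y

/-- The profile `S_i(b, y)`. -/
def S (g Q χ : ℝ → ℝ) (L i : ℕ) (b : Fin L → ℝ) (y : ℝ) : ℝ := profiles g Q χ L i i b y

/-- The localized approximate profile
`Q̃_b = Q + χ_{B₁} (∑_{i=1}^L b_i T_i + ∑_{i=2}^{L+2} S_i)`. -/
def Qloc (g Q χ : ℝ → ℝ) {L : ℕ} (b : Fin L → ℝ) (y : ℝ) : ℝ :=
  Q y + cut χ (B1 (par b 1)) y *
    (∑ i ∈ Finset.Icc 1 L, par b i * T Q i y + ∑ i ∈ Finset.Icc 2 (L + 2), S g Q χ L i b y)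

/-- The coefficients `c_{k,M}` of `Φ_M`: `c_{0,M} = 1` and, for `k ≥ 1`,
`c_{k,M} = (-1)^{k+1} ∑_{p<k} c_{p,M} (H^p(χ_M ΛQ), T_k) / (χ_M ΛQ, ΛQ)`. -/
def coefM (g Q χ : ℝ → ℝ) (M : ℝ) : ℕ → ℝ
  | 0 => 1
  | k + 1 => (-1) ^ (k + 2) *
      (∑ p : Fin (k + 1), coefM g Q χ M p *
        pair ((H g Q)^[p] fun y => cut χ M y * Lam Q y) (T Q (k + 1)))
      / pair (fun y => cut χ M y * Lam Q y) (Lam Q)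
  decreasing_by exact p.2

/-- The direction `Φ_M = ∑_{p=0}^L c_{p,M} H^p(χ_M ΛQ)`. -/
def PhiM (g Q χ : ℝ → ℝ) (L : ℕ) (M y : ℝ) : ℝ :=
  ∑ p ∈ Finset.range (L + 1), coefM g Q χ M p * (H g Q)^[p] (fun x => cut χ M x * Lam Q x) y

/-- `c_1 = L / (2L-1)`, `c_{k+1} = -(L-k) / (2L-1) c_k` (zero-based index: `seqC L k` is
`c_{k+1}`). -/
def seqC (L : ℕ) : ℕ → ℝ
  | 0 => (L : ℝ) / (2 * L - 1)
  | k + 1 => -((L : ℝ) - (k + 1)) / (2 * L - 1) * seqC L k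

/-- `d_1 = -2L / (2L-1)²`, `d_{k+1} = -(L-k) / (2L-1) d_k + 4L(L-k) / (2L-1)² c_k`
(zero-based index: `seqD L k` is `d_{k+1}`). -/
def seqD (L : ℕ) : ℕ → ℝ
  | 0 => -(2 * (L : ℝ)) / (2 * L - 1) ^ 2
  | k + 1 => -((L : ℝ) - (k + 1)) / (2 * L - 1) * seqD L k
      + 4 * L * ((L : ℝ) - (k + 1)) / (2 * L - 1) ^ 2 * seqC L k

/-- The approximate solution `b_k^e(s) = c_k / s^k + d_k / (s^k log s)` of the modulation system
(zero-based index: component `k` is `b_{k+1}^e`). -/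
def bExact (L : ℕ) (s : ℝ) (k : Fin L) : ℝ :=
  seqC L k / s ^ ((k : ℕ) + 1) + seqD L k / (s ^ ((k : ℕ) + 1) * Real.log s)

/-- The matrix `A_L` of the linearization of the modulation system around `b^e`:
`(A_L U)_k = (L-k) / (2L-1) U_k + U_{k+1} - (2k-1) c_k U_1`. -/
def matA (L : ℕ) : Matrix (Fin L) (Fin L) ℝ := fun i j =>
  (if i = j then ((L : ℝ) - ((i : ℝ) + 1)) / (2 * L - 1) else 0)
    + (if (j : ℕ) = i + 1 then 1 else 0)
    - (if (j : ℕ) = 0 then (2 * ((i : ℝ) + 1) - 1) * seqC L i else 0)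

/-- `D_L = diag(-1, 2 / (2L-1), 3 / (2L-1), …, L / (2L-1))`. -/
def matD (L : ℕ) : Matrix (Fin L) (Fin L) ℝ :=
  Matrix.diagonal fun i => if (i : ℕ) = 0 then -1 else ((i : ℝ) + 1) / (2 * L - 1)

/-- `P` diagonalizes `A_L`, that is `A_L = P⁻¹ D_L P`. -/
def Diagonalizes {L : ℕ} (P : Matrix (Fin L) (Fin L) ℝ) : Prop :=
  IsUnit P ∧ P * matA L = matD L * P

/-- The renormalized time `s(t) = s₀ + ∫_0^t dτ / λ²(τ)`. -/
def renTime (s₀ : ℝ) (lam : ℝ → ℝ) (t : ℝ) : ℝ := s₀ + ∫ τ in (0 : ℝ)..t, 1 / lam τ ^ 2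

/-- The radiation in renormalized variables: `ε(t, y) = u(t, λ(t) y) - Q̃_{b(t)}(y)`,
equivalently `u(t, r) = (Q̃_{b(t)} + ε(t, ·))(r / λ(t))`. -/
def eps (g Q χ : ℝ → ℝ) {L : ℕ} (u : ℝ → ℝ → ℝ) (b : ℝ → Fin L → ℝ) (lam : ℝ → ℝ)
    (t y : ℝ) : ℝ :=
  u t (lam t * y) - Qloc g Q χ (b t) y

/-- `∫ |H^k ε|² y dy`, with value `∞` if the integral diverges. -/
def energy (g Q : ℝ → ℝ) (k : ℕ) (ε : ℝ → ℝ) : ENNReal :=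
  ∫⁻ y in Ioi (0 : ℝ), ENNReal.ofReal ((H g Q)^[k] ε y ^ 2 * y)

/-- `∫ |∂_y ε|² y dy + ∫ |ε / y|² y dy`, with value `∞` if one of them diverges. -/
def energyNorm (ε : ℝ → ℝ) : ENNReal :=
  ∫⁻ y in Ioi (0 : ℝ), ENNReal.ofReal ((deriv ε y ^ 2 + (ε y / y) ^ 2) * y)

/-- The variable `V = P U`, where `b_k = b_k^e(s) + U_k / (s^k (log s)^{5/4})`. -/
def modeV {L : ℕ} (P : Matrix (Fin L) (Fin L) ℝ) (s : ℝ) (b : Fin L → ℝ) : Fin L → ℝ :=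
  P.mulVec fun k => s ^ ((k : ℕ) + 1) * Real.log s ^ ((5 : ℝ) / 4) * (b k - bExact L s k)

/-- A smooth solution `u(t, r)` of the 1-corotational flow on `0 ≤ t < T`, written as
`u(t, r) = (Q̃_{b(t)} + ε(t, ·))(r / λ(t))`, which lies in the bootstrap regime with constants
`M`, `K` and initial renormalized time `s₀`.

Smoothness of the corotational map `(g(u) cos θ, g(u) sin θ, z(u))` through `r = 0` amounts to
`u` having a smooth odd extension in `r`; `u` denotes this extension. -/
structure IsTrapped (g Q χ : ℝ → ℝ) {L : ℕ} (P : Matrix (Fin L) (Fin L) ℝ) (M K s₀ T : ℝ)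
    (u : ℝ → ℝ → ℝ) (b : ℝ → Fin L → ℝ) (lam : ℝ → ℝ) : Prop where
  smooth : ContDiffOn ℝ ∞ (fun p : ℝ × ℝ => u p.1 p.2) (Ico 0 T ×ˢ univ)
  odd : ∀ t ∈ Ico 0 T, ∀ r, u t (-r) = -u t r
  flow : ∀ t ∈ Ioo 0 T, ∀ r, 0 < r →
    deriv (fun τ => u τ r) t - deriv (deriv (u t)) r - deriv (u t) r / r
      + nonlin g (u t r) / r ^ 2 = 0
  b_smooth : ContDiffOn ℝ 1 b (Ico 0 T)
  lam_smooth : ContDiffOn ℝ 1 lam (Ico 0 T)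
  lam_pos : ∀ t ∈ Ico 0 T, 0 < lam t
  -- the orthogonality conditions that fix the decomposition
  orth : ∀ t ∈ Ico 0 T, ∀ k ≤ L,
    pair (eps g Q χ u b lam t) ((H g Q)^[k] (PhiM g Q χ L M)) = 0
  -- the bootstrap bounds on the radiation
  bound_low : ∀ t ∈ Ico 0 T,
    energyNorm (eps g Q χ u b lam t) ≤ ENNReal.ofReal (10 * par (b 0) 1 ^ ((1 : ℝ) / 4))
  bound_mid : ∀ t ∈ Ico 0 T, ∀ k, 1 ≤ k → k ≤ L →
    energy g Q k (eps g Q χ u b lam t) ≤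
      ENNReal.ofReal (par (b t) 1 ^ ((2 * (k : ℝ) - 1) * (2 * L / (2 * L - 1)))
        * |Real.log (par (b t) 1)| ^ K)
  bound_high : ∀ t ∈ Ico 0 T,
    energy g Q (L + 1) (eps g Q χ u b lam t) ≤
      ENNReal.ofReal (K * (par (b t) 1 ^ (2 * L + 2) / Real.log (par (b t) 1) ^ 2))
  -- the bootstrap bounds on the modes: `|V_1| ≤ 2` and `V_2² + … + V_L² ≤ 4`
  bound_stable : ∀ t ∈ Ico 0 T, ∀ i : Fin L, (i : ℕ) = 0 →
    |modeV P (renTime s₀ lam t) (b t) i| ≤ 2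
  bound_unstable : ∀ t ∈ Ico 0 T,
    (∑ i : Fin L, if (i : ℕ) = 0 then 0 else modeV P (renTime s₀ lam t) (b t) i ^ 2) ≤ 4

/-- The corrected parameter
`b̃_L = b_L + (-1)^L (H^L ε, χ_{B_δ} ΛQ) / (4 δ |log b_1|)`, `B_δ = b_1^{-δ} = B₀^{2δ}`. -/
def bTilde (g Q χ : ℝ → ℝ) {L : ℕ} (δ : ℝ) (u : ℝ → ℝ → ℝ) (b : ℝ → Fin L → ℝ)
    (lam : ℝ → ℝ) (t : ℝ) : ℝ :=
  par (b t) L + (-1) ^ L *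
    pair ((H g Q)^[L] (eps g Q χ u b lam t))
      (fun y => cut χ (B0 (par (b t) 1) ^ (2 * δ)) y * Lam Q y)
    / (4 * δ * |Real.log (par (b t) 1)|)

end HeatFlow

end

/-! The correction added to b_L is designed to cancel the defect of its modulation equation. In
renormalized time, on the region where the cut-offs are inactive, the radiation satisfies ∂_s ε =
-Hε + (λ_s/λ + b_1) ΛQ - Σ_j Mod_j (T_j + O(b_1)) + (smaller terms), with Mod_j = (b_j)_s +
(2j-1+c_{b_1}) b_1 b_j - b_{j+1}. Test this equation against H^L(χ_B ΛQ), B = B_δ. As H is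
symmetric, H ΛQ = 0 and H T_{j+1} = -T_j, this direction is orthogonal to ΛQ, T_1, …, T_{L-1}, and
it sees T_L with the factor (-1)^L ∫ χ_B (ΛQ)². Since ΛQ ~ 2/y, that integral is 4 log B + O(1) =
4δ|log b_1| + O(1) (`exists_abs_integral_cut_sub_log_le`). Division by 4δ|log b_1| therefore removes
Mod_L from the equation of b_L up to O(Mod_L / |log b_1|). The linear term (H^{L+1} ε, χ_B ΛQ) is
bounded through Cauchy–Schwarz by √E_{2L+2} times √(4δ|log b_1| + C), and the same division leaves
the gain |log b_1|^{-1/2} of the statement (`abs_integral_mul_HR_cut_le`).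

Everything else is estimated crudely, and this is possible because δ is small. The test function
lives on y ≤ 2B, far inside y < B_0/4; there all cut-offs in the profile are constant, the radiation
Σ_{b_1} equals c_{b_1} T_1, and the profiles S_i are finite sums of coefficients homogeneous in b
times fixed functions of polynomial growth. A factor (1+B)^n costs at most a multiple of b_1^{-1/4}
when δ n ≤ 1/4, and each remaining error term has a spare power of b_1 that pays for it. No sharp
decay in y is needed.

Three inputs feed the estimate. The profile solves the equation up to weight L+3, that is
O(b_1^{L+3}), since the recursion for S_i cancels all lower weights (`profile_identity`,
`exists_profile_error`). The orthogonality conditions give a pointwise bound of ε by √E_{2L+2} times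
a polynomial: inverting H^{L+1} leaves a combination of T_0, …, T_L, whose coefficients are fixed by
the duality (T_j, H^k Φ_M) = ±δ_{jk} ∫ χ_M (ΛQ)² (`exists_coercive`, `exists_abs_remR_le`).
Differentiating the same conditions in time controls all Mod_j and λ_s/λ + b_1
(`exists_modulation_bound`). Both time-dependent arguments rest on one testing estimate,
`exists_testing_bound`; `exists_error_bound` collects the terms.

Regularity at y = 0 is handled once and for all by writing u(y) = y w(y) with w smooth and even. On
w the operator H is a four-dimensional radial Schrödinger operator without singular potential, and
its inverse is a composition of averages ∫_0^1 t^k h(ty) dt, which visibly preserve smoothness,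
evenness and polynomial growth. -/

namespace HeatFlow

/-! ### Functions whose derivatives grow at most polynomially. -/

/-- Polynomial growth. -/
def PolyGrowth (w : ℝ → ℝ) : Prop := ∃ (C : ℝ) (k : ℕ), ∀ x, |w x| ≤ C * (1 + |x|) ^ k

theorem one_le_one_add_abs_pow (x : ℝ) (k : ℕ) : 1 ≤ (1 + |x|) ^ k :=
  one_le_pow₀ (by linarith [abs_nonneg x])

theorem PolyGrowth.nonneg_bound {w : ℝ → ℝ} (h : PolyGrowth w) :
    ∃ (C : ℝ) (k : ℕ), 0 ≤ C ∧ ∀ x, |w x| ≤ C * (1 + |x|) ^ k := by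
  obtain ⟨C, k, h⟩ := h
  refine ⟨C, k, ?_, h⟩
  have := h 0
  simp at this
  exact (abs_nonneg _).trans this

theorem PolyGrowth.of_le {w v : ℝ → ℝ} (h : PolyGrowth v) (hw : ∀ x, |w x| ≤ |v x|) :
    PolyGrowth w := by
  obtain ⟨C, k, h⟩ := h
  exact ⟨C, k, fun x => (hw x).trans (h x)⟩

theorem PolyGrowth.of_bound {w : ℝ → ℝ} (C : ℝ) (hw : ∀ x, |w x| ≤ C) : PolyGrowth w :=
  ⟨C, 0, fun x => by simpa using hw x⟩

theorem PolyGrowth.add {w v : ℝ → ℝ} (hw : PolyGrowth w) (hv : PolyGrowth v) :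
    PolyGrowth (fun x => w x + v x) := by
  obtain ⟨C, k, hC, hw⟩ := hw.nonneg_bound
  obtain ⟨D, l, hD, hv⟩ := hv.nonneg_bound
  refine ⟨C + D, k + l, fun x => ?_⟩
  have h1 := one_le_one_add_abs_pow x k
  have h2 := one_le_one_add_abs_pow x l
  calc |w x + v x| ≤ |w x| + |v x| := abs_add_le _ _
    _ ≤ C * (1 + |x|) ^ k + D * (1 + |x|) ^ l := add_le_add (hw x) (hv x)
    _ ≤ C * ((1 + |x|) ^ k * (1 + |x|) ^ l) + D * ((1 + |x|) ^ k * (1 + |x|) ^ l) := by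
        gcongr
        · exact le_mul_of_one_le_right (by positivity) h2
        · exact le_mul_of_one_le_left (by positivity) h1
    _ = _ := by rw [pow_add]; ring

theorem PolyGrowth.mul {w v : ℝ → ℝ} (hw : PolyGrowth w) (hv : PolyGrowth v) :
    PolyGrowth (fun x => w x * v x) := by
  obtain ⟨C, k, hC, hw⟩ := hw.nonneg_bound
  obtain ⟨D, l, hD, hv⟩ := hv.nonneg_bound
  refine ⟨C * D, k + l, fun x => ?_⟩
  rw [abs_mul, pow_add]
  calc |w x| * |v x| ≤ (C * (1 + |x|) ^ k) * (D * (1 + |x|) ^ l) := by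
        gcongr
        · exact hw x
        · exact hv x
    _ = _ := by ring

/-- `w` has `n` derivatives, all of polynomial growth. -/
def Tempered : ℕ → (ℝ → ℝ) → Prop
  | 0, w => Continuous w ∧ PolyGrowth w
  | n + 1, w => Differentiable ℝ w ∧ PolyGrowth w ∧ Tempered n (deriv w)

theorem Tempered.continuous {n : ℕ} {w : ℝ → ℝ} (h : Tempered n w) : Continuous w := by
  cases n with
  | zero => exact h.1
  | succ n => exact h.1.continuous

theorem Tempered.pred {n : ℕ} {w : ℝ → ℝ} (h : Tempered (n + 1) w) : Tempered n w := by
  induction n generalizing w with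
  | zero => exact ⟨h.1.continuous, h.2.1⟩
  | succ n ih => exact ⟨h.1, h.2.1, ih h.2.2⟩

theorem Tempered.const (n : ℕ) (c : ℝ) : Tempered n (fun _ => c) := by
  induction n generalizing c with
  | zero => exact ⟨continuous_const, .of_bound |c| fun _ => le_rfl⟩
  | succ n ih =>
    refine ⟨differentiable_const _, .of_bound |c| fun _ => le_rfl, ?_⟩
    simpa using ih 0

theorem Tempered.add {n : ℕ} {w v : ℝ → ℝ} (hw : Tempered n w) (hv : Tempered n v) :
    Tempered n (fun x => w x + v x) := by
  induction n generalizing w v with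
  | zero => exact ⟨hw.1.add hv.1, hw.2.add hv.2⟩
  | succ n ih =>
    refine ⟨hw.1.add hv.1, hw.2.1.add hv.2.1, ?_⟩
    have : deriv (fun x => w x + v x) = fun x => deriv w x + deriv v x := by
      ext x; exact deriv_fun_add (hw.1 x) (hv.1 x)
    rw [this]
    exact ih hw.2.2 hv.2.2

theorem Tempered.mul {n : ℕ} {w v : ℝ → ℝ} (hw : Tempered n w) (hv : Tempered n v) :
    Tempered n (fun x => w x * v x) := by
  induction n generalizing w v with
  | zero => exact ⟨hw.1.mul hv.1, hw.2.mul hv.2⟩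
  | succ n ih =>
    refine ⟨hw.1.mul hv.1, hw.2.1.mul hv.2.1, ?_⟩
    have : deriv (fun x => w x * v x) = fun x => deriv w x * v x + w x * deriv v x := by
      ext x; exact deriv_fun_mul (hw.1 x) (hv.1 x)
    rw [this]
    exact (ih hw.2.2 hv.pred).add (ih hw.pred hv.2.2)

/-- The bound on `w` confines its values to a compact interval, so φ and its derivatives are bounded
along `w` without any growth assumption on φ. -/
theorem Tempered.comp {n : ℕ} {φ w : ℝ → ℝ} (hφ : ContDiff ℝ ∞ φ) (hw : Tempered n w)
    {B : ℝ} (hB : ∀ x, |w x| ≤ B) : Tempered n (fun x => φ (w x)) := by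
  have bdd : ∀ φ : ℝ → ℝ, ContDiff ℝ ∞ φ → PolyGrowth (fun x => φ (w x)) := by
    intro φ hφ
    obtain ⟨C, hC⟩ := (isCompact_Icc (a := -B) (b := B)).exists_bound_of_continuousOn
      hφ.continuous.continuousOn
    exact .of_bound C fun x => hC _ (abs_le.1 (hB x))
  induction n generalizing φ with
  | zero => exact ⟨hφ.continuous.comp hw.1, bdd φ hφ⟩
  | succ n ih =>
    have hd : Differentiable ℝ φ := hφ.differentiable (by simp)
    refine ⟨hd.comp hw.1, bdd φ hφ, ?_⟩
    have : deriv (fun x => φ (w x)) = fun x => deriv φ (w x) * deriv w x := by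
      ext x; exact deriv_comp x (hd _) (hw.1 x)
    rw [this]
    exact (ih (contDiff_infty_iff_deriv.1 hφ).2 hw.pred).mul hw.2.2

theorem Tempered.contDiff {n : ℕ} {w : ℝ → ℝ} (h : Tempered n w) : ContDiff ℝ n w := by
  induction n generalizing w with
  | zero => exact contDiff_zero.2 h.1
  | succ n ih =>
    push_cast
    exact contDiff_succ_iff_deriv.2 ⟨h.1, by simp, ih h.2.2⟩

/-- All derivatives have polynomial growth. -/
def TG (w : ℝ → ℝ) : Prop := ∀ n, Tempered n w

namespace TG
variable {w v : ℝ → ℝ}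

theorem contDiff (h : TG w) : ContDiff ℝ ∞ w := contDiff_infty.2 fun n => (h n).contDiff
theorem continuous (h : TG w) : Continuous w := (h 0).continuous
theorem differentiable (h : TG w) : Differentiable ℝ w := (h 1).1
theorem polyGrowth (h : TG w) : PolyGrowth w := (h 0).2
theorem deriv (h : TG w) : TG (deriv w) := fun n => (h (n + 1)).2.2
theorem const (c : ℝ) : TG (fun _ => c) := fun n => .const n c
theorem add (hw : TG w) (hv : TG v) : TG (fun x => w x + v x) := fun n => (hw n).add (hv n)
theorem mul (hw : TG w) (hv : TG v) : TG (fun x => w x * v x) := fun n => (hw n).mul (hv n)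
theorem const_mul (c : ℝ) (hv : TG v) : TG (fun x => c * v x) := (const c).mul hv
theorem neg (hv : TG v) : TG (fun x => -v x) := by simpa using const_mul (-1) hv
theorem sub (hw : TG w) (hv : TG v) : TG (fun x => w x - v x) := by
  simpa [sub_eq_add_neg] using hw.add hv.neg
theorem pow (hw : TG w) (k : ℕ) : TG (fun x => w x ^ k) := by
  induction k with
  | zero => simpa using const 1
  | succ k ih => simpa [pow_succ] using ih.mul hw
theorem comp {φ : ℝ → ℝ} (hφ : ContDiff ℝ ∞ φ) (hw : TG w) {B : ℝ} (hB : ∀ x, |w x| ≤ B) :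
    TG (fun x => φ (w x)) := fun n => (hw n).comp hφ hB

/-- Bootstrap for solutions of first order equations: if `w'` is an expression in `w` and known
functions, each level of regularity of `w` gives the next. It serves for reciprocals and for the
ground state. -/
theorem of_deriv (hd : Differentiable ℝ w) (hp : PolyGrowth w)
    (h : ∀ n, Tempered n w → Tempered n (_root_.deriv w)) : TG w := by
  intro n
  induction n with
  | zero => exact ⟨hd.continuous, hp⟩
  | succ n ih => exact ⟨hd, hp, h n ih⟩

theorem id : TG (fun x => x) := by
  refine of_deriv differentiable_id ⟨1, 1, fun x => by simp⟩ fun n _ => ?_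
  simpa using Tempered.const n 1

theorem inv (hw : TG w) (h0 : ∀ x, w x ≠ 0) (hp : PolyGrowth (fun x => (w x)⁻¹)) :
    TG (fun x => (w x)⁻¹) := by
  refine of_deriv (fun x => (hw.differentiable x).inv (h0 x)) hp fun n hn => ?_
  have : _root_.deriv (fun x => (w x)⁻¹)
      = fun x => ((-1) * _root_.deriv w x) * ((w x)⁻¹ * (w x)⁻¹) := by
    ext x
    rw [((hw.differentiable x).hasDerivAt.fun_inv (h0 x)).deriv]
    field_simp [h0 x]
  rw [this]
  exact ((Tempered.const n (-1)).mul (hw.deriv n)).mul (hn.mul hn)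
end TG

/-! ### Averages as a smooth substitute for division by powers of the variable. -/

/-- The weighted average `∫_0^1 t^k h(t x) dt`. -/
noncomputable def Av (k : ℕ) (h : ℝ → ℝ) (x : ℝ) : ℝ := ∫ t in (0 : ℝ)..1, t ^ k * h (t * x)

/-- Substitute z = t x. Read backwards, the average is a primitive vanishing at 0 divided by
x^(k+1), in a form that makes sense and is smooth at x = 0. -/
theorem pow_mul_Av (k : ℕ) (h : ℝ → ℝ) (x : ℝ) :
    x ^ (k + 1) * Av k h x = ∫ z in (0 : ℝ)..x, z ^ k * h z := by
  have := intervalIntegral.mul_integral_comp_mul_left (a := 0) (b := 1)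
    (f := fun z => z ^ k * h z) (c := x)
  simp only [mul_zero, mul_one] at this
  rw [← this, Av, pow_succ, mul_comm (x ^ k), mul_assoc, ← intervalIntegral.integral_const_mul]
  congr 1
  refine intervalIntegral.integral_congr fun t _ => ?_
  simp only [mul_pow, mul_comm t x]
  ring

theorem Av_even {k : ℕ} {h : ℝ → ℝ} (he : ∀ x, h (-x) = h x) (x : ℝ) :
    Av k h (-x) = Av k h x := by
  simp only [Av, mul_neg, he]

theorem continuous_Av {k : ℕ} {h : ℝ → ℝ} (hh : Continuous h) : Continuous (Av k h) := by
  unfold Av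
  exact intervalIntegral.continuous_parametric_intervalIntegral_of_continuous' (by fun_prop) _ _

theorem abs_Av_le {k : ℕ} {h : ℝ → ℝ} {x B : ℝ}
    (hB : ∀ t ∈ Icc (0 : ℝ) 1, |h (t * x)| ≤ B) : |Av k h x| ≤ B := by
  have := intervalIntegral.norm_integral_le_of_norm_le_const (a := (0 : ℝ)) (b := 1)
    (f := fun t => t ^ k * h (t * x)) (C := B) fun t ht => by
      rw [uIoc_of_le zero_le_one] at ht
      rw [Real.norm_eq_abs, abs_mul, abs_pow, abs_of_pos ht.1]
      calc t ^ k * |h (t * x)| ≤ 1 * |h (t * x)| := by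
            gcongr; exact pow_le_one₀ ht.1.le ht.2
        _ ≤ B := by rw [one_mul]; exact hB t ⟨ht.1.le, ht.2⟩
  simpa [Av] using this

/-- Differentiation only raises the weight by one and replaces `h` by `h'`, so the family of
averages is closed under it; smoothness and growth follow by induction. -/
theorem hasDerivAt_Av {k : ℕ} {h : ℝ → ℝ} (hh : ContDiff ℝ 1 h) (x : ℝ) :
    HasDerivAt (Av k h) (Av (k + 1) (deriv h) x) x := by
  have hd : Differentiable ℝ h := hh.differentiable (by simp)
  have hc : Continuous (deriv h) := hh.continuous_deriv le_rfl
  obtain ⟨C, hC⟩ := (isCompact_Icc (a := -(|x| + 1)) (b := |x| + 1)).exists_bound_of_continuousOn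
    hc.continuousOn
  unfold Av
  refine (intervalIntegral.hasDerivAt_integral_of_dominated_loc_of_deriv_le
    (F := fun y t => t ^ k * h (t * y)) (F' := fun y t => t ^ (k + 1) * deriv h (t * y))
    (bound := fun _ => C) (s := Metric.ball x 1) (Metric.ball_mem_nhds x one_pos)
    ?_ ?_ ?_ ?_ ?_ ?_).2
  · refine Eventually.of_forall fun y => Continuous.aestronglyMeasurable ?_
    have := hd.continuous; fun_prop
  · refine Continuous.intervalIntegrable ?_ _ _
    have := hd.continuous; fun_prop
  · refine Continuous.aestronglyMeasurable ?_; fun_prop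
  · refine Eventually.of_forall fun t ht y hy => ?_
    rw [uIoc_of_le zero_le_one] at ht
    have h1 : |y| ≤ |x| + 1 := by
      have h3 : |y - x| < 1 := by simpa [Real.dist_eq] using hy
      have h2 : |y| ≤ |x| + |y - x| := by simpa using abs_add_le x (y - x)
      linarith
    have hm : |t * y| ≤ |x| + 1 := by
      rw [abs_mul, abs_of_pos ht.1]
      nlinarith [abs_nonneg y, ht.2, ht.1]
    have hb := hC (t * y) (abs_le.1 hm)
    rw [Real.norm_eq_abs] at hb
    rw [Real.norm_eq_abs, abs_mul, abs_pow, abs_of_pos ht.1]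
    calc t ^ (k + 1) * |deriv h (t * y)| ≤ 1 * |deriv h (t * y)| := by
          gcongr; exact pow_le_one₀ ht.1.le ht.2
      _ ≤ C := by linarith
  · exact intervalIntegrable_const
  · refine Eventually.of_forall fun t _ y _ => ?_
    have h1 : HasDerivAt (fun y => t * y) t y := by simpa using (hasDerivAt_id y).const_mul t
    have h2 := ((hd (t * y)).hasDerivAt.comp y h1).const_mul (t ^ k)
    refine h2.congr_deriv ?_
    ring

theorem deriv_Av {k : ℕ} {h : ℝ → ℝ} (hh : ContDiff ℝ 1 h) :
    deriv (Av k h) = Av (k + 1) (deriv h) := by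
  ext x; exact (hasDerivAt_Av hh x).deriv

theorem contDiff_Av {k : ℕ} {h : ℝ → ℝ} (hh : ContDiff ℝ ∞ h) : ContDiff ℝ ∞ (Av k h) := by
  have key : ∀ n : ℕ, ∀ k h, ContDiff ℝ ∞ h → ContDiff ℝ n (Av k h) := by
    intro n
    induction n with
    | zero => exact fun k h hh => contDiff_zero.2 (continuous_Av hh.continuous)
    | succ n ih =>
      intro k h hh
      have h1 : ContDiff ℝ 1 h := hh.of_le (by exact_mod_cast le_top)
      push_cast
      refine contDiff_succ_iff_deriv.2 ⟨fun x => (hasDerivAt_Av h1 x).differentiableAt, by simp, ?_⟩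
      rw [deriv_Av h1]
      exact ih _ _ (contDiff_infty_iff_deriv.1 hh).2
  exact contDiff_infty.2 fun n => key n k h hh

theorem PolyGrowth.Av {k : ℕ} {h : ℝ → ℝ} (hh : PolyGrowth h) : PolyGrowth (Av k h) := by
  obtain ⟨C, m, hC, hb⟩ := hh.nonneg_bound
  refine ⟨C, m, fun x => abs_Av_le fun t ht => (hb _).trans ?_⟩
  rw [abs_mul, abs_of_nonneg ht.1]
  have : t * |x| ≤ |x| := mul_le_of_le_one_left (abs_nonneg x) ht.2
  have h0 : 0 ≤ t * |x| := mul_nonneg ht.1 (abs_nonneg x)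
  gcongr

theorem TG.Av {k : ℕ} {h : ℝ → ℝ} (hh : TG h) : TG (Av k h) := by
  have key : ∀ n : ℕ, ∀ k h, TG h → Tempered n (HeatFlow.Av k h) := by
    intro n
    induction n with
    | zero => exact fun k h hh => ⟨continuous_Av hh.continuous, hh.polyGrowth.Av⟩
    | succ n ih =>
      intro k h hh
      have h1 : ContDiff ℝ 1 h := hh.contDiff.of_le (by exact_mod_cast le_top)
      refine ⟨fun x => (hasDerivAt_Av h1 x).differentiableAt, hh.polyGrowth.Av, ?_⟩
      rw [deriv_Av h1]
      exact ih _ _ hh.deriv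
  exact fun n => key n k h hh

theorem Av_add {k : ℕ} {h h' : ℝ → ℝ} (hh : Continuous h) (hh' : Continuous h') (x : ℝ) :
    Av k (fun z => h z + h' z) x = Av k h x + Av k h' x := by
  unfold Av
  rw [← intervalIntegral.integral_add]
  · simp only [mul_add]
  · exact Continuous.intervalIntegrable (by fun_prop) _ _
  · exact Continuous.intervalIntegrable (by fun_prop) _ _

theorem Av_const_mul {k : ℕ} (c : ℝ) (h : ℝ → ℝ) (x : ℝ) :
    Av k (fun z => c * h z) x = c * Av k h x := by
  unfold Av
  rw [← intervalIntegral.integral_const_mul]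
  congr 1; ext t; ring

/-! ### Smooth even and odd functions, and Hadamard division. -/

/-- Smooth even functions. -/
structure SmoothEven (w : ℝ → ℝ) : Prop where
  smooth : ContDiff ℝ ∞ w
  even : ∀ x, w (-x) = w x

/-- Smooth odd functions. -/
structure SmoothOdd (w : ℝ → ℝ) : Prop where
  smooth : ContDiff ℝ ∞ w
  odd : ∀ x, w (-x) = -w x

theorem SmoothEven.deriv {w : ℝ → ℝ} (h : SmoothEven w) : SmoothOdd (deriv w) := by
  refine ⟨(contDiff_infty_iff_deriv.1 h.smooth).2, fun x => ?_⟩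
  have : w = fun y => w (-y) := funext fun y => (h.even y).symm
  have h2 : _root_.deriv w x = -_root_.deriv w (-x) := by
    conv_lhs => rw [this]
    exact deriv_comp_neg w x
  linarith

theorem SmoothOdd.deriv {w : ℝ → ℝ} (h : SmoothOdd w) : SmoothEven (deriv w) := by
  refine ⟨(contDiff_infty_iff_deriv.1 h.smooth).2, fun x => ?_⟩
  have : w = fun y => -w (-y) := funext fun y => by rw [h.odd]; ring
  have h2 : _root_.deriv w x = _root_.deriv w (-x) := by
    conv_lhs => rw [this]
    have h3 := deriv_comp_neg w x
    rw [deriv.fun_neg, h3]; ring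
  exact h2.symm

theorem SmoothEven.Av {k : ℕ} {w : ℝ → ℝ} (h : SmoothEven w) : SmoothEven (Av k w) :=
  ⟨contDiff_Av h.smooth, Av_even h.even⟩

theorem SmoothEven.add {w v : ℝ → ℝ} (hw : SmoothEven w) (hv : SmoothEven v) :
    SmoothEven (fun x => w x + v x) :=
  ⟨hw.smooth.add hv.smooth, fun x => by simp only [hw.even, hv.even]⟩

theorem SmoothEven.mul {w v : ℝ → ℝ} (hw : SmoothEven w) (hv : SmoothEven v) :
    SmoothEven (fun x => w x * v x) :=
  ⟨hw.smooth.mul hv.smooth, fun x => by simp only [hw.even, hv.even]⟩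

theorem SmoothEven.const (c : ℝ) : SmoothEven (fun _ => c) := ⟨contDiff_const, fun _ => rfl⟩

theorem SmoothEven.const_mul {w : ℝ → ℝ} (c : ℝ) (hw : SmoothEven w) :
    SmoothEven (fun x => c * w x) := (SmoothEven.const c).mul hw

theorem SmoothEven.neg {w : ℝ → ℝ} (hw : SmoothEven w) : SmoothEven (fun x => -w x) := by
  simpa using hw.const_mul (-1)

theorem SmoothEven.sub {w v : ℝ → ℝ} (hw : SmoothEven w) (hv : SmoothEven v) :
    SmoothEven (fun x => w x - v x) := by simpa [sub_eq_add_neg] using hw.add hv.neg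

theorem SmoothEven.sq_mul {w : ℝ → ℝ} (hw : SmoothEven w) : SmoothEven (fun x => x ^ 2 * w x) :=
  SmoothEven.mul ⟨contDiff_id.pow 2, fun x => by simp⟩ hw

theorem SmoothEven.sum {ι : Type*} (s : Finset ι) {f : ι → ℝ → ℝ} (h : ∀ i ∈ s, SmoothEven (f i)) :
    SmoothEven (fun x => ∑ i ∈ s, f i x) :=
  ⟨ContDiff.sum fun i hi => (h i hi).smooth, fun x => Finset.sum_congr rfl fun i hi => (h i hi).even x⟩

theorem SmoothEven.continuous {w : ℝ → ℝ} (hw : SmoothEven w) : Continuous w := hw.smooth.continuous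
theorem SmoothEven.differentiable {w : ℝ → ℝ} (hw : SmoothEven w) : Differentiable ℝ w :=
  hw.smooth.differentiable (by simp)
theorem SmoothOdd.differentiable {w : ℝ → ℝ} (hw : SmoothOdd w) : Differentiable ℝ w :=
  hw.smooth.differentiable (by simp)

theorem SmoothOdd.map_zero {w : ℝ → ℝ} (h : SmoothOdd w) : w 0 = 0 := by
  have := h.odd 0
  simp at this; linarith

/-- Hadamard division of an odd function. -/
theorem SmoothOdd.eq_mul_Av {w : ℝ → ℝ} (h : SmoothOdd w) (x : ℝ) : w x = x * Av 0 (_root_.deriv w) x := by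
  have h1 := pow_mul_Av 0 (_root_.deriv w) x
  simp only [pow_zero, one_mul, zero_add, pow_one] at h1
  rw [h1, intervalIntegral.integral_deriv_eq_sub (fun y _ => h.differentiable y)
    (h.deriv.continuous.intervalIntegrable _ _), h.map_zero, sub_zero]

/-- Hadamard division of an even function. -/
theorem SmoothEven.eq_add_sq_mul_Av {w : ℝ → ℝ} (h : SmoothEven w) (x : ℝ) :
    w x = w 0 + x ^ 2 * HeatFlow.Av 1 (HeatFlow.Av 0 (_root_.deriv (_root_.deriv w))) x := by
  have h1 := pow_mul_Av 1 (HeatFlow.Av 0 (_root_.deriv (_root_.deriv w))) x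
  have h2 : ∀ z, z ^ 1 * HeatFlow.Av 0 (_root_.deriv (_root_.deriv w)) z = _root_.deriv w z := fun z => by
    rw [pow_one, ← h.deriv.eq_mul_Av]
  simp only [h2] at h1
  rw [h1, intervalIntegral.integral_deriv_eq_sub (fun y _ => h.differentiable y)
    (h.deriv.smooth.continuous.intervalIntegrable _ _)]
  ring

/-- Identities between reduced functions may thus be checked for y > 0, where division by y is
harmless. -/
theorem SmoothEven.ext_of_pos {w v : ℝ → ℝ} (hw : SmoothEven w) (hv : SmoothEven v)
    (h : ∀ y, 0 < y → w y = v y) : w = v := by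
  have h0 : w 0 = v 0 := by
    have h1 : Tendsto w (𝓝[>] 0) (𝓝 (w 0)) := hw.continuous.continuousWithinAt.tendsto
    have h2 : Tendsto v (𝓝[>] 0) (𝓝 (v 0)) := hv.continuous.continuousWithinAt.tendsto
    refine tendsto_nhds_unique h1 (h2.congr' ?_)
    filter_upwards [self_mem_nhdsWithin] with y hy using (h y hy).symm
  ext y
  rcases lt_trichotomy y 0 with hy | rfl | hy
  · rw [← hw.even, ← hv.even, h _ (by linarith)]
  · exact h0
  · exact h y hy

/-! ### The linearized operator on reduced functions. -/

/-- The operator `H` acting on the reduced function `w`, where `u(y) = y w(y)`. -/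
noncomputable def HR (V w : ℝ → ℝ) (y : ℝ) : ℝ :=
  -deriv (deriv w) y - 3 * Av 0 (deriv (deriv w)) y + V y * w y

theorem SmoothEven.HR {V w : ℝ → ℝ} (hV : SmoothEven V) (hw : SmoothEven w) :
    SmoothEven (HR V w) :=
  ((hw.deriv.deriv.neg).sub (hw.deriv.deriv.Av.const_mul 3)).add (hV.mul hw)

theorem TG.HR {V w : ℝ → ℝ} (hV : TG V) (hw : TG w) : TG (HR V w) :=
  ((hw.deriv.deriv.neg).sub (hw.deriv.deriv.Av.const_mul 3)).add (hV.mul hw)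

/-- This is -Δ + V on radial functions in dimension four: the conjugation by y absorbs the singular
part 1/y² of the potential. The average in the definition is w'/y continued through the origin, `w'`
being odd. -/
theorem HR_eq {V w : ℝ → ℝ} (hw : SmoothEven w) {y : ℝ} (hy : y ≠ 0) :
    HR V w y = -deriv (deriv w) y - 3 * (deriv w y / y) + V y * w y := by
  have := hw.deriv.eq_mul_Av y
  rw [HR, this]
  field_simp

/-! ### Consequences of oddness and periodicity of the target profile. -/

namespace IsTargetProfile
variable {g : ℝ → ℝ} (hg : IsTargetProfile g)
include hg

theorem smoothOdd : SmoothOdd g := ⟨hg.smooth, hg.odd⟩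

/-- Oddness about 0 and period 2π give oddness about π, so the pole at infinity can be treated like
the one at the origin. -/
theorem smoothOdd_reflect : SmoothOdd fun w => g (Real.pi - w) := by
  refine ⟨hg.smooth.comp (contDiff_const.sub contDiff_id), fun w => ?_⟩
  have := hg.periodic (-(Real.pi - w))
  rw [hg.odd] at this
  rw [← this]; congr 1; ring

theorem smooth_nonlin : ContDiff ℝ ∞ (nonlin g) :=
  hg.smooth.mul (contDiff_infty_iff_deriv.1 hg.smooth).2

theorem smoothOdd_nonlin : SmoothOdd (nonlin g) := by
  refine ⟨hg.smooth_nonlin, fun u => ?_⟩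
  simp only [nonlin, hg.odd, hg.smoothOdd.deriv.even]; ring

theorem deriv_nonlin_zero : deriv (nonlin g) 0 = 1 := by
  have h1 : HasDerivAt g (deriv g 0) 0 := (hg.smoothOdd.differentiable 0).hasDerivAt
  have h2 : HasDerivAt (deriv g) (deriv (deriv g) 0) 0 :=
    (hg.smoothOdd.deriv.differentiable 0).hasDerivAt
  have := (h1.mul h2).deriv
  change deriv (g * deriv g) 0 = 1
  rw [this, hg.map_zero, hg.deriv_zero]; ring

theorem nonlin_periodic : Function.Periodic (nonlin g) (2 * Real.pi) := by
  intro u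
  have : deriv g (u + 2 * Real.pi) = deriv g u := by
    have h1 : (fun x => g (x + 2 * Real.pi)) = g := funext hg.periodic
    conv_rhs => rw [← h1]
    rw [deriv_comp_add_const]
  simp only [nonlin, hg.periodic, this]

theorem iteratedDeriv_nonlin_bounded (n : ℕ) :
    ∃ C, ∀ u, |iteratedDeriv n (nonlin g) u| ≤ C := by
  have hp : Function.Periodic (iteratedDeriv n (nonlin g)) (2 * Real.pi) := by
    intro u
    have h1 : (fun x => nonlin g (x + 2 * Real.pi)) = nonlin g := funext hg.nonlin_periodic
    have := iteratedDeriv_comp_add_const n (nonlin g) (2 * Real.pi)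
    rw [h1] at this
    exact (congrFun this u).symm
  have hc : Continuous (iteratedDeriv n (nonlin g)) :=
    hg.smooth_nonlin.continuous_iteratedDeriv n (by exact_mod_cast le_top)
  obtain ⟨C, hC⟩ := (isCompact_Icc (a := (0 : ℝ)) (b := 2 * Real.pi)).exists_bound_of_continuousOn
    hc.continuousOn
  refine ⟨C, fun u => ?_⟩
  obtain ⟨v, hv, e⟩ := hp.exists_mem_Ico₀ (by positivity) u
  rw [e]
  exact hC v ⟨hv.1, hv.2.le⟩

theorem exists_lipschitz : ∃ K, LipschitzWith K g := by
  have hp : Function.Periodic (deriv g) (2 * Real.pi) := by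
    intro u
    have h1 : (fun x => g (x + 2 * Real.pi)) = g := funext hg.periodic
    conv_rhs => rw [← h1]
    rw [deriv_comp_add_const]
  have hc : Continuous (deriv g) := hg.smoothOdd.deriv.continuous
  obtain ⟨C, hC⟩ := (isCompact_Icc (a := (0 : ℝ)) (b := 2 * Real.pi)).exists_bound_of_continuousOn
    hc.continuousOn
  refine ⟨C.toNNReal, lipschitzWith_of_nnnorm_deriv_le hg.smoothOdd.differentiable fun u => ?_⟩
  obtain ⟨v, hv, e⟩ := hp.exists_mem_Ico₀ (by positivity) u
  rw [e]
  have := hC v ⟨hv.1, hv.2.le⟩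
  rw [← NNReal.coe_le_coe, coe_nnnorm]
  exact this.trans (Real.le_coe_toNNReal C)

end IsTargetProfile

/-- An odd function with unit slope at the origin. -/
theorem SmoothOdd.eq_add_cube {g : ℝ → ℝ} (hg : SmoothOdd g) (h1 : _root_.deriv g 0 = 1) :
    ∃ h k, SmoothEven h ∧ SmoothEven k ∧ (∀ v, g v = v * h v) ∧ ∀ v, h v = 1 + v ^ 2 * k v := by
  have hE : SmoothEven (Av 0 (_root_.deriv g)) := hg.deriv.Av
  refine ⟨Av 0 (_root_.deriv g),
    Av 1 (Av 0 (_root_.deriv (_root_.deriv (Av 0 (_root_.deriv g))))), hE,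
    hE.deriv.deriv.Av.Av, hg.eq_mul_Av, fun v => ?_⟩
  rw [hE.eq_add_sq_mul_Av v]
  congr 1
  simp [Av, h1]

/-! ### Regularity of the ground state at the origin and its asymptotics at infinity. -/

namespace IsGroundState
variable {g Q : ℝ → ℝ} (hQ : IsGroundState g Q) (hg : IsTargetProfile g)
include hQ

theorem Lam_eq {y : ℝ} (hy : 0 < y) : Lam Q y = g (Q y) := by
  rw [Lam, (hQ.ode y hy).deriv]; field_simp

theorem continuousOn : ContinuousOn Q (Ioi 0) :=
  fun y hy => (hQ.ode y hy).continuousAt.continuousWithinAt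

include hg

/-- In the variable s = log y the equation is the autonomous Q' = g(Q) with g Lipschitz, so a
solution that meets an equilibrium is that equilibrium. -/
theorem eq_const_of_eq {a y₀ : ℝ} (ha : g a = 0) (hy₀ : 0 < y₀) (h : Q y₀ = a) :
    ∀ y, 0 < y → Q y = a := by
  obtain ⟨K, hK⟩ := hg.exists_lipschitz
  have hx : ∀ s, HasDerivAt (fun s => Q (Real.exp s)) (g (Q (Real.exp s))) s := fun s => by
    refine ((hQ.ode _ (Real.exp_pos s)).comp s (Real.hasDerivAt_exp s)).congr_deriv ?_
    field_simp [(Real.exp_pos s).ne']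
  have := ODE_solution_unique_univ (v := fun _ => g) (s := fun _ => univ) (K := K)
    (f := fun s => Q (Real.exp s)) (g := fun _ => a) (t₀ := Real.log y₀)
    (fun _ => hK.lipschitzOnWith) (fun s => ⟨hx s, trivial⟩)
    (fun s => ⟨by simpa [ha] using hasDerivAt_const s a, trivial⟩)
    (by simp [Real.exp_log hy₀, h])
  intro y hy
  simpa [Real.exp_log hy] using congrFun this (Real.log y)

/-- Leaving the interval would force Q to take the value 0 or π by connectedness, hence to be
constant, against the limit at the opposite end. -/
theorem pos_lt_pi {y : ℝ} (hy : 0 < y) : 0 < Q y ∧ Q y < Real.pi := by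
  have hpi := Real.pi_pos
  constructor
  · by_contra! hneg
    obtain ⟨z, hz0, hz⟩ : ∃ z, 0 < z ∧ Real.pi / 2 < Q z :=
      ((eventually_gt_atTop 0).and (hQ.tendsto_pi.eventually_const_lt (by linarith))).exists
    obtain ⟨x, hx, e⟩ := isPreconnected_Ioi.intermediate_value (show y ∈ Ioi 0 from hy) (show z ∈ Ioi 0 from hz0)
      (hQ.continuousOn) (show (0 : ℝ) ∈ Icc (Q y) (Q z) from ⟨hneg, by linarith⟩)
    have := hQ.eq_const_of_eq hg hg.map_zero hx e z hz0
    linarith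
  · by_contra! hneg
    obtain ⟨z, hz, hz0⟩ : ∃ z, Q z < Real.pi / 2 ∧ 0 < z :=
      ((hQ.tendsto_zero.eventually_lt_const (show (0 : ℝ) < Real.pi / 2 by linarith)).and
        self_mem_nhdsWithin).exists
    obtain ⟨x, hx, e⟩ := isPreconnected_Ioi.intermediate_value (show z ∈ Ioi 0 from hz0) (show y ∈ Ioi 0 from hy)
      (hQ.continuousOn) (show Real.pi ∈ Icc (Q z) (Q y) from ⟨by linarith, hneg⟩)
    have := hQ.eq_const_of_eq hg hg.map_pi hx e z hz0
    linarith

/-- A weak first rate: Q²/y is nondecreasing near 0, because its derivative is (2 g(Q)/Q - 1) Q²/y²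
and g(Q)/Q tends to 1. It is only meant to make the derivative of log(Q/y) bounded in the next
lemma. -/
theorem exists_sq_le : ∃ C y₁, 0 < y₁ ∧ ∀ y, 0 < y → y ≤ y₁ → Q y ^ 2 ≤ C * y := by
  obtain ⟨h, k, hh, hk, e1, e2⟩ := hg.smoothOdd.eq_add_cube hg.deriv_zero
  have h0 : h 0 = 1 := by simp [e2]
  have hT : Tendsto (fun y => h (Q y)) (𝓝[>] 0) (𝓝 1) := by
    rw [← h0]; exact (hh.continuous.tendsto 0).comp hQ.tendsto_zero
  have hev := hT.eventually_const_lt (show (1 / 2 : ℝ) < 1 by norm_num)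
  obtain ⟨y₁, hy₁, hs⟩ := mem_nhdsGT_iff_exists_Ioc_subset.1 hev
  have hy₁ : 0 < y₁ := hy₁
  have hd : ∀ y, 0 < y → HasDerivAt (fun y => Q y ^ 2 / y) ((2 * h (Q y) - 1) * Q y ^ 2 / y ^ 2) y := by
    intro y hy
    refine (((hQ.ode y hy).pow 2).div (hasDerivAt_id y) hy.ne').congr_deriv ?_
    rw [e1]; simp; field_simp
  have hmono : MonotoneOn (fun y => Q y ^ 2 / y) (Ioc 0 y₁) := by
    refine monotoneOn_of_deriv_nonneg (convex_Ioc _ _)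
      (fun y hy => (hd y hy.1).continuousAt.continuousWithinAt)
      (fun y hy => (hd y (interior_subset hy).1).differentiableAt.differentiableWithinAt) ?_
    intro y hy
    have hy' := interior_subset hy
    rw [(hd y hy'.1).deriv]
    have : (1 / 2 : ℝ) < h (Q y) := hs hy'
    have : 0 ≤ 2 * h (Q y) - 1 := by linarith
    positivity
  refine ⟨Q y₁ ^ 2 / y₁, y₁, hy₁, fun y hy hle => ?_⟩
  have := hmono ⟨hy, hle⟩ ⟨hy₁, le_rfl⟩ hle
  simp only at this
  rwa [div_le_iff₀ hy] at this

/-- The logarithmic derivative of Q/y is Q² k(Q)/y, bounded since Q² = O(y). So log(Q/y) is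
Lipschitz near 0 and extends continuously there; taking the logarithm makes the limit positive. -/
theorem exists_tendsto_div : ∃ c, 0 < c ∧ Tendsto (fun y => Q y / y) (𝓝[>] 0) (𝓝 c) := by
  obtain ⟨h, k, hh, hk, e1, e2⟩ := hg.smoothOdd.eq_add_cube hg.deriv_zero
  obtain ⟨C, y₁, hy₁, hC⟩ := hQ.exists_sq_le hg
  obtain ⟨D, hD⟩ := (isCompact_Icc (a := (0 : ℝ)) (b := Real.pi)).exists_bound_of_continuousOn
    hk.continuous.continuousOn
  have hd : ∀ y, 0 < y → HasDerivAt (fun y => Real.log (Q y / y)) (Q y ^ 2 * k (Q y) / y) y := by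
    intro y hy
    have hp := (hQ.pos_lt_pi hg hy).1
    refine (((hQ.ode y hy).div (hasDerivAt_id y) hy.ne').log (div_pos hp hy).ne').congr_deriv ?_
    rw [e1, e2]; simp; field_simp; ring
  have hLip : LipschitzOnWith (C * D).toNNReal (fun y => Real.log (Q y / y)) (Ioc 0 y₁) := by
    refine (convex_Ioc 0 y₁).lipschitzOnWith_of_nnnorm_hasDerivWithin_le
      (fun y hy => (hd y hy.1).hasDerivWithinAt) fun y hy => ?_
    rw [← NNReal.coe_le_coe, coe_nnnorm]
    refine le_trans ?_ (Real.le_coe_toNNReal _)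
    have hp := hQ.pos_lt_pi hg hy.1
    have hk' := hD (Q y) ⟨hp.1.le, hp.2.le⟩
    rw [Real.norm_eq_abs, abs_div, abs_mul, abs_of_nonneg (sq_nonneg (Q y)), abs_of_pos hy.1,
      div_le_iff₀ hy.1]
    calc Q y ^ 2 * |k (Q y)| ≤ (C * y) * D :=
          mul_le_mul (hC y hy.1 hy.2) hk' (abs_nonneg _) ((sq_nonneg _).trans (hC y hy.1 hy.2))
      _ = _ := by ring
  obtain ⟨G, hG, hE⟩ := hLip.extend_real
  refine ⟨Real.exp (G 0), Real.exp_pos _, ?_⟩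
  have hT : Tendsto (fun y => Real.exp (G y)) (𝓝[>] 0) (𝓝 (Real.exp (G 0))) :=
    ((Real.continuous_exp.comp hG.continuous).tendsto 0).mono_left nhdsWithin_le_nhds
  refine hT.congr' ?_
  filter_upwards [Ioc_mem_nhdsGT hy₁] with y hy
  rw [← hE hy, Real.exp_log (div_pos (hQ.pos_lt_pi hg hy.1).1 hy.1)]

/-- The even extension ψ of Q/y solves ψ' = y ψ³ k(yψ), an equation without singularity at 0. Once
it holds across the origin, `TG.of_deriv` yields all derivatives at once. -/
theorem exists_slope : ∃ ψ, TG ψ ∧ (∀ y, ψ (-y) = ψ y) ∧ (∀ y, 0 < ψ y) ∧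
    (∀ y, 0 < y → Q y = y * ψ y) ∧ ∃ B, ∀ y, |y * ψ y| ≤ B := by
  obtain ⟨h, k, hh, hk, e1, e2⟩ := hg.smoothOdd.eq_add_cube hg.deriv_zero
  obtain ⟨c, hc, hT⟩ := hQ.exists_tendsto_div hg
  set ψ : ℝ → ℝ := fun y => if y = 0 then c else Q |y| / |y| with hψ
  have hpos : ∀ y, 0 < y → ψ y = Q y / y := fun y hy => by simp [hψ, hy.ne', abs_of_pos hy]
  have heven : ∀ y, ψ (-y) = ψ y := fun y => by simp [hψ]
  have hQψ : ∀ y, 0 < y → Q y = y * ψ y := fun y hy => by rw [hpos y hy]; field_simp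
  have hB : ∀ y, |y * ψ y| ≤ Real.pi := by
    have hp : ∀ y, 0 < y → |y * ψ y| ≤ Real.pi := fun y hy => by
      rw [← hQψ y hy, abs_of_pos (hQ.pos_lt_pi hg hy).1]; exact (hQ.pos_lt_pi hg hy).2.le
    intro y
    rcases lt_trichotomy y 0 with hy | rfl | hy
    · have := hp (-y) (by linarith)
      rwa [heven, neg_mul, abs_neg] at this
    · simp [Real.pi_pos.le]
    · exact hp y hy
  have hψp : ∀ y, 0 < ψ y := by
    intro y
    by_cases hy : y = 0
    · simp [hψ, hy, hc]
    · simp only [hψ, hy, if_false]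
      exact div_pos (hQ.pos_lt_pi hg (abs_pos.2 hy)).1 (abs_pos.2 hy)
  have hcont0 : ContinuousAt ψ 0 := by
    have hTψ : Tendsto ψ (𝓝[>] 0) (𝓝 c) := hT.congr' (by
      filter_upwards [self_mem_nhdsWithin] with y hy using (hpos y hy).symm)
    have hTn : Tendsto ψ (𝓝[<] 0) (𝓝 c) := by
      have : Tendsto (fun y => ψ (-y)) (𝓝[<] 0) (𝓝 c) := by
        refine hTψ.comp ?_
        simpa using tendsto_neg_nhdsLT (a := (0:ℝ))
      simpa only [heven] using this
    have h00 : ψ 0 = c := by simp [hψ]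
    rw [continuousAt_iff_punctured_nhds, h00, ← nhdsLT_sup_nhdsGT]
    exact hTn.sup hTψ
  have hd : ∀ y, 0 < y → HasDerivAt ψ (y * ψ y ^ 3 * k (y * ψ y)) y := by
    intro y hy
    have h1 : HasDerivAt ψ _ y :=
      ((hQ.ode y hy).div (hasDerivAt_id y) hy.ne').congr_of_eventuallyEq (by
        filter_upwards [lt_mem_nhds hy] with z hz using hpos z hz)
    refine h1.congr_deriv ?_
    rw [← hQψ y hy, hpos y hy, e1, e2]; simp; field_simp; ring
  have hcont : Continuous ψ := by
    refine continuous_iff_continuousAt.2 fun y => ?_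
    rcases lt_trichotomy y 0 with hy | rfl | hy
    · have h2 := (hd (-y) (by linarith)).continuousAt
      have : ContinuousAt (fun y => ψ (-y)) y := ContinuousAt.comp (f := fun y => -y) h2 continuous_neg.continuousAt
      simpa only [heven] using this
    · exact hcont0
    · exact (hd y hy).continuousAt
  have hd' : ∀ y, y ≠ 0 → HasDerivAt ψ (y * ψ y ^ 3 * k (y * ψ y)) y := by
    intro y hy
    rcases lt_or_gt_of_ne hy with hy | hy
    · have h1 := (hd (-y) (by linarith)).comp y (hasDerivAt_neg y)
      have h2 : ψ ∘ Neg.neg = ψ := funext heven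
      rw [h2] at h1
      refine h1.congr_deriv ?_
      rw [heven, neg_mul y (ψ y), hk.even]; ring
    · exact hd y hy
  have hall : ∀ y, HasDerivAt ψ (y * ψ y ^ 3 * k (y * ψ y)) y := by
    intro y
    by_cases hy : y = 0
    · subst hy
      -- At 0 the derivative exists because ψ is continuous there and the derivatives at nearby
      -- points have a limit.
      refine hasDerivAt_of_hasDerivAt_of_ne (g := fun y => y * ψ y ^ 3 * k (y * ψ y)) hd' hcont0 ?_
      have := hk.continuous
      exact Continuous.continuousAt (by fun_prop)
    · exact hd' y hy
  have hpg : PolyGrowth ψ := by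
    obtain ⟨D, hD⟩ := (isCompact_Icc (a := (-1 : ℝ)) (b := 1)).exists_bound_of_continuousOn
      hcont.continuousOn
    refine .of_bound (max D Real.pi) fun y => ?_
    rcases le_or_gt |y| 1 with hy | hy
    · exact (hD y (abs_le.1 hy)).trans (le_max_left _ _)
    · refine le_trans ?_ (le_max_right _ _)
      have := hB y
      rw [abs_mul] at this
      nlinarith [abs_nonneg (ψ y)]
  refine ⟨ψ, ?_, heven, hψp, hQψ, Real.pi, hB⟩
  refine TG.of_deriv (fun y => (hall y).differentiableAt) hpg fun n hn => ?_
  have : deriv ψ = fun y => y * (ψ y * (ψ y * ψ y)) * k (y * ψ y) := by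
    ext y; rw [(hall y).deriv]; ring
  rw [this]
  have hid := TG.id n
  exact (hid.mul (hn.mul (hn.mul hn))).mul ((hid.mul hn).comp hk.smooth hB)

/-- `ΛQ = 2 / y + O(1 / y²)` at infinity. -/
theorem exists_asymp : ∃ C y₁, ∀ y, y₁ ≤ y → 0 < y → |y * Lam Q y - 2| ≤ C / y := by
  have hr := hg.smoothOdd_reflect
  have hr1 : deriv (fun w => g (Real.pi - w)) 0 = 1 := by
    rw [deriv_comp_const_sub]; simp [hg.deriv_pi]
  obtain ⟨h, k, hh, hk, e1, e2⟩ := hr.eq_add_cube hr1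
  obtain ⟨D, hD⟩ := (isCompact_Icc (a := (0 : ℝ)) (b := Real.pi)).exists_bound_of_continuousOn
    hk.continuous.continuousOn
  have hD0 : 0 ≤ D := (norm_nonneg _).trans (hD 0 ⟨le_rfl, Real.pi_pos.le⟩)
  obtain ⟨y₁, hy₁⟩ := eventually_atTop.1
    (hQ.normalized.eventually_le_const (show (2 : ℝ) < 3 by norm_num))
  set y₂ := max y₁ 1
  have hgw : ∀ y, 0 < y → g (Q y) = (Real.pi - Q y) * (1 + (Real.pi - Q y) ^ 2 * k (Real.pi - Q y)) := by
    intro y _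
    have := e1 (Real.pi - Q y)
    rw [e2] at this
    simpa using this
  -- 27 = 3³ comes from the bound y(π - Q) ≤ 3, valid for large y by the normalization.
  set E : ℝ := 27 * D
  have hE : ∀ y, y₂ ≤ y → |(Real.pi - Q y) - g (Q y)| ≤ E / y ^ 2 ∧
      |y * g (Q y) - y * (Real.pi - Q y)| ≤ E / y := by
    intro y hy
    have hy1 : 1 ≤ y := (le_max_right _ _).trans hy
    have hy0 : 0 < y := by linarith
    have hb := hQ.pos_lt_pi hg hy0
    set w := Real.pi - Q y with hw
    have hw0 : 0 < w := by simp only [hw]; linarith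
    have hw1 : w ≤ Real.pi := by simp only [hw]; linarith
    have h3 : y * w ≤ 3 := hy₁ y ((le_max_left _ _).trans hy)
    have hk1 : |k w| ≤ D := hD w ⟨hw0.le, hw1⟩
    have hcube : y ^ 3 * w ^ 3 ≤ 27 := by
      have h4 : (y * w) ^ 3 ≤ 3 ^ 3 := by gcongr
      rw [mul_pow] at h4; norm_num at h4; exact h4
    have hmain : |w ^ 3 * k w| ≤ E / y ^ 3 := by
      rw [abs_mul, abs_of_pos (by positivity : 0 < w ^ 3), le_div_iff₀ (by positivity)]
      calc w ^ 3 * |k w| * y ^ 3 = (y ^ 3 * w ^ 3) * |k w| := by ring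
        _ ≤ 27 * D := by gcongr
    have hE0 : 0 ≤ E := by positivity
    constructor
    · rw [hgw y hy0]
      have : w - w * (1 + w ^ 2 * k w) = -(w ^ 3 * k w) := by ring
      rw [this, abs_neg]
      refine hmain.trans ?_
      gcongr
      norm_num
    · rw [hgw y hy0]
      have : y * (w * (1 + w ^ 2 * k w)) - y * w = y * (w ^ 3 * k w) := by ring
      rw [this, abs_mul, abs_of_pos hy0]
      calc y * |w ^ 3 * k w| ≤ y * (E / y ^ 3) := by gcongr
        _ = E / y ^ 2 := by field_simp
        _ ≤ E / y := by
            gcongr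
            nlinarith
  -- The derivative of y(π - Q) is at most E/y² in size, so adding ±E/y makes it monotone in either
  -- direction; comparison with the common limit 2 then gives the rate E/y.
  have hd : ∀ σ y, 0 < y → HasDerivAt (fun y => y * (Real.pi - Q y) + σ * (E / y))
      ((Real.pi - Q y) - g (Q y) - σ * (E / y ^ 2)) y := by
    intro σ y hy
    have h1 := (hasDerivAt_id y).mul ((hQ.ode y hy).const_sub Real.pi)
    have h2 := (((hasDerivAt_id y).inv hy.ne').const_mul E).const_mul σ
    refine ((h1.add h2).congr_deriv ?_).congr_of_eventuallyEq ?_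
    · simp; field_simp; ring
    · exact Eventually.of_forall fun z => by simp [div_eq_mul_inv]
  have hlim : ∀ σ, Tendsto (fun y => y * (Real.pi - Q y) + σ * (E / y)) atTop (𝓝 2) := by
    intro σ
    have := hQ.normalized.add ((tendsto_const_nhds.div_atTop tendsto_id (a := E)).const_mul σ)
    simpa using this
  have y₂pos : 0 < y₂ := lt_of_lt_of_le one_pos (le_max_right _ _)
  have hup : AntitoneOn (fun y => y * (Real.pi - Q y) + 1 * (E / y)) (Ici y₂) := by
    refine antitoneOn_of_deriv_nonpos (convex_Ici _)
      (fun y hy => (hd 1 y (y₂pos.trans_le hy)).continuousAt.continuousWithinAt)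
      (fun y hy => (hd 1 y (y₂pos.trans_le (interior_subset hy))).differentiableAt.differentiableWithinAt) ?_
    intro y hy
    have hy' : y₂ ≤ y := interior_subset hy
    rw [(hd 1 y (y₂pos.trans_le hy')).deriv]
    have := (abs_le.1 (hE y hy').1).2
    linarith
  have hdn : MonotoneOn (fun y => y * (Real.pi - Q y) + (-1) * (E / y)) (Ici y₂) := by
    refine monotoneOn_of_deriv_nonneg (convex_Ici _)
      (fun y hy => (hd (-1) y (y₂pos.trans_le hy)).continuousAt.continuousWithinAt)
      (fun y hy => (hd (-1) y (y₂pos.trans_le (interior_subset hy))).differentiableAt.differentiableWithinAt) ?_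
    intro y hy
    have hy' : y₂ ≤ y := interior_subset hy
    rw [(hd (-1) y (y₂pos.trans_le hy')).deriv]
    have := (abs_le.1 (hE y hy').1).1
    linarith
  refine ⟨2 * E, y₂, fun y hy hy0 => ?_⟩
  have hA : 2 ≤ y * (Real.pi - Q y) + 1 * (E / y) :=
    le_of_tendsto (hlim 1) (by
      filter_upwards [eventually_ge_atTop y] with z hz
      exact hup hy (hy.trans hz) hz)
  have hB : y * (Real.pi - Q y) + (-1) * (E / y) ≤ 2 :=
    ge_of_tendsto (hlim (-1)) (by
      filter_upwards [eventually_ge_atTop y] with z hz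
      exact hdn hy (hy.trans hz) hz)
  have hC := abs_le.1 (hE y hy).2
  rw [hQ.Lam_eq hy0, mul_div_assoc, abs_le]
  constructor <;> linarith

end IsGroundState

/-! ### The smooth data extracted from the ground state. -/

/-- The smooth functions attached to the ground state: the odd extension `Q₀` of `Q`, its
derivative `q = ΛQ / y`, `p = 1 / q`, and `V = (f'(Q) - 1) / y²`. -/
structure Reduced (g Q Q₀ q p V : ℝ → ℝ) : Prop where
  Q₀_odd : SmoothOdd Q₀
  Q₀_eq : ∀ y, 0 < y → Q y = Q₀ y
  hasDerivAt_Q₀ : ∀ y, HasDerivAt Q₀ (q y) y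
  q_even : SmoothEven q
  q_tg : TG q
  q_pos : ∀ y, 0 < q y
  p_even : SmoothEven p
  p_tg : TG p
  p_mul_q : ∀ y, p y * q y = 1
  V_even : SmoothEven V
  V_tg : TG V
  V_eq : ∀ y, 0 < y → deriv (nonlin g) (Q y) = 1 + y ^ 2 * V y
  HR_q : HR V q = fun _ => 0
  harmonic : ∀ y, 0 < y → deriv q y + q y / y = nonlin g (Q y) / y ^ 2
  asymp : ∃ C, ∀ y, 1 ≤ y → |y ^ 2 * q y - 2| ≤ C / y
  taylor : ∀ j, 2 ≤ j → ∃ F, TG F ∧ SmoothEven F ∧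
    ∀ y, 0 < y → iteratedDeriv j (nonlin g) (Q y) * y ^ j / y ^ 2 = y * F y

theorem SmoothOdd.iteratedDeriv {f : ℝ → ℝ} (hf : SmoothOdd f) (m : ℕ) :
    SmoothOdd (iteratedDeriv (2 * m) f) ∧ SmoothEven (iteratedDeriv (2 * m + 1) f) := by
  induction m with
  | zero =>
    simp only [mul_zero, iteratedDeriv_zero, zero_add, iteratedDeriv_one]
    exact ⟨hf, hf.deriv⟩
  | succ m ih =>
    have h1 : SmoothOdd (_root_.iteratedDeriv (2 * (m + 1)) f) := by
      rw [show 2 * (m + 1) = 2 * m + 1 + 1 by ring, iteratedDeriv_succ]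
      exact ih.2.deriv
    refine ⟨h1, ?_⟩
    rw [iteratedDeriv_succ]
    exact h1.deriv

/-- All the data come from Q = yψ and parity: an odd or even function of Q yields the powers of y
that the singular weights require. The kernel equation for `q` is the relation y q = g(Q)
differentiated twice. -/
theorem IsGroundState.exists_reduced {g Q : ℝ → ℝ} (hQ : IsGroundState g Q)
    (hg : IsTargetProfile g) : ∃ Q₀ q p V, Reduced g Q Q₀ q p V := by
  obtain ⟨ψ, hψ, heven, hpos, hQψ, B, hB⟩ := hQ.exists_slope hg
  have hψE : SmoothEven ψ := ⟨hψ.contDiff, heven⟩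
  set Q₀ : ℝ → ℝ := fun y => y * ψ y with hQ₀
  have hQtg : TG Q₀ := TG.id.mul hψ
  have hodd : SmoothOdd Q₀ := ⟨hQtg.contDiff, fun y => by simp [hQ₀, heven]⟩
  set q := deriv Q₀ with hq
  have hqE : SmoothEven q := hodd.deriv
  have hqtg : TG q := hQtg.deriv
  have hQ₀d : ∀ y, HasDerivAt Q₀ (q y) y := fun y => (hodd.differentiable y).hasDerivAt
  have hqg : ∀ y, 0 < y → y * q y = g (Q y) := by
    intro y hy
    have h1 : HasDerivAt Q (q y) y := (hQ₀d y).congr_of_eventuallyEq (by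
      filter_upwards [lt_mem_nhds hy] with z hz using hQψ z hz)
    rw [h1.unique (hQ.ode y hy)]; field_simp
  have hqpos' : ∀ y, 0 < y → 0 < q y := by
    intro y hy
    have h1 := hQ.pos_lt_pi hg hy
    have h2 := hg.pos _ h1.1 h1.2
    rw [← hqg y hy] at h2
    exact pos_of_mul_pos_right h2 hy.le
  have hqpos : ∀ y, 0 < q y := by
    intro y
    rcases lt_trichotomy y 0 with hy | rfl | hy
    · rw [← hqE.even]; exact hqpos' _ (by linarith)
    · have : HasDerivAt Q₀ (1 * ψ 0 + 0 * deriv ψ 0) 0 :=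
        (hasDerivAt_id (0 : ℝ)).mul (hψ.differentiable 0).hasDerivAt
      rw [(hQ₀d 0).unique this]; simpa using hpos 0
    · exact hqpos' y hy
  -- asymptotics
  obtain ⟨C₀, y₁, hasy⟩ := hQ.exists_asymp hg
  have hLam : ∀ y, 0 < y → y * Lam Q y = y ^ 2 * q y := fun y hy => by
    rw [hQ.Lam_eq hy, ← hqg y hy]; ring
  have hasymp : ∃ C, ∀ y, 1 ≤ y → |y ^ 2 * q y - 2| ≤ C / y := by
    have hc : Continuous fun y => y * (y ^ 2 * q y - 2) := by
      have := hqE.continuous; fun_prop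
    obtain ⟨D, hD⟩ := (isCompact_Icc (a := (1 : ℝ)) (b := y₁)).exists_bound_of_continuousOn
      hc.continuousOn
    refine ⟨max C₀ D, fun y hy => ?_⟩
    have hy0 : 0 < y := by linarith
    rcases le_total y₁ y with h | h
    · rw [← hLam y hy0]
      exact (hasy y h hy0).trans (by gcongr; exact le_max_left _ _)
    · have := hD y ⟨hy, h⟩
      rw [Real.norm_eq_abs, abs_mul, abs_of_pos hy0] at this
      rw [le_div_iff₀ hy0, mul_comm]
      exact this.trans (le_max_right _ _)
  -- As y² q tends to 2, it is at least 1 far out, so 1/q is at most y² there.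
  have hpg : PolyGrowth fun y => (q y)⁻¹ := by
    obtain ⟨C, hC⟩ := hasymp
    have hc : Continuous fun y => (q y)⁻¹ := hqE.continuous.inv₀ fun y => (hqpos y).ne'
    obtain ⟨D, hD⟩ := (isCompact_Icc (a := -(max C 1)) (b := max C 1)).exists_bound_of_continuousOn
      hc.continuousOn
    have hD0 : 0 ≤ D := (norm_nonneg _).trans (hD 0 (by simp))
    refine ⟨D + 1, 2, fun y => ?_⟩
    have hone := one_le_one_add_abs_pow y 2
    rcases le_or_gt |y| (max C 1) with h | h
    · have := hD y (abs_le.1 h)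
      rw [Real.norm_eq_abs] at this
      nlinarith
    · have h1 : 1 ≤ |y| := (le_max_right _ _).trans h.le
      have h2 := hC |y| h1
      have h3 : C / |y| ≤ 1 := by
        rw [div_le_one (by linarith)]; exact (le_max_left _ _).trans h.le
      have h4 : q |y| = q y := by
        rcases abs_choice y with e | e <;> rw [e]
        exact hqE.even y
      rw [h4] at h2
      have h5 : 1 ≤ |y| ^ 2 * q y := by have := (abs_le.1 h2).1; linarith
      rw [abs_of_pos (inv_pos.2 (hqpos y)), inv_eq_one_div, div_le_iff₀ (hqpos y)]
      have h6 : |y| ^ 2 * q y ≤ (1 + |y|) ^ 2 * q y := by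
        have := (hqpos y).le
        gcongr; linarith
      have h7 : 0 ≤ D * ((1 + |y|) ^ 2 * q y) := by have := (hqpos y).le; positivity
      linarith
  -- the potential
  have hf := hg.smoothOdd_nonlin
  set k := Av 1 (Av 0 (deriv (deriv (deriv (nonlin g))))) with hk
  have hkE : SmoothEven k := hf.deriv.deriv.deriv.Av.Av
  set V : ℝ → ℝ := fun y => ψ y ^ 2 * k (Q₀ y) with hV
  have hVtg : TG V := (hψ.pow 2).mul (hQtg.comp hkE.smooth hB)
  have hVE : SmoothEven V := ⟨hVtg.contDiff, fun y => by
    simp only [hV, heven, hodd.odd, hkE.even]⟩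
  have hVeq : ∀ y, 0 < y → deriv (nonlin g) (Q y) = 1 + y ^ 2 * V y := by
    intro y hy
    rw [hf.deriv.eq_add_sq_mul_Av, hg.deriv_nonlin_zero, hQψ y hy]
    simp only [hV, hQ₀]; ring
  -- the kernel
  have hq1 : ∀ y, HasDerivAt q (deriv q y) y := fun y => (hqE.differentiable y).hasDerivAt
  have hq2 : ∀ y, HasDerivAt (deriv q) (deriv (deriv q) y) y := fun y =>
    (hqE.deriv.differentiable y).hasDerivAt
  have hgd : ∀ y, 0 < y → q y + y * deriv q y = deriv g (Q y) * q y := by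
    intro y hy
    have h1 : HasDerivAt (fun y => y * q y) (1 * q y + y * deriv q y) y :=
      (hasDerivAt_id y).mul (hq1 y)
    have h2 : HasDerivAt (fun y => y * q y) (deriv g (Q₀ y) * q y) y := by
      refine ((hg.smoothOdd.differentiable _).hasDerivAt.comp y (hQ₀d y)).congr_of_eventuallyEq ?_
      filter_upwards [lt_mem_nhds hy] with z hz
      rw [hqg z hz, hQψ z hz]; rfl
    have := h1.unique h2
    rw [one_mul] at this
    rw [this, hQψ y hy]
  have hharm : ∀ y, 0 < y → y * (q y + y * deriv q y) = nonlin g (Q y) := by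
    intro y hy
    rw [hgd y hy, nonlin, ← hqg y hy]; ring
  have hker : HR V q = fun _ => 0 := by
    refine (hVE.HR hqE).ext_of_pos (.const 0) fun y hy => ?_
    rw [HR_eq hqE hy.ne']
    have h1 : HasDerivAt (fun y => y * (q y + y * deriv q y))
        (1 * (q y + y * deriv q y) + y * (deriv q y + (1 * deriv q y + y * deriv (deriv q) y))) y :=
      (hasDerivAt_id y).mul ((hq1 y).add ((hasDerivAt_id y).mul (hq2 y)))
    have h2 : HasDerivAt (fun y => y * (q y + y * deriv q y))
        (deriv (nonlin g) (Q₀ y) * q y) y := by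
      refine ((hf.differentiable _).hasDerivAt.comp y (hQ₀d y)).congr_of_eventuallyEq ?_
      filter_upwards [lt_mem_nhds hy] with z hz
      rw [hharm z hz, hQψ z hz]; rfl
    have h3 := h1.unique h2
    have h4 := hVeq y hy
    rw [hQψ y hy] at h4
    rw [show Q₀ y = y * ψ y from rfl, h4] at h3
    field_simp
    refine mul_left_cancel₀ hy.ne' ?_
    linear_combination (-1) * h3
  refine ⟨Q₀, q, fun y => (q y)⁻¹, V, hodd, hQψ, hQ₀d, hqE, hqtg, hqpos,
    ⟨hqE.smooth.inv fun y => (hqpos y).ne', fun y => by rw [hqE.even]⟩,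
    hqtg.inv (fun y => (hqpos y).ne') hpg, fun y => inv_mul_cancel₀ (hqpos y).ne',
    hVE, hVtg, hVeq, hker, ?_, hasymp, ?_⟩
  · intro y hy
    rw [← hharm y hy]; field_simp; ring
  · intro j hj
    have hpar := hf.iteratedDeriv
    -- The weight y^(j-2) must become y times an even function. For odd j it already has the right
    -- parity; for even j the derivative f^(j) is odd and contributes the missing factor Q = yψ.
    obtain ⟨m, rfl | rfl⟩ : ∃ m, j = 2 * m + 2 ∨ j = 2 * m + 3 := ⟨(j - 2) / 2, by omega⟩
    · have ho : SmoothOdd (iteratedDeriv (2 * m + 2) (nonlin g)) := (hpar (m + 1)).1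
      set κ := Av 0 (deriv (iteratedDeriv (2 * m + 2) (nonlin g)))
      have hκ : SmoothEven κ := ho.deriv.Av
      have htg : TG fun y => y ^ (2 * m) * (ψ y * κ (Q₀ y)) :=
        (TG.id.pow _).mul (hψ.mul (hQtg.comp hκ.smooth hB))
      refine ⟨_, htg, ⟨htg.contDiff, fun y => ?_⟩, fun y hy => ?_⟩
      · simp only [heven, hodd.odd, hκ.even, Even.neg_pow (even_two_mul m)]
      · rw [ho.eq_mul_Av, hQψ y hy, pow_add]
        field_simp
        rfl
    · have he : SmoothEven (iteratedDeriv (2 * m + 3) (nonlin g)) := (hpar (m + 1)).2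
      have htg : TG fun y => y ^ (2 * m) * iteratedDeriv (2 * m + 3) (nonlin g) (Q₀ y) :=
        (TG.id.pow _).mul (hQtg.comp he.smooth hB)
      refine ⟨_, htg, ⟨htg.contDiff, fun y => ?_⟩, fun y hy => ?_⟩
      · simp only [hodd.odd, he.even, Even.neg_pow (even_two_mul m)]
      · rw [hQψ y hy]
        simp only [hQ₀]
        field_simp
        ring

/-- Boundedness of `y² q`. -/
theorem Reduced.exists_sq_mul_le {g Q Q₀ q p V : ℝ → ℝ} (hR : Reduced g Q Q₀ q p V) :
    ∃ C, 0 ≤ C ∧ ∀ y, 0 < y → y ^ 2 * q y ≤ C := by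
  obtain ⟨C, hC⟩ := hR.asymp
  have hc : Continuous fun y => y ^ 2 * q y := by
    have := hR.q_even.continuous; fun_prop
  obtain ⟨D, hD⟩ := (isCompact_Icc (a := (0 : ℝ)) (b := 1)).exists_bound_of_continuousOn
    hc.continuousOn
  have hD0 : 0 ≤ D := (norm_nonneg _).trans (hD 0 (by simp))
  refine ⟨D + |C| + 2, by positivity, fun y hy => ?_⟩
  rcases le_total y 1 with h | h
  · have := (le_abs_self _).trans (hD y ⟨hy.le, h⟩)
    have := abs_nonneg C
    linarith
  · have h1 := (abs_le.1 (hC y h)).2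
    have h2 : C / y ≤ |C| := (div_le_div_of_nonneg_right (le_abs_self C) hy.le).trans
      (div_le_self (abs_nonneg C) h)
    linarith

theorem Reduced.Lam_eq {g Q Q₀ q p V : ℝ → ℝ} (hR : Reduced g Q Q₀ q p V) {y : ℝ} (hy : 0 < y) :
    Lam Q y = y * q y := by
  have h1 : HasDerivAt Q (q y) y := (hR.hasDerivAt_Q₀ y).congr_of_eventuallyEq (by
    filter_upwards [lt_mem_nhds hy] with z hz using hR.Q₀_eq z hz)
  rw [Lam, h1.deriv]

theorem hasDerivAt_pow_mul_Av {k : ℕ} {h : ℝ → ℝ} (hh : Continuous h) (y : ℝ) :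
    HasDerivAt (fun y => y ^ (k + 1) * Av k h y) (y ^ k * h y) y := by
  simp only [pow_mul_Av]
  have hc : Continuous fun z => z ^ k * h z := by fun_prop
  exact intervalIntegral.integral_hasDerivAt_right (hc.intervalIntegrable _ _)
    hc.aestronglyMeasurable.stronglyMeasurableAtFilter hc.continuousAt

/-! ### Inversion of the linearized operator and Green's identity. -/

/-- The inverse of `H` on reduced functions. -/
noncomputable def HI (q p F : ℝ → ℝ) (y : ℝ) : ℝ :=
  -(q y * (y ^ 2 * Av 1 (fun x => p x ^ 2 * Av 3 (fun z => F z * q z) x) y))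

/-- The scaling generator on reduced functions. -/
noncomputable def LR (w : ℝ → ℝ) (y : ℝ) : ℝ := w y + y * deriv w y

theorem SmoothEven.LR {w : ℝ → ℝ} (hw : SmoothEven w) : SmoothEven (LR w) :=
  hw.add ⟨contDiff_id.mul hw.deriv.smooth, fun y => by simp [hw.deriv.odd]⟩

theorem TG.LR {w : ℝ → ℝ} (hw : TG w) : TG (LR w) := hw.add (TG.id.mul hw.deriv)

theorem SmoothEven.pow {w : ℝ → ℝ} (hw : SmoothEven w) (k : ℕ) : SmoothEven fun x => w x ^ k :=
  ⟨hw.smooth.pow k, fun x => by simp only [hw.even]⟩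

theorem HR_const_mul {V w : ℝ → ℝ} (hw : SmoothEven w) (c : ℝ) :
    HR V (fun x => c * w x) = fun x => c * HR V w x := by
  have h1 : deriv (fun x => c * w x) = fun x => c * deriv w x := by
    ext x; exact deriv_const_mul c (hw.differentiable x)
  have h2 : deriv (fun x => c * deriv w x) = fun x => c * deriv (deriv w) x := by
    ext x; exact deriv_const_mul c (hw.deriv.differentiable x)
  ext y
  simp only [HR, h1, h2, Av_const_mul]
  ring

theorem HR_add {V w v : ℝ → ℝ} (hw : SmoothEven w) (hv : SmoothEven v) :
    HR V (fun x => w x + v x) = fun x => HR V w x + HR V v x := by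
  have h1 : deriv (fun x => w x + v x) = fun x => deriv w x + deriv v x := by
    ext x; exact deriv_fun_add (hw.differentiable x) (hv.differentiable x)
  have h2 : deriv (fun x => deriv w x + deriv v x)
      = fun x => deriv (deriv w) x + deriv (deriv v) x := by
    ext x; exact deriv_fun_add (hw.deriv.differentiable x) (hv.deriv.differentiable x)
  ext y
  simp only [HR, h1, h2]
  rw [Av_add hw.deriv.deriv.continuous hv.deriv.deriv.continuous]
  ring

theorem HI_const_mul (q p F : ℝ → ℝ) (c : ℝ) :
    HI q p (fun x => c * F x) = fun x => c * HI q p F x := by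
  ext y
  have h1 : ∀ x, Av 3 (fun z => c * F z * q z) x = c * Av 3 (fun z => F z * q z) x := fun x => by
    rw [← Av_const_mul]; simp only [mul_assoc]
  have h2 : (fun x => p x ^ 2 * Av 3 (fun z => c * F z * q z) x)
      = fun x => c * (p x ^ 2 * Av 3 (fun z => F z * q z) x) := by
    ext x; rw [h1]; ring
  simp only [HI, h2, Av_const_mul]
  ring

theorem HI_add {q p F F' : ℝ → ℝ} (hq : Continuous q) (hp : Continuous p) (hF : Continuous F)
    (hF' : Continuous F') :
    HI q p (fun x => F x + F' x) = fun x => HI q p F x + HI q p F' x := by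
  ext y
  have h2 : (fun x => p x ^ 2 * Av 3 (fun z => (F z + F' z) * q z) x)
      = fun x => p x ^ 2 * Av 3 (fun z => F z * q z) x + p x ^ 2 * Av 3 (fun z => F' z * q z) x := by
    ext x
    rw [← mul_add, ← Av_add (by fun_prop) (by fun_prop)]
    simp only [add_mul]
  have hc : ∀ F : ℝ → ℝ, Continuous F →
      Continuous fun x => p x ^ 2 * Av 3 (fun z => F z * q z) x := fun F hF =>
    (hp.pow 2).mul (continuous_Av (hF.mul hq))
  simp only [HI, h2]
  rw [Av_add (hc F hF) (hc F' hF')]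
  ring

namespace Reduced
variable {g Q Q₀ q p V : ℝ → ℝ} (hR : Reduced g Q Q₀ q p V)
include hR

theorem smoothEven_HI {F : ℝ → ℝ} (hF : SmoothEven F) : SmoothEven (HI q p F) :=
  (hR.q_even.mul (((hR.p_even.pow 2).mul (hF.mul hR.q_even).Av).Av.sq_mul)).neg

theorem tg_HI {F : ℝ → ℝ} (hF : TG F) : TG (HI q p F) :=
  (hR.q_tg.mul ((TG.id.pow 2).mul ((hR.p_tg.pow 2).mul (hF.mul hR.q_tg).Av).Av)).neg

theorem deriv_p (y : ℝ) : HasDerivAt p (-(deriv q y) * p y ^ 2) y := by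
  have h1 := (hR.q_even.differentiable y).hasDerivAt.fun_inv (hR.q_pos y).ne'
  have h2 : p = fun y => (q y)⁻¹ := funext fun z => eq_inv_of_mul_eq_one_left (hR.p_mul_q z)
  rw [h2]
  refine h1.congr_deriv ?_
  have := hR.q_pos y
  field_simp

/-- Reduction of order: the candidate is -q G with G' = y p² N, and the terms in G alone disappear
because q is in the kernel. What is left is the first order equation y N' + 4 N = F q of the inner
average. -/
theorem HR_HI {F : ℝ → ℝ} (hF : SmoothEven F) : HR V (HI q p F) = F := by
  refine (hR.V_even.HR (hR.smoothEven_HI hF)).ext_of_pos hF fun y hy => ?_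
  set N := Av 3 (fun z => F z * q z) with hN
  set G : ℝ → ℝ := fun y => y ^ 2 * Av 1 (fun x => p x ^ 2 * N x) y with hG
  have hNE : SmoothEven N := (hF.mul hR.q_even).Av
  have hGd : ∀ y, HasDerivAt G (y * (p y ^ 2 * N y)) y := fun y => by
    simpa using hasDerivAt_pow_mul_Av (k := 1) (((hR.p_even.pow 2).mul hNE).continuous) y
  have hNd : HasDerivAt N (deriv N y) y := (hNE.differentiable y).hasDerivAt
  have hN' : y * deriv N y = F y * q y - 4 * N y := by
    have h1 : HasDerivAt (fun y => y ^ (3 + 1) * N y) (y ^ 3 * (F y * q y)) y :=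
      hasDerivAt_pow_mul_Av (hF.mul hR.q_even).continuous y
    have h2 : HasDerivAt (fun y => y ^ (3 + 1) * N y) _ y := (hasDerivAt_pow (3 + 1) y).mul hNd
    have h3 := h1.unique h2
    have : y ^ 3 ≠ 0 := by positivity
    refine mul_left_cancel₀ this ?_
    push_cast at h3
    linear_combination -h3
  have hq1 : ∀ y, HasDerivAt q (deriv q y) y := fun y => (hR.q_even.differentiable y).hasDerivAt
  have hq2 : HasDerivAt (deriv q) (deriv (deriv q) y) y :=
    (hR.q_even.deriv.differentiable y).hasDerivAt
  have hw : HI q p F = fun y => -(q y * G y) := rfl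
  have hw1 : deriv (HI q p F) = fun y => -(deriv q y * G y + y * (p y * N y)) := by
    ext z
    rw [hw]
    have := ((hq1 z).mul (hGd z)).neg.deriv
    rw [show (fun y => -(q y * G y)) = -(q * G) from rfl, this]
    have := hR.p_mul_q z
    linear_combination (-z * p z * N z) * this
  have hw2 : deriv (deriv (HI q p F)) y = -(deriv (deriv q) y * G y + deriv q y * (y * (p y ^ 2 * N y))
      + (p y * N y + y * (-(deriv q y) * p y ^ 2 * N y + p y * deriv N y))) := by
    rw [hw1]
    have h3 : HasDerivAt (fun y => y * (p y * N y)) (1 * (p y * N y)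
        + y * (-(deriv q y) * p y ^ 2 * N y + p y * deriv N y)) y :=
      (hasDerivAt_id y).mul ((hR.deriv_p y).mul hNd)
    have := ((hq2.mul (hGd y)).add h3).neg.deriv
    rw [one_mul] at this
    exact this
  rw [HR_eq (hR.smoothEven_HI hF) hy.ne', hw2, hw1, hw]
  have hk := congrFun hR.HR_q y
  rw [HR_eq hR.q_even hy.ne'] at hk
  have hpq := hR.p_mul_q y
  field_simp at hk ⊢
  linear_combination (-G y) * hk + p y * hN' * y + y * F y * hpq

/-- Smoothness at the origin excludes the singular kernel element: the Wronskian y³(w' q - w q')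
vanishes at 0, hence equals -∫_0^y F q z³ dz with F = HR V w. Dividing by q² shows that w/q + G is
constant. -/
theorem eq_smul_add_HI {w : ℝ → ℝ} (hw : SmoothEven w) (y : ℝ) :
    w y = w 0 * p 0 * q y + HI q p (HR V w) y := by
  set F := HR V w with hFdef
  have hF : SmoothEven F := hR.V_even.HR hw
  set N := Av 3 (fun z => F z * q z) with hN
  have hNE : SmoothEven N := (hF.mul hR.q_even).Av
  set G : ℝ → ℝ := fun y => y ^ 2 * Av 1 (fun x => p x ^ 2 * N x) y with hG
  have hGE : SmoothEven G := ((hR.p_even.pow 2).mul hNE).Av.sq_mul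
  have hGd : ∀ y, HasDerivAt G (y * (p y ^ 2 * N y)) y := fun y => by
    simpa using hasDerivAt_pow_mul_Av (k := 1) (((hR.p_even.pow 2).mul hNE).continuous) y
  have hw1 : ∀ y, HasDerivAt w (deriv w y) y := fun y => (hw.differentiable y).hasDerivAt
  have hw2 : ∀ y, HasDerivAt (deriv w) (deriv (deriv w) y) y := fun y =>
    (hw.deriv.differentiable y).hasDerivAt
  have hq1 : ∀ y, HasDerivAt q (deriv q y) y := fun y => (hR.q_even.differentiable y).hasDerivAt
  have hq2 : ∀ y, HasDerivAt (deriv q) (deriv (deriv q) y) y := fun y =>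
    (hR.q_even.deriv.differentiable y).hasDerivAt
  have hW : ∀ y, y ^ 3 * (deriv w y * q y - w y * deriv q y) = -(y ^ 4 * N y) := by
    have hd : ∀ y, HasDerivAt (fun y => y ^ 3 * (deriv w y * q y - w y * deriv q y)
        + y ^ (3 + 1) * N y) 0 y := by
      intro y
      have h1 := ((hasDerivAt_pow 3 y).mul (((hw2 y).mul (hq1 y)).sub ((hw1 y).mul (hq2 y)))).add
        (hasDerivAt_pow_mul_Av (k := 3) (hF.mul hR.q_even).continuous y)
      refine h1.congr_deriv ?_
      simp only [Pi.sub_apply, Pi.mul_apply]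
      have hk := congrFun hR.HR_q y
      simp only [HR] at hk
      have e1 := hw.deriv.eq_mul_Av y
      have e2 := hR.q_even.deriv.eq_mul_Av y
      rw [hFdef, HR]
      push_cast
      linear_combination (3 * y ^ 2 * q y) * e1 - (3 * y ^ 2 * w y) * e2 + (y ^ 3 * w y) * hk
    have hc := is_const_of_deriv_eq_zero (fun y => (hd y).differentiableAt) (fun y => (hd y).deriv)
    intro y
    have := hc y 0
    simp at this
    linarith
  have hD : ∀ y, deriv (fun y => w y * p y + G y) y = 0 := by
    have hE : SmoothEven fun y => w y * p y + G y := (hw.mul hR.p_even).add hGE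
    intro y
    by_cases hy : y = 0
    · rw [hy]; exact hE.deriv.map_zero
    have h1 := ((hw1 y).mul (hR.deriv_p y)).add (hGd y)
    rw [show (fun y => w y * p y + G y) = w * p + G from rfl, h1.deriv]
    have hpq := hR.p_mul_q y
    refine mul_left_cancel₀ (pow_ne_zero 3 hy) ?_
    linear_combination p y ^ 2 * hW y - y ^ 3 * deriv w y * p y * hpq
  have hE : SmoothEven fun y => w y * p y + G y := (hw.mul hR.p_even).add hGE
  have hc := is_const_of_deriv_eq_zero hE.differentiable hD y 0
  have hG0 : G 0 = 0 := by simp [hG]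
  simp only [hG0, add_zero] at hc
  have hpq := hR.p_mul_q y
  have : HI q p F y = -(q y * G y) := rfl
  rw [this, ← hc]
  linear_combination (-w y) * hpq

/-- `H` is symmetric for the measure `y³ dy` on reduced functions. -/
theorem integral_HR_mul {u w : ℝ → ℝ} (hu : SmoothEven u) (hw : SmoothEven w) {r : ℝ}
    (h0 : w r = 0) (h1 : deriv w r = 0) :
    ∫ y in (0 : ℝ)..r, HR V u y * w y * y ^ 3 = ∫ y in (0 : ℝ)..r, u y * HR V w y * y ^ 3 := by
  have hd : ∀ y, HasDerivAt (fun y => y ^ 3 * (deriv u y * w y - u y * deriv w y))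
      (u y * HR V w y * y ^ 3 - HR V u y * w y * y ^ 3) y := by
    intro y
    have hu1 := (hu.differentiable y).hasDerivAt
    have hu2 := (hu.deriv.differentiable y).hasDerivAt
    have hw1 := (hw.differentiable y).hasDerivAt
    have hw2 := (hw.deriv.differentiable y).hasDerivAt
    refine ((hasDerivAt_pow 3 y).mul ((hu2.mul hw1).sub (hu1.mul hw2))).congr_deriv ?_
    simp only [Pi.sub_apply, Pi.mul_apply, HR]
    have e1 := hu.deriv.eq_mul_Av y
    have e2 := hw.deriv.eq_mul_Av y
    push_cast
    linear_combination (3 * y ^ 2 * w y) * e1 - (3 * y ^ 2 * u y) * e2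
  have hcu : Continuous fun y => u y * HR V w y * y ^ 3 :=
    (hu.continuous.mul (hR.V_even.HR hw).continuous).mul (continuous_pow 3)
  have hcw : Continuous fun y => HR V u y * w y * y ^ 3 :=
    ((hR.V_even.HR hu).continuous.mul hw.continuous).mul (continuous_pow 3)
  have := intervalIntegral.integral_eq_sub_of_hasDerivAt (a := 0) (b := r) (fun y _ => hd y)
    ((hcu.sub hcw).intervalIntegrable _ _)
  rw [intervalIntegral.integral_sub (hcu.intervalIntegrable _ _) (hcw.intervalIntegrable _ _),
    h0, h1] at this
  simp at this
  linarith

/-- Stated on 0 < y < R only, since the profiles agree with their reduced expressions only below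
B_0/4. -/
theorem H_eq {w F : ℝ → ℝ} (hw : SmoothEven w) {R : ℝ} (h : ∀ y, 0 < y → y < R → F y = y * w y)
    {y : ℝ} (hy : 0 < y) (hyR : y < R) : H g Q F y = y * HR V w y := by
  have hev : ∀ z, 0 < z → z < R → F =ᶠ[𝓝 z] fun y => y * w y := fun z hz hzR => by
    filter_upwards [Ioo_mem_nhds hz hzR] with x hx using h x hx.1 hx.2
  have hw1 := fun y => (hw.differentiable y).hasDerivAt
  have hw2 := fun y => (hw.deriv.differentiable y).hasDerivAt
  have hd1 : ∀ z, 0 < z → z < R → deriv F z = w z + z * deriv w z := fun z hz hzR => by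
    have : HasDerivAt (fun y => y * w y) (1 * w z + z * deriv w z) z :=
      (hasDerivAt_id z).mul (hw1 z)
    rw [(hev z hz hzR).deriv_eq, this.deriv, one_mul]
  have hev1 : deriv F =ᶠ[𝓝 y] fun z => w z + z * deriv w z := by
    filter_upwards [Ioo_mem_nhds hy hyR] with x hx using hd1 x hx.1 hx.2
  have hd2 : deriv (deriv F) y = 2 * deriv w y + y * deriv (deriv w) y := by
    have : HasDerivAt (fun z => w z + z * deriv w z)
      (deriv w y + (1 * deriv w y + y * deriv (deriv w) y)) y :=
      (hw1 y).add ((hasDerivAt_id y).mul (hw2 y))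
    rw [hev1.deriv_eq, this.deriv]; ring
  rw [H, hd2, hd1 y hy hyR, h y hy hyR, HR_eq hw hy.ne', hR.V_eq y hy]
  field_simp
  ring

theorem smoothEven_HR_iter {w : ℝ → ℝ} (hw : SmoothEven w) (k : ℕ) :
    SmoothEven ((HR V)^[k] w) := by
  induction k with
  | zero => exact hw
  | succ k ih => rw [Function.iterate_succ_apply']; exact hR.V_even.HR ih

theorem smoothEven_HI_iter {w : ℝ → ℝ} (hw : SmoothEven w) (k : ℕ) :
    SmoothEven ((HI q p)^[k] w) := by
  induction k with
  | zero => exact hw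
  | succ k ih => rw [Function.iterate_succ_apply']; exact hR.smoothEven_HI ih

theorem tg_HI_iter {w : ℝ → ℝ} (hw : TG w) (k : ℕ) : TG ((HI q p)^[k] w) := by
  induction k with
  | zero => exact hw
  | succ k ih => rw [Function.iterate_succ_apply']; exact hR.tg_HI ih

theorem H_iter_eq {w F : ℝ → ℝ} (hw : SmoothEven w) {R : ℝ}
    (h : ∀ y, 0 < y → y < R → F y = y * w y) (k : ℕ)
    {y : ℝ} (hy : 0 < y) (hyR : y < R) : (H g Q)^[k] F y = y * (HR V)^[k] w y := by
  induction k generalizing y with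
  | zero => exact h y hy hyR
  | succ k ih =>
    rw [Function.iterate_succ_apply', Function.iterate_succ_apply']
    exact hR.H_eq (hR.smoothEven_HR_iter hw k) (fun z hz hzR => ih hz hzR) hy hyR

/-- Write Γ = ΛQ · J with J' = p²/y³ and integrate by parts: ∫ F Γ x = y⁴ N J - G. The terms
containing J cancel, so the arbitrary base point 1 in Γ does not matter and only -q G survives. -/
theorem Hinv_eq {w F : ℝ → ℝ} (hw : Continuous w) {R : ℝ}
    (h : ∀ y, 0 < y → y < R → F y = y * w y)
    {y : ℝ} (hy : 0 < y) (hyR : y < R) : Hinv Q F y = y * HI q p w y := by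
  have hqc := hR.q_even.continuous
  have hpc := hR.p_even.continuous
  set N := Av 3 (fun z => w z * q z) with hN
  have hNc : Continuous N := continuous_Av (hw.mul hqc)
  set G : ℝ → ℝ := fun y => y ^ 2 * Av 1 (fun x => p x ^ 2 * N x) y with hG
  have hGd : ∀ y, HasDerivAt G (y * (p y ^ 2 * N y)) y := fun y => by
    simpa using hasDerivAt_pow_mul_Av (k := 1) (h := fun x => p x ^ 2 * N x) (by fun_prop) y
  set J : ℝ → ℝ := fun y => ∫ x in (1 : ℝ)..y, p x ^ 2 / x ^ 3 with hJ
  have hcI : ContinuousOn (fun x => p x ^ 2 / x ^ 3) (Ioi 0) :=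
    (hpc.pow 2).continuousOn.div (continuous_pow 3).continuousOn fun x hx => pow_ne_zero 3 (ne_of_gt hx)
  have hJd : ∀ y, 0 < y → HasDerivAt J (p y ^ 2 / y ^ 3) y := fun y hy => by
    refine intervalIntegral.integral_hasDerivAt_right (ContinuousOn.intervalIntegrable
      (hcI.mono fun x hx => ?_)) (hcI.stronglyMeasurableAtFilter isOpen_Ioi y hy)
      (hcI.continuousAt (Ioi_mem_nhds hy))
    exact lt_of_lt_of_le (lt_min one_pos hy) hx.1
  have hGam : ∀ y, 0 < y → Gam Q y = y * q y * J y := fun y hy => by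
    rw [Gam, hR.Lam_eq hy]
    congr 1
    refine intervalIntegral.integral_congr fun x hx => ?_
    have hx0 : 0 < x := lt_of_lt_of_le (lt_min one_pos hy) hx.1
    have := hR.p_mul_q x
    have hq0 := hR.q_pos x
    simp only [hR.Lam_eq hx0]
    field_simp
    linear_combination (-1 - p x * q x) * this
  obtain ⟨D, hD⟩ := (isCompact_Icc (a := (0 : ℝ)) (b := 1)).exists_bound_of_continuousOn
    (f := fun x => p x ^ 2) (by fun_prop)
  -- J may be singular at the origin, but this bound makes the boundary term x⁴ N J vanish there and
  -- the integrand bounded.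
  have hJb : ∀ x, 0 < x → x ≤ 1 → x ^ 3 * |J x| ≤ D := by
    intro x hx hx1
    have hD0 : 0 ≤ D := (norm_nonneg _).trans (hD 0 (by simp))
    have := intervalIntegral.norm_integral_le_of_norm_le_const (a := (1 : ℝ)) (b := x)
      (f := fun x => p x ^ 2 / x ^ 3) (C := D / x ^ 3) fun z hz => by
        rw [uIoc_of_ge hx1] at hz
        have hz0 : 0 < z := hx.trans hz.1
        rw [norm_div, Real.norm_of_nonneg (by positivity : 0 ≤ z ^ 3)]
        have := hD z ⟨hz0.le, hz.2⟩
        have h3 := hz.1.le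
        gcongr
    have h4 : |x - 1| ≤ 1 := by rw [abs_le]; constructor <;> linarith
    have h5 : |J x| ≤ D / x ^ 3 := by
      refine (this.trans (mul_le_mul_of_nonneg_left h4 (by positivity))).trans (by simp)
    rw [le_div_iff₀ (by positivity)] at h5
    linarith
  have hI1 : ∫ x in (0 : ℝ)..y, F x * Lam Q x * x = y ^ 4 * N y := by
    rw [hN, show y ^ 4 = y ^ (3 + 1) by norm_num, pow_mul_Av]
    refine intervalIntegral.integral_congr_ae (Eventually.of_forall fun x hx => ?_)
    rw [uIoc_of_le hy.le] at hx
    rw [h x hx.1 (hx.2.trans_lt hyR), hR.Lam_eq hx.1]; ring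
  have hI2 : ∫ x in (0 : ℝ)..y, F x * Gam Q x * x = y ^ 4 * N y * J y - G y := by
    have h1 : ∫ x in (0 : ℝ)..y, F x * Gam Q x * x
        = ∫ x in (0 : ℝ)..y, x ^ 3 * (w x * q x) * J x := by
      refine intervalIntegral.integral_congr_ae (Eventually.of_forall fun x hx => ?_)
      rw [uIoc_of_le hy.le] at hx
      rw [h x hx.1 (hx.2.trans_lt hyR), hGam x hx.1]; ring
    have hder : ∀ x, 0 < x → HasDerivAt (fun x => x ^ 4 * N x * J x - G x)
        (x ^ 3 * (w x * q x) * J x) x := by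
      intro x hx
      refine (((hasDerivAt_pow_mul_Av (k := 3) (h := fun z => w z * q z) (by fun_prop) x).mul (hJd x hx)).sub
        (hGd x)).congr_deriv ?_
      field_simp
      ring
    have hfun : ContinuousOn (fun x => x ^ 3 * (w x * q x) * J x) (Ioi 0) :=
      (by fun_prop : Continuous fun x => x ^ 3 * (w x * q x)).continuousOn.mul
        fun x hx => (hJd x hx).continuousAt.continuousWithinAt
    have hint : IntervalIntegrable (fun x => x ^ 3 * (w x * q x) * J x) volume 0 y := by
      rw [intervalIntegrable_iff_integrableOn_Ioc_of_le hy.le]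
      obtain ⟨B, hB⟩ := (isCompact_Icc (a := (0 : ℝ)) (b := 1)).exists_bound_of_continuousOn
        (f := fun z => w z * q z) (by fun_prop)
      obtain ⟨B', hB'⟩ := (isCompact_Icc (a := (1 : ℝ)) (b := max y 1)).exists_bound_of_continuousOn
        (hfun.mono fun x hx => lt_of_lt_of_le one_pos hx.1)
      refine Integrable.of_bound ?_ (max (B * D) B') ?_
      · exact (hfun.mono fun x hx => hx.1).aestronglyMeasurable measurableSet_Ioc
      · refine (ae_restrict_iff' measurableSet_Ioc).2 (Eventually.of_forall fun x hx => ?_)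
        rcases le_total x 1 with h1 | h1
        · refine le_trans ?_ (le_max_left _ _)
          have e1 := hB x ⟨hx.1.le, h1⟩
          have e2 := hJb x hx.1 h1
          rw [Real.norm_eq_abs] at e1 ⊢
          have : |x ^ 3 * (w x * q x) * J x| = |w x * q x| * (x ^ 3 * |J x|) := by
            rw [abs_mul, abs_mul, abs_of_pos (pow_pos hx.1 3)]; ring
          rw [this]
          have := hx.1
          gcongr
          exact (norm_nonneg _).trans (hB 0 (by simp))
        · exact (hB' x ⟨h1, hx.2.trans (le_max_left _ _)⟩).trans (le_max_right _ _)
    have h0 : Tendsto (fun x => x ^ 4 * N x * J x - G x) (𝓝[>] 0) (𝓝 0) := by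
      have hGt : Tendsto G (𝓝[>] 0) (𝓝 0) := by
        have := (hGd 0).continuousAt.tendsto
        rw [show G 0 = 0 by simp [hG]] at this
        exact this.mono_left nhdsWithin_le_nhds
      have hb : Tendsto (fun x => x * N x * D) (𝓝[>] 0) (𝓝 0) := by
        have hc : Continuous fun x => x * N x * D := by fun_prop
        have := hc.tendsto 0
        simp only [zero_mul] at this
        exact this.mono_left nhdsWithin_le_nhds
      have : Tendsto (fun x => x ^ 4 * N x * J x) (𝓝[>] 0) (𝓝 0) := by
        refine squeeze_zero_norm' ?_ (by simpa using hb.norm)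
        filter_upwards [Ioc_mem_nhdsGT one_pos] with x hx
        have hD0 : 0 ≤ D := (norm_nonneg _).trans (hD 0 (by simp))
        have e2 := hJb x hx.1 hx.2
        have e3 : |x ^ 4 * N x * J x| = |x * N x| * (x ^ 3 * |J x|) := by
          rw [abs_mul, abs_mul, abs_mul, abs_of_pos (pow_pos hx.1 4), abs_of_pos hx.1]; ring
        rw [Real.norm_eq_abs, e3, ← abs_mul, ← abs_mul, abs_mul _ D, abs_of_nonneg hD0]
        gcongr
      simpa using this.sub hGt
    have hy' : Tendsto (fun x => x ^ 4 * N x * J x - G x) (𝓝[<] y)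
        (𝓝 (y ^ 4 * N y * J y - G y)) :=
      (hder y hy).continuousAt.tendsto.mono_left nhdsWithin_le_nhds
    rw [h1, intervalIntegral.integral_eq_sub_of_hasDerivAt_of_tendsto hy
      (fun x hx => hder x hx.1) hint h0 hy', sub_zero]
  rw [Hinv, hI1, hI2, hGam y hy, hR.Lam_eq hy]
  have : HI q p w y = -(q y * G y) := rfl
  rw [this]; ring

theorem Hinv_iter_eq {w F : ℝ → ℝ} (hw : SmoothEven w) {R : ℝ}
    (h : ∀ y, 0 < y → y < R → F y = y * w y) (k : ℕ)
    {y : ℝ} (hy : 0 < y) (hyR : y < R) : (Hinv Q)^[k] F y = y * (HI q p)^[k] w y := by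
  induction k generalizing y with
  | zero => exact h y hy hyR
  | succ k ih =>
    rw [Function.iterate_succ_apply', Function.iterate_succ_apply']
    exact hR.Hinv_eq (hR.smoothEven_HI_iter hw k).continuous (fun z hz hzR => ih hz hzR) hy hyR

end Reduced

theorem Lam_eq_mul_LR {w F : ℝ → ℝ} (hw : SmoothEven w) {R : ℝ}
    (h : ∀ y, 0 < y → y < R → F y = y * w y) {y : ℝ} (hy : 0 < y) (hyR : y < R) :
    Lam F y = y * LR w y := by
  have hev : F =ᶠ[𝓝 y] fun y => y * w y := by
    filter_upwards [Ioo_mem_nhds hy hyR] with x hx using h x hx.1 hx.2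
  have : HasDerivAt (fun y => y * w y) (1 * w y + y * deriv w y) y :=
    (hasDerivAt_id y).mul (hw.differentiable y).hasDerivAt
  rw [Lam, LR, hev.deriv_eq, this.deriv, one_mul]

/-! ### Quantitative inversion with polynomial bounds. -/

/-- Weighted Cauchy–Schwarz inequality on an interval. -/
theorem abs_integral_mul_le {f h θ : ℝ → ℝ} {r : ℝ} (hr : 0 ≤ r) (hf : Continuous f)
    (hh : Continuous h) (hθ : Continuous θ) (hθ0 : ∀ y ∈ Icc 0 r, 0 ≤ θ y) :
    |∫ y in (0 : ℝ)..r, f y * h y * θ y| ≤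
      √(∫ y in (0 : ℝ)..r, f y ^ 2 * θ y) * √(∫ y in (0 : ℝ)..r, h y ^ 2 * θ y) := by
  set a := ∫ y in (0 : ℝ)..r, h y ^ 2 * θ y
  set b := ∫ y in (0 : ℝ)..r, f y * h y * θ y
  set c := ∫ y in (0 : ℝ)..r, f y ^ 2 * θ y
  have ha : 0 ≤ a := intervalIntegral.integral_nonneg hr fun y hy => mul_nonneg (sq_nonneg _) (hθ0 y hy)
  have hc : 0 ≤ c := intervalIntegral.integral_nonneg hr fun y hy => mul_nonneg (sq_nonneg _) (hθ0 y hy)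
  have key : ∀ s : ℝ, 0 ≤ a * (s * s) + 2 * b * s + c := by
    intro s
    have h1 : 0 ≤ ∫ y in (0 : ℝ)..r, (f y + s * h y) ^ 2 * θ y :=
      intervalIntegral.integral_nonneg hr fun y hy => mul_nonneg (sq_nonneg _) (hθ0 y hy)
    have h2 : ∫ y in (0 : ℝ)..r, (f y + s * h y) ^ 2 * θ y
        = (∫ y in (0 : ℝ)..r, s * s * (h y ^ 2 * θ y)) +
          (∫ y in (0 : ℝ)..r, 2 * s * (f y * h y * θ y)) + ∫ y in (0 : ℝ)..r, f y ^ 2 * θ y := by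
      rw [← intervalIntegral.integral_add, ← intervalIntegral.integral_add]
      · refine intervalIntegral.integral_congr fun y _ => ?_
        ring
      all_goals exact Continuous.intervalIntegrable (by fun_prop) _ _
    rw [h2, intervalIntegral.integral_const_mul, intervalIntegral.integral_const_mul] at h1
    linarith
  have hd := discrim_le_zero key
  rw [discrim] at hd
  rw [← Real.sqrt_mul hc]
  refine Real.abs_le_sqrt ?_
  nlinarith

/-- One power of the weight t^(k+1) absorbs the singularity 1/t of the rescaled argument. -/
theorem abs_Av_le_div {k : ℕ} {h : ℝ → ℝ} {x B : ℝ} (hx : 0 < x)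
    (hB : ∀ t ∈ Ioc (0 : ℝ) 1, |h (t * x)| ≤ B / (t * x)) : |Av (k + 1) h x| ≤ B / x := by
  have hB0 : 0 ≤ B := by
    have := (abs_nonneg _).trans (hB 1 ⟨one_pos, le_rfl⟩)
    rw [one_mul] at this
    by_contra hneg
    exact absurd this (not_le.2 (div_neg_of_neg_of_pos (not_le.1 hneg) hx))
  have := intervalIntegral.norm_integral_le_of_norm_le_const (a := (0 : ℝ)) (b := 1)
    (f := fun t => t ^ (k + 1) * h (t * x)) (C := B / x) fun t ht => by
      rw [uIoc_of_le zero_le_one] at ht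
      rw [Real.norm_eq_abs, abs_mul, abs_pow, abs_of_pos ht.1]
      have ht0 := ht.1
      calc t ^ (k + 1) * |h (t * x)| ≤ t ^ (k + 1) * (B / (t * x)) := by gcongr; exact hB t ht
        _ = t ^ k * (B / x) := by field_simp; ring
        _ ≤ 1 * (B / x) := by gcongr; exact pow_le_one₀ ht.1.le ht.2
        _ = B / x := one_mul _
  simpa [Av] using this

namespace Reduced
variable {g Q Q₀ q p V : ℝ → ℝ} (hR : Reduced g Q Q₀ q p V)
include hR

/-- The input may blow up like 1/y at the origin, which is all that the L² control of
`exists_abs_sub_le` provides; one inversion already gives a function bounded near 0. -/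
theorem exists_abs_HI_le (k : ℕ) : ∃ (C : ℝ) (m : ℕ), 0 ≤ C ∧ ∀ F A r, 0 ≤ A →
    (∀ y, 0 < y → y < r → |F y| ≤ A * (1 + y) ^ k / y) →
    ∀ y, 0 < y → y < r → |HI q p F y| ≤ C * A * (1 + y) ^ m := by
  obtain ⟨Cq, mq, hCq, hq⟩ := hR.q_tg.polyGrowth.nonneg_bound
  obtain ⟨Cp, mp, hCp, hp⟩ := hR.p_tg.polyGrowth.nonneg_bound
  refine ⟨Cq * (Cp ^ 2 * Cq), mq + 1 + (mp * 2 + k + mq), by positivity, ?_⟩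
  intro F A r hA hF y hy hyr
  have h1 : ∀ x, 0 < x → x ≤ y →
      |Av 3 (fun z => F z * q z) x| ≤ A * Cq * (1 + y) ^ (k + mq) / x := by
    intro x hx hxy
    refine abs_Av_le_div hx fun t ht => ?_
    have htx : 0 < t * x := mul_pos ht.1 hx
    have hle : t * x ≤ y := (mul_le_of_le_one_left hx.le ht.2).trans hxy
    have hq1 := hq (t * x)
    have hF1 := hF (t * x) htx (hle.trans_lt hyr)
    rw [abs_of_pos htx] at hq1
    rw [abs_mul]
    calc |F (t * x)| * |q (t * x)|
        ≤ (A * (1 + t * x) ^ k / (t * x)) * (Cq * (1 + t * x) ^ mq) := by gcongr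
      _ ≤ (A * (1 + y) ^ k / (t * x)) * (Cq * (1 + y) ^ mq) := by gcongr
      _ = _ := by rw [pow_add]; ring
  have h2 : |Av 1 (fun x => p x ^ 2 * Av 3 (fun z => F z * q z) x) y|
      ≤ Cp ^ 2 * Cq * A * (1 + y) ^ (mp * 2 + k + mq) / y := by
    refine abs_Av_le_div hy fun t ht => ?_
    have htx : 0 < t * y := mul_pos ht.1 hy
    have hle : t * y ≤ y := mul_le_of_le_one_left hy.le ht.2
    have hp1 := hp (t * y)
    rw [abs_of_pos htx] at hp1
    have h3 := h1 (t * y) htx hle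
    rw [abs_mul, abs_pow]
    calc |p (t * y)| ^ 2 * |Av 3 (fun z => F z * q z) (t * y)|
        ≤ (Cp * (1 + t * y) ^ mp) ^ 2 * (A * Cq * (1 + y) ^ (k + mq) / (t * y)) := by gcongr
      _ ≤ (Cp * (1 + y) ^ mp) ^ 2 * (A * Cq * (1 + y) ^ (k + mq) / (t * y)) := by gcongr
      _ = _ := by rw [mul_pow, ← pow_mul, add_assoc, pow_add _ (mp * 2)]; ring
  have hq1 := hq y
  rw [abs_of_pos hy] at hq1
  rw [HI, abs_neg, abs_mul, abs_mul, abs_of_pos (pow_pos hy 2)]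
  calc |q y| * (y ^ 2 * |Av 1 (fun x => p x ^ 2 * Av 3 (fun z => F z * q z) x) y|)
      ≤ (Cq * (1 + y) ^ mq) * (y ^ 2 * (Cp ^ 2 * Cq * A * (1 + y) ^ (mp * 2 + k + mq) / y)) := by
        gcongr
    _ = Cq * (Cp ^ 2 * Cq) * A * ((1 + y) ^ mq * y * (1 + y) ^ (mp * 2 + k + mq)) := by
        field_simp
    _ ≤ Cq * (Cp ^ 2 * Cq) * A * ((1 + y) ^ mq * (1 + y) * (1 + y) ^ (mp * 2 + k + mq)) := by
        gcongr; linarith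
    _ = _ := by rw [pow_add _ (mq + 1), pow_succ _ mq]

theorem exists_abs_HI_iter_le (n k : ℕ) (hn : 1 ≤ n) : ∃ (C : ℝ) (m : ℕ), 0 ≤ C ∧
    ∀ F A r, 0 ≤ A → (∀ y, 0 < y → y < r → |F y| ≤ A * (1 + y) ^ k / y) →
    ∀ y, 0 < y → y < r → |(HI q p)^[n] F y| ≤ C * A * (1 + y) ^ m := by
  induction n, hn using Nat.le_induction with
  | base => exact hR.exists_abs_HI_le k
  | succ n hn ih =>
    obtain ⟨C, m, hC, h⟩ := ih
    obtain ⟨C', m', hC', h'⟩ := hR.exists_abs_HI_le (m + 1)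
    refine ⟨C' * C, m', by positivity, fun F A r hA hF y hy hyr => ?_⟩
    rw [Function.iterate_succ_apply', mul_assoc C']
    refine h' _ (C * A) r (by positivity) (fun z hz hzr => (h F A r hA hF z hz hzr).trans ?_) y hy hyr
    rw [le_div_iff₀ hz, pow_succ, ← mul_assoc]
    gcongr
    linarith

/-- A function is, up to a multiple of `q`, controlled by its image under `H` in `L²`. -/
theorem exists_abs_sub_le : ∃ (C : ℝ) (k : ℕ), 0 ≤ C ∧ ∀ w r η, SmoothEven w → 1 < r → 0 ≤ η →
    ∫ y in (0 : ℝ)..r, HR V w y ^ 2 * y ^ 3 ≤ η ^ 2 →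
    ∃ a, ∀ y, 0 < y → y < r → |w y - a * q y| ≤ C * η * (1 + y) ^ k / y := by
  obtain ⟨Cq, mq, hCq, hq⟩ := hR.q_tg.polyGrowth.nonneg_bound
  obtain ⟨Cp, mp, hCp, hp⟩ := hR.p_tg.polyGrowth.nonneg_bound
  refine ⟨Cq * (Cp ^ 2 * Cq * 2 ^ (2 * mp + mq)), mq + (2 * mp + mq + 2), by positivity, ?_⟩
  intro w r η hw hr hη hE
  set F := HR V w with hFdef
  have hF : SmoothEven F := hR.V_even.HR hw
  set N := Av 3 (fun z => F z * q z) with hN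
  have hNE : SmoothEven N := (hF.mul hR.q_even).Av
  -- the bound on `N`
  have hNb : ∀ y, 0 < y → y < r → |y * (p y ^ 2 * N y)| ≤ Cp ^ 2 * Cq * η * (1 + y) ^ (2 * mp + mq) / y := by
    intro y hy hyr
    have hcs := abs_integral_mul_le hy.le hF.continuous hR.q_even.continuous
      (θ := fun y => y ^ 3) (by fun_prop) (fun y hy => pow_nonneg hy.1 3)
    have h1 : ∫ z in (0 : ℝ)..y, F z * q z * z ^ 3 = y ^ 4 * N y := by
      rw [hN, show y ^ 4 = y ^ (3 + 1) by norm_num, pow_mul_Av]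
      exact intervalIntegral.integral_congr fun z _ => by ring
    have h2 : √(∫ z in (0 : ℝ)..y, F z ^ 2 * z ^ 3) ≤ η := by
      refine Real.sqrt_le_iff.2 ⟨hη, le_trans ?_ hE⟩
      have hc : Continuous fun z => F z ^ 2 * z ^ 3 := by have := hF.continuous; fun_prop
      refine intervalIntegral.integral_mono_interval le_rfl hy.le hyr.le ?_
        (hc.intervalIntegrable _ _)
      refine (ae_restrict_iff' measurableSet_Ioc).2 (Eventually.of_forall fun z hz => ?_)
      have := hz.1
      simp only [Pi.zero_apply]; positivity
    have h3 : √(∫ z in (0 : ℝ)..y, q z ^ 2 * z ^ 3) ≤ Cq * (1 + y) ^ mq * y ^ 2 := by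
      refine Real.sqrt_le_iff.2 ⟨by positivity, ?_⟩
      have := intervalIntegral.norm_integral_le_of_norm_le_const (a := (0 : ℝ)) (b := y)
        (f := fun z => q z ^ 2 * z ^ 3) (C := (Cq * (1 + y) ^ mq) ^ 2 * y ^ 3) fun z hz => by
          rw [uIoc_of_le hy.le] at hz
          have hz0 := hz.1
          have hz1 := hz.2
          have hqz := hq z
          rw [abs_of_pos hz0] at hqz
          rw [Real.norm_eq_abs, abs_mul, abs_pow, abs_of_pos (pow_pos hz0 3)]
          have : |q z| ≤ Cq * (1 + y) ^ mq := hqz.trans (by gcongr)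
          gcongr
      rw [Real.norm_eq_abs, sub_zero, abs_of_pos hy] at this
      refine (le_abs_self _).trans (this.trans (le_of_eq (by ring)))
    have h4 : y ^ 4 * |N y| ≤ η * (Cq * (1 + y) ^ mq * y ^ 2) := by
      rw [← abs_of_pos (pow_pos hy 4), ← abs_mul, ← h1]
      exact hcs.trans (by gcongr)
    have hp1 := hp y
    rw [abs_of_pos hy] at hp1
    rw [abs_mul, abs_mul, abs_of_pos hy, abs_pow, le_div_iff₀ hy]
    have h5 : y ^ 2 * |N y| ≤ η * (Cq * (1 + y) ^ mq) := by
      refine le_of_mul_le_mul_left ?_ (pow_pos hy 2)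
      linarith [h4]
    calc y * (|p y| ^ 2 * |N y|) * y = |p y| ^ 2 * (y ^ 2 * |N y|) := by ring
      _ ≤ (Cp * (1 + y) ^ mp) ^ 2 * (η * (Cq * (1 + y) ^ mq)) := by gcongr
      _ = _ := by rw [mul_pow, ← pow_mul, pow_add, mul_comm 2 mp]; ring
  have hrep := hR.eq_smul_add_HI hw
  set G : ℝ → ℝ := fun y => y ^ 2 * Av 1 (fun x => p x ^ 2 * N x) y with hG
  have hGd : ∀ y, HasDerivAt G (y * (p y ^ 2 * N y)) y := fun y => by
    simpa using hasDerivAt_pow_mul_Av (k := 1) (((hR.p_even.pow 2).mul hNE).continuous) y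
  -- The coefficient is normalized at y = 1 rather than at y = 0: integrating G' from 1 avoids the
  -- uncontrolled integral near the origin, at the price of the factor 1/y in the bound.
  refine ⟨w 0 * p 0 - G 1, fun y hy hyr => ?_⟩
  have hdiff : |G y - G 1| ≤ Cp ^ 2 * Cq * 2 ^ (2 * mp + mq) * η * (1 + y) ^ (2 * mp + mq + 2) / y := by
    rcases le_total y 1 with h | h
    · have := (convex_Icc y 1).norm_image_sub_le_of_norm_hasDerivWithin_le
        (f := G) (C := Cp ^ 2 * Cq * η * 2 ^ (2 * mp + mq) / y)
        (fun x _ => (hGd x).hasDerivWithinAt) (fun x hx => by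
          have hx0 : 0 < x := hy.trans_le hx.1
          refine (hNb x hx0 (hx.2.trans_lt hr)).trans ?_
          have h1 := hx.1
          have h2 : 1 + x ≤ 2 := by linarith [hx.2]
          gcongr) (right_mem_Icc.2 h) (left_mem_Icc.2 h)
      rw [Real.norm_eq_abs, Real.norm_eq_abs] at this
      have h4 : |y - 1| ≤ 1 := by rw [abs_le]; constructor <;> linarith
      refine this.trans ((mul_le_mul_of_nonneg_left h4 (by positivity)).trans ?_)
      have h5 : (1 : ℝ) ≤ (1 + y) ^ (2 * mp + mq + 2) := one_le_pow₀ (by linarith)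
      rw [mul_one]
      refine div_le_div_of_nonneg_right ?_ hy.le
      calc Cp ^ 2 * Cq * η * 2 ^ (2 * mp + mq) = Cp ^ 2 * Cq * 2 ^ (2 * mp + mq) * η * 1 := by ring
        _ ≤ _ := by gcongr
    · have := (convex_Icc 1 y).norm_image_sub_le_of_norm_hasDerivWithin_le
        (f := G) (C := Cp ^ 2 * Cq * η * (1 + y) ^ (2 * mp + mq))
        (fun x _ => (hGd x).hasDerivWithinAt) (fun x hx => by
          have hx1 := hx.1
          have hx0 : 0 < x := one_pos.trans_le hx.1
          refine (hNb x hx0 (hx.2.trans_lt hyr)).trans ?_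
          refine (div_le_self (by positivity) hx1).trans ?_
          have h1 := hx.2
          gcongr) (left_mem_Icc.2 h) (right_mem_Icc.2 h)
      rw [Real.norm_eq_abs, Real.norm_eq_abs] at this
      refine this.trans ?_
      rw [abs_of_nonneg (by linarith), le_div_iff₀ hy, pow_add (1 + y) _ 2]
      have h5 : (1 : ℝ) ≤ 2 ^ (2 * mp + mq) := one_le_pow₀ (by norm_num)
      have h6 : (y - 1) * y ≤ (1 + y) ^ 2 := by nlinarith
      calc Cp ^ 2 * Cq * η * (1 + y) ^ (2 * mp + mq) * (y - 1) * y
          = Cp ^ 2 * Cq * 1 * η * ((1 + y) ^ (2 * mp + mq) * ((y - 1) * y)) := by ring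
        _ ≤ _ := by gcongr
  have hq1 := hq y
  rw [abs_of_pos hy] at hq1
  have hHI : HI q p F y = -(q y * G y) := rfl
  have : w y - (w 0 * p 0 - G 1) * q y = -(q y * (G y - G 1)) := by
    rw [hrep y, hHI]; ring
  rw [this, abs_neg, abs_mul]
  calc |q y| * |G y - G 1| ≤ (Cq * (1 + y) ^ mq) *
        (Cp ^ 2 * Cq * 2 ^ (2 * mp + mq) * η * (1 + y) ^ (2 * mp + mq + 2) / y) := by gcongr
    _ = _ := by rw [pow_add _ mq]; ring

/-- Inversion of `H^n` modulo its regular kernel. -/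
theorem exists_eq_sum_HI_iter {w : ℝ → ℝ} (hw : SmoothEven w) (n : ℕ) : ∃ a : ℕ → ℝ, ∀ y,
    w y = ∑ k ∈ Finset.range n, a k * (HI q p)^[k] q y + (HI q p)^[n] ((HR V)^[n] w) y := by
  induction n generalizing w with
  | zero => exact ⟨0, fun y => by simp⟩
  | succ n ih =>
    obtain ⟨a, ha⟩ := ih (hR.V_even.HR hw)
    refine ⟨fun k => if k = 0 then w 0 * p 0 else a (k - 1), fun y => ?_⟩
    have hsum : ∀ (s : Finset ℕ) (a : ℕ → ℝ) (v : ℝ → ℝ), SmoothEven v →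
        HI q p (fun y => ∑ k ∈ s, a k * (HI q p)^[k] q y + v y)
          = fun y => ∑ k ∈ s, a k * (HI q p)^[k + 1] q y + HI q p v y := by
      intro s a v hv
      induction s using Finset.induction_on with
      | empty => simp
      | insert i s hi ihs =>
        simp only [Finset.sum_insert hi, add_assoc]
        rw [HI_add hR.q_even.continuous hR.p_even.continuous
          ((hR.smoothEven_HI_iter hR.q_even i).const_mul _).continuous
          ((SmoothEven.sum s fun k _ => (hR.smoothEven_HI_iter hR.q_even k).const_mul (a k)).add
            hv).continuous, HI_const_mul, ihs]
        simp only [Function.iterate_succ_apply']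
    have h1 : HR V w = fun y => ∑ k ∈ Finset.range n, a k * (HI q p)^[k] q y
        + (HI q p)^[n] ((HR V)^[n] (HR V w)) y := funext ha
    have h2 : HI q p (HR V w) y = ∑ k ∈ Finset.range n, a k * (HI q p)^[k + 1] q y
        + HI q p ((HI q p)^[n] ((HR V)^[n] (HR V w))) y := by
      conv_lhs => rw [h1]
      rw [hsum _ _ _ (hR.smoothEven_HI_iter (hR.smoothEven_HR_iter (hR.V_even.HR hw) n) n)]
    rw [hR.eq_smul_add_HI hw y, h2, Finset.sum_range_succ']
    simp only [if_true, Nat.add_one_sub_one, Nat.add_eq_zero_iff, one_ne_zero, and_false, if_false,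
      Function.iterate_zero, id, Function.iterate_succ_apply]
    rw [← Function.iterate_succ_apply' (HI q p), ← Function.iterate_succ_apply (HI q p)]
    ring

end Reduced

/-! ### The profiles T_i, even cut-offs and duality with the directions H^k Φ_M. -/

/-- Reduced profiles: `T_i = y * TR i`. -/
noncomputable def TR (q p : ℝ → ℝ) (i : ℕ) (y : ℝ) : ℝ := (-1) ^ i * (HI q p)^[i] q y

/-- The even extension of the cut-off `χ_B`. -/
noncomputable def evenCut (χ : ℝ → ℝ) (B y : ℝ) : ℝ := χ (y / B) * χ (-(y / B))

namespace IsCutoff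
variable {χ : ℝ → ℝ} (hχ : IsCutoff χ)
include hχ

theorem evenCut_even (B : ℝ) : SmoothEven (evenCut χ B) := by
  have h1 : ContDiff ℝ ∞ fun y : ℝ => y / B := contDiff_id.div_const B
  refine ⟨(hχ.smooth.comp h1).mul (hχ.smooth.comp h1.neg), fun y => ?_⟩
  simp only [evenCut, neg_div, neg_neg]; ring

theorem cut_eq {B y : ℝ} (hB : 0 < B) (hy : 0 < y) : cut χ B y = evenCut χ B y := by
  have : 0 < y / B := div_pos hy hB
  rw [cut, evenCut, hχ.eq_one (-(y / B)) (by linarith), mul_one]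

theorem evenCut_zero {B y : ℝ} (hB : 0 < B) (hy : 2 * B ≤ y) : evenCut χ B y = 0 := by
  rw [evenCut, hχ.eq_zero (y / B) (by rwa [le_div_iff₀ hB]), zero_mul]

theorem evenCut_one {B y : ℝ} (hB : 0 < B) (hy : |y| ≤ B) : evenCut χ B y = 1 := by
  have h := abs_le.1 hy
  rw [evenCut, hχ.eq_one, hχ.eq_one, one_mul]
  · rw [← neg_div, div_le_one hB]; linarith
  · rw [div_le_one hB]; exact h.2

theorem nonneg (y : ℝ) : 0 ≤ χ y := by
  have := hχ.antitone (le_max_left y 2)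
  rwa [hχ.eq_zero _ (le_max_right y 2)] at this

theorem le_one (y : ℝ) : χ y ≤ 1 := by
  have := hχ.antitone (min_le_left y 1)
  rwa [hχ.eq_one _ (min_le_right y 1)] at this

theorem evenCut_nonneg (B y : ℝ) : 0 ≤ evenCut χ B y := mul_nonneg (hχ.nonneg _) (hχ.nonneg _)

theorem evenCut_le_one (B y : ℝ) : evenCut χ B y ≤ 1 :=
  mul_le_one₀ (hχ.le_one _) (hχ.nonneg _) (hχ.le_one _)

end IsCutoff

theorem eq_zero_of_Ioi {f : ℝ → ℝ} (hf : Continuous f) {R : ℝ} (h : ∀ y, R < y → f y = 0) :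
    f R = 0 := by
  have h1 : Tendsto f (𝓝[>] R) (𝓝 (f R)) := hf.continuousWithinAt.tendsto
  refine tendsto_nhds_unique (h1.congr' ?_) tendsto_const_nhds
  filter_upwards [self_mem_nhdsWithin] with y hy using h y hy

theorem SmoothEven.deriv_eq_zero {w : ℝ → ℝ} (hw : SmoothEven w) {R : ℝ}
    (h : ∀ y, R ≤ y → w y = 0) : ∀ y, R ≤ y → _root_.deriv w y = 0 := by
  have h1 : ∀ y, R < y → _root_.deriv w y = 0 := fun y hy => by
    have : w =ᶠ[𝓝 y] fun _ => 0 := by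
      filter_upwards [lt_mem_nhds hy] with z hz using h z hz.le
    rw [this.deriv_eq, deriv_const]
  intro y hy
  rcases hy.eq_or_lt with rfl | hy
  · exact eq_zero_of_Ioi hw.deriv.smooth.continuous h1
  · exact h1 y hy

theorem SmoothEven.HR_eq_zero {V w : ℝ → ℝ} (hV : SmoothEven V) (hw : SmoothEven w) {R : ℝ}
    (hR0 : 0 < R) (h : ∀ y, R ≤ y → w y = 0) : ∀ y, R ≤ y → HeatFlow.HR V w y = 0 := by
  have h1 : ∀ y, R < y → HeatFlow.HR V w y = 0 := fun y hy => by
    have : _root_.deriv w =ᶠ[𝓝 y] fun _ => 0 := by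
      filter_upwards [lt_mem_nhds hy] with z hz using hw.deriv_eq_zero h z hz.le
    rw [HR_eq hw (hR0.trans hy).ne', this.deriv_eq, this.eq_of_nhds, h y hy.le]
    simp
  intro y hy
  rcases hy.eq_or_lt with rfl | hy
  · exact eq_zero_of_Ioi (hV.HR hw).continuous h1
  · exact h1 y hy

/-- A compactly supported second factor makes the pairing local, so the first factor needs a reduced
form only on its support; the measure y dy becomes y³ dy. -/
theorem pair_eq_integral {u v w z : ℝ → ℝ} {r : ℝ} (hr : 0 < r)
    (hu : ∀ y, 0 < y → y < r → u y = y * w y) (hv : ∀ y, 0 < y → v y = y * z y)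
    (hz : ∀ y, r ≤ y → z y = 0) : pair u v = ∫ y in (0 : ℝ)..r, w y * z y * y ^ 3 := by
  rw [pair, intervalIntegral.integral_of_le hr.le,
    setIntegral_eq_of_subset_of_forall_sdiff_eq_zero (s := Ioc 0 r) measurableSet_Ioi
      (fun y hy => hy.1) (fun y hy => ?_)]
  · refine setIntegral_congr_fun measurableSet_Ioc fun y hy => ?_
    rcases hy.2.eq_or_lt with e | h
    · simp only [hv y hy.1, hz y e.ge]; ring
    · simp only [hv y hy.1, hu y hy.1 h]; ring
  · have h1 : r ≤ y := by
      by_contra h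
      exact hy.2 ⟨hy.1, (not_le.1 h).le⟩
    rw [hv y hy.1, hz y h1]; ring

/-- The reduced direction: `Φ_M = y * PhiR`. -/
noncomputable def PhiR (g Q χ q V : ℝ → ℝ) (L : ℕ) (M y : ℝ) : ℝ :=
  ∑ j ∈ Finset.range (L + 1), coefM g Q χ M j * (HR V)^[j] (fun x => evenCut χ M x * q x) y

namespace Reduced
variable {g Q Q₀ q p V : ℝ → ℝ} (hR : Reduced g Q Q₀ q p V)
include hR

theorem T_eq (i : ℕ) {y : ℝ} (hy : 0 < y) : T Q i y = y * TR q p i y := by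
  rw [T, TR, hR.Hinv_iter_eq (F := Lam Q) hR.q_even (R := y + 1) (fun z hz _ => hR.Lam_eq hz) i hy
    (by linarith)]
  ring

theorem smoothEven_TR (i : ℕ) : SmoothEven (TR q p i) :=
  (hR.smoothEven_HI_iter hR.q_even i).const_mul _

theorem tg_TR (i : ℕ) : TG (TR q p i) := (hR.tg_HI_iter hR.q_tg i).const_mul _

theorem HR_TR_zero : HR V (TR q p 0) = fun _ => 0 := by
  have : TR q p 0 = q := by ext; simp [TR]
  rw [this, hR.HR_q]

theorem HR_TR_succ (i : ℕ) : HR V (TR q p (i + 1)) = fun y => -TR q p i y := by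
  have h1 : TR q p (i + 1) = fun y => (-1) ^ (i + 1) * (HI q p)^[i + 1] q y := rfl
  rw [h1, HR_const_mul (hR.smoothEven_HI_iter hR.q_even _), Function.iterate_succ_apply',
    hR.HR_HI (hR.smoothEven_HI_iter hR.q_even i)]
  ext y; simp only [TR, pow_succ]; ring

omit hR in
theorem HR_zero : HR V (fun _ => 0) = fun _ => 0 := by
  have h := HR_const_mul (V := V) (SmoothEven.const 0) 0
  simpa using h

omit hR in
theorem HR_iter_zero (k : ℕ) : (HR V)^[k] (fun _ => 0) = fun _ => 0 := by
  induction k with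
  | zero => rfl
  | succ k ih => rw [Function.iterate_succ_apply', ih, HR_zero]

theorem HR_iter_const_mul {w : ℝ → ℝ} (hw : SmoothEven w) (c : ℝ) (k : ℕ) :
    (HR V)^[k] (fun x => c * w x) = fun x => c * (HR V)^[k] w x := by
  induction k with
  | zero => rfl
  | succ k ih =>
    rw [Function.iterate_succ_apply', ih, HR_const_mul (hR.smoothEven_HR_iter hw k),
      Function.iterate_succ_apply']

theorem HR_iter_TR (k j : ℕ) : (HR V)^[k] (TR q p j) =
    if k ≤ j then fun y => (-1) ^ k * TR q p (j - k) y else fun _ => 0 := by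
  induction k generalizing j with
  | zero => ext y; simp
  | succ k ih =>
    rw [Function.iterate_succ_apply]
    cases j with
    | zero => rw [hR.HR_TR_zero, HR_iter_zero]; simp
    | succ j =>
      have h1 : HR V (TR q p (j + 1)) = fun y => (-1) * TR q p j y := by
        rw [hR.HR_TR_succ]; ext y; ring
      rw [h1, hR.HR_iter_const_mul (hR.smoothEven_TR j), ih]
      by_cases h : k ≤ j
      · simp only [h, if_true, Nat.add_le_add_iff_right, Nat.add_sub_add_right, pow_succ]
        ext y; ring
      · simp [h]

theorem HR_iter_eq_zero {w : ℝ → ℝ} (hw : SmoothEven w) {R : ℝ}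
    (hR0 : 0 < R) (h : ∀ y, R ≤ y → w y = 0) (k : ℕ) : ∀ y, R ≤ y → (HR V)^[k] w y = 0 := by
  induction k with
  | zero => exact h
  | succ k ih =>
    rw [Function.iterate_succ_apply']
    exact hR.V_even.HR_eq_zero (hR.smoothEven_HR_iter hw k) hR0 ih

theorem integral_HR_iter_mul {u w : ℝ → ℝ} (hu : SmoothEven u) (hw : SmoothEven w) {r : ℝ}
    (hr : 0 < r) (h : ∀ y, r ≤ y → w y = 0) (k : ℕ) :
    ∫ y in (0 : ℝ)..r, (HR V)^[k] u y * w y * y ^ 3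
      = ∫ y in (0 : ℝ)..r, u y * (HR V)^[k] w y * y ^ 3 := by
  induction k generalizing w with
  | zero => rfl
  | succ k ih =>
    rw [Function.iterate_succ_apply', hR.integral_HR_mul (hR.smoothEven_HR_iter hu k) hw
      (h r le_rfl) (hw.deriv_eq_zero h r le_rfl), ih (hR.V_even.HR hw)
      (hR.V_even.HR_eq_zero hw hr h), Function.iterate_succ_apply]

section Directions
variable {χ : ℝ → ℝ} (hχ : IsCutoff χ) {M : ℝ} (hM : 0 < M)
include hχ hM

omit hM in
theorem smoothEven_cut_q (B : ℝ) : SmoothEven fun x => evenCut χ B x * q x :=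
  (hχ.evenCut_even B).mul hR.q_even

omit hR in
theorem cut_q_zero {y : ℝ} (hy : 2 * M ≤ y) : evenCut χ M y * q y = 0 := by
  rw [hχ.evenCut_zero hM hy, zero_mul]

theorem cut_Lam_eq {y : ℝ} (hy : 0 < y) :
    cut χ M y * Lam Q y = y * (evenCut χ M y * q y) := by
  rw [hχ.cut_eq hM hy, hR.Lam_eq hy]; ring

theorem H_iter_cut (k : ℕ) {y : ℝ} (hy : 0 < y) :
    (H g Q)^[k] (fun x => cut χ M x * Lam Q x) y
      = y * (HR V)^[k] (fun x => evenCut χ M x * q x) y :=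
  hR.H_iter_eq (hR.smoothEven_cut_q hχ M) (R := y + 1)
    (fun z hz _ => hR.cut_Lam_eq hχ hM hz) k hy (by linarith)

omit hM in
theorem smoothEven_PhiR (L : ℕ) : SmoothEven (PhiR g Q χ q V L M) :=
  SmoothEven.sum _ fun k _ => (hR.smoothEven_HR_iter ((hχ.evenCut_even M).mul hR.q_even) k).const_mul _

theorem PhiR_eq_zero (L : ℕ) : ∀ y, 2 * M ≤ y → PhiR g Q χ q V L M y = 0 := fun y hy =>
  Finset.sum_eq_zero fun k _ => by
    rw [hR.HR_iter_eq_zero (hR.smoothEven_cut_q hχ M) (by linarith : 0 < 2 * M)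
      (fun y hy => cut_q_zero hχ hM hy) k y hy, mul_zero]

theorem H_iter_PhiM (L k : ℕ) {y : ℝ} (hy : 0 < y) :
    (H g Q)^[k] (PhiM g Q χ L M) y = y * (HR V)^[k] (PhiR g Q χ q V L M) y := by
  refine hR.H_iter_eq (hR.smoothEven_PhiR hχ L) (R := y + 1) (fun z hz _ => ?_) k hy (by linarith)
  rw [PhiM, PhiR, Finset.mul_sum]
  refine Finset.sum_congr rfl fun j _ => ?_
  rw [hR.H_iter_cut hχ hM j hz]; ring

theorem integral_cut_pos : 0 < ∫ y in (0 : ℝ)..(2 * M), evenCut χ M y * q y * q y * y ^ 3 := by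
  have hc : Continuous fun y => evenCut χ M y * q y * q y * y ^ 3 := by
    have h1 := (hχ.evenCut_even M).continuous
    have h2 := hR.q_even.continuous
    fun_prop
  refine intervalIntegral.integral_pos (by linarith) hc.continuousOn (fun y hy => ?_)
    ⟨M, ⟨hM.le, by linarith⟩, ?_⟩
  · have := hχ.evenCut_nonneg M y
    have := hR.q_pos y
    have := hy.1
    positivity
  · rw [hχ.evenCut_one hM (by rw [abs_of_pos hM])]
    have := hR.q_pos M
    positivity

theorem pair_cut_cut : pair (fun y => cut χ M y * Lam Q y) (Lam Q)
    = ∫ y in (0 : ℝ)..(2 * M), evenCut χ M y * q y * q y * y ^ 3 := by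
  have h1 : pair (fun y => cut χ M y * Lam Q y) (Lam Q)
      = pair (Lam Q) (fun y => cut χ M y * Lam Q y) := by simp only [pair, mul_comm (Lam Q _)]
  rw [h1, pair_eq_integral (r := 2 * M) (w := q) (by linarith) (fun y hy _ => hR.Lam_eq hy)
    (fun y hy => hR.cut_Lam_eq hχ hM hy) (fun y hy => cut_q_zero hχ hM hy)]
  exact intervalIntegral.integral_congr fun y _ => by ring

theorem pair_H_iter_T (j k : ℕ) : pair ((H g Q)^[j] fun y => cut χ M y * Lam Q y) (T Q k)
    = ∫ y in (0 : ℝ)..(2 * M), TR q p k y * (HR V)^[j] (fun x => evenCut χ M x * q x) y * y ^ 3 := by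
  have h1 : pair ((H g Q)^[j] fun y => cut χ M y * Lam Q y) (T Q k)
      = pair (T Q k) ((H g Q)^[j] fun y => cut χ M y * Lam Q y) := by
    simp only [pair, mul_comm (T Q k _)]
  rw [h1]
  exact pair_eq_integral (by linarith) (fun y hy _ => hR.T_eq k hy)
    (fun y hy => hR.H_iter_cut hχ hM j hy)
    (hR.HR_iter_eq_zero (hR.smoothEven_cut_q hχ M) (by linarith)
      (fun y hy => cut_q_zero hχ hM hy) j)

/-- This is what the coefficients c_{k,M} are chosen for. In Σ_k c_{k,M} (T_j, H^k(χ_M ΛQ)) the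
terms k > j vanish, as H^k T_j = 0; the term k = j is (-1)^j c_{j,M} (χ_M ΛQ, ΛQ), and the recursion
makes it cancel the terms k < j. -/
theorem integral_TR_mul_PhiR {L j : ℕ} (hj : j ≤ L) :
    ∫ y in (0 : ℝ)..(2 * M), TR q p j y * PhiR g Q χ q V L M y * y ^ 3
      = if j = 0 then ∫ y in (0 : ℝ)..(2 * M), evenCut χ M y * q y * q y * y ^ 3 else 0 := by
  set X : ℝ → ℝ := fun x => evenCut χ M x * q x with hX
  have hXE : SmoothEven X := hR.smoothEven_cut_q hχ M
  have hX0 : ∀ y, 2 * M ≤ y → X y = 0 := fun y hy => cut_q_zero hχ hM hy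
  set I : ℕ → ℕ → ℝ := fun k j => ∫ y in (0 : ℝ)..(2 * M), TR q p j y * (HR V)^[k] X y * y ^ 3 with hI
  have hsum : ∫ y in (0 : ℝ)..(2 * M), TR q p j y * PhiR g Q χ q V L M y * y ^ 3
      = ∑ k ∈ Finset.range (L + 1), coefM g Q χ M k * I k j := by
    simp only [hI, ← intervalIntegral.integral_const_mul]
    rw [← intervalIntegral.integral_finsetSum]
    · refine intervalIntegral.integral_congr fun y _ => ?_
      simp only [PhiR, Finset.mul_sum, Finset.sum_mul]
      refine Finset.sum_congr rfl fun k _ => ?_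
      ring
    · intro k _
      have h1 := (hR.smoothEven_TR j).continuous
      have h2 := (hR.smoothEven_HR_iter hXE k).continuous
      exact Continuous.intervalIntegrable (by fun_prop) _ _
  have hIk : ∀ k j, I k j = ∫ y in (0 : ℝ)..(2 * M), (HR V)^[k] (TR q p j) y * X y * y ^ 3 := fun k j =>
    (hR.integral_HR_iter_mul (hR.smoothEven_TR j) hXE (by linarith) hX0 k).symm
  have hgt : ∀ k j, j < k → I k j = 0 := fun k j h => by
    rw [hIk, hR.HR_iter_TR, if_neg (not_le.2 h)]; simp
  have hq0 : TR q p 0 = q := by ext; simp [TR]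
  have heq : ∀ j, I j j = (-1) ^ j * ∫ y in (0 : ℝ)..(2 * M), evenCut χ M y * q y * q y * y ^ 3 := by
    intro j
    rw [hIk, hR.HR_iter_TR, if_pos le_rfl, ← intervalIntegral.integral_const_mul]
    refine intervalIntegral.integral_congr fun y _ => ?_
    simp only [Nat.sub_self, hq0, hX]; ring
  have hpos := hR.integral_cut_pos hχ hM
  have hsplit : ∑ k ∈ Finset.range (L + 1), coefM g Q χ M k * I k j
      = ∑ k ∈ Finset.range j, coefM g Q χ M k * I k j + coefM g Q χ M j * I j j := by
    rw [← Finset.sum_range_succ]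
    symm
    refine Finset.sum_subset (fun k hk => ?_) fun k _ hk => ?_
    · simp only [Finset.mem_range] at hk ⊢; omega
    · simp only [Finset.mem_range, not_lt] at hk
      rw [hgt k j (by omega), mul_zero]
  rw [hsum, hsplit, heq]
  cases j with
  | zero => simp [coefM]
  | succ j =>
    rw [coefM, hR.pair_cut_cut hχ hM]
    simp only [hR.pair_H_iter_T hχ hM]
    rw [← Finset.sum_range (f := fun k => coefM g Q χ M k * I k (j + 1))]
    have h1 : ((-1 : ℝ) ^ (j + 2)) * (-1) ^ (j + 1) = -1 := by
      rw [← pow_add]; exact Odd.neg_one_pow ⟨j + 1, by ring⟩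
    simp only [Nat.add_eq_zero_iff, one_ne_zero, and_false, if_false]
    set A := ∫ y in (0 : ℝ)..(2 * M), evenCut χ M y * q y * q y * y ^ 3
    have hA : A * A⁻¹ = 1 := mul_inv_cancel₀ hpos.ne'
    rw [div_eq_mul_inv]
    linear_combination (∑ k ∈ Finset.range (j + 1), coefM g Q χ M k * I k (j + 1)) * h1 * (A * A⁻¹)
      - (∑ k ∈ Finset.range (j + 1), coefM g Q χ M k * I k (j + 1)) * hA

/-- Moving H^k onto T_j turns it into ±T_{j-k} or 0, which reduces to the previous lemma. The
resulting duality is diagonal, so orthogonality to H^k Φ_M reads off the coefficient of T_k. -/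
theorem integral_TR_mul_HR_iter_PhiR {L j k : ℕ} (hj : j ≤ L) :
    ∫ y in (0 : ℝ)..(2 * M), TR q p j y * (HR V)^[k] (PhiR g Q χ q V L M) y * y ^ 3
      = if j = k then (-1) ^ k * ∫ y in (0 : ℝ)..(2 * M), evenCut χ M y * q y * q y * y ^ 3
        else 0 := by
  rw [← hR.integral_HR_iter_mul (hR.smoothEven_TR j) (hR.smoothEven_PhiR hχ L) (by linarith)
    (hR.PhiR_eq_zero hχ hM L), hR.HR_iter_TR]
  by_cases h : k ≤ j
  · simp only [h, if_true, mul_assoc, intervalIntegral.integral_const_mul]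
    simp only [← mul_assoc]
    rw [hR.integral_TR_mul_PhiR hχ hM (by omega)]
    by_cases h2 : j = k
    · simp [h2]
    · have : j - k ≠ 0 := by omega
      simp [h2, this]
  · have : j ≠ k := by omega
    simp [h, this]

end Directions

theorem HI_iter_add {F F' : ℝ → ℝ} (hF : SmoothEven F) (hF' : SmoothEven F') (n : ℕ) :
    (HI q p)^[n] (fun x => F x + F' x) = fun x => (HI q p)^[n] F x + (HI q p)^[n] F' x := by
  induction n with
  | zero => rfl
  | succ n ih =>
    simp only [Function.iterate_succ_apply']
    rw [ih, HI_add hR.q_even.continuous hR.p_even.continuous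
      (hR.smoothEven_HI_iter hF n).continuous (hR.smoothEven_HI_iter hF' n).continuous]

omit hR in
theorem HI_iter_const_mul (F : ℝ → ℝ) (c : ℝ) (n : ℕ) :
    (HI q p)^[n] (fun x => c * F x) = fun x => c * (HI q p)^[n] F x := by
  induction n with
  | zero => rfl
  | succ n ih => simp only [Function.iterate_succ_apply']; rw [ih, HI_const_mul]

/-! ### Coercivity under the orthogonality conditions. -/

/-- Coercivity: under the orthogonality conditions the function is controlled by `H^{L+1}`. -/
theorem exists_coercive {χ : ℝ → ℝ} (hχ : IsCutoff χ) {L : ℕ} (hL : 1 ≤ L) :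
    ∃ m : ℕ, ∀ M : ℝ, 0 < M → ∃ C : ℝ, 0 ≤ C ∧ ∀ w r η, SmoothEven w → 1 < r → 2 * M < r → 0 ≤ η →
      ∫ y in (0 : ℝ)..r, (HR V)^[L + 1] w y ^ 2 * y ^ 3 ≤ η ^ 2 →
      (∀ k ≤ L, ∫ y in (0 : ℝ)..(2 * M), w y * (HR V)^[k] (PhiR g Q χ q V L M) y * y ^ 3 = 0) →
      ∀ y, 0 < y → y < r → |w y| ≤ C * η * (1 + y) ^ m := by
  obtain ⟨C₁, k₁, hC₁, h₁⟩ := hR.exists_abs_sub_le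
  obtain ⟨C₂, m₂, hC₂, h₂⟩ := hR.exists_abs_HI_iter_le L k₁ hL
  have hPG : PolyGrowth fun y => ∑ j ∈ Finset.range (L + 1), |TR q p j y| := by
    have : ∀ s : Finset ℕ, PolyGrowth fun y => ∑ j ∈ s, |TR q p j y| := by
      intro s
      induction s using Finset.induction_on with
      | empty => exact .of_bound 0 (by simp)
      | insert a s ha ih =>
        simp only [Finset.sum_insert ha]
        exact PolyGrowth.add ((hR.tg_TR a).polyGrowth.of_le (fun x => by simp)) ih
    exact this _
  obtain ⟨C₃, m₃, hC₃, h₃⟩ := hPG.nonneg_bound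
  -- The growth exponent is fixed before M. This order matters: the threshold on δ depends on the
  -- exponent and must not depend on M.
  refine ⟨m₃ + m₂, fun M hM => ?_⟩
  set a := ∫ y in (0 : ℝ)..(2 * M), evenCut χ M y * q y * q y * y ^ 3 with ha
  have hapos : 0 < a := hR.integral_cut_pos hχ hM
  have hΨc : ∀ k, Continuous ((HR V)^[k] (PhiR g Q χ q V L M)) := fun k =>
    (hR.smoothEven_HR_iter (hR.smoothEven_PhiR hχ L) k).continuous
  obtain ⟨D, hD⟩ : ∃ D, ∀ k ∈ Finset.range (L + 1), ∀ y ∈ Icc 0 (2 * M),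
      |(HR V)^[k] (PhiR g Q χ q V L M) y| ≤ D := by
    have : ∀ k, ∃ D, ∀ y ∈ Icc 0 (2 * M), |(HR V)^[k] (PhiR g Q χ q V L M) y| ≤ D := fun k =>
      isCompact_Icc.exists_bound_of_continuousOn (hΨc k).continuousOn
    choose D hD using this
    refine ⟨∑ k ∈ Finset.range (L + 1), |D k|, fun k hk y hy => (hD k y hy).trans
      ((le_abs_self _).trans (Finset.single_le_sum (f := fun k => |D k|) (fun _ _ => abs_nonneg _) hk))⟩
  have hD0 : 0 ≤ D := (abs_nonneg _).trans (hD 0 (by simp) 0 ⟨le_rfl, by linarith⟩)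
  set E : ℝ := C₂ * C₁ * (1 + 2 * M) ^ m₂ * D * (2 * M) ^ 3 * (2 * M) / a with hE
  have hE0 : 0 ≤ E := by positivity
  refine ⟨E * C₃ + C₂ * C₁, by positivity, fun w r η hw hr1 hrM hη hen horth => ?_⟩
  have hHw := hR.smoothEven_HR_iter hw L
  obtain ⟨α, hα⟩ := h₁ ((HR V)^[L] w) r η hHw hr1 hη (by
    simpa only [Function.iterate_succ_apply'] using hen)
  -- The last kernel coefficient is α instead of the value at 0, because only this difference is
  -- bounded by η. The other L coefficients come from the exact representation.
  set R : ℝ → ℝ := fun y => (HR V)^[L] w y - α * q y with hRdef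
  have hRE : SmoothEven R := hHw.sub (hR.q_even.const_mul α)
  have hRb := h₂ R (C₁ * η) r (by positivity) hα
  obtain ⟨a₀, hrep⟩ := hR.exists_eq_sum_HI_iter hw L
  have hdec : (HR V)^[L] w = fun y => α * q y + R y := by ext y; simp [hRdef]
  set c : ℕ → ℝ := fun k => (if k = L then α else a₀ k) * (-1) ^ k with hc
  have hrep' : ∀ y, w y = ∑ k ∈ Finset.range (L + 1), c k * TR q p k y + (HI q p)^[L] R y := by
    intro y
    rw [hrep y, hdec, hR.HI_iter_add (hR.q_even.const_mul α) hRE, HI_iter_const_mul,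
      Finset.sum_range_succ]
    have hsq : ∀ k : ℕ, ((-1 : ℝ) ^ k) * (-1) ^ k = 1 := fun k => by
      rw [← pow_add]; exact Even.neg_one_pow ⟨k, rfl⟩
    have e1 : ∑ k ∈ Finset.range L, c k * TR q p k y
        = ∑ k ∈ Finset.range L, a₀ k * (HI q p)^[k] q y := by
      refine Finset.sum_congr rfl fun k hk => ?_
      have : k ≠ L := (Finset.mem_range.1 hk).ne
      simp only [hc, this, if_false, TR]
      linear_combination (a₀ k * (HI q p)^[k] q y) * hsq k
    rw [e1]
    simp only [hc, if_true, TR]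
    linear_combination (-α * (HI q p)^[L] q y) * hsq L
  have hRIc : Continuous ((HI q p)^[L] R) := (hR.smoothEven_HI_iter hRE L).continuous
  -- Test the representation with H^k Φ_M: by duality only c_k survives, against the inverted
  -- remainder on [0, 2M].
  have hck : ∀ k ∈ Finset.range (L + 1), |c k| ≤ E * η := by
    intro k hk
    have hkL : k ≤ L := by simpa [Nat.lt_succ_iff] using hk
    have h4 := horth k hkL
    have hTc : ∀ j, Continuous (TR q p j) := fun j => (hR.smoothEven_TR j).continuous
    have hΨ := hΨc k
    have h5 : ∫ y in (0 : ℝ)..(2 * M), w y * (HR V)^[k] (PhiR g Q χ q V L M) y * y ^ 3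
        = ∑ j ∈ Finset.range (L + 1), c j *
            (∫ y in (0 : ℝ)..(2 * M), TR q p j y * (HR V)^[k] (PhiR g Q χ q V L M) y * y ^ 3)
          + ∫ y in (0 : ℝ)..(2 * M), (HI q p)^[L] R y * (HR V)^[k] (PhiR g Q χ q V L M) y * y ^ 3 := by
      simp only [← intervalIntegral.integral_const_mul]
      rw [← intervalIntegral.integral_finsetSum, ← intervalIntegral.integral_add]
      · refine intervalIntegral.integral_congr fun y _ => ?_
        simp only [hrep' y, add_mul, Finset.sum_mul]
        congr 1
        exact Finset.sum_congr rfl fun j _ => by ring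
      · refine Continuous.intervalIntegrable ?_ _ _
        exact continuous_finsetSum _ fun j _ => by have := hTc j; fun_prop
      · exact Continuous.intervalIntegrable (by fun_prop) _ _
      · exact fun j _ => Continuous.intervalIntegrable (by have := hTc j; fun_prop) _ _
    have h6 : ∑ j ∈ Finset.range (L + 1), c j *
            (∫ y in (0 : ℝ)..(2 * M), TR q p j y * (HR V)^[k] (PhiR g Q χ q V L M) y * y ^ 3)
        = c k * ((-1) ^ k * a) := by
      rw [Finset.sum_eq_single k]
      · rw [hR.integral_TR_mul_HR_iter_PhiR hχ hM hkL, if_pos rfl]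
      · intro j hj hjk
        rw [hR.integral_TR_mul_HR_iter_PhiR hχ hM (by simpa [Nat.lt_succ_iff] using hj),
          if_neg hjk, mul_zero]
      · exact fun h => absurd hk h
    have h7 : |∫ y in (0 : ℝ)..(2 * M), (HI q p)^[L] R y * (HR V)^[k] (PhiR g Q χ q V L M) y * y ^ 3|
        ≤ E * η * a := by
      have := intervalIntegral.norm_integral_le_of_norm_le_const (a := (0 : ℝ)) (b := 2 * M)
        (f := fun y => (HI q p)^[L] R y * (HR V)^[k] (PhiR g Q χ q V L M) y * y ^ 3)
        (C := C₂ * (C₁ * η) * (1 + 2 * M) ^ m₂ * D * (2 * M) ^ 3) fun y hy => by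
          rw [uIoc_of_le (by linarith)] at hy
          have hy0 := hy.1
          have hy1 := hy.2
          have e1 := hRb y hy0 (by linarith)
          have e2 := hD k hk y ⟨hy0.le, hy1⟩
          rw [Real.norm_eq_abs, abs_mul, abs_mul, abs_of_pos (pow_pos hy0 3)]
          have e3 : |(HI q p)^[L] R y| ≤ C₂ * (C₁ * η) * (1 + 2 * M) ^ m₂ := e1.trans (by gcongr)
          gcongr
      rw [Real.norm_eq_abs, sub_zero, abs_of_pos (by linarith : 0 < 2 * M)] at this
      refine this.trans (le_of_eq ?_)
      rw [hE]; field_simp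
    rw [h5, h6] at h4
    have h8 : |c k| * a = |c k * ((-1) ^ k * a)| := by
      have h9 : |(-1 : ℝ) ^ k * a| = a := by
        rw [abs_mul ((-1 : ℝ) ^ k), abs_pow, abs_neg, abs_one, one_pow, one_mul, abs_of_pos hapos]
      exact (congrArg (|c k| * ·) h9).symm.trans (abs_mul _ _).symm
    refine le_of_mul_le_mul_right ?_ hapos
    rw [h8, eq_neg_of_add_eq_zero_left h4, abs_neg]
    exact h7
  intro y hy hyr
  have e3 := h₃ y
  rw [abs_of_pos hy, abs_of_nonneg (Finset.sum_nonneg fun _ _ => abs_nonneg _)] at e3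
  have hy1 : 1 ≤ 1 + y := by linarith
  calc |w y| ≤ |∑ k ∈ Finset.range (L + 1), c k * TR q p k y| + |(HI q p)^[L] R y| := by
        rw [hrep' y]; exact abs_add_le _ _
    _ ≤ ∑ k ∈ Finset.range (L + 1), |c k| * |TR q p k y| + C₂ * (C₁ * η) * (1 + y) ^ m₂ := by
        refine add_le_add ((Finset.abs_sum_le_sum_abs _ _).trans (le_of_eq ?_)) (hRb y hy hyr)
        exact Finset.sum_congr rfl fun k _ => abs_mul _ _
    _ ≤ ∑ k ∈ Finset.range (L + 1), E * η * |TR q p k y| + C₂ * (C₁ * η) * (1 + y) ^ m₂ := by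
        gcongr with k hk
        exact hck k hk
    _ = E * η * ∑ k ∈ Finset.range (L + 1), |TR q p k y| + C₂ * (C₁ * η) * (1 + y) ^ m₂ := by
        rw [Finset.mul_sum]
    _ ≤ E * η * (C₃ * (1 + y) ^ m₃) + C₂ * (C₁ * η) * (1 + y) ^ m₂ := by gcongr
    _ ≤ E * η * (C₃ * (1 + y) ^ (m₃ + m₂)) + C₂ * (C₁ * η) * (1 + y) ^ (m₃ + m₂) := by
        gcongr <;> omega
    _ = _ := by ring

end Reduced

/-! ### Parameter integrals and the cut-off integrals behind c_{b_1}. -/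

/-- Differentiation under the integral sign, within a convex set of parameters. -/
theorem hasDerivWithinAt_integral {F F' : ℝ → ℝ → ℝ} {s : Set ℝ} (hs : Convex ℝ s) {a b t₀ : ℝ}
    (ht₀ : t₀ ∈ s) (hF : ∀ t ∈ s, ContinuousOn (F t) (uIcc a b))
    (hd : ∀ t ∈ s, ∀ y ∈ uIcc a b, HasDerivWithinAt (fun t => F t y) (F' t y) s t)
    (hc : ContinuousOn (Function.uncurry F') (s ×ˢ uIcc a b)) :
    HasDerivWithinAt (fun t => ∫ y in a..b, F t y) (∫ y in a..b, F' t₀ y) s t₀ := by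
  have hF' : ∀ t ∈ s, ContinuousOn (F' t) (uIcc a b) := fun t ht =>
    hc.comp (f := fun y => (t, y)) (by fun_prop) fun y hy => ⟨ht, hy⟩
  rw [hasDerivWithinAt_iff_isLittleO, Asymptotics.isLittleO_iff]
  intro c hc0
  set ε : ℝ := c / (|b - a| + 1)
  have hε : 0 < ε := by positivity
  -- By compactness F' is uniformly close to its value at t₀; the mean value inequality then bounds
  -- the remainder of F uniformly in y. Working within a convex set covers the initial time.
  obtain ⟨v, hv, hv'⟩ := isCompact_uIcc.mem_uniformity_of_prod hc ht₀ (Metric.dist_mem_uniformity hε)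
  obtain ⟨ρ, hρ, hball⟩ := Metric.mem_nhdsWithin_iff.1 hv
  have hmem : Metric.ball t₀ ρ ∩ s ∈ 𝓝[s] t₀ :=
    inter_mem (mem_nhdsWithin_of_mem_nhds (Metric.ball_mem_nhds _ hρ)) self_mem_nhdsWithin
  filter_upwards [hmem] with t ht
  have hts : t ∈ s := ht.2
  have hI : ∀ t ∈ s, IntervalIntegrable (F t) volume a b := fun t ht => (hF t ht).intervalIntegrable
  have hI' : IntervalIntegrable (F' t₀) volume a b := (hF' t₀ ht₀).intervalIntegrable
  rw [← intervalIntegral.integral_sub (hI t hts) (hI t₀ ht₀), smul_eq_mul,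
    ← intervalIntegral.integral_const_mul,
    ← intervalIntegral.integral_sub ((hI t hts).sub (hI t₀ ht₀)) (hI'.const_mul _)]
  have := intervalIntegral.norm_integral_le_of_norm_le_const (a := a) (b := b)
    (f := fun y => F t y - F t₀ y - (t - t₀) * F' t₀ y) (C := ε * ‖t - t₀‖) fun y hy => by
      have hy' : y ∈ uIcc a b := uIoc_subset_uIcc hy
      have hmv := ((convex_ball t₀ ρ).inter hs).norm_image_sub_le_of_norm_hasDerivWithin_le
        (f := fun t => F t y - t * F' t₀ y) (f' := fun t => F' t y - F' t₀ y) (C := ε)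
        (fun τ hτ => ((hd τ hτ.2 y hy').sub (by
          simpa using (hasDerivWithinAt_id τ s).mul_const (F' t₀ y))).mono inter_subset_right)
        (fun τ hτ => (hv' τ (hball hτ) y hy').le)
        ⟨Metric.mem_ball_self hρ, ht₀⟩ ht
      refine le_trans (le_of_eq ?_) hmv
      congr 1; ring
  refine this.trans ?_
  have h1 : ε * |b - a| ≤ c := by
    rw [div_mul_eq_mul_div, div_le_iff₀ (by positivity)]
    nlinarith
  nlinarith [norm_nonneg (t - t₀)]

/-- `((z/2) d/dz)^n χ`. -/
noncomputable def cutIter (χ : ℝ → ℝ) : ℕ → ℝ → ℝ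
  | 0 => χ
  | n + 1 => fun z => z / 2 * deriv (cutIter χ n) z

/-- The integrals `∫ χ_n(4 y √x) (ΛQ)² y dy`. -/
noncomputable def cutInt (Q χ : ℝ → ℝ) (n : ℕ) (x : ℝ) : ℝ :=
  ∫ y in Ioi (0 : ℝ), cutIter χ n (4 * y * √x) * Lam Q y ^ 2 * y

namespace IsCutoff
variable {χ : ℝ → ℝ} (hχ : IsCutoff χ)
include hχ

theorem contDiff_cutIter (n : ℕ) : ContDiff ℝ ∞ (cutIter χ n) := by
  induction n with
  | zero => exact hχ.smooth
  | succ n ih => exact (contDiff_id.div_const 2).mul (contDiff_infty_iff_deriv.1 ih).2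

theorem cutIter_eq_zero (n : ℕ) : ∀ z, 2 ≤ z → cutIter χ n z = 0 := by
  induction n with
  | zero => exact hχ.eq_zero
  | succ n ih =>
    have h1 : ∀ z, 2 < z → cutIter χ (n + 1) z = 0 := fun z hz => by
      have : cutIter χ n =ᶠ[𝓝 z] fun _ => 0 := by
        filter_upwards [lt_mem_nhds hz] with x hx using ih x hx.le
      change z / 2 * deriv (cutIter χ n) z = 0
      rw [this.deriv_eq, deriv_const, mul_zero]
    intro z hz
    rcases hz.eq_or_lt with rfl | hz
    · exact eq_zero_of_Ioi (hχ.contDiff_cutIter _).continuous h1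
    · exact h1 z hz

/-- After one derivative only the transition zone 1 < z < 2 remains, where y is comparable to
x^(-1/2). This is why the differentiated integrals are bounded although the original one grows
logarithmically. -/
theorem cutIter_succ_eq_zero (n : ℕ) : ∀ z, z ≤ 1 → cutIter χ (n + 1) z = 0 := by
  have hconst : ∀ n, ∃ c, ∀ z, z ≤ 1 → cutIter χ n z = c := by
    intro n
    induction n with
    | zero => exact ⟨1, hχ.eq_one⟩
    | succ n ih =>
      obtain ⟨c, hc⟩ := ih
      have h1 : ∀ z, z < 1 → cutIter χ (n + 1) z = 0 := fun z hz => by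
        have : cutIter χ n =ᶠ[𝓝 z] fun _ => c := by
          filter_upwards [gt_mem_nhds hz] with x hx using hc x hx.le
        change z / 2 * deriv (cutIter χ n) z = 0
        rw [this.deriv_eq, deriv_const, mul_zero]
      refine ⟨0, fun z hz => ?_⟩
      rcases hz.eq_or_lt with rfl | hz
      · have h2 : Tendsto (cutIter χ (n + 1)) (𝓝[<] 1) (𝓝 (cutIter χ (n + 1) 1)) :=
          (hχ.contDiff_cutIter _).continuous.continuousWithinAt.tendsto
        refine tendsto_nhds_unique (h2.congr' ?_) tendsto_const_nhds
        filter_upwards [self_mem_nhdsWithin] with y hy using h1 y hy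
      · exact h1 z hz
  obtain ⟨c, hc⟩ := hconst (n + 1)
  intro z hz
  rw [hc z hz, ← hc 0 zero_le_one]
  simp [cutIter]

end IsCutoff

namespace Reduced
variable {g Q Q₀ q p V : ℝ → ℝ} (hR : Reduced g Q Q₀ q p V) {χ : ℝ → ℝ} (hχ : IsCutoff χ)
include hR hχ

theorem cutInt_eq (n : ℕ) {x r : ℝ} (hx : 0 < x) (hr : 1 / 2 ≤ r * √x) (hr0 : 0 < r) :
    cutInt Q χ n x = ∫ y in (0 : ℝ)..r, cutIter χ n (4 * y * √x) * (q y ^ 2 * y ^ 3) := by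
  have hsx := Real.sqrt_pos.2 hx
  rw [cutInt, intervalIntegral.integral_of_le hr0.le,
    setIntegral_eq_of_subset_of_forall_sdiff_eq_zero (s := Ioc 0 r) measurableSet_Ioi
      (fun y hy => hy.1) (fun y hy => ?_)]
  · refine setIntegral_congr_fun measurableSet_Ioc fun y hy => ?_
    simp only [hR.Lam_eq hy.1]; ring
  · have h1 : r < y := by
      by_contra h
      exact hy.2 ⟨hy.1, not_lt.1 h⟩
    rw [hχ.cutIter_eq_zero n, zero_mul, zero_mul]
    nlinarith

/-- The derivative of 4y√x in x is itself divided by 2x; the operator (z/2) d/dz in `cutIter` is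
exactly x d/dx, so the family is closed under differentiation. -/
theorem hasDerivAt_cutInt (n : ℕ) {x : ℝ} (hx : 0 < x) :
    HasDerivAt (cutInt Q χ n) (cutInt Q χ (n + 1) x * x⁻¹) x := by
  have hsx := Real.sqrt_pos.2 hx
  -- For parameters larger than x/4 the integrands vanish beyond this r, so one fixed interval
  -- serves in a neighbourhood of x.
  set r : ℝ := 1 / √x with hr
  have hr0 : 0 < r := by positivity
  have hkey : ∀ z, x / 4 < z → 1 / 2 ≤ r * √z := by
    intro z hz
    have : √x / 2 ≤ √z := by
      rw [show √x / 2 = √(x / 4) by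
        rw [Real.sqrt_div hx.le, show (4 : ℝ) = 2 ^ 2 by norm_num, Real.sqrt_sq (by norm_num)]]
      exact Real.sqrt_le_sqrt hz.le
    calc (1 : ℝ) / 2 = r * (√x / 2) := by rw [hr]; field_simp
      _ ≤ r * √z := by gcongr
  have hx4 : x ∈ Ioi (x / 4) := by simp only [mem_Ioi]; linarith
  have hpos : ∀ z ∈ Ioi (x / 4), 0 < z := fun z hz => lt_trans (by positivity) hz
  have hc := (hχ.contDiff_cutIter n)
  have hcd := (hχ.contDiff_cutIter n).differentiable (by simp)
  have hc1 := (hχ.contDiff_cutIter (n + 1)).continuous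
  have hqc := hR.q_even.continuous
  have h := hasDerivWithinAt_integral (convex_Ioi (x / 4)) (a := 0) (b := r) (t₀ := x)
    (F := fun z y => cutIter χ n (4 * y * √z) * (q y ^ 2 * y ^ 3))
    (F' := fun z y => cutIter χ (n + 1) (4 * y * √z) * z⁻¹ * (q y ^ 2 * y ^ 3)) hx4
    (fun z _ => by have := hc.continuous; fun_prop)
    (fun z hz y _ => by
      have hz0 := hpos z hz
      have h1 : HasDerivAt (fun z => 4 * y * √z) (4 * y * (1 / (2 * √z))) z :=
        (Real.hasDerivAt_sqrt hz0.ne').const_mul _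
      have h2 := (((hcd _).hasDerivAt.comp z h1).mul_const (q y ^ 2 * y ^ 3)).hasDerivWithinAt
        (s := Ioi (x / 4))
      refine h2.congr_deriv ?_
      have hs : √z ^ 2 = z := Real.sq_sqrt hz0.le
      have hs0 := Real.sqrt_pos.2 hz0
      simp only [cutIter]
      field_simp
      rw [hs]; ring)
    (by
      have h3 : ContinuousOn (fun w : ℝ × ℝ => w.1⁻¹) (Ioi (x / 4) ×ˢ uIcc 0 r) :=
        continuousOn_fst.inv₀ fun w hw => (hpos _ hw.1).ne'
      exact (ContinuousOn.mul (by fun_prop) h3).mul (by fun_prop))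
  have h' := h.hasDerivAt (Ioi_mem_nhds hx4)
  have e1 : cutInt Q χ (n + 1) x * x⁻¹
      = ∫ y in (0 : ℝ)..r, cutIter χ (n + 1) (4 * y * √x) * x⁻¹ * (q y ^ 2 * y ^ 3) := by
    rw [hR.cutInt_eq hχ (n + 1) hx (hkey x hx4) hr0, ← intervalIntegral.integral_mul_const]
    exact intervalIntegral.integral_congr fun y _ => by ring
  rw [e1]
  refine h'.congr_of_eventuallyEq ?_
  filter_upwards [Ioi_mem_nhds hx4] with z hz
  exact hR.cutInt_eq hχ n (hpos z hz) (hkey z hz) hr0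

/-- On the transition zone (ΛQ)² y is at most C/y, that is C√x, on an interval of length
O(x^(-1/2)). -/
theorem exists_abs_cutInt_le (n : ℕ) (hn : 1 ≤ n) : ∃ C, 0 ≤ C ∧ ∀ x, 0 < x → |cutInt Q χ n x| ≤ C := by
  obtain ⟨m, rfl⟩ : ∃ m, n = m + 1 := ⟨n - 1, by omega⟩
  obtain ⟨C, hC0, hC⟩ := hR.exists_sq_mul_le
  obtain ⟨D, hD⟩ := (isCompact_Icc (a := (1 : ℝ)) (b := 2)).exists_bound_of_continuousOn
    (hχ.contDiff_cutIter (m + 1)).continuous.continuousOn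
  have hD0 : 0 ≤ D := (norm_nonneg _).trans (hD 1 (by simp))
  refine ⟨2 * D * C ^ 2, by positivity, fun x hx => ?_⟩
  have hsx := Real.sqrt_pos.2 hx
  rw [hR.cutInt_eq hχ _ hx (r := 1 / (2 * √x)) (by field_simp; rfl) (by positivity)]
  have := intervalIntegral.norm_integral_le_of_norm_le_const (a := 0) (b := 1 / (2 * √x))
    (f := fun y => cutIter χ (m + 1) (4 * y * √x) * (q y ^ 2 * y ^ 3))
    (C := D * C ^ 2 * (4 * √x)) fun y hy => by
      rw [uIoc_of_le (by positivity)] at hy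
      have hy0 := hy.1
      rw [norm_mul]
      rcases le_total (4 * y * √x) 1 with h | h
      · rw [hχ.cutIter_succ_eq_zero m _ h, norm_zero, zero_mul]; positivity
      · have h1 : ‖cutIter χ (m + 1) (4 * y * √x)‖ ≤ D := by
          refine hD _ ⟨h, ?_⟩
          have := hy.2
          rw [le_div_iff₀ (by positivity)] at this
          linarith
        have h2 : ‖q y ^ 2 * y ^ 3‖ ≤ C ^ 2 * (4 * √x) := by
          have hq := hR.q_pos y
          rw [Real.norm_of_nonneg (by positivity)]
          have h3 := hC y hy0
          calc q y ^ 2 * y ^ 3 ≤ q y ^ 2 * y ^ 3 * (4 * y * √x) := le_mul_of_one_le_right (by positivity) h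
            _ = (y ^ 2 * q y) ^ 2 * (4 * √x) := by ring
            _ ≤ _ := by gcongr
        calc _ ≤ D * (C ^ 2 * (4 * √x)) := by gcongr
          _ = _ := by ring
  rw [Real.norm_eq_abs, sub_zero, abs_of_pos (by positivity : (0 : ℝ) < 1 / (2 * √x))] at this
  refine this.trans (le_of_eq ?_)
  field_simp; norm_num

theorem exists_cutInt_zero_ge : ∃ c, 0 < c ∧ ∀ x, 0 < x → x ≤ 1 → c ≤ cutInt Q χ 0 x := by
  have hqc := hR.q_even.continuous
  refine ⟨∫ y in (0 : ℝ)..(1 / 4), q y ^ 2 * y ^ 3, ?_, fun x hx hx1 => ?_⟩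
  · refine intervalIntegral.intervalIntegral_pos_of_pos_on
      (Continuous.intervalIntegrable (by fun_prop) _ _) (fun y hy => ?_) (by norm_num)
    have := hR.q_pos y
    have := hy.1
    positivity
  · have hsx := Real.sqrt_pos.2 hx
    have hsx1 : √x ≤ 1 := Real.sqrt_le_one.2 hx1
    rw [hR.cutInt_eq hχ 0 hx (r := 1 / (2 * √x)) (by field_simp; rfl) (by positivity)]
    have hcc := (hχ.contDiff_cutIter 0).continuous
    have h14 : (1 : ℝ) / 4 ≤ 1 / (2 * √x) := by
      rw [div_le_div_iff₀ (by norm_num) (by positivity)]; linarith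
    have e1 : ∫ y in (0 : ℝ)..(1 / 4), q y ^ 2 * y ^ 3
        = ∫ y in (0 : ℝ)..(1 / 4), cutIter χ 0 (4 * y * √x) * (q y ^ 2 * y ^ 3) := by
      refine intervalIntegral.integral_congr fun y hy => ?_
      rw [uIcc_of_le (by norm_num)] at hy
      have : cutIter χ 0 (4 * y * √x) = 1 := hχ.eq_one _ (by nlinarith [hy.1, hy.2])
      simp only [this, one_mul]
    rw [e1]
    have hcont : Continuous fun y => cutIter χ 0 (4 * y * √x) * (q y ^ 2 * y ^ 3) := by fun_prop
    refine intervalIntegral.integral_mono_interval le_rfl (by norm_num) h14 ?_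
      (hcont.intervalIntegrable _ _)
    refine (ae_restrict_iff' measurableSet_Ioc).2 (Eventually.of_forall fun y hy => ?_)
    have := hy.1
    have h2 : 0 ≤ cutIter χ 0 (4 * y * √x) := hχ.nonneg _
    simp only [Pi.zero_apply]; positivity

omit hR hχ in
theorem _root_.HeatFlow.cb_eq {b₁ : ℝ} (hb : 0 < b₁) : cb Q χ b₁ = 4 * (cutInt Q χ 0 b₁)⁻¹ := by
  have hs := Real.sqrt_pos.2 hb
  rw [cb, cutInt, div_eq_mul_inv]
  congr 2
  refine setIntegral_congr_fun measurableSet_Ioi fun y _ => ?_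
  have : y / (B0 b₁ / 4) = 4 * y * √b₁ := by rw [B0]; field_simp
  simp only [cut, this, cutIter]

end Reduced

/-! ### A weighted symbol calculus in the parameters. -/

/-- Homogeneous coefficients of weight `i` in the parameters `b_1, …, b_m`: the algebra generated
by the `b_j`, of weight `j`, by `1 / b_1`, and by the integrals `cutInt n`, of weight `0`. -/
inductive Coef (Q χ : ℝ → ℝ) {L : ℕ} (m : ℕ) : ℤ → ((Fin L → ℝ) → ℝ) → Prop
  | zero (i : ℤ) : Coef Q χ m i fun _ => 0
  | const (c : ℝ) : Coef Q χ m 0 fun _ => c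
  | par (j : ℕ) (h1 : 1 ≤ j) (hm : j ≤ m) : Coef Q χ m j fun b => par b j
  | inv : Coef Q χ m (-1) fun b => (HeatFlow.par b 1)⁻¹
  | cutInt (n : ℕ) (hn : 1 ≤ n) : Coef Q χ m 0 fun b => cutInt Q χ n (HeatFlow.par b 1)
  | cutInv : Coef Q χ m 0 fun b => (HeatFlow.cutInt Q χ 0 (HeatFlow.par b 1))⁻¹
  | add {i : ℤ} {a c : (Fin L → ℝ) → ℝ} (ha : Coef Q χ m i a) (hc : Coef Q χ m i c) :
      Coef Q χ m i fun b => a b + c b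
  | mul {i j : ℤ} {a c : (Fin L → ℝ) → ℝ} (ha : Coef Q χ m i a) (hc : Coef Q χ m j c) :
      Coef Q χ m (i + j) fun b => a b * c b

/-- The range of parameters of the trapped regime. -/
structure Admissible {L : ℕ} (A : ℝ) (b : Fin L → ℝ) : Prop where
  pos : 0 < par b 1
  le_one : par b 1 ≤ 1
  bound : ∀ k, |par b k| ≤ A * par b 1 ^ k

/-- The linear form with given coefficients. -/
noncomputable def linForm {L : ℕ} (c : Fin L → ℝ) : (Fin L → ℝ) →L[ℝ] ℝ :=
  ∑ j, c j • ContinuousLinearMap.proj j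

theorem linForm_apply {L : ℕ} (c v : Fin L → ℝ) : linForm c v = ∑ j, c j * v j := by
  simp [linForm]

theorem par_succ {L : ℕ} (b : Fin L → ℝ) (j : Fin L) : par b (j + 1) = b j := by
  rw [par, dif_pos ⟨by omega, by omega⟩]
  rfl

theorem par_of_lt {L : ℕ} (b : Fin L → ℝ) {j : ℕ} (h : L < j) : par b j = 0 :=
  dif_neg (by omega)

theorem par_zero {L : ℕ} (b : Fin L → ℝ) : par b 0 = 0 := dif_neg (by omega)

theorem hasFDerivAt_par {L : ℕ} (b : Fin L → ℝ) (k : ℕ) :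
    HasFDerivAt (fun b : Fin L → ℝ => par b k)
      (linForm fun j : Fin L => if (j : ℕ) + 1 = k then 1 else 0) b := by
  by_cases h : 1 ≤ k ∧ k ≤ L
  · obtain ⟨h1, h2⟩ := h
    obtain ⟨i, rfl⟩ : ∃ i : Fin L, k = i + 1 := ⟨⟨k - 1, by omega⟩, by simp; omega⟩
    have e : (fun b : Fin L → ℝ => par b (i + 1)) = ContinuousLinearMap.proj (R := ℝ) (φ := fun _ : Fin L => ℝ) i := by
      ext b; simp [par_succ]
    have e2 : linForm (fun j : Fin L => if (j : ℕ) + 1 = (i : ℕ) + 1 then (1 : ℝ) else 0)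
        = ContinuousLinearMap.proj (R := ℝ) (φ := fun _ : Fin L => ℝ) i := by
      ext v; simp [linForm_apply, Fin.val_inj]
    rw [e, e2]
    exact ContinuousLinearMap.hasFDerivAt _
  · have e : (fun b : Fin L → ℝ => par b k) = fun _ => 0 := by ext b; exact dif_neg h
    have e2 : linForm (fun j : Fin L => if (j : ℕ) + 1 = k then (1 : ℝ) else 0) = 0 := by
      have : ∀ j : Fin L, (j : ℕ) + 1 ≠ k := fun j hj => h ⟨by omega, by omega⟩
      ext v; simp [linForm_apply, this]
    rw [e, e2]
    exact hasFDerivAt_const _ _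

theorem continuous_par {L : ℕ} (k : ℕ) : Continuous fun b : Fin L → ℝ => par b k :=
  continuous_iff_continuousAt.2 fun b => (hasFDerivAt_par b k).continuousAt

namespace Coef
variable {Q χ : ℝ → ℝ} {L : ℕ} {m : ℕ} {i : ℤ} {a : (Fin L → ℝ) → ℝ}

theorem cast {j : ℤ} (h : Coef Q χ m i a) (e : i = j) : Coef Q χ m j a := e ▸ h

theorem mono {m' : ℕ} (h : Coef Q χ m i a) (hm : m ≤ m') : Coef Q χ m' i a := by
  induction h with
  | zero i => exact .zero i
  | const c => exact .const c
  | par j h1 h2 => exact .par j h1 (h2.trans hm)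
  | inv => exact .inv
  | cutInt n hn => exact .cutInt n hn
  | cutInv => exact .cutInv
  | add _ _ ih1 ih2 => exact ih1.add ih2
  | mul _ _ ih1 ih2 => exact ih1.mul ih2

theorem const_mul (c : ℝ) (h : Coef Q χ m i a) : Coef Q χ m i fun b => c * a b :=
  ((Coef.const c).mul h).cast (zero_add i)

theorem parAny (k : ℕ) (hm : k ≤ m) : Coef Q χ m k fun b : Fin L → ℝ => HeatFlow.par b k := by
  rcases Nat.eq_zero_or_pos k with rfl | h
  · simp only [par_zero]; exact .zero _
  · exact .par k h hm

variable {g Q₀ q p V : ℝ → ℝ} (hR : Reduced g Q Q₀ q p V) (hχ : IsCutoff χ)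
include hR hχ

/-- Homogeneity in the regime |b_k| ≤ A b_1^k. The unbounded logarithmic integral enters the algebra
only through its inverse, which is bounded. -/
theorem exists_bound (h : Coef Q χ m i a) {A : ℝ} (hA : 0 ≤ A) :
    ∃ C, 0 ≤ C ∧ ∀ b, Admissible A b → |a b| ≤ C * HeatFlow.par b 1 ^ i := by
  induction h with
  | zero i => exact ⟨0, le_rfl, fun b _ => by simp⟩
  | const c => exact ⟨|c|, abs_nonneg c, fun b _ => by simp⟩
  | par j h1 h2 => exact ⟨A, hA, fun b hb => by simpa using hb.bound j⟩
  | inv =>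
    refine ⟨1, zero_le_one, fun b hb => ?_⟩
    rw [abs_of_pos (inv_pos.2 hb.pos), zpow_neg_one, one_mul]
  | cutInt n hn =>
    obtain ⟨C, hC, h⟩ := hR.exists_abs_cutInt_le hχ n hn
    exact ⟨C, hC, fun b hb => by simpa using h _ hb.pos⟩
  | cutInv =>
    obtain ⟨c, hc, h⟩ := hR.exists_cutInt_zero_ge hχ
    refine ⟨c⁻¹, by positivity, fun b hb => ?_⟩
    have := h _ hb.pos hb.le_one
    rw [zpow_zero, mul_one, abs_of_pos (inv_pos.2 (hc.trans_le this))]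
    gcongr
  | add _ _ ih1 ih2 =>
    obtain ⟨C, hC, h⟩ := ih1
    obtain ⟨D, hD, h'⟩ := ih2
    refine ⟨C + D, by positivity, fun b hb => (abs_add_le _ _).trans ?_⟩
    rw [add_mul]
    exact add_le_add (h b hb) (h' b hb)
  | mul _ _ ih1 ih2 =>
    obtain ⟨C, hC, h⟩ := ih1
    obtain ⟨D, hD, h'⟩ := ih2
    refine ⟨C * D, by positivity, fun b hb => ?_⟩
    rw [abs_mul, zpow_add₀ hb.pos.ne', mul_mul_mul_comm]
    have := hb.pos
    exact mul_le_mul (h b hb) (h' b hb) (abs_nonneg _) (by positivity)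

/-- The algebra is stable under ∂/∂b_j, which lowers the weight by j. The index `m` records which
parameters can occur, so derivatives in later ones vanish identically; this is how the restricted
sum over j < i in the source becomes a full sum. -/
theorem exists_hasFDerivAt (h : Coef Q χ m i a) (hm : 1 ≤ m) : ∃ a' : Fin L → (Fin L → ℝ) → ℝ,
    (∀ j : Fin L, Coef Q χ m (i - (((j : ℕ) : ℤ) + 1)) (a' j)) ∧ (∀ j : Fin L, m < (j : ℕ) + 1 → a' j = fun _ => 0) ∧
    ∀ b, 0 < HeatFlow.par b 1 → HasFDerivAt a (linForm fun j => a' j b) b := by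
  -- The common case of a generator that depends on b_1 alone.
  have hfun : ∀ (i : ℤ) (φ : ℝ → ℝ) (φ' : ℝ → ℝ), Coef Q χ m (i - 1) (fun b : Fin L → ℝ => φ' (HeatFlow.par b 1)) →
      (∀ x, 0 < x → HasDerivAt φ (φ' x) x) → ∃ a' : Fin L → (Fin L → ℝ) → ℝ,
      (∀ j : Fin L, Coef Q χ m (i - (((j : ℕ) : ℤ) + 1)) (a' j)) ∧
      (∀ j : Fin L, m < (j : ℕ) + 1 → a' j = fun _ => 0) ∧
      ∀ b, 0 < HeatFlow.par b 1 →
        HasFDerivAt (fun b : Fin L → ℝ => φ (HeatFlow.par b 1)) (linForm fun j => a' j b) b := by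
    intro i φ φ' hφ' hd
    refine ⟨fun j => if (j : ℕ) + 1 = 1 then fun b => φ' (HeatFlow.par b 1) else fun _ => 0, fun j => ?_,
      fun j hj => if_neg (by omega), fun b hb => ?_⟩
    · beta_reduce
      split_ifs with hj
      · exact hφ'.cast (by omega)
      · exact .zero _
    · refine ((hd _ hb).comp_hasFDerivAt b (hasFDerivAt_par b 1)).congr_fderiv ?_
      ext v
      simp only [linForm_apply, _root_.smul_apply, smul_eq_mul, Finset.mul_sum]
      refine Finset.sum_congr rfl fun j _ => ?_
      split_ifs with hj <;> simp
  induction h with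
  | zero i => exact ⟨fun _ _ => 0, fun j => .zero _, fun _ _ => rfl, fun b _ =>
      (hasFDerivAt_const _ _).congr_fderiv (by ext v; simp [linForm_apply])⟩
  | const c => exact ⟨fun _ _ => 0, fun j => .zero _, fun _ _ => rfl, fun b _ =>
      (hasFDerivAt_const _ _).congr_fderiv (by ext v; simp [linForm_apply])⟩
  | par k h1 h2 =>
    refine ⟨fun j _ => if (j : ℕ) + 1 = k then 1 else 0, fun j => ?_, fun j hj => ?_, fun b _ =>
      hasFDerivAt_par b k⟩
    · beta_reduce
      split_ifs with hj
      · exact (Coef.const 1).cast (by omega)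
      · exact .zero _
    · ext b; exact if_neg (by omega)
  | inv =>
    refine hfun (-1) (fun x => x⁻¹) (fun x => (-1) * (x⁻¹ * x⁻¹)) ((Coef.inv.mul .inv).const_mul (-1)) fun x hx => ?_
    refine (hasDerivAt_inv hx.ne').congr_deriv ?_
    field_simp
  | cutInt n hn =>
    exact hfun 0 (HeatFlow.cutInt Q χ n) (fun x => HeatFlow.cutInt Q χ (n + 1) x * x⁻¹)
      ((Coef.cutInt (n + 1) (by omega)).mul .inv) fun x hx => hR.hasDerivAt_cutInt hχ n hx
  | cutInv =>
    refine hfun 0 (fun x => (HeatFlow.cutInt Q χ 0 x)⁻¹) (fun x => (-1) * ((HeatFlow.cutInt Q χ 1 x * x⁻¹) *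
        ((HeatFlow.cutInt Q χ 0 x)⁻¹ * (HeatFlow.cutInt Q χ 0 x)⁻¹)))
      ((((Coef.cutInt 1 le_rfl).mul .inv).mul (Coef.cutInv.mul .cutInv)).const_mul (-1)) fun x hx => ?_
    have hpos : HeatFlow.cutInt Q χ 0 x ≠ 0 := by
      have hsx := Real.sqrt_pos.2 hx
      have hqc := hR.q_even.continuous
      have hcc := (hχ.contDiff_cutIter 0).continuous
      rw [hR.cutInt_eq hχ 0 hx (r := 1 / (2 * √x)) (by field_simp; rfl) (by positivity)]
      refine (intervalIntegral.integral_pos (by positivity) (by fun_prop) (fun y hy => ?_)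
        ⟨1 / (4 * √x), ⟨by positivity, ?_⟩, ?_⟩).ne'
      · have := hy.1
        have h2 : 0 ≤ cutIter χ 0 (4 * y * √x) := hχ.nonneg _
        positivity
      · gcongr; norm_num
      · have h1 : cutIter χ 0 (4 * (1 / (4 * √x)) * √x) = 1 := hχ.eq_one _ (by field_simp; rfl)
        have := hR.q_pos (1 / (4 * √x))
        rw [h1]; positivity
    refine ((hR.hasDerivAt_cutInt hχ 0 hx).fun_inv hpos).congr_deriv ?_
    field_simp
  | add _ _ ih1 ih2 =>
    obtain ⟨a', h1, h2, h3⟩ := ih1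
    obtain ⟨c', k1, k2, k3⟩ := ih2
    refine ⟨fun j b => a' j b + c' j b, fun j => (h1 j).add (k1 j), fun j hj => ?_, fun b hb => ?_⟩
    · ext b; simp [h2 j hj, k2 j hj]
    · refine ((h3 b hb).add (k3 b hb)).congr_fderiv ?_
      ext v; simp [linForm_apply, add_mul, Finset.sum_add_distrib]
  | @mul i₁ i₂ a c ha hc ih1 ih2 =>
    obtain ⟨a', h1, h2, h3⟩ := ih1
    obtain ⟨c', k1, k2, k3⟩ := ih2
    refine ⟨fun j b => a' j b * c b + a b * c' j b, fun j => ?_, fun j hj => ?_, fun b hb => ?_⟩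
    · exact (((h1 j).mul hc).cast (by ring)).add ((ha.mul (k1 j)).cast (by ring))
    · ext b; simp [h2 j hj, k2 j hj]
    · refine ((h3 b hb).mul (k3 b hb)).congr_fderiv ?_
      ext v
      simp only [linForm_apply, add_mul, Finset.sum_add_distrib, _root_.add_apply,
        _root_.smul_apply, smul_eq_mul, Finset.mul_sum]
      rw [add_comm]
      congr 1 <;> exact Finset.sum_congr rfl fun j _ => by ring

theorem continuousOn (h : Coef Q χ m i a) (hm : 1 ≤ m) : ContinuousOn a {b | 0 < HeatFlow.par b 1} := by
  obtain ⟨a', -, -, h3⟩ := h.exists_hasFDerivAt hR hχ hm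
  exact fun b hb => (h3 b hb).continuousAt.continuousWithinAt

end Coef

/-- Finite sums of products of a coefficient of weight `i` and a fixed tempered even function. -/
inductive Sym (Q χ : ℝ → ℝ) {L : ℕ} (m : ℕ) (i : ℤ) : ((Fin L → ℝ) → ℝ → ℝ) → Prop
  | term {a : (Fin L → ℝ) → ℝ} {e : ℝ → ℝ} (ha : Coef Q χ m i a) (he : TG e) (he' : SmoothEven e) :
      Sym Q χ m i fun b y => a b * e y
  | add {F G : (Fin L → ℝ) → ℝ → ℝ} (hF : Sym Q χ m i F) (hG : Sym Q χ m i G) :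
      Sym Q χ m i fun b y => F b y + G b y

namespace Sym
variable {Q χ : ℝ → ℝ} {L : ℕ} {m : ℕ} {i : ℤ} {F G : (Fin L → ℝ) → ℝ → ℝ}

theorem cast {j : ℤ} (h : Sym Q χ m i F) (e : i = j) : Sym Q χ m j F := e ▸ h

theorem smoothEven (h : Sym Q χ m i F) (b : Fin L → ℝ) : SmoothEven (F b) := by
  induction h with
  | term ha he he' => exact he'.const_mul _
  | add _ _ ih1 ih2 => exact ih1.add ih2

theorem mono {m' : ℕ} (h : Sym Q χ m i F) (hm : m ≤ m') : Sym Q χ m' i F := by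
  induction h with
  | term ha he he' => exact .term (ha.mono hm) he he'
  | add _ _ ih1 ih2 => exact ih1.add ih2

theorem zero : Sym Q χ m i (fun _ _ => 0 : (Fin L → ℝ) → ℝ → ℝ) := by
  simpa using Sym.term (Coef.zero (Q := Q) (χ := χ) (m := m) (L := L) i) (TG.const 0) (.const 0)

theorem sum {ι : Type*} (s : Finset ι) {F : ι → (Fin L → ℝ) → ℝ → ℝ}
    (h : ∀ k ∈ s, Sym Q χ m i (F k)) : Sym Q χ m i fun b y => ∑ k ∈ s, F k b y := by
  classical
  induction s using Finset.induction_on with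
  | empty => simpa using zero
  | insert a s ha ih =>
    simp only [Finset.sum_insert ha]
    exact (h a (by simp)).add (ih fun k hk => h k (by simp [hk]))

/-- Linear operators in y act on the functions and leave the coefficients alone, hence preserve
weights; this covers multiplication, Λ and the inverse of H. -/
theorem map {T : (ℝ → ℝ) → ℝ → ℝ} (h : Sym Q χ m i F)
    (h1 : ∀ w, TG w → TG (T w)) (h2 : ∀ w, SmoothEven w → SmoothEven (T w))
    (h3 : ∀ c w, SmoothEven w → T (fun y => c * w y) = fun y => c * T w y)
    (h4 : ∀ w v, SmoothEven w → SmoothEven v → T (fun y => w y + v y) = fun y => T w y + T v y) :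
    Sym Q χ m i fun b => T (F b) := by
  induction h with
  | @term a e ha he he' =>
    have := Sym.term ha (h1 e he) (h2 e he')
    convert this using 2 with b
    exact h3 _ _ he'
  | @add F G hF hG ih1 ih2 =>
    convert ih1.add ih2 using 2 with b
    exact h4 _ _ (hF.smoothEven b) (hG.smoothEven b)

theorem coef_mul {j : ℤ} {a : (Fin L → ℝ) → ℝ} (ha : Coef Q χ m j a) (h : Sym Q χ m i F) :
    Sym Q χ m (j + i) fun b y => a b * F b y := by
  induction h with
  | @term c e hc he he' => simpa only [mul_assoc] using Sym.term (ha.mul hc) he he'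
  | add _ _ ih1 ih2 => simpa only [mul_add] using ih1.add ih2

theorem fun_mul {e : ℝ → ℝ} (he : TG e) (he' : SmoothEven e) (h : Sym Q χ m i F) :
    Sym Q χ m i fun b y => e y * F b y :=
  h.map (T := fun w y => e y * w y) (fun _ hw => he.mul hw) (fun _ hw => he'.mul hw)
    (fun c w _ => by ext y; ring) (fun w v _ _ => by ext y; ring)

theorem mul {j : ℤ} (hF : Sym Q χ m i F) (hG : Sym Q χ m j G) :
    Sym Q χ m (i + j) fun b y => F b y * G b y := by
  induction hF with
  | @term a e ha he he' => simpa only [mul_assoc] using (hG.fun_mul he he').coef_mul ha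
  | add _ _ ih1 ih2 => simpa only [add_mul] using ih1.add ih2

theorem neg (h : Sym Q χ m i F) : Sym Q χ m i fun b y => -F b y := by
  simpa using (h.coef_mul (Coef.const (-1))).cast (zero_add i)

theorem sub (hF : Sym Q χ m i F) (hG : Sym Q χ m i G) : Sym Q χ m i fun b y => F b y - G b y := by
  simpa only [sub_eq_add_neg] using hF.add hG.neg

theorem LR (h : Sym Q χ m i F) : Sym Q χ m i fun b => HeatFlow.LR (F b) := by
  refine h.map (fun _ hw => hw.LR) (fun _ hw => hw.LR) (fun c w hw => ?_) (fun w v hw hv => ?_)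
  · ext y
    simp only [HeatFlow.LR]
    rw [deriv_const_mul c (hw.differentiable y)]; ring
  · ext y
    simp only [HeatFlow.LR]
    rw [deriv_fun_add (hw.differentiable y) (hv.differentiable y)]; ring

variable {g Q₀ q p V : ℝ → ℝ} (hR : Reduced g Q Q₀ q p V) (hχ : IsCutoff χ)
include hR

theorem HI (h : Sym Q χ m i F) : Sym Q χ m i fun b => HeatFlow.HI q p (F b) :=
  h.map (fun _ hw => hR.tg_HI hw) (fun _ hw => hR.smoothEven_HI hw)
    (fun c w _ => HI_const_mul q p w c)
    (fun _ _ hw hv => HI_add hR.q_even.continuous hR.p_even.continuous hw.continuous hv.continuous)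

include hχ

theorem exists_bound (h : Sym Q χ m i F) {A : ℝ} (hA : 0 ≤ A) :
    ∃ (C : ℝ) (k : ℕ), 0 ≤ C ∧ ∀ b, Admissible A b → ∀ y,
      |F b y| ≤ C * par b 1 ^ i * (1 + |y|) ^ k := by
  induction h with
  | term ha he he' =>
    obtain ⟨C, hC, h⟩ := ha.exists_bound hR hχ hA
    obtain ⟨D, k, hD, h'⟩ := he.polyGrowth.nonneg_bound
    refine ⟨C * D, k, by positivity, fun b hb y => ?_⟩
    rw [abs_mul]
    have := hb.pos
    calc _ ≤ (C * par b 1 ^ i) * (D * (1 + |y|) ^ k) :=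
          mul_le_mul (h b hb) (h' y) (abs_nonneg _) (by positivity)
      _ = _ := by ring
  | add _ _ ih1 ih2 =>
    obtain ⟨C, k, hC, h⟩ := ih1
    obtain ⟨D, l, hD, h'⟩ := ih2
    refine ⟨C + D, k + l, by positivity, fun b hb y => (abs_add_le _ _).trans ?_⟩
    have h1 := one_le_one_add_abs_pow y k
    have h2 := one_le_one_add_abs_pow y l
    have := hb.pos
    calc _ ≤ C * par b 1 ^ i * (1 + |y|) ^ k + D * par b 1 ^ i * (1 + |y|) ^ l :=
          add_le_add (h b hb y) (h' b hb y)
      _ ≤ C * par b 1 ^ i * ((1 + |y|) ^ k * (1 + |y|) ^ l)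
          + D * par b 1 ^ i * ((1 + |y|) ^ k * (1 + |y|) ^ l) := by
          gcongr
          · exact le_mul_of_one_le_right (by positivity) h2
          · exact le_mul_of_one_le_left (by positivity) h1
      _ = _ := by rw [pow_add]; ring

theorem exists_hasFDerivAt (h : Sym Q χ m i F) (hm : 1 ≤ m) :
    ∃ F' : Fin L → (Fin L → ℝ) → ℝ → ℝ,
    (∀ j : Fin L, Sym Q χ m (i - (((j : ℕ) : ℤ) + 1)) (F' j)) ∧
    (∀ j : Fin L, m < (j : ℕ) + 1 → F' j = fun _ _ => 0) ∧
    ∀ b, 0 < par b 1 → ∀ y, HasFDerivAt (fun b => F b y) (linForm fun j => F' j b y) b := by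
  induction h with
  | @term a e ha he he' =>
    obtain ⟨a', h1, h2, h3⟩ := ha.exists_hasFDerivAt hR hχ hm
    refine ⟨fun j b y => a' j b * e y, fun j => .term (h1 j) he he', fun j hj => ?_, fun b hb y => ?_⟩
    · ext b y; simp [h2 j hj]
    · refine ((h3 b hb).mul_const (e y)).congr_fderiv ?_
      ext v
      simp only [linForm_apply, _root_.smul_apply, smul_eq_mul, Finset.mul_sum]
      exact Finset.sum_congr rfl fun j _ => by ring
  | add _ _ ih1 ih2 =>
    obtain ⟨a', h1, h2, h3⟩ := ih1
    obtain ⟨c', k1, k2, k3⟩ := ih2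
    refine ⟨fun j b y => a' j b y + c' j b y, fun j => (h1 j).add (k1 j), fun j hj => ?_,
      fun b hb y => ?_⟩
    · ext b y; simp [h2 j hj, k2 j hj]
    · refine ((h3 b hb y).add (k3 b hb y)).congr_fderiv ?_
      ext v; simp [linForm_apply, add_mul, Finset.sum_add_distrib]

theorem continuousOn (h : Sym Q χ m i F) (hm : 1 ≤ m) :
    ContinuousOn (fun z : (Fin L → ℝ) × ℝ => F z.1 z.2) ({b | 0 < par b 1} ×ˢ univ) := by
  induction h with
  | @term a e ha he he' =>
    exact ((ha.continuousOn hR hχ hm).comp continuousOn_fst fun z hz => hz.1).mul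
      (he.continuous.comp continuous_snd).continuousOn
  | add _ _ ih1 ih2 => exact ih1.add ih2

end Sym

/-! ### The profiles S_i in the region where the cut-offs are inactive. -/

open Polynomial in
-- With j ≥ 2 factors and no constant term, a monomial of weight i uses only weights below i.
-- Algebraically, X^i divides P - P' and X divides the cofactor of P^j - P'^j. So the nonlinear term
-- of weight i+1 is determined by S_1, …, S_i.
theorem coeff_pow_congr {P P' : ℝ[X]} {i j : ℕ} (h0 : P.coeff 0 = 0) (h0' : P'.coeff 0 = 0)
    (hj : 2 ≤ j) (h : ∀ k < i, P.coeff k = P'.coeff k) : (P ^ j).coeff i = (P' ^ j).coeff i := by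
  have h1 : X ^ i ∣ P - P' := by
    rw [X_pow_dvd_iff]
    intro d hd
    rw [coeff_sub, h d hd, sub_self]
  have h2 : X ∣ ∑ k ∈ Finset.range j, P ^ k * P' ^ (j - 1 - k) := by
    refine Finset.dvd_sum fun k _ => ?_
    rcases Nat.eq_zero_or_pos k with rfl | hk
    · exact Dvd.dvd.mul_left (dvd_pow (X_dvd_iff.2 h0') (by omega)) _
    · exact Dvd.dvd.mul_right (dvd_pow (X_dvd_iff.2 h0) (by omega)) _
  have h3 : X ^ (i + 1) ∣ P ^ j - P' ^ j := by
    rw [← (Commute.all P P').geom_sum₂_mul, pow_succ']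
    exact mul_dvd_mul h2 h1
  have := X_pow_dvd_iff.1 h3 i (by omega)
  rw [coeff_sub] at this
  linarith

namespace Sym
variable {Q χ : ℝ → ℝ} {L m : ℕ}

open Polynomial in
theorem coeff_pow {P : (Fin L → ℝ) → ℝ → ℝ[X]} (h : ∀ i : ℕ, Sym Q χ m i fun b y => (P b y).coeff i)
    (j i : ℕ) : Sym Q χ m i fun b y => (P b y ^ j).coeff i := by
  induction j generalizing i with
  | zero =>
    simp only [pow_zero, coeff_one]
    split_ifs with h
    · subst h
      simpa using Sym.term (L := L) (m := m) (Coef.const (Q := Q) (χ := χ) 1) (TG.const 1) (.const 1)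
    · exact zero
  | succ j ih =>
    simp only [pow_succ, coeff_mul]
    refine sum _ fun x hx => ((ih x.1).mul (h x.2)).cast ?_
    exact_mod_cast Finset.HasAntidiagonal.mem_antidiagonal.1 hx

end Sym

/-- The set on which the profiles are given by the formulas without radiation. -/
def Inner {L : ℕ} (b : Fin L → ℝ) (y : ℝ) : Prop := 0 < par b 1 ∧ 0 < y ∧ y < B0 (par b 1) / 4

theorem Inner.B0_pos {L : ℕ} {b : Fin L → ℝ} {y : ℝ} (h : Inner b y) : 0 < B0 (par b 1) := by
  have := Real.sqrt_pos.2 h.1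
  rw [B0]; positivity

/-- Openness in b is what allows the parameter derivatives of S_i to be computed from the inner
expression. -/
theorem Inner.eventually {L : ℕ} {b : Fin L → ℝ} {y : ℝ} (h : Inner b y) :
    ∀ᶠ b' in 𝓝 b, Inner b' y := by
  have hc : ContinuousAt (fun b : Fin L → ℝ => B0 (par b 1) / 4) b := by
    have := (continuous_par (L := L) 1).continuousAt (x := b)
    have h2 : √(par b 1) ≠ 0 := (Real.sqrt_pos.2 h.1).ne'
    unfold B0
    fun_prop (disch := assumption)
  filter_upwards [(continuous_par (L := L) 1).continuousAt.eventually_const_lt h.1,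
    hc.eventually_const_lt h.2.2] with b' h1 h2
  exact ⟨h1, h.2.1, h2⟩

theorem parDeriv_eq {L : ℕ} {S F : (Fin L → ℝ) → ℝ → ℝ} {c : Fin L → ℝ} {b : Fin L → ℝ} {y : ℝ}
    (hS : ∀ᶠ b' in 𝓝 b, S b' y = y * F b' y) (hF : HasFDerivAt (fun b => F b y) (linForm c) b)
    (j : Fin L) : parDeriv S j b y = y * c j := by
  have hu : HasDerivAt (Function.update b j) (Pi.single j (1 : ℝ)) (b j) :=
    hasDerivAt_update b j (b j)
  have he : Function.update b j (b j) = b := Function.update_eq_self j b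
  have hc : Tendsto (Function.update b j) (𝓝 (b j)) (𝓝 b) := by
    have := hu.continuousAt.tendsto
    rwa [he] at this
  have hF' : HasFDerivAt (fun b => F b y) (linForm c) (Function.update b j (b j)) := by rwa [he]
  have h1 : HasDerivAt (fun x => F (Function.update b j x) y) (linForm c (Pi.single j 1)) (b j) :=
    hF'.comp_hasDerivAt (b j) hu
  have e : (fun x => S (Function.update b j x) y) =ᶠ[𝓝 (b j)]
    fun x => y * F (Function.update b j x) y := hc.eventually hS
  rw [parDeriv, e.deriv_eq, (h1.const_mul y).deriv, linForm_apply]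
  simp [Pi.single_apply]

section
variable {g Q χ : ℝ → ℝ} {L : ℕ}

theorem profiles_eq (n i : ℕ) (h : i ≤ n) : profiles g Q χ L n i = S g Q χ L i := by
  induction n with
  | zero => obtain rfl : i = 0 := by omega
            rfl
  | succ n ih =>
    rcases Nat.lt_or_ge n i with hn | hn
    · obtain rfl : i = n + 1 := by omega
      rfl
    · cases n with
      | zero => obtain rfl : i = 0 := by omega
                rfl
      | succ n => rw [← ih hn, profiles, Function.update_of_ne (by omega)]

theorem S_le_one {i : ℕ} (h : i ≤ 1) : S g Q χ L i = fun _ _ => 0 := by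
  interval_cases i <;> rfl

theorem S_succ (n : ℕ) (b : Fin L → ℝ) (y : ℝ) : S g Q χ L (n + 2) b y =
    -Hinv Q (source g Q χ (profiles g Q χ L (n + 1)) (n + 1) b) y := by
  rw [S, profiles, Function.update_self]

end

open Polynomial in
/-- The generating polynomial of the reduced profiles of weight less than `m`. -/
noncomputable def genPoly (q p : ℝ → ℝ) {L : ℕ} (F : ℕ → (Fin L → ℝ) → ℝ → ℝ) (m : ℕ)
    (b : Fin L → ℝ) (y : ℝ) : ℝ[X] :=
  ∑ k ∈ (Finset.Icc 1 (L + 2)).filter (· < m), C (par b k * TR q p k y + F k b y) * X ^ k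

open Polynomial in
theorem coeff_genPoly (q p : ℝ → ℝ) {L : ℕ} (F : ℕ → (Fin L → ℝ) → ℝ → ℝ) (m : ℕ)
    (b : Fin L → ℝ) (y : ℝ) (i : ℕ) : (genPoly q p F m b y).coeff i =
      if 1 ≤ i ∧ i ≤ L + 2 ∧ i < m then par b i * TR q p i y + F i b y else 0 := by
  simp only [genPoly, finsetSum_coeff, coeff_C_mul, coeff_X_pow, mul_ite, mul_one, mul_zero,
    Finset.sum_ite_eq, Finset.mem_filter, Finset.mem_Icc, and_assoc]

/-- The reduced form of the terms of weight `i` in the nonlinearity. -/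
noncomputable def taylorR (q p : ℝ → ℝ) (W : ℕ → ℝ → ℝ) {L : ℕ} (F : ℕ → (Fin L → ℝ) → ℝ → ℝ)
    (m i : ℕ) (b : Fin L → ℝ) (y : ℝ) : ℝ :=
  ∑ j ∈ Finset.Icc 2 (L + 2), W j y * (genPoly q p F m b y ^ j).coeff i

/-- The reduced form of the source terms. -/
noncomputable def sourceR (Q χ q p : ℝ → ℝ) (W : ℕ → ℝ → ℝ) {L : ℕ} (F : ℕ → (Fin L → ℝ) → ℝ → ℝ)
    (F' : ℕ → Fin L → (Fin L → ℝ) → ℝ → ℝ) (i : ℕ) (b : Fin L → ℝ) (y : ℝ) : ℝ :=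
  par b 1 * par b i * (LR (TR q p i) y - (2 * (i : ℝ) - 1 + 4 * (cutInt Q χ 0 (par b 1))⁻¹) * TR q p i y)
    + par b 1 * LR (F i b) y + taylorR q p W F (i + 1) (i + 1) b y
    - ∑ j : Fin L, if (j : ℕ) + 1 < i then
        ((2 * ((j : ℝ) + 1) - 1 + 4 * (cutInt Q χ 0 (par b 1))⁻¹) * par b 1 * par b (j + 1) - par b (j + 2))
          * F' i j b y else 0

/-- The functions `f^{(j)}(Q) y^{j-3} / j!`. -/
structure TaylorData (g Q : ℝ → ℝ) (W : ℕ → ℝ → ℝ) : Prop where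
  tg : ∀ j, TG (W j)
  even : ∀ j, SmoothEven (W j)
  eq : ∀ j, 2 ≤ j → ∀ y, 0 < y →
    iteratedDeriv j (nonlin g) (Q y) / (Nat.factorial j : ℝ) * y ^ j / y ^ 2 = y * W j y

/-- A representation of a profile of weight `i` by symbols. -/
structure ProfileRep (g Q χ : ℝ → ℝ) {L : ℕ} (i : ℕ) (F : (Fin L → ℝ) → ℝ → ℝ)
    (F' : Fin L → (Fin L → ℝ) → ℝ → ℝ) : Prop where
  eq : ∀ b y, Inner b y → S g Q χ L i b y = y * F b y
  hasFDerivAt : ∀ b y, 0 < par b 1 → HasFDerivAt (fun b => F b y) (linForm fun j => F' j b y) b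

/-- A family of symbols of the weights of the profiles and of their derivatives. -/
structure SymFamily (Q χ : ℝ → ℝ) {L : ℕ} (i : ℕ) (F : (Fin L → ℝ) → ℝ → ℝ)
    (F' : Fin L → (Fin L → ℝ) → ℝ → ℝ) : Prop where
  zero : i ≤ 1 → F = fun _ _ => 0
  sym : Sym Q χ (i - 1) i F
  sym' : ∀ j : Fin L, Sym Q χ (i - 1) (i - (((j : ℕ) : ℤ) + 1)) (F' j)
  zero' : ∀ j : Fin L, i ≤ (j : ℕ) + 1 → F' j = fun _ _ => 0

namespace Reduced
variable {g Q Q₀ q p V : ℝ → ℝ} (hR : Reduced g Q Q₀ q p V)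
include hR

theorem exists_taylorData : ∃ W, TaylorData g Q W := by
  have : ∀ j, ∃ F, TG F ∧ SmoothEven F ∧ (2 ≤ j → ∀ y, 0 < y →
    iteratedDeriv j (nonlin g) (Q y) / (Nat.factorial j : ℝ) * y ^ j / y ^ 2 = y * F y) := by
    intro j
    by_cases hj : 2 ≤ j
    · obtain ⟨F, h1, h2, h3⟩ := hR.taylor j hj
      refine ⟨fun y => (j.factorial : ℝ)⁻¹ * F y, h1.const_mul _, h2.const_mul _, fun _ y hy => ?_⟩
      rw [mul_left_comm, ← h3 y hy]
      ring
    · exact ⟨fun _ => 0, .const 0, .const 0, fun h => absurd h hj⟩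
  choose W h1 h2 h3 using this
  exact ⟨W, h1, h2, h3⟩

variable {χ : ℝ → ℝ} (hχ : IsCutoff χ) {L : ℕ}
include hχ

/-- Below B_0/4 the first cut-off equals 1 and the second contribution vanishes, and the inverse of
H depends on its argument on (0, y) only: the radiation is c_{b_1} T_1 there. -/
theorem radiation_eq {b : Fin L → ℝ} {y : ℝ} (h : Inner b y) :
    radiation g Q χ (par b 1) y = y * (-cb Q χ (par b 1) * HI q p q y) := by
  have hB := h.B0_pos
  set B := B0 (par b 1)
  have h1 : ∀ y, 0 < y → y < B / 4 →
      -cb Q χ (par b 1) * cut χ (B / 4) y * Lam Q y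
      + db Q χ (par b 1) * H g Q (fun x => (1 - cut χ B x) * Lam Q x) y
      = y * (-cb Q χ (par b 1) * q y) := by
    intro y hy hyB
    rw [hR.H_eq (.const 0) (R := B / 4) (fun x hx hxB => ?_) hy hyB, HR_zero, cut,
      hχ.eq_one _ ((div_le_one (by positivity)).2 hyB.le), hR.Lam_eq hy]
    · ring
    · rw [cut, hχ.eq_one _ ((div_le_one hB).2 (by linarith))]; ring
  rw [radiation, hR.Hinv_eq (by have := hR.q_even.continuous; fun_prop) h1 h.2.1 h.2.2, HI_const_mul]

/-- The iterated inverse of the radiation is a multiple of T_i, so it merely shifts 2i-1 to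
2i-1+c_{b_1}. This is the origin of c_{b_1} in the modulation equations. -/
theorem Theta_eq {b : Fin L → ℝ} {y : ℝ} (h : Inner b y) {i : ℕ} (hi : 1 ≤ i) :
    Theta g Q χ i (par b 1) y = y * (LR (TR q p i) y
      - (2 * (i : ℝ) - 1 + 4 * (cutInt Q χ 0 (par b 1))⁻¹) * TR q p i y) := by
  obtain ⟨i, rfl⟩ : ∃ k, i = k + 1 := ⟨i - 1, by omega⟩
  have h1 := hR.Hinv_iter_eq ((hR.smoothEven_HI hR.q_even).const_mul (-cb Q χ (par b 1)))
    (fun y hy hyB => hR.radiation_eq hχ ⟨h.1, hy, hyB⟩) i h.2.1 h.2.2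
  rw [HI_iter_const_mul, ← Function.iterate_succ_apply] at h1
  rw [Theta, Lam_eq_mul_LR (hR.smoothEven_TR (i + 1)) (fun y hy _ => hR.T_eq (i + 1) hy) h.2.1 h.2.2,
    hR.T_eq _ h.2.1, Nat.add_sub_cancel, h1, ← cb_eq h.1, TR]
  have : ((-1 : ℝ) ^ (i + 1)) ^ 2 = 1 := by rw [← pow_mul, mul_comm, pow_mul]; simp
  rcases neg_one_pow_eq_or ℝ i with e | e <;> simp only [pow_succ, e] <;> ring

variable {W : ℕ → ℝ → ℝ} (hW : TaylorData g Q W)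
include hW

omit hχ in
open Polynomial in
-- Up to weights that cannot contribute, the profile polynomial is y times the reduced one; the
-- factor y^j, with f^(j)(Q)/y², makes up the smooth function `W j`.
theorem taylorPart_eq {SS F : ℕ → (Fin L → ℝ) → ℝ → ℝ} {b : Fin L → ℝ} {y : ℝ} (hy : 0 < y) {i m : ℕ}
    (hm : i ≤ m) (h : ∀ k < i, SS k b y = y * F k b y) :
    taylorPart g Q SS i b y / y ^ 2 = y * taylorR q p W F m i b y := by
  rw [taylorPart, taylorR, Finset.sum_div, Finset.mul_sum]
  refine Finset.sum_congr rfl fun j hj => ?_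
  have hj2 := (Finset.mem_Icc.1 hj).1
  have hS : ∀ k, (∑ k ∈ Finset.Icc 1 (L + 2), C (par b k * T Q k y + SS k b y) * X ^ k).coeff k
      = if 1 ≤ k ∧ k ≤ L + 2 then par b k * T Q k y + SS k b y else 0 := fun k => by
    simp only [finsetSum_coeff, coeff_C_mul, coeff_X_pow, mul_ite, mul_one, mul_zero,
      Finset.sum_ite_eq, Finset.mem_Icc]
  rw [coeff_pow_congr (P' := C y * genPoly q p F m b y) (by simp)
    (by simp [coeff_genPoly]) hj2 (fun k hk => ?_), mul_pow, ← C_pow, coeff_C_mul]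
  · rw [← mul_assoc y, ← hW.eq j hj2 y hy]; ring
  · rw [hS, coeff_C_mul, coeff_genPoly]
    have : k < m := by omega
    simp only [this, and_true]
    split_ifs
    · rw [hR.T_eq k hy, h k hk]; ring
    · simp

omit hR hχ hW in
theorem _root_.HeatFlow.SymFamily.genPoly {F : ℕ → (Fin L → ℝ) → ℝ → ℝ} {F' : ℕ → Fin L → (Fin L → ℝ) → ℝ → ℝ}
    (hR : Reduced g Q Q₀ q p V)
    (hF : ∀ k, SymFamily Q χ k (F k) (F' k)) {m n : ℕ} (hm : n ≤ m + 1) (i : ℕ) :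
    Sym Q χ m i fun b y => (HeatFlow.genPoly q p F n b y).coeff i := by
  simp only [coeff_genPoly]
  split_ifs with h
  · exact (Sym.term (Coef.parAny i (by omega)) (hR.tg_TR i) (hR.smoothEven_TR i)).add
      ((hF i).sym.mono (by omega))
  · exact Sym.zero

omit hχ in
theorem sym_taylorR {F : ℕ → (Fin L → ℝ) → ℝ → ℝ} {F' : ℕ → Fin L → (Fin L → ℝ) → ℝ → ℝ}
    (hF : ∀ k, SymFamily Q χ k (F k) (F' k)) {m n : ℕ} (hm : n ≤ m + 1) (i : ℕ) :
    Sym Q χ m i (taylorR q p W F n i) :=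
  Sym.sum _ fun j _ => (Sym.coeff_pow (SymFamily.genPoly hR hF hm) j i).fun_mul (hW.tg j) (hW.even j)

omit hχ in
-- Each term of the source is homogeneous of the same weight i+1: multiplication by b_1 raises it by
-- one, and ∂/∂b_j followed by a coefficient of weight j+1 does as well.
theorem sym_sourceR {F : ℕ → (Fin L → ℝ) → ℝ → ℝ} {F' : ℕ → Fin L → (Fin L → ℝ) → ℝ → ℝ}
    (hF : ∀ k, SymFamily Q χ k (F k) (F' k)) {i : ℕ} (hi : 1 ≤ i) :
    Sym Q χ i (i + 1 : ℕ) (sourceR Q χ q p W F F' i) := by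
  have hc : ∀ r : ℝ, Coef Q χ i 0 fun b : Fin L → ℝ => r + 4 * (cutInt Q χ 0 (par b 1))⁻¹ := fun r =>
    (Coef.const r).add (Coef.cutInv.const_mul 4)
  have h1 := Coef.par (Q := Q) (χ := χ) (L := L) (m := i) 1 le_rfl hi
  refine Sym.sub (((Sym.coef_mul (i := 0) ((h1.mul (Coef.par i hi le_rfl)).cast (by push_cast; ring)) ?_).cast (add_zero _)).add
    (((hF i).sym.LR.mono (by omega)).coef_mul h1 |>.cast (by push_cast; ring)) |>.add
      (hR.sym_taylorR hW hF le_rfl _)) (Sym.sum _ fun j _ => ?_)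
  · refine Sym.sub ?_ ((Sym.term (hc _) (hR.tg_TR i) (hR.smoothEven_TR i)))
    simpa using Sym.term (Coef.const 1) (hR.tg_TR i).LR (hR.smoothEven_TR i).LR
  · split_ifs with h
    · refine (Sym.coef_mul (j := j + 2) ?_ (((hF i).sym' j).mono (by omega))).cast (by push_cast; ring)
      have := ((hc (2 * ((j : ℝ) + 1) - 1)).mul h1).mul (Coef.par ((j : ℕ) + 1) (by omega) (by omega))
      have h2 := this.cast (j := ((j : ℕ) : ℤ) + 2) (by push_cast; ring)
      have h3 := (Coef.par (Q := Q) (χ := χ) (L := L) (m := i) ((j : ℕ) + 2) (by omega) (by omega)).const_mul (-1)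
      simpa [sub_eq_add_neg] using h2.add (h3.cast (by push_cast; ring))
    · exact Sym.zero

theorem source_eq {F : ℕ → (Fin L → ℝ) → ℝ → ℝ} {F' : ℕ → Fin L → (Fin L → ℝ) → ℝ → ℝ} {i : ℕ}
    (hi : 1 ≤ i) (hF : ∀ k, SymFamily Q χ k (F k) (F' k))
    (h : ∀ k ≤ i, ProfileRep g Q χ k (F k) (F' k)) {b : Fin L → ℝ} {y : ℝ} (hb : Inner b y) :
    source g Q χ (profiles g Q χ L i) i b y = y * sourceR Q χ q p W F F' i b y := by
  have hL : Lam (profiles g Q χ L i i b) y = y * LR (F i b) y := by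
    rw [profiles_eq _ _ le_rfl]
    exact Lam_eq_mul_LR ((hF i).sym.smoothEven b)
      (fun y hy hyB => (h i le_rfl).eq b y ⟨hb.1, hy, hyB⟩) hb.2.1 hb.2.2
  rw [source, sourceR, hR.Theta_eq hχ hb hi, hL, hR.taylorPart_eq hW (m := i + 1) (F := F) hb.2.1 le_rfl
    (fun k hk => by rw [profiles_eq _ _ (by omega), (h k (by omega)).eq b y hb]), cb_eq hb.1,
    mul_sub y (_ + _) _, Finset.mul_sum]
  congr 1
  · ring
  · refine Finset.sum_congr rfl fun j _ => ?_
    split_ifs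
    · rw [profiles_eq _ _ le_rfl, parDeriv_eq (hb.eventually.mono fun b' h' => (h i le_rfl).eq b' y h')
        ((h i le_rfl).hasFDerivAt b y hb.1)]
      ring
    · ring

/-- Strong induction along the recursion for S_i: the inner expression of the source is a symbol,
and so is its image under the inverse of H. -/
theorem exists_profileRep (i : ℕ) : ∃ (F : (Fin L → ℝ) → ℝ → ℝ) (F' : Fin L → (Fin L → ℝ) → ℝ → ℝ),
    SymFamily Q χ i F F' ∧ ProfileRep g Q χ i F F' := by
  induction i using Nat.strong_induction_on with
  | _ i ih =>
  have hz : ∀ k, SymFamily Q χ k (fun (_ : Fin L → ℝ) _ => 0) (fun _ _ _ => 0) := fun k =>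
    ⟨fun _ => rfl, Sym.zero, fun _ => Sym.zero, fun _ _ => rfl⟩
  rcases Nat.lt_or_ge 1 i with hi | hi
  · obtain ⟨n, rfl⟩ : ∃ n, i = n + 2 := ⟨i - 2, by omega⟩
    -- Indices beyond n+1 are padded with zero; the source of index n+1 does not involve them.
    have : ∀ k, ∃ (F : (Fin L → ℝ) → ℝ → ℝ) (F' : Fin L → (Fin L → ℝ) → ℝ → ℝ),
        SymFamily Q χ k F F' ∧ (k ≤ n + 1 → ProfileRep g Q χ k F F') := fun k => by
      by_cases hk : k ≤ n + 1
      · obtain ⟨F, F', h1, h2⟩ := ih k (by omega)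
        exact ⟨F, F', h1, fun _ => h2⟩
      · exact ⟨_, _, hz k, fun h => absurd h hk⟩
    choose F F' h1 h2 using this
    have hs := ((hR.sym_sourceR hW h1 (i := n + 1) (by omega)).HI hR).neg
    obtain ⟨G', k1, k2, k3⟩ := hs.exists_hasFDerivAt hR hχ (by omega)
    refine ⟨_, G', ⟨fun h => by omega, hs, k1, fun j hj => k2 j (by omega)⟩, fun b y hb => ?_,
      fun b y hb => k3 b hb y⟩
    rw [S_succ, hR.Hinv_eq ((hR.sym_sourceR hW h1 (i := n + 1) (by omega)).smoothEven b).continuous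
      (fun y hy hyB => hR.source_eq hχ hW (by omega) h1 h2 ⟨hb.1, hy, hyB⟩) hb.2.1 hb.2.2]
    ring
  · refine ⟨_, _, hz i, fun b y _ => by simp [S_le_one hi], fun b y _ => ?_⟩
    refine (hasFDerivAt_const _ _).congr_fderiv ?_
    ext v; simp [linForm_apply]

/-- The symbol and the integral formula both represent S_{i+1} in the inner region, and H is local,
so applying it to either gives the same value. -/
theorem HR_profile {F : ℕ → (Fin L → ℝ) → ℝ → ℝ} {F' : ℕ → Fin L → (Fin L → ℝ) → ℝ → ℝ}
    (hF : ∀ k, SymFamily Q χ k (F k) (F' k))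
    (h : ∀ k, ProfileRep g Q χ k (F k) (F' k)) {b : Fin L → ℝ} {y : ℝ} (hb : Inner b y) {i : ℕ}
    (hi : 1 ≤ i) : HR V (F (i + 1) b) y = -sourceR Q χ q p W F F' i b y := by
  obtain ⟨n, rfl⟩ : ∃ n, i = n + 1 := ⟨i - 1, by omega⟩
  have hs := (hR.sym_sourceR hW hF hi).smoothEven b
  have h1 := hR.H_eq (((hF (n + 2)).sym.smoothEven b))
    (fun y hy hyB => (h (n + 2)).eq b y ⟨hb.1, hy, hyB⟩) hb.2.1 hb.2.2
  have h2 := hR.H_eq (((hR.smoothEven_HI hs)).const_mul (-1)) (F := S g Q χ L (n + 2) b)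
    (R := B0 (par b 1) / 4) (fun y hy hyB => by
      rw [S_succ, hR.Hinv_eq hs.continuous
        (fun y hy hyB => hR.source_eq hχ hW (by omega) hF (fun k _ => h k) ⟨hb.1, hy, hyB⟩) hy hyB]
      ring) hb.2.1 hb.2.2
  rw [h1, HR_const_mul (hR.smoothEven_HI hs), hR.HR_HI hs] at h2
  have := mul_left_cancel₀ hb.2.1.ne' h2
  simpa using this

end Reduced

/-! ### The error with which the profile solves the equation. -/

theorem abs_le_of_hasDerivAt {G G' : ℝ → ℝ} {c h : ℝ} (hG : ∀ z, HasDerivAt G (G' z) z) (h0 : G 0 = 0)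
    (hc : ∀ z, |z| ≤ |h| → |G' z| ≤ c) : |G h| ≤ c * |h| := by
  have := (convex_uIcc (0 : ℝ) h).norm_image_sub_le_of_norm_hasDerivWithin_le
    (fun z _ => (hG z).hasDerivWithinAt)
    (fun z hz => hc z (by simpa using abs_sub_left_of_mem_uIcc hz)) left_mem_uIcc right_mem_uIcc
  simpa [h0] using this

theorem abs_taylor_le (n : ℕ) {C : ℝ} (hC : 0 ≤ C) {f : ℝ → ℝ} (hf : ContDiff ℝ ∞ f)
    (hb : ∀ u, |iteratedDeriv (n + 1) f u| ≤ C) (x h : ℝ) :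
    |f (x + h) - ∑ j ∈ Finset.range (n + 1), iteratedDeriv j f x / (Nat.factorial j : ℝ) * h ^ j|
      ≤ C * |h| ^ (n + 1) := by
  induction n generalizing f h with
  | zero =>
    have hd : Differentiable ℝ f := hf.differentiable (by simp)
    have := abs_le_of_hasDerivAt (G := fun z => f (x + z) - f x) (G' := fun z => deriv f (x + z))
      (c := C) (h := h) (fun z => by
      simpa using ((hd (x + z)).hasDerivAt.comp_const_add x z).sub_const (f x)) (by simp)
      (fun z _ => by simpa using hb (x + z))
    simpa using this
  | succ n ih =>
    have hd : Differentiable ℝ f := hf.differentiable (by simp)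
    have hf' : ContDiff ℝ ∞ (deriv f) := (contDiff_infty_iff_deriv.1 hf).2
    have hs : ∀ j, iteratedDeriv (j + 1) f = iteratedDeriv j (deriv f) := fun j => iteratedDeriv_succ'
    refine (abs_le_of_hasDerivAt (G := fun z => f (x + z) - ∑ j ∈ Finset.range (n + 1 + 1),
        iteratedDeriv j f x / (Nat.factorial j : ℝ) * z ^ j)
      (G' := fun z => deriv f (x + z) - ∑ j ∈ Finset.range (n + 1),
        iteratedDeriv j (deriv f) x / (Nat.factorial j : ℝ) * z ^ j) (c := C * |h| ^ (n + 1))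
      (fun z => ?_) ?_ fun z hz => (ih hf' (by simpa only [hs] using hb) z).trans ?_).trans ?_
    · have h2 := (hd (x + z)).hasDerivAt.comp_const_add x z
      refine h2.sub ?_
      have h3 : HasDerivAt (fun z : ℝ => ∑ j ∈ Finset.range (n + 1 + 1),
          iteratedDeriv j f x / (Nat.factorial j : ℝ) * z ^ j)
          (∑ j ∈ Finset.range (n + 1 + 1), iteratedDeriv j f x / (Nat.factorial j : ℝ) *
            (j * z ^ (j - 1))) z :=
        HasDerivAt.fun_sum fun j _ => (hasDerivAt_pow j z).const_mul _
      refine h3.congr_deriv ?_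
      rw [Finset.sum_range_succ']
      simp only [Nat.cast_zero, zero_mul, mul_zero, add_zero, Nat.add_sub_cancel]
      refine Finset.sum_congr rfl fun j _ => ?_
      rw [hs, Nat.factorial_succ]
      push_cast
      have := (Nat.cast_ne_zero (R := ℝ)).2 j.factorial_ne_zero
      field_simp
    · rw [Finset.sum_range_succ']; simp
    · gcongr
    · rw [pow_succ _ (n + 1)]; exact le_of_eq (by ring)

theorem HR_sum {V : ℝ → ℝ} {ι : Type*} (s : Finset ι) {w : ι → ℝ → ℝ}
    (hw : ∀ k ∈ s, SmoothEven (w k)) :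
    HR V (fun y => ∑ k ∈ s, w k y) = fun y => ∑ k ∈ s, HR V (w k) y := by
  classical
  induction s using Finset.induction_on with
  | empty => simpa using Reduced.HR_zero
  | insert a s ha ih =>
    simp only [Finset.sum_insert ha]
    rw [HR_add (hw a (by simp)) (SmoothEven.sum _ fun k hk => hw k (by simp [hk])),
      ih fun k hk => hw k (by simp [hk])]

theorem LR_sum {ι : Type*} (s : Finset ι) {w : ι → ℝ → ℝ}
    (hw : ∀ k ∈ s, SmoothEven (w k)) :
    LR (fun y => ∑ k ∈ s, w k y) = fun y => ∑ k ∈ s, LR (w k) y := by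
  ext y
  simp only [LR]
  rw [deriv_fun_sum fun k hk => (hw k hk).differentiable y, Finset.mul_sum, Finset.sum_add_distrib]

theorem sum_range_add_two {f : ℕ → ℝ} (h0 : f 0 = 0) (h1 : f 1 = 0) (m n : ℕ) :
    ∑ i ∈ Finset.range (m + n + 2), f i
      = ∑ i ∈ Finset.range m, f (i + 2) + ∑ i ∈ Finset.range n, f (m + i + 2) := by
  rw [Finset.sum_range_succ', Finset.sum_range_succ', Finset.sum_range_add, h0]
  simp [h1]

theorem LR_add {w v : ℝ → ℝ} (hw : SmoothEven w) (hv : SmoothEven v) :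
    LR (fun y => w y + v y) = fun y => LR w y + LR v y := by
  ext y
  simp only [LR]
  rw [deriv_fun_add (hw.differentiable y) (hv.differentiable y)]; ring

theorem LR_const_mul {w : ℝ → ℝ} (hw : SmoothEven w) (c : ℝ) :
    LR (fun y => c * w y) = fun y => c * LR w y := by
  ext y
  simp only [LR]
  rw [deriv_const_mul c (hw.differentiable y)]; ring

/-- The reduced profile. -/
noncomputable def alphaR (q p : ℝ → ℝ) {L : ℕ} (F : ℕ → (Fin L → ℝ) → ℝ → ℝ) (b : Fin L → ℝ)
    (y : ℝ) : ℝ := ∑ k ∈ Finset.range (L + 2), (par b (k + 1) * TR q p (k + 1) y + F (k + 1) b y)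

/-- The derivatives of the reduced profile in the parameters. -/
noncomputable def alphaR' (q p : ℝ → ℝ) {L : ℕ} (F' : ℕ → Fin L → (Fin L → ℝ) → ℝ → ℝ) (j : Fin L)
    (b : Fin L → ℝ) (y : ℝ) : ℝ := TR q p (j + 1) y + ∑ k ∈ Finset.range (L + 2), F' (k + 1) j b y

/-- The leading part of the modulation equations. -/
noncomputable def modR (Q χ : ℝ → ℝ) {L : ℕ} (j : ℕ) (b : Fin L → ℝ) : ℝ :=
  (2 * ((j : ℝ) + 1) - 1 + 4 * (cutInt Q χ 0 (par b 1))⁻¹) * par b 1 * par b (j + 1) - par b (j + 2)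

theorem coef_modR (Q χ : ℝ → ℝ) {L m : ℕ} (j : ℕ) (hm : j + 2 ≤ m) :
    Coef Q χ m (j + 2) fun b : Fin L → ℝ => modR Q χ j b := by
  have := (((Coef.const (Q := Q) (χ := χ) (L := L) (m := m) (2 * ((j : ℝ) + 1) - 1)).add
    (Coef.cutInv.const_mul 4)).mul (Coef.par 1 le_rfl (by omega))).mul (Coef.par (j + 1) (by omega) (by omega))
  have h2 := this.cast (j := (j : ℤ) + 2) (by push_cast; ring)
  have h3 := (Coef.par (Q := Q) (χ := χ) (L := L) (m := m) (j + 2) (by omega) hm).const_mul (-1)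
  simpa [sub_eq_add_neg, modR] using h2.add (h3.cast (by push_cast; ring))

/-- Families of functions of order `b_1^n` with polynomial growth. -/
def ParBound {L : ℕ} (A : ℝ) (n : ℕ) (G : (Fin L → ℝ) → ℝ → ℝ) : Prop :=
  ∃ (C : ℝ) (k : ℕ), 0 ≤ C ∧ ∀ b, Admissible A b → ∀ y, |G b y| ≤ C * par b 1 ^ n * (1 + |y|) ^ k

namespace ParBound
variable {L : ℕ} {A : ℝ} {n : ℕ} {G G' : (Fin L → ℝ) → ℝ → ℝ}

theorem zero : ParBound A n (fun _ _ => 0 : (Fin L → ℝ) → ℝ → ℝ) :=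
  ⟨0, 0, le_rfl, fun b _ y => by simp⟩

theorem neg (h : ParBound A n G) : ParBound A n fun b y => -G b y := by
  simpa only [ParBound, abs_neg] using h

theorem add (h : ParBound A n G) (h' : ParBound A n G') : ParBound A n fun b y => G b y + G' b y := by
  obtain ⟨C, k, hC, h1⟩ := h
  obtain ⟨D, l, hD, h2⟩ := h'
  refine ⟨C + D, k + l, by positivity, fun b hb y => (abs_add_le _ _).trans ?_⟩
  have e1 := one_le_one_add_abs_pow y k
  have e2 := one_le_one_add_abs_pow y l
  have := hb.pos
  calc _ ≤ C * par b 1 ^ n * (1 + |y|) ^ k + D * par b 1 ^ n * (1 + |y|) ^ l :=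
        add_le_add (h1 b hb y) (h2 b hb y)
    _ ≤ C * par b 1 ^ n * ((1 + |y|) ^ k * (1 + |y|) ^ l)
        + D * par b 1 ^ n * ((1 + |y|) ^ k * (1 + |y|) ^ l) := by
        gcongr
        · exact le_mul_of_one_le_right (by positivity) e2
        · exact le_mul_of_one_le_left (by positivity) e1
    _ = _ := by rw [pow_add (1 + |y|)]; ring

theorem sum {ι : Type*} (s : Finset ι) {G : ι → (Fin L → ℝ) → ℝ → ℝ}
    (h : ∀ x ∈ s, ParBound A n (G x)) : ParBound A n fun b y => ∑ x ∈ s, G x b y := by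
  classical
  induction s using Finset.induction_on with
  | empty => simpa using zero
  | insert a s ha ih =>
    simp only [Finset.sum_insert ha]
    exact (h a (by simp)).add (ih fun x hx => h x (by simp [hx]))

theorem _root_.HeatFlow.Sym.parBound {g Q Q₀ q p V χ : ℝ → ℝ} {i : ℤ} {m : ℕ} (hG : Sym Q χ m i G)
    (hR : Reduced g Q Q₀ q p V) (hχ : IsCutoff χ) (hA : 0 ≤ A) (hi : (n : ℤ) ≤ i) :
    ParBound A n G := by
  obtain ⟨C, k, hC, h⟩ := hG.exists_bound hR hχ hA
  refine ⟨C, k, hC, fun b hb y => (h b hb y).trans ?_⟩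
  have := zpow_le_zpow_right_of_le_one₀ hb.pos hb.le_one hi
  rw [zpow_natCast] at this
  gcongr

end ParBound

namespace Reduced
variable {g Q Q₀ q p V : ℝ → ℝ} (hR : Reduced g Q Q₀ q p V)
variable {χ : ℝ → ℝ} (hχ : IsCutoff χ) {L : ℕ} {W : ℕ → ℝ → ℝ} (hW : TaylorData g Q W)
  {F : ℕ → (Fin L → ℝ) → ℝ → ℝ} {F' : ℕ → Fin L → (Fin L → ℝ) → ℝ → ℝ}
  (hF : ∀ k, SymFamily Q χ k (F k) (F' k))
include hR hF

theorem smoothEven_alphaR (b : Fin L → ℝ) : SmoothEven (alphaR q p F b) :=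
  SmoothEven.sum _ fun _ _ => ((hR.smoothEven_TR _).const_mul _).add ((hF _).sym.smoothEven b)

omit hR hF in
theorem hasFDerivAt_alphaR (h : ∀ k, ProfileRep g Q χ k (F k) (F' k)) {b : Fin L → ℝ}
    (hb : 0 < par b 1) (y : ℝ) :
    HasFDerivAt (fun b => alphaR q p F b y) (linForm fun j => alphaR' q p F' j b y) b := by
  have : HasFDerivAt (fun b => alphaR q p F b y) (∑ k ∈ Finset.range (L + 2),
      (TR q p (k + 1) y • linForm (fun j : Fin L => if (j : ℕ) + 1 = k + 1 then 1 else 0)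
        + linForm fun j => F' (k + 1) j b y)) b :=
    HasFDerivAt.fun_sum fun k _ => ((hasFDerivAt_par b (k + 1)).mul_const _).add
      ((h (k + 1)).hasFDerivAt b y hb)
  refine this.congr_fderiv ?_
  ext v
  simp only [_root_.sum_apply, linForm_apply, _root_.add_apply, _root_.smul_apply,
    smul_eq_mul, Finset.mul_sum, alphaR', add_mul, Finset.sum_mul, Finset.sum_add_distrib]
  congr 1
  · rw [Finset.sum_comm]
    refine Finset.sum_congr rfl fun j _ => ?_
    simp only [ite_mul, one_mul, zero_mul, mul_ite, mul_zero, add_left_inj]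
    rw [Finset.sum_ite_eq, if_pos (Finset.mem_range.2 (by omega))]
  · exact Finset.sum_comm

theorem sym_alphaR_term {k : ℕ} (hk : k < L + 2) : Sym Q χ (L + 2) ((k + 1 : ℕ) : ℤ)
    fun b y => par b (k + 1) * TR q p (k + 1) y + F (k + 1) b y :=
  (Sym.term (Coef.parAny (k + 1) (by omega)) (hR.tg_TR _) (hR.smoothEven_TR _)).add
    ((hF (k + 1)).sym.mono (by omega))

theorem parBound_alphaR (hχ : IsCutoff χ) {A : ℝ} (hA : 0 ≤ A) :
    ParBound A 1 fun b : Fin L → ℝ => alphaR q p F b :=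
  ParBound.sum _ fun k hk => (hR.sym_alphaR_term hF (Finset.mem_range.1 hk)).parBound hR hχ hA
    (by push_cast; omega)

theorem parBound_LR_alphaR (hχ : IsCutoff χ) {A : ℝ} (hA : 0 ≤ A) :
    ParBound A 1 fun b : Fin L → ℝ => LR (alphaR q p F b) := by
  have : (fun b : Fin L → ℝ => LR (alphaR q p F b)) = fun b y => ∑ k ∈ Finset.range (L + 2),
      LR (fun y => par b (k + 1) * TR q p (k + 1) y + F (k + 1) b y) y := by
    ext b y
    unfold alphaR
    rw [LR_sum _ fun k hk => (hR.sym_alphaR_term hF (Finset.mem_range.1 hk)).smoothEven b]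
  rw [this]
  exact ParBound.sum _ fun k hk => (hR.sym_alphaR_term hF (Finset.mem_range.1 hk)).LR.parBound hR hχ hA
    (by push_cast; omega)

theorem parBound_alphaR' (hχ : IsCutoff χ) {A : ℝ} (hA : 0 ≤ A) (j : Fin L) :
    ParBound A 1 fun b : Fin L → ℝ => fun y => alphaR' q p F' j b y - TR q p (j + 1) y := by
  simp only [alphaR', add_sub_cancel_left]
  refine ParBound.sum _ fun k hk => ?_
  by_cases hz : k + 1 ≤ (j : ℕ) + 1
  · simp only [(hF (k + 1)).zero' j hz]; exact ParBound.zero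
  · exact (((hF (k + 1)).sym' j).mono (m' := L + 2) (by have := Finset.mem_range.1 hk; omega)).parBound hR hχ hA
      (by push_cast; omega)

omit hR hF in
theorem taylorR_eq_zero {m i : ℕ} (hi : i < 2) (b : Fin L → ℝ) (y : ℝ) :
    taylorR q p W F m i b y = 0 := by
  refine Finset.sum_eq_zero fun j hj => ?_
  have hj2 := (Finset.mem_Icc.1 hj).1
  rw [coeff_pow_congr (P' := 0) (by simp [coeff_genPoly]) (by simp) hj2, zero_pow (by omega)]
  · simp
  · intro k hk
    obtain rfl : k = 0 := by omega
    simp [coeff_genPoly]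

omit hR hF in
theorem taylorR_eq {m i : ℕ} (h : i ≤ m) (b : Fin L → ℝ) (y : ℝ) :
    taylorR q p W F i i b y = taylorR q p W F m i b y := by
  refine Finset.sum_congr rfl fun j hj => ?_
  have hj2 := (Finset.mem_Icc.1 hj).1
  rw [coeff_pow_congr (P' := genPoly q p F m b y) (by simp [coeff_genPoly]) (by simp [coeff_genPoly]) hj2]
  intro k hk
  have : k < m := by omega
  simp [coeff_genPoly, hk, this]

omit hR hF in
-- Set X = 1 in the generating polynomial: the sum of the coefficients over all weights recovers the
-- Taylor polynomial.
theorem sum_mul_alphaR_pow (b : Fin L → ℝ) (y : ℝ) :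
    ∑ j ∈ Finset.Icc 2 (L + 2), W j y * alphaR q p F b y ^ j
      = ∑ i ∈ Finset.range ((L + 1) + (L + 2) ^ 2 + 2), taylorR q p W F (L + 3) i b y := by
  have hdeg : (genPoly q p F (L + 3) b y).natDegree ≤ L + 2 := by
    rw [Polynomial.natDegree_le_iff_coeff_eq_zero]
    intro N hN
    rw [coeff_genPoly, if_neg (by omega)]
  have heval : (genPoly q p F (L + 3) b y).eval 1 = alphaR q p F b y := by
    rw [Polynomial.eval_eq_sum_range' (n := L + 2 + 1) (by omega), Finset.sum_range_succ', alphaR]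
    simp only [coeff_genPoly, one_pow, mul_one]
    rw [if_neg (by omega), add_zero]
    exact Finset.sum_congr rfl fun k hk => if_pos (by have := Finset.mem_range.1 hk; omega)
  simp only [taylorR]
  rw [Finset.sum_comm]
  refine Finset.sum_congr rfl fun j hj => ?_
  have hj2 := (Finset.mem_Icc.1 hj).2
  rw [← heval, ← Polynomial.eval_pow, Polynomial.eval_eq_sum_range' (n := (L + 1) + (L + 2) ^ 2 + 2),
    Finset.mul_sum]
  · simp
  · refine lt_of_le_of_lt (Polynomial.natDegree_pow_le.trans (Nat.mul_le_mul hj2 hdeg)) ?_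
    rw [pow_two]; omega

include hχ hW

/-- The recursion for S_i is built so that all linear terms of weight at most L+2 telescope against
the sources. Apart from the nonlinear parts of weights 2 to L+2, which the Taylor expansion will
cancel, only two terms of weight L+3 made from S_{L+2} remain. -/
theorem profile_identity (h : ∀ k, ProfileRep g Q χ k (F k) (F' k)) {b : Fin L → ℝ} {y : ℝ}
    (hb : Inner b y) :
    -par b 1 * (q y + LR (alphaR q p F b) y) - HR V (alphaR q p F b) y
      + ∑ j : Fin L, modR Q χ j b * alphaR' q p F' j b y
    = -par b 1 * LR (F (L + 2) b) y + ∑ j : Fin L, modR Q χ j b * F' (L + 2) j b y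
      + ∑ k ∈ Finset.range (L + 1), taylorR q p W F (k + 2) (k + 2) b y := by
  have hT := hR.smoothEven_TR
  have hS := fun k => (hF k).sym.smoothEven b
  have e1 : HR V (alphaR q p F b) y = -(∑ k ∈ Finset.range (L + 2), par b (k + 1) * TR q p k y)
      - ∑ k ∈ Finset.range (L + 1), sourceR Q χ q p W F F' (k + 1) b y := by
    unfold alphaR
    rw [HR_sum _ fun k _ => ((hT _).const_mul _).add (hS _)]
    have : ∀ k, HR V (fun y => par b (k + 1) * TR q p (k + 1) y + F (k + 1) b y) y
        = -(par b (k + 1) * TR q p k y) + HR V (F (k + 1) b) y := fun k => by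
      rw [HR_add ((hT _).const_mul _) (hS _), HR_const_mul (hT _), hR.HR_TR_succ]
      ring
    simp only [this, Finset.sum_add_distrib, Finset.sum_neg_distrib]
    rw [Finset.sum_range_succ' (fun k => HR V (F (k + 1) b) y)]
    rw [(hF (0 + 1)).zero le_rfl, HR_zero, add_zero, sub_eq_add_neg]
    congr 1
    rw [← Finset.sum_neg_distrib]
    exact Finset.sum_congr rfl fun k _ => hR.HR_profile hχ hW hF h hb (i := k + 1) (by omega)
  have e2 : LR (alphaR q p F b) y = ∑ k ∈ Finset.range (L + 2),
      (par b (k + 1) * LR (TR q p (k + 1)) y + LR (F (k + 1) b) y) := by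
    unfold alphaR
    rw [LR_sum _ fun k _ => ((hT _).const_mul _).add (hS _)]
    refine Finset.sum_congr rfl fun k _ => ?_
    rw [LR_add ((hT _).const_mul _) (hS _), LR_const_mul (hT _)]
  have e3 : ∀ k, sourceR Q χ q p W F F' (k + 1) b y =
      par b 1 * (par b (k + 1) * LR (TR q p (k + 1)) y + LR (F (k + 1) b) y)
      - (modR Q χ k b + par b (k + 2)) * TR q p (k + 1) y + taylorR q p W F (k + 2) (k + 2) b y
      - ∑ j : Fin L, modR Q χ j b * F' (k + 1) j b y := fun k => by
    have : (∑ j : Fin L, if (j : ℕ) + 1 < k + 1 then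
        ((2 * ((j : ℝ) + 1) - 1 + 4 * (cutInt Q χ 0 (par b 1))⁻¹) * par b 1 * par b (j + 1) - par b (j + 2))
          * F' (k + 1) j b y else 0) = ∑ j : Fin L, modR Q χ j b * F' (k + 1) j b y := by
      refine Finset.sum_congr rfl fun j _ => ?_
      split_ifs with hj
      · rfl
      · rw [(hF (k + 1)).zero' j (by omega), mul_zero]
    rw [sourceR, this, modR]
    push_cast
    ring
  have e4 : ∑ j : Fin L, modR Q χ j b * alphaR' q p F' j b y
      = ∑ k ∈ Finset.range (L + 1), modR Q χ k b * TR q p (k + 1) y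
        + ∑ k ∈ Finset.range (L + 1), ∑ j : Fin L, modR Q χ j b * F' (k + 1) j b y
        + ∑ j : Fin L, modR Q χ j b * F' (L + 2) j b y := by
    -- The modulation term of index L+1 vanishes because b_{L+1} = b_{L+2} = 0; this closes the
    -- telescoping at the top.
    have hz : modR Q χ L b = 0 := by
      rw [modR, par_of_lt b (show L < L + 1 by omega), par_of_lt b (show L < L + 2 by omega)]; ring
    rw [Finset.sum_range_succ, hz, zero_mul, add_zero,
      ← Fin.sum_univ_eq_sum_range (fun k => modR Q χ k b * TR q p (k + 1) y),
      Finset.sum_comm, ← Finset.sum_add_distrib, ← Finset.sum_add_distrib]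
    refine Finset.sum_congr rfl fun j _ => ?_
    rw [alphaR', Finset.sum_range_succ, ← Finset.mul_sum]
    ring
  -- Shift of index from H T_{k+1} = -T_k; the bottom term b_1 ΛQ is the one that cancels the
  -- scaling of Q.
  have e5 : ∑ k ∈ Finset.range (L + 2), par b (k + 1) * TR q p k y
      = ∑ k ∈ Finset.range (L + 1), par b (k + 2) * TR q p (k + 1) y + par b 1 * q y := by
    rw [Finset.sum_range_succ']; simp [TR]
  rw [e1, e2, e4, e5, Finset.sum_range_succ _ (L + 1), par_of_lt b (show L < L + 1 + 1 by omega)]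
  simp only [e3, Finset.sum_add_distrib, Finset.sum_sub_distrib, ← Finset.mul_sum, add_mul]
  ring

/-- Three sources of error, each O(b_1^(L+3)): the two leftover terms of S_{L+2}, the parts of
weight at least L+3 in the Taylor polynomial, and the Taylor remainder of order L+3 in a quantity
that is O(b_1). -/
theorem exists_profile_error (hg : IsTargetProfile g) (h : ∀ k, ProfileRep g Q χ k (F k) (F' k)) {A : ℝ}
    (hA : 0 ≤ A) : ∃ (C : ℝ) (k : ℕ), 0 ≤ C ∧ ∀ b y, Admissible A b → Inner b y →
    |-par b 1 * (q y + LR (alphaR q p F b) y) - HR V (alphaR q p F b) y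
      + ∑ j : Fin L, modR Q χ j b * alphaR' q p F' j b y
      - (nonlin g (Q y + y * alphaR q p F b y) - nonlin g (Q y)
        - deriv (nonlin g) (Q y) * (y * alphaR q p F b y)) / y ^ 3|
    ≤ C * par b 1 ^ (L + 3) * (1 + y) ^ k := by
  obtain ⟨Cf, hCf, hf⟩ : ∃ C, 0 ≤ C ∧ ∀ u, |iteratedDeriv (L + 3) (nonlin g) u| ≤ C := by
    obtain ⟨C, hC⟩ := hg.iteratedDeriv_nonlin_bounded (L + 3)
    exact ⟨C, (abs_nonneg _).trans (hC 0), hC⟩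
  have b1 : ParBound A (L + 3) fun b : Fin L → ℝ => fun y => -par b 1 * LR (F (L + 2) b) y := by
    have := (((hF (L + 2)).sym.LR.coef_mul (Coef.par 1 le_rfl (by omega))).neg).parBound hR hχ hA
      (n := L + 3) (by push_cast; omega)
    simpa only [neg_mul] using this
  have b2 : ParBound A (L + 3) fun b : Fin L → ℝ => fun y => ∑ j : Fin L, modR Q χ j b * F' (L + 2) j b y :=
    ParBound.sum _ fun j _ => ((((hF (L + 2)).sym' j).mono (m' := L + 2) (by omega)).coef_mul
      (coef_modR Q χ j (by omega))).parBound hR hχ hA (by push_cast; omega)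
  have b3 : ParBound A (L + 3) fun b : Fin L → ℝ => fun y =>
      ∑ i ∈ Finset.range ((L + 2) ^ 2), taylorR q p W F (L + 3) (L + 1 + i + 2) b y :=
    ParBound.sum _ fun i _ => (hR.sym_taylorR hW hF (m := L + 2) le_rfl _).parBound hR hχ hA
      (by push_cast; omega)
  obtain ⟨C, k, hC, hb3⟩ := (b1.add b2).add b3.neg
  obtain ⟨C', k', hC', hb4⟩ := hR.parBound_alphaR hF hχ hA
  refine ⟨C + Cf * C' ^ (L + 3), k + (L + k' * (L + 3)), by positivity, fun b y hb hy => ?_⟩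
  have hy0 := hy.2.1
  have hp := hb.pos
  set α := alphaR q p F b y
  set R := nonlin g (Q y + y * α) - ∑ j ∈ Finset.range (L + 2 + 1),
    iteratedDeriv j (nonlin g) (Q y) / (Nat.factorial j : ℝ) * (y * α) ^ j with hRdef
  have hRb : |R| ≤ Cf * |y * α| ^ (L + 3) := abs_taylor_le (L + 2) hCf hg.smooth_nonlin hf _ _
  have hsum : ∑ j ∈ Finset.range (L + 2 + 1),
      iteratedDeriv j (nonlin g) (Q y) / (Nat.factorial j : ℝ) * (y * α) ^ j
      = nonlin g (Q y) + deriv (nonlin g) (Q y) * (y * α)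
        + y ^ 3 * ∑ j ∈ Finset.Icc 2 (L + 2), W j y * α ^ j := by
    have : Finset.range (L + 2 + 1) = insert 0 (insert 1 (Finset.Icc 2 (L + 2))) := by
      ext x; simp; omega
    rw [this, Finset.sum_insert (by simp), Finset.sum_insert (by simp), Finset.mul_sum, ← add_assoc]
    simp only [iteratedDeriv_zero, iteratedDeriv_one, Nat.factorial_zero, Nat.factorial_one, pow_zero,
      pow_one, Nat.cast_one, div_one, mul_one]
    congr 1
    refine Finset.sum_congr rfl fun j hj => ?_
    have h1 := hW.eq j (Finset.mem_Icc.1 hj).1 y hy0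
    rw [div_eq_iff (by positivity)] at h1
    rw [mul_pow, ← mul_assoc, h1]
    ring
  have hN : (nonlin g (Q y + y * α) - nonlin g (Q y) - deriv (nonlin g) (Q y) * (y * α)) / y ^ 3
      = ∑ j ∈ Finset.Icc 2 (L + 2), W j y * α ^ j + R / y ^ 3 := by
    rw [hRdef, hsum]
    field_simp
    ring
  -- The weights 2 to L+2 are exactly those of the sources and cancel; there is nothing of weight 0
  -- or 1.
  have hT : ∑ j ∈ Finset.Icc 2 (L + 2), W j y * α ^ j =
      ∑ k ∈ Finset.range (L + 1), taylorR q p W F (k + 2) (k + 2) b y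
      + ∑ i ∈ Finset.range ((L + 2) ^ 2), taylorR q p W F (L + 3) (L + 1 + i + 2) b y := by
    rw [sum_mul_alphaR_pow, sum_range_add_two (taylorR_eq_zero (by norm_num) b y)
      (taylorR_eq_zero (by norm_num) b y)]
    exact congrArg (· + _) (Finset.sum_congr rfl fun i hi =>
      (taylorR_eq (by have := Finset.mem_range.1 hi; omega) b y).symm)
  have hd : |R / y ^ 3| ≤ Cf * C' ^ (L + 3) * par b 1 ^ (L + 3) * (1 + y) ^ (L + k' * (L + 3)) := by
    rw [abs_div, abs_of_pos (show 0 < y ^ 3 by positivity), div_le_iff₀ (by positivity)]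
    have h1 := hb4 b hb y
    rw [abs_of_pos hy0, pow_one] at h1
    calc |R| ≤ Cf * |y * α| ^ (L + 3) := hRb
      _ = Cf * (y ^ L * y ^ 3) * |α| ^ (L + 3) := by
        rw [abs_mul, abs_of_pos hy0, mul_pow]; ring
      _ ≤ Cf * ((1 + y) ^ L * y ^ 3) * (C' * par b 1 * (1 + y) ^ k') ^ (L + 3) := by
        gcongr
        linarith
      _ = _ := by ring
  have h3 := hb3 b hb y
  simp only [abs_of_pos hy0] at h3
  rw [hR.profile_identity hχ hW hF h hy, hN, hT]
  have hp1 : (1 + y) ^ k ≤ (1 + y) ^ (k + (L + k' * (L + 3))) :=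
    pow_le_pow_right₀ (by linarith) (by omega)
  have hp2 : (1 + y) ^ (L + k' * (L + 3)) ≤ (1 + y) ^ (k + (L + k' * (L + 3))) :=
    pow_le_pow_right₀ (by linarith) (by omega)
  generalize ∑ k ∈ Finset.range (L + 1), taylorR q p W F (k + 2) (k + 2) b y = Z₁ at *
  generalize ∑ i ∈ Finset.range ((L + 2) ^ 2), taylorR q p W F (L + 3) (L + 1 + i + 2) b y = Z₂ at *
  generalize -par b 1 * LR (F (L + 2) b) y + ∑ j : Fin L, modR Q χ j b * F' (L + 2) j b y = Z₃ at *
  have e : Z₃ + Z₁ - (Z₁ + Z₂ + R / y ^ 3) = (Z₃ + -Z₂) + -(R / y ^ 3) := by ring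
  rw [e]
  calc _ ≤ |Z₃ + -Z₂| + |-(R / y ^ 3)| := abs_add_le _ _
    _ = |Z₃ + -Z₂| + |R / y ^ 3| := by rw [abs_neg]
    _ ≤ C * par b 1 ^ (L + 3) * (1 + y) ^ k
        + Cf * C' ^ (L + 3) * par b 1 ^ (L + 3) * (1 + y) ^ (L + k' * (L + 3)) := add_le_add h3 hd
    _ ≤ C * par b 1 ^ (L + 3) * (1 + y) ^ (k + (L + k' * (L + 3)))
        + Cf * C' ^ (L + 3) * par b 1 ^ (L + 3) * (1 + y) ^ (k + (L + k' * (L + 3))) := by gcongr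
    _ = _ := by ring

end Reduced

/-! ### Localized directions with bounds uniform in the localization scale. -/

theorem SmoothEven.euler {w : ℝ → ℝ} (hw : SmoothEven w) : SmoothEven fun y => y * _root_.deriv w y :=
  ⟨contDiff_id.mul hw.deriv.smooth, fun y => by rw [hw.deriv.odd]; ring⟩

/-- Smooth even functions vanishing outside `(-2, 2)`. -/
structure CutProfile (η : ℝ → ℝ) : Prop where
  smoothEven : SmoothEven η
  zero : ∀ z, 2 ≤ |z| → η z = 0

namespace CutProfile
variable {η θ : ℝ → ℝ}

theorem of_pos (h : SmoothEven η) (h0 : ∀ z, 2 ≤ z → η z = 0) : CutProfile η := by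
  refine ⟨h, fun z hz => ?_⟩
  rcases abs_cases z with ⟨e, _⟩ | ⟨e, _⟩ <;> rw [e] at hz
  · exact h0 z hz
  · rw [← h.even]; exact h0 _ hz

theorem deriv_zero (h : CutProfile η) {z : ℝ} (hz : 2 ≤ z) : deriv η z = 0 :=
  h.smoothEven.deriv_eq_zero (R := 2) (fun y hy => h.zero y (hy.trans (le_abs_self y))) z hz

theorem Av (h : CutProfile η) : CutProfile (Av 0 (deriv (deriv η))) :=
  of_pos h.smoothEven.deriv.deriv.Av fun z hz => by
    have := h.smoothEven.deriv.eq_mul_Av z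
    rw [h.deriv_zero hz] at this
    exact (mul_eq_zero.1 this.symm).resolve_left (by linarith)

theorem deriv_deriv (h : CutProfile η) : CutProfile (deriv (deriv η)) :=
  of_pos h.smoothEven.deriv.deriv fun z hz => by
    have h1 : ContDiff ℝ ∞ (deriv (deriv η)) := h.smoothEven.deriv.deriv.smooth
    have h2 : ∀ y, 2 < y → deriv (deriv η) y = 0 := fun y hy => by
      have : deriv η =ᶠ[𝓝 y] fun _ => 0 := by
        filter_upwards [Ioi_mem_nhds hy] with x hx using h.deriv_zero (le_of_lt hx)
      rw [this.deriv_eq]; simp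
    rcases hz.eq_or_lt with rfl | hz
    · exact eq_zero_of_Ioi h1.continuous h2
    · exact h2 z hz

theorem euler (h : CutProfile η) : CutProfile fun z => z * deriv η z :=
  of_pos h.smoothEven.euler fun z hz => by rw [h.deriv_zero hz, mul_zero]

theorem add (h : CutProfile η) (h' : CutProfile θ) : CutProfile fun z => η z + θ z :=
  ⟨h.smoothEven.add h'.smoothEven, fun z hz => by rw [h.zero z hz, h'.zero z hz, add_zero]⟩

theorem const_mul (c : ℝ) (h : CutProfile η) : CutProfile fun z => c * η z :=
  ⟨h.smoothEven.const_mul c, fun z hz => by rw [h.zero z hz, mul_zero]⟩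

theorem exists_bound (h : CutProfile η) : ∃ C, 0 ≤ C ∧ ∀ z, |η z| ≤ C := by
  obtain ⟨C, hC⟩ := (isCompact_Icc (a := (-2 : ℝ)) (b := 2)).exists_bound_of_continuousOn
    h.smoothEven.continuous.continuousOn
  have h0 : 0 ≤ C := (norm_nonneg _).trans (hC 0 (by norm_num))
  refine ⟨C, h0, fun z => ?_⟩
  by_cases hz : |z| ≤ 2
  · exact hC z (abs_le.1 hz)
  · rw [h.zero z (by linarith), abs_zero]; exact h0

end CutProfile

theorem SmoothEven.comp_div {η : ℝ → ℝ} (h : SmoothEven η) (B : ℝ) : SmoothEven fun y => η (y / B) :=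
  ⟨h.smooth.comp (contDiff_id.div_const B), fun y => by rw [neg_div, h.even]⟩

theorem hasDerivAt_comp_div {η : ℝ → ℝ} (h : Differentiable ℝ η) (B y : ℝ) :
    HasDerivAt (fun y => η (y / B)) (deriv η (y / B) / B) y :=
  ((h (y / B)).hasDerivAt.comp y ((hasDerivAt_id y).div_const B)).congr_deriv (by ring)

/-- Finite sums of functions `B^{-2j} η(y / B) e(y)` with `η` a cut-off and `e` tempered. -/
inductive CutForm : (ℝ → ℝ → ℝ) → Prop
  | term {η e : ℝ → ℝ} (j : ℕ) (hη : CutProfile η) (he : TG e) (he' : SmoothEven e) :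
      CutForm fun B y => B⁻¹ ^ (2 * j) * (η (y / B) * e y)
  | add {W Z : ℝ → ℝ → ℝ} (hW : CutForm W) (hZ : CutForm Z) : CutForm fun B y => W B y + Z B y

namespace CutForm
variable {W : ℝ → ℝ → ℝ}

theorem smoothEven (h : CutForm W) (B : ℝ) : SmoothEven (W B) := by
  induction h with
  | term j hη he he' => exact ((hη.smoothEven.comp_div B).mul he').const_mul _
  | add _ _ ih1 ih2 => exact ih1.add ih2

theorem eq_zero (h : CutForm W) {B : ℝ} (hB : 0 < B) {y : ℝ} (hy : 2 * B ≤ y) : W B y = 0 := by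
  induction h with
  | term j hη he he' =>
    beta_reduce
    rw [hη.zero (y / B) ?_]
    · simp
    · exact le_abs_self (y / B) |>.trans' ((le_div_iff₀ hB).2 hy)
  | add _ _ ih1 ih2 => beta_reduce; rw [ih1, ih2, add_zero]

theorem exists_bound (h : CutForm W) :
    ∃ (C : ℝ) (k : ℕ), 0 ≤ C ∧ ∀ B, 1 ≤ B → ∀ y, |W B y| ≤ C * (1 + |y|) ^ k := by
  induction h with
  | term j hη he he' =>
    obtain ⟨C, hC, h⟩ := hη.exists_bound
    obtain ⟨D, k, hD, h'⟩ := he.polyGrowth.nonneg_bound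
    refine ⟨C * D, k, by positivity, fun B hB y => ?_⟩
    have hB0 : 0 < B := by linarith
    rw [abs_mul, abs_mul, abs_of_pos (pow_pos (inv_pos.2 hB0) _)]
    have h1 : B⁻¹ ^ (2 * j) ≤ 1 := pow_le_one₀ (inv_pos.2 hB0).le (inv_le_one_of_one_le₀ hB)
    calc _ ≤ 1 * (C * (D * (1 + |y|) ^ k)) := by
          gcongr
          · exact h _
          · exact h' _
      _ = _ := by ring
  | add _ _ ih1 ih2 =>
    obtain ⟨C, k, hC, h⟩ := ih1
    obtain ⟨D, l, hD, h'⟩ := ih2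
    refine ⟨C + D, k + l, by positivity, fun B hB y => (abs_add_le _ _).trans ?_⟩
    have h1 := one_le_one_add_abs_pow y k
    have h2 := one_le_one_add_abs_pow y l
    calc _ ≤ C * (1 + |y|) ^ k + D * (1 + |y|) ^ l := add_le_add (h B hB y) (h' B hB y)
      _ ≤ C * ((1 + |y|) ^ k * (1 + |y|) ^ l) + D * ((1 + |y|) ^ k * (1 + |y|) ^ l) := by
          gcongr
          · exact le_mul_of_one_le_right (by positivity) h2
          · exact le_mul_of_one_le_left (by positivity) h1
      _ = _ := by rw [pow_add (1 + |y|)]; ring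

theorem euler (h : CutForm W) : ∃ W', CutForm W' ∧ ∀ B, 0 < B → ∀ y, y * deriv (W B) y = W' B y := by
  induction h with
  | @term η e j hη he he' =>
    refine ⟨_, (term j hη.euler he he').add (term j hη (TG.id.mul he.deriv) he'.euler), fun B hB y => ?_⟩
    have := ((hasDerivAt_comp_div hη.smoothEven.differentiable B y).mul
      (he'.differentiable y).hasDerivAt).const_mul (B⁻¹ ^ (2 * j))
    have e : deriv (fun y => B⁻¹ ^ (2 * j) * (η (y / B) * e y)) y = _ := this.deriv
    rw [e]
    field_simp
  | add hW hZ ih1 ih2 =>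
    obtain ⟨W', h1, h2⟩ := ih1
    obtain ⟨Z', k1, k2⟩ := ih2
    refine ⟨_, h1.add k1, fun B hB y => ?_⟩
    rw [deriv_fun_add ((hW.smoothEven B).differentiable y) ((hZ.smoothEven B).differentiable y),
      mul_add, h2 B hB, k2 B hB]

/-- In the commutator with the cut-off, η'(z) = z times an even function of z = y/B. The cross term
B⁻¹ η'(y/B) e' thus becomes B⁻² times even factors, and the form with even powers of 1/B is
preserved. -/
theorem HR {V : ℝ → ℝ} (hV : TG V) (hV' : SmoothEven V) (h : CutForm W) :
    ∃ W', CutForm W' ∧ ∀ B, 0 < B → HR V (W B) = W' B := by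
  induction h with
  | @term η e j hη he he' =>
    refine ⟨_, ((term j hη (hV.HR he) (hV'.HR he')).add
      (term (j + 1) ((hη.deriv_deriv.add (hη.Av.const_mul 3)).const_mul (-1)) he he')).add
      (term (j + 1) (hη.Av.const_mul (-2)) (TG.id.mul he.deriv) he'.euler), fun B hB => ?_⟩
    have hs := (hη.smoothEven.comp_div B).mul he'
    rw [HR_const_mul hs]
    refine SmoothEven.ext_of_pos ((hV'.HR hs).const_mul _) ?_ fun y hy => ?_
    · exact (((((hη.smoothEven.comp_div B).mul (hV'.HR he')).const_mul _)).add
        (((((hη.deriv_deriv.add (hη.Av.const_mul 3)).const_mul (-1)).smoothEven.comp_div B).mul he').const_mul _)).add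
        ((((hη.Av.const_mul (-2)).smoothEven.comp_div B).mul he'.euler).const_mul _)
    · have hd : ∀ y, HasDerivAt (fun y => η (y / B) * e y)
          (deriv η (y / B) / B * e y + η (y / B) * deriv e y) y := fun y =>
        (hasDerivAt_comp_div hη.smoothEven.differentiable B y).mul (he'.differentiable y).hasDerivAt
      have hd1 : deriv (fun y => η (y / B) * e y) =
          fun y => deriv η (y / B) / B * e y + η (y / B) * deriv e y := funext fun y => (hd y).deriv
      have hd2 : HasDerivAt (fun y => deriv η (y / B) / B * e y + η (y / B) * deriv e y)
          (deriv (deriv η) (y / B) / B / B * e y + deriv η (y / B) / B * deriv e y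
            + (deriv η (y / B) / B * deriv e y + η (y / B) * deriv (deriv e) y)) y :=
        (((hasDerivAt_comp_div hη.smoothEven.deriv.differentiable B y).div_const B).mul
          (he'.differentiable y).hasDerivAt).add
        ((hasDerivAt_comp_div hη.smoothEven.differentiable B y).mul (he'.deriv.differentiable y).hasDerivAt)
      have h3 := hη.smoothEven.deriv.eq_mul_Av (y / B)
      rw [HR_eq hs hy.ne', hd1, hd2.deriv, HR_eq he' hy.ne']
      beta_reduce
      rw [h3]
      have : B⁻¹ ^ (2 * (j + 1)) = B⁻¹ ^ (2 * j) * (B⁻¹ * B⁻¹) := by ring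
      rw [this]
      field_simp
      ring
  | @add W Z hW hZ ih1 ih2 =>
    obtain ⟨W', h1, h2⟩ := ih1
    obtain ⟨Z', k1, k2⟩ := ih2
    refine ⟨_, h1.add k1, fun B hB => ?_⟩
    rw [HR_add (hW.smoothEven B) (hZ.smoothEven B), h2 B hB, k2 B hB]

theorem HR_iter {V : ℝ → ℝ} (hV : TG V) (hV' : SmoothEven V) (h : CutForm W) (n : ℕ) :
    ∃ W', CutForm W' ∧ ∀ B, 0 < B → (HeatFlow.HR V)^[n] (W B) = W' B := by
  induction n with
  | zero => exact ⟨W, h, fun _ _ => rfl⟩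
  | succ n ih =>
    obtain ⟨W', h1, h2⟩ := ih
    obtain ⟨Z, k1, k2⟩ := h1.HR hV hV'
    exact ⟨Z, k1, fun B hB => by rw [Function.iterate_succ_apply', h2 B hB, k2 B hB]⟩

/-- B ∂_B acts on η(y/B) as -z d/dz, so it stays in the class. It is needed because B = b_1^(-δ)
moves with time. -/
theorem exists_hasDerivAt (h : CutForm W) :
    ∃ W', CutForm W' ∧ ∀ B, 0 < B → ∀ y, HasDerivAt (fun B => W B y) (B⁻¹ * W' B y) B := by
  induction h with
  | @term η e j hη he he' =>
    refine ⟨_, term j ((hη.const_mul (-(2 * (j : ℝ)))).add (hη.euler.const_mul (-1))) he he',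
      fun B hB y => ?_⟩
    have h1 : HasDerivAt (fun B : ℝ => η (y / B)) (deriv η (y / B) * (-(y / B ^ 2))) B := by
      have h2 : HasDerivAt (fun B : ℝ => y / B) (-(y / B ^ 2)) B := by
        refine ((hasDerivAt_inv hB.ne').const_mul y).congr_deriv ?_ |>.congr_of_eventuallyEq ?_
        · ring
        · exact Eventually.of_forall fun x => div_eq_mul_inv _ _
      exact (hη.smoothEven.differentiable (y / B)).hasDerivAt.comp B h2
    have h2 := ((hasDerivAt_inv hB.ne').fun_pow (2 * j)).mul (h1.mul_const (e y))
    refine h2.congr_deriv ?_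
    rcases Nat.eq_zero_or_pos j with rfl | hj
    · simp; field_simp
    · obtain ⟨i, hi⟩ : ∃ i, 2 * j = i + 1 := ⟨2 * j - 1, by omega⟩
      have hi' : 2 * (j : ℝ) = i + 1 := by exact_mod_cast hi
      rw [hi, hi', Nat.add_sub_cancel]
      push_cast
      ring
  | add hW hZ ih1 ih2 =>
    obtain ⟨W', h1, h2⟩ := ih1
    obtain ⟨Z', k1, k2⟩ := ih2
    exact ⟨_, h1.add k1, fun B hB y => ((h2 B hB y).add (k2 B hB y)).congr_deriv (by ring)⟩

theorem continuousOn (h : CutForm W) : ContinuousOn (fun z : ℝ × ℝ => W z.1 z.2) (Ioi 0 ×ˢ univ) := by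
  induction h with
  | @term η e j hη he he' =>
    have h1 : ContinuousOn (fun z : ℝ × ℝ => z.1⁻¹) (Ioi 0 ×ˢ univ) :=
      continuousOn_fst.inv₀ fun z hz => (ne_of_gt hz.1)
    have h2 : ContinuousOn (fun z : ℝ × ℝ => η (z.2 * z.1⁻¹)) (Ioi 0 ×ˢ univ) :=
      hη.smoothEven.continuous.comp_continuousOn (continuousOn_snd.mul h1)
    exact (h1.pow (2 * j)).mul (h2.mul (he'.continuous.comp continuous_snd).continuousOn)
  | add _ _ ih1 ih2 => exact ih1.add ih2

end CutForm

theorem IsCutoff.cutProfile {χ : ℝ → ℝ} (hχ : IsCutoff χ) : CutProfile (evenCut χ 1) :=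
  .of_pos (hχ.evenCut_even 1) fun z hz => hχ.evenCut_zero one_pos (by linarith)

namespace Reduced
variable {g Q Q₀ q p V : ℝ → ℝ} (hR : Reduced g Q Q₀ q p V) {χ : ℝ → ℝ} (hχ : IsCutoff χ)
include hR hχ

theorem exists_cutForm (n : ℕ) : ∃ W, CutForm W ∧
    ∀ B, 0 < B → (HR V)^[n] (fun y => evenCut χ B y * q y) = W B := by
  obtain ⟨W, h1, h2⟩ := (CutForm.term 0 hχ.cutProfile hR.q_tg hR.q_even).HR_iter hR.V_tg hR.V_even n
  refine ⟨W, h1, fun B hB => ?_⟩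
  rw [← h2 B hB]
  congr 1
  ext y
  simp [evenCut]

end Reduced

/-! ### Partial derivatives of the flow, and the range of the parameters. -/

theorem exists_partials {D : Set ℝ} (hD : UniqueDiffOn ℝ D) {U : ℝ × ℝ → ℝ}
    (hU : ContDiffOn ℝ ∞ U (D ×ˢ univ)) : ∃ Ut Ur : ℝ × ℝ → ℝ,
    ContDiffOn ℝ ∞ Ut (D ×ˢ univ) ∧ ContDiffOn ℝ ∞ Ur (D ×ˢ univ) ∧
    ∀ z ∈ D ×ˢ univ, HasFDerivWithinAt U
      (Ut z • ContinuousLinearMap.fst ℝ ℝ ℝ + Ur z • ContinuousLinearMap.snd ℝ ℝ ℝ) (D ×ˢ univ) z := by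
  have hS : UniqueDiffOn ℝ (D ×ˢ (univ : Set ℝ)) := hD.prod uniqueDiffOn_univ
  have hF : ContDiffOn ℝ ∞ (fderivWithin ℝ U (D ×ˢ univ)) (D ×ˢ univ) :=
    hU.fderivWithin hS (by simp)
  refine ⟨fun z => fderivWithin ℝ U (D ×ˢ univ) z (1, 0), fun z => fderivWithin ℝ U (D ×ˢ univ) z (0, 1),
    hF.clm_apply contDiffOn_const, hF.clm_apply contDiffOn_const, fun z hz => ?_⟩
  refine ((hU.differentiableOn (by simp)) z hz).hasFDerivWithinAt.congr_fderiv ?_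
  ext <;> simp

theorem hasDerivWithinAt_curve {D : Set ℝ} {U Ut Ur : ℝ × ℝ → ℝ} {t : ℝ} {γ : ℝ → ℝ} {γ' : ℝ}
    (ht : t ∈ D) (h : ∀ z ∈ D ×ˢ univ, HasFDerivWithinAt U
      (Ut z • ContinuousLinearMap.fst ℝ ℝ ℝ + Ur z • ContinuousLinearMap.snd ℝ ℝ ℝ) (D ×ˢ univ) z)
    (hγ : HasDerivWithinAt γ γ' D t) :
    HasDerivWithinAt (fun τ => U (τ, γ τ)) (Ut (t, γ t) + γ' * Ur (t, γ t)) D t := by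
  have h1 : HasDerivWithinAt (fun τ => (τ, γ τ)) (1, γ') D t := (hasDerivWithinAt_id t D).prodMk hγ
  have hm : MapsTo (fun τ => (τ, γ τ)) D (D ×ˢ univ) := fun τ hτ => ⟨hτ, mem_univ _⟩
  have := (h (t, γ t) ⟨ht, mem_univ _⟩).comp_hasDerivWithinAt t h1 hm
  refine this.congr_deriv ?_
  simp
  ring

theorem hasDerivAt_snd {D : Set ℝ} {U Ut Ur : ℝ × ℝ → ℝ} {t : ℝ}
    (ht : t ∈ D) (h : ∀ z ∈ D ×ˢ univ, HasFDerivWithinAt U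
      (Ut z • ContinuousLinearMap.fst ℝ ℝ ℝ + Ur z • ContinuousLinearMap.snd ℝ ℝ ℝ) (D ×ˢ univ) z) (r : ℝ) :
    HasDerivAt (fun r => U (t, r)) (Ur (t, r)) r := by
  have h1 : HasDerivWithinAt (fun r : ℝ => (t, r)) (0, 1) univ r :=
    (hasDerivWithinAt_const r univ t).prodMk (hasDerivWithinAt_id r univ)
  have hm : MapsTo (fun r : ℝ => (t, r)) univ (D ×ˢ univ) := fun τ _ => ⟨ht, mem_univ _⟩
  have := (h (t, r) ⟨ht, mem_univ _⟩).comp_hasDerivWithinAt r h1 hm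
  rw [hasDerivWithinAt_univ] at this
  refine this.congr_deriv ?_
  simp

/-- The bounds on the modes give s^k b_k = c_k + O(1/log s). As c_1 ≥ 1/2, b_1 is comparable to 1/s,
whence |b_k| ≤ A b_1^k. The constant A is fixed first; any smallness of b_1 is then obtained by
enlarging s₀. -/
theorem exists_admissible {L : ℕ} (hL : 1 ≤ L) {P : Matrix (Fin L) (Fin L) ℝ} (hP : Diagonalizes P) :
    ∃ A : ℝ, 0 ≤ A ∧ ∀ β : ℝ, 0 < β → ∃ σ : ℝ, 1 < σ ∧ ∀ (g Q χ : ℝ → ℝ) (M K s₀ T : ℝ)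
      (u : ℝ → ℝ → ℝ) (b : ℝ → Fin L → ℝ) (lam : ℝ → ℝ), σ ≤ s₀ →
      IsTrapped g Q χ P M K s₀ T u b lam → ∀ t ∈ Ico 0 T, Admissible A (b t) ∧ par (b t) 1 ≤ β := by
  set A₀ : ℝ := ∑ k, ∑ i, |P⁻¹ k i| * 2
  have hA₀ : 0 ≤ A₀ := by positivity
  set A₁ : ℝ := ∑ k : Fin L, (|seqC L k| + |seqD L k|) + A₀
  have hA₁ : 0 ≤ A₁ := by positivity
  refine ⟨A₁ * 4 ^ L, by positivity, fun β hβ => ?_⟩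
  -- With log s ≥ E the correction to c_1 is at most 1/4, which leaves s b_1 ≥ 1/4.
  set E : ℝ := 1 + 4 * (|seqD L 0| + A₀)
  have hE : 1 ≤ E := by have : 0 ≤ |seqD L 0| := abs_nonneg _
                        simp only [E]; linarith
  refine ⟨Real.exp E + A₁ / β + A₁ + 1, ?_, fun g Q χ M K s₀ T u b lam hs₀ h t ht => ?_⟩
  · have : 0 ≤ A₁ / β := by positivity
    linarith [Real.exp_pos E]
  set s := renTime s₀ lam t with hs
  have hss : s₀ ≤ s := by
    have : 0 ≤ ∫ τ in (0 : ℝ)..t, 1 / lam τ ^ 2 :=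
      intervalIntegral.integral_nonneg ht.1 fun τ _ => by positivity
    rw [hs, renTime]; linarith
  have hAβ : 0 ≤ A₁ / β := by positivity
  have hsE : Real.exp E ≤ s := by linarith
  have hs0 : 0 < s := (Real.exp_pos E).trans_le hsE
  have hlog : E ≤ Real.log s := (Real.le_log_iff_exp_le hs0).2 hsE
  have hlog1 : 1 ≤ Real.log s := hE.trans hlog
  -- The power 5/4 is weakened to 1, so that both corrections are bounded by a multiple of 1/log s.
  have hlog54 : Real.log s ≤ Real.log s ^ ((5 : ℝ) / 4) := by
    conv_lhs => rw [← Real.rpow_one (Real.log s)]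
    exact Real.rpow_le_rpow_of_exponent_le hlog1 (by norm_num)
  set ℓ := Real.log s
  set ρ := ℓ ^ ((5 : ℝ) / 4) with hρ
  set x : Fin L → ℝ := fun k => s ^ ((k : ℕ) + 1) * ρ * (b t k - bExact L s k) with hx
  have hV : ∀ i, |modeV P s (b t) i| ≤ 2 := by
    intro i
    by_cases hi : (i : ℕ) = 0
    · exact h.bound_stable t ht i hi
    · have h1 := h.bound_unstable t ht
      have h2 := Finset.single_le_sum (f := fun i : Fin L => if (i : ℕ) = 0 then (0 : ℝ) else
        modeV P s (b t) i ^ 2) (fun i _ => by split_ifs <;> positivity) (Finset.mem_univ i)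
      simp only [if_neg hi] at h2
      exact abs_le_of_sq_le_sq (by linarith) (by norm_num)
  have hxV : x = P⁻¹.mulVec (modeV P s (b t)) := by
    have : IsUnit P.det := (Matrix.isUnit_iff_isUnit_det P).1 hP.1
    rw [modeV, Matrix.mulVec_mulVec, Matrix.nonsing_inv_mul P this, Matrix.one_mulVec]
  have hxb : ∀ k, |x k| ≤ A₀ := by
    intro k
    rw [hxV, Matrix.mulVec, dotProduct]
    refine (Finset.abs_sum_le_sum_abs _ _).trans ?_
    refine le_trans (Finset.sum_le_sum fun i _ => ?_)
      (Finset.single_le_sum (f := fun k => ∑ i, |P⁻¹ k i| * 2) (fun k _ => by positivity) (Finset.mem_univ k))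
    rw [abs_mul]
    exact mul_le_mul_of_nonneg_left (hV i) (abs_nonneg _)
  have hρ0 : 0 < ρ := by linarith
  have hsb : ∀ k : Fin L, s ^ ((k : ℕ) + 1) * b t k = seqC L k + (seqD L k / ℓ + x k / ρ) := by
    intro k
    have : x k / ρ = s ^ ((k : ℕ) + 1) * (b t k - bExact L s k) := by
      rw [hx]; field_simp
    have hl : Real.log s = ℓ := rfl
    rw [this, bExact, hl]
    have : ℓ ≠ 0 := by linarith
    field_simp
    ring
  have hrest : ∀ k : Fin L, |seqD L k / ℓ + x k / ρ| ≤ (|seqD L k| + A₀) / ℓ := by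
    intro k
    refine (abs_add_le _ _).trans ?_
    rw [abs_div, abs_div, abs_of_pos hρ0, abs_of_pos (show 0 < ℓ by linarith), add_div]
    gcongr
    · exact hxb k
  have hup : ∀ k : Fin L, |b t k| ≤ A₁ / s ^ ((k : ℕ) + 1) := by
    intro k
    rw [le_div_iff₀ (by positivity)]
    have h1 : |b t k| * s ^ ((k : ℕ) + 1) = |s ^ ((k : ℕ) + 1) * b t k| := by
      rw [abs_mul, abs_of_pos (show 0 < s ^ ((k : ℕ) + 1) by positivity), mul_comm]
    rw [h1, hsb]
    have h2 := Finset.single_le_sum (f := fun k : Fin L => |seqC L k| + |seqD L k|)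
      (fun k _ => by positivity) (Finset.mem_univ k)
    have h3 : (|seqD L k| + A₀) / ℓ ≤ |seqD L k| + A₀ := div_le_self (by positivity) hlog1
    have := abs_add_le (seqC L k) (seqD L k / ℓ + x k / ρ)
    have := hrest k
    simp only [A₁]
    linarith
  have hb1 : 1 / (4 * s) ≤ par (b t) 1 := by
    have h1 : par (b t) 1 = b t ⟨0, by omega⟩ := par_succ (b t) ⟨0, by omega⟩
    have h2 := hsb ⟨0, by omega⟩
    have h3 := hrest ⟨0, by omega⟩
    have h4 : (1 : ℝ) / 2 ≤ seqC L 0 := by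
      have : (1 : ℝ) ≤ L := by exact_mod_cast hL
      rw [seqC, div_le_div_iff₀ (by norm_num) (by linarith)]
      linarith
    have h5 : (|seqD L 0| + A₀) / ℓ ≤ 1 / 4 := by
      rw [div_le_iff₀ (by linarith)]; simp only [E] at hlog; linarith
    rw [h1, div_le_iff₀ (by positivity)]
    have h6 := (abs_le.1 (h3.trans h5)).1
    simp only [zero_add, pow_one] at h2
    linarith
  have hpos : 0 < par (b t) 1 := lt_of_lt_of_le (by positivity) hb1
  have hb1up : par (b t) 1 ≤ A₁ / s := by
    have h1 : par (b t) 1 = b t ⟨0, by omega⟩ := par_succ (b t) ⟨0, by omega⟩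
    have := hup ⟨0, by omega⟩
    rw [h1]
    simpa using (le_abs_self _).trans this
  refine ⟨⟨hpos, hb1up.trans ?_, fun k => ?_⟩, hb1up.trans ?_⟩
  · rw [div_le_one hs0]; linarith [Real.exp_pos E]
  · by_cases hk : 1 ≤ k ∧ k ≤ L
    · obtain ⟨i, rfl⟩ : ∃ i : Fin L, k = i + 1 := ⟨⟨k - 1, by omega⟩, by simp; omega⟩
      rw [par_succ]
      refine (hup i).trans ?_
      have h1 : 1 / s ≤ 4 * par (b t) 1 := by
        have : 1 / (4 * s) = 1 / s / 4 := by ring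
        rw [this] at hb1; linarith
      calc A₁ / s ^ ((i : ℕ) + 1) = A₁ * (1 / s) ^ ((i : ℕ) + 1) := by rw [one_div, inv_pow]; rfl
        _ ≤ A₁ * (4 * par (b t) 1) ^ ((i : ℕ) + 1) := by gcongr
        _ = A₁ * 4 ^ ((i : ℕ) + 1) * par (b t) 1 ^ ((i : ℕ) + 1) := by rw [mul_pow]; ring
        _ ≤ A₁ * 4 ^ L * par (b t) 1 ^ ((i : ℕ) + 1) := by
          gcongr
          · norm_num
          · omega
    · rw [par, dif_neg hk, abs_zero]; positivity
  · rw [div_le_iff₀ hs0]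
    have : A₁ / β * β = A₁ := by field_simp
    nlinarith [Real.exp_pos E]

/-! ### The reduced radiation and its pointwise control. -/

/-- The remainder `(u(t, λ y) - Q - y α) / y`. -/
noncomputable def remR (Q₀ : ℝ → ℝ) {L : ℕ} (α : (Fin L → ℝ) → ℝ → ℝ) (u : ℝ → ℝ → ℝ)
    (b : ℝ → Fin L → ℝ) (lam : ℝ → ℝ) (t : ℝ) : ℝ → ℝ :=
  Av 0 (deriv fun y => u t (lam t * y) - Q₀ y - y * α (b t) y)

/-- The remainder is formed with the inner profile without any cut-off, so it is smooth and even on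
the whole line; it agrees with ε/y only in the inner region, which is all that the tests see. -/
theorem eps_eq_of_smoothOdd {Q₀ : ℝ → ℝ} {L : ℕ} {α : (Fin L → ℝ) → ℝ → ℝ} {u : ℝ → ℝ → ℝ}
    {b : ℝ → Fin L → ℝ} {lam : ℝ → ℝ} {t : ℝ} (hQ : SmoothOdd Q₀) (hα : SmoothEven (α (b t)))
    (hu : SmoothOdd (u t)) : SmoothEven (remR Q₀ α u b lam t) ∧
      ∀ y, u t (lam t * y) - Q₀ y - y * α (b t) y = y * remR Q₀ α u b lam t y := by
  have h : SmoothOdd fun y => u t (lam t * y) - Q₀ y - y * α (b t) y := by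
    refine ⟨((hu.smooth.comp (contDiff_const.mul contDiff_id)).sub hQ.smooth).sub
      (contDiff_id.mul hα.smooth), fun y => ?_⟩
    rw [mul_neg, hu.odd, hQ.odd, hα.even]; ring
  exact ⟨h.deriv.Av, h.eq_mul_Av⟩

theorem IsTrapped.smoothOdd {g Q χ : ℝ → ℝ} {L : ℕ} {P : Matrix (Fin L) (Fin L) ℝ} {M K s₀ T : ℝ}
    {u : ℝ → ℝ → ℝ} {b : ℝ → Fin L → ℝ} {lam : ℝ → ℝ} (h : IsTrapped g Q χ P M K s₀ T u b lam)
    {t : ℝ} (ht : t ∈ Ico 0 T) : SmoothOdd (u t) := by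
  refine ⟨?_, h.odd t ht⟩
  have := h.smooth.comp (contDiffOn_const.prodMk contDiffOn_id : ContDiffOn ℝ ∞ (fun r : ℝ => (t, r)) univ)
    fun r _ => ⟨ht, mem_univ _⟩
  exact contDiffOn_univ.1 this

theorem B0_div_le_B1 {b₁ : ℝ} (hb : 0 < b₁) (hb' : b₁ ≤ Real.exp (-1)) : B0 b₁ / 4 ≤ B1 b₁ := by
  have h1 : 1 ≤ |Real.log b₁| := by
    have : Real.log b₁ ≤ -1 := (Real.log_le_iff_le_exp hb).2 hb'
    rw [abs_of_neg (by linarith)]; linarith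
  have := Real.sqrt_pos.2 hb
  rw [B0, B1, div_div, div_le_div_iff₀ (by positivity) this]
  nlinarith

namespace Reduced
variable {g Q Q₀ q p V : ℝ → ℝ} (hR : Reduced g Q Q₀ q p V)
include hR

theorem integral_sq_le_energy {w ε : ℝ → ℝ} (hw : SmoothEven w) {R : ℝ} (hR0 : 0 ≤ R)
    (h : ∀ y, 0 < y → y < R → ε y = y * w y) (k : ℕ) (hfin : energy g Q k ε ≠ ⊤) :
    ∫ y in (0 : ℝ)..R, (HR V)^[k] w y ^ 2 * y ^ 3 ≤ (energy g Q k ε).toReal := by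
  have hc := (hR.smoothEven_HR_iter hw k).continuous
  rw [intervalIntegral.integral_of_le hR0, integral_Ioc_eq_integral_Ioo,
    integral_eq_lintegral_of_nonneg_ae]
  · refine ENNReal.toReal_mono hfin ?_
    rw [energy]
    refine le_trans (le_of_eq ?_) (lintegral_mono_set (s := Ioo 0 R) Ioo_subset_Ioi_self)
    refine setLIntegral_congr_fun measurableSet_Ioo fun y hy => ?_
    rw [hR.H_iter_eq hw h k hy.1 hy.2]
    congr 1; ring
  · filter_upwards [ae_restrict_mem measurableSet_Ioo] with y hy
    have := hy.1
    positivity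
  · exact (by fun_prop : Continuous fun y => (HR V)^[k] w y ^ 2 * y ^ 3).aestronglyMeasurable

variable {χ : ℝ → ℝ} (hχ : IsCutoff χ) {L : ℕ}
  {F : ℕ → (Fin L → ℝ) → ℝ → ℝ} {F' : ℕ → Fin L → (Fin L → ℝ) → ℝ → ℝ}
  (hF : ∀ k, SymFamily Q χ k (F k) (F' k)) (h : ∀ k, ProfileRep g Q χ k (F k) (F' k))
include hχ hF h

theorem Qloc_eq {b : Fin L → ℝ} {y : ℝ} (hb : Inner b y) (hb' : par b 1 ≤ Real.exp (-1)) :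
    Qloc g Q χ b y = Q₀ y + y * alphaR q p F b y := by
  have hB := B0_div_le_B1 hb.1 hb'
  have hB1 : 0 < B1 (par b 1) := hb.2.1.trans (hb.2.2.trans_le hB)
  rw [Qloc, hR.Q₀_eq y hb.2.1, cut, hχ.eq_one _ ((div_le_one hB1).2 (hb.2.2.le.trans hB)), one_mul, alphaR,
    Finset.sum_add_distrib]
  have e1 : ∑ i ∈ Finset.Icc 1 L, par b i * T Q i y
      = y * ∑ k ∈ Finset.range (L + 2), par b (k + 1) * TR q p (k + 1) y := by
    have : Finset.Icc 1 L = Finset.Ico 1 (L + 1) := by ext; simp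
    rw [Finset.sum_range_succ, Finset.sum_range_succ, par_of_lt b (show L < L + 1 by omega),
      par_of_lt b (show L < L + 1 + 1 by omega), zero_mul, zero_mul, add_zero, add_zero, Finset.mul_sum,
      this, Finset.sum_Ico_eq_sum_range, Nat.add_sub_cancel]
    refine Finset.sum_congr rfl fun k _ => ?_
    rw [hR.T_eq _ hb.2.1, add_comm 1 k]
    ring
  have e2 : ∑ i ∈ Finset.Icc 2 (L + 2), S g Q χ L i b y
      = y * ∑ k ∈ Finset.range (L + 2), F (k + 1) b y := by
    have : Finset.Icc 2 (L + 2) = Finset.Ico 2 (L + 1 + 2) := by ext; simp; omega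
    rw [Finset.sum_range_succ', (hF (0 + 1)).zero le_rfl, add_zero, Finset.mul_sum, this,
      Finset.sum_Ico_eq_sum_range, Nat.add_sub_cancel]
    refine Finset.sum_congr rfl fun k _ => ?_
    rw [(h _).eq b y hb, add_comm 2 k]
  rw [e1, e2]; ring

omit hR hχ hF h in
theorem _root_.HeatFlow.le_B0 {b₁ x : ℝ} (hb : 0 < b₁) (hx : 0 < x) (h : b₁ ≤ (1 / x) ^ 2) : x ≤ B0 b₁ := by
  have h1 : √b₁ ≤ 1 / x := Real.sqrt_le_iff.2 ⟨by positivity, h⟩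
  rw [B0, le_div_iff₀ (Real.sqrt_pos.2 hb)]
  calc x * √b₁ ≤ x * (1 / x) := by gcongr
    _ = 1 := by field_simp

theorem eps_eq {P : Matrix (Fin L) (Fin L) ℝ} {M K s₀ T : ℝ} {u : ℝ → ℝ → ℝ} {b : ℝ → Fin L → ℝ}
    {lam : ℝ → ℝ} (hT : IsTrapped g Q χ P M K s₀ T u b lam) {t : ℝ} (ht : t ∈ Ico 0 T) {y : ℝ}
    (hb : Inner (b t) y) (hb' : par (b t) 1 ≤ Real.exp (-1)) :
    eps g Q χ u b lam t y = y * remR Q₀ (alphaR q p F) u b lam t y := by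
  rw [← (eps_eq_of_smoothOdd hR.Q₀_odd (hR.smoothEven_alphaR hF (b t)) (hT.smoothOdd ht)).2 y, eps,
    hR.Qloc_eq hχ hF h hb hb']
  ring

/-- The directions are supported in y ≤ 2M, inside the inner region, so the orthogonality of ε
passes to the remainder. -/
theorem integral_remR_mul_eq_zero {P : Matrix (Fin L) (Fin L) ℝ} {M K s₀ T : ℝ} {u : ℝ → ℝ → ℝ}
    {b : ℝ → Fin L → ℝ} {lam : ℝ → ℝ} (hT : IsTrapped g Q χ P M K s₀ T u b lam) {t : ℝ}
    (ht : t ∈ Ico 0 T) (hb : 0 < par (b t) 1) (hb' : par (b t) 1 ≤ Real.exp (-1)) (hM : 0 < M)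
    (hMB : 2 * M < B0 (par (b t) 1) / 4) {k : ℕ} (hk : k ≤ L) :
    ∫ y in (0 : ℝ)..(2 * M), remR Q₀ (alphaR q p F) u b lam t y
      * (HR V)^[k] (PhiR g Q χ q V L M) y * y ^ 3 = 0 := by
  have hs := hR.smoothEven_PhiR hχ (M := M) L
  refine (pair_eq_integral (by positivity) (fun y hy hyM => ?_) (fun y hy => hR.H_iter_PhiM hχ hM L k hy)
    (hR.HR_iter_eq_zero hs (by positivity) (hR.PhiR_eq_zero hχ hM L) k)).symm.trans (hT.orth t ht k hk)
  exact hR.eps_eq hχ hF h hT ht ⟨hb, hy, hyM.trans hMB⟩ hb'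

theorem exists_abs_remR_le (hL : 1 ≤ L) : ∃ m : ℕ, ∀ M : ℝ, 0 < M → ∃ C : ℝ, 0 ≤ C ∧
    ∀ (P : Matrix (Fin L) (Fin L) ℝ) (K s₀ T : ℝ) (u : ℝ → ℝ → ℝ) (b : ℝ → Fin L → ℝ)
    (lam : ℝ → ℝ), IsTrapped g Q χ P M K s₀ T u b lam → ∀ t ∈ Ico 0 T, 0 < par (b t) 1 →
    par (b t) 1 ≤ Real.exp (-1) → 1 < B0 (par (b t) 1) / 4 → 2 * M < B0 (par (b t) 1) / 4 →
    ∀ y, Inner (b t) y → |remR Q₀ (alphaR q p F) u b lam t y|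
      ≤ C * √(energy g Q (L + 1) (eps g Q χ u b lam t)).toReal * (1 + y) ^ m := by
  obtain ⟨m, hm⟩ := hR.exists_coercive hχ hL
  refine ⟨m, fun M hM => ?_⟩
  obtain ⟨C, hC, hb⟩ := hm M hM
  refine ⟨C, hC, fun P K s₀ T u b lam hT t ht hb1 hb2 hB1 hBM y hy => ?_⟩
  have hw := (eps_eq_of_smoothOdd (lam := lam) hR.Q₀_odd (hR.smoothEven_alphaR hF (b t)) (hT.smoothOdd ht)).1
  refine hb _ _ _ hw hB1 hBM (Real.sqrt_nonneg _) ?_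
    (fun k hk => hR.integral_remR_mul_eq_zero hχ hF h hT ht hb1 hb2 hM hBM hk) y hy.2.1 hy.2.2
  rw [Real.sq_sqrt ENNReal.toReal_nonneg]
  exact hR.integral_sq_le_energy hw (by linarith)
    (fun y hy hyB => hR.eps_eq hχ hF h hT ht ⟨hb1, hy, hyB⟩ hb2) _
    ((hT.bound_high t ht).trans_lt ENNReal.ofReal_lt_top).ne

end Reduced

/-- The time derivative is one-sided at t = 0, hence the formulation within [0, T); the equation
itself, imposed for t > 0, extends to t = 0 by continuity. -/
theorem IsTrapped.exists_partials {g Q χ : ℝ → ℝ} {L : ℕ} {P : Matrix (Fin L) (Fin L) ℝ} {M K s₀ T : ℝ}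
    {u : ℝ → ℝ → ℝ} {b : ℝ → Fin L → ℝ} {lam : ℝ → ℝ} (hg : IsTargetProfile g)
    (h : IsTrapped g Q χ P M K s₀ T u b lam) (hT : 0 < T) : ∃ Ut Ur Urr : ℝ × ℝ → ℝ,
    ContinuousOn Ut (Ico 0 T ×ˢ univ) ∧ ContinuousOn Ur (Ico 0 T ×ˢ univ) ∧
    (∀ t ∈ Ico 0 T, ∀ (γ : ℝ → ℝ) (γ' : ℝ), HasDerivWithinAt γ γ' (Ico 0 T) t →
      HasDerivWithinAt (fun τ => u τ (γ τ)) (Ut (t, γ t) + γ' * Ur (t, γ t)) (Ico 0 T) t) ∧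
    (∀ t ∈ Ico 0 T, ∀ r, HasDerivAt (u t) (Ur (t, r)) r) ∧
    (∀ t ∈ Ico 0 T, ∀ r, HasDerivAt (fun r => Ur (t, r)) (Urr (t, r)) r) ∧
    ∀ t ∈ Ico 0 T, ∀ r, 0 < r → Ut (t, r) = Urr (t, r) + Ur (t, r) / r - nonlin g (u t r) / r ^ 2 := by
  have hD := uniqueDiffOn_Ico (0 : ℝ) T
  obtain ⟨Ut, Ur, h1, h2, h3⟩ := HeatFlow.exists_partials hD h.smooth
  obtain ⟨Urt, Urr, k1, k2, k3⟩ := HeatFlow.exists_partials hD h2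
  have hr : ∀ t ∈ Ico 0 T, ∀ r, HasDerivAt (u t) (Ur (t, r)) r := fun t ht r => hasDerivAt_snd ht h3 r
  have hrr : ∀ t ∈ Ico 0 T, ∀ r, HasDerivAt (fun r => Ur (t, r)) (Urr (t, r)) r := fun t ht r =>
    hasDerivAt_snd ht k3 r
  have hcurve : ∀ t ∈ Ico 0 T, ∀ (γ : ℝ → ℝ) (γ' : ℝ), HasDerivWithinAt γ γ' (Ico 0 T) t →
      HasDerivWithinAt (fun τ => u τ (γ τ)) (Ut (t, γ t) + γ' * Ur (t, γ t)) (Ico 0 T) t :=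
    fun t ht γ γ' hγ => hasDerivWithinAt_curve ht h3 hγ
  have hin : ∀ t ∈ Ioo 0 T, ∀ r, 0 < r →
      Ut (t, r) = Urr (t, r) + Ur (t, r) / r - nonlin g (u t r) / r ^ 2 := by
    intro t ht r hr0
    have ht' : t ∈ Ico 0 T := Ioo_subset_Ico_self ht
    have e1 : deriv (u t) = fun r => Ur (t, r) := funext fun r => (hr t ht' r).deriv
    have e2 : deriv (fun τ => u τ r) t = Ut (t, r) := by
      have := (hcurve t ht' (fun _ => r) 0 (hasDerivWithinAt_const _ _ _)).hasDerivAt (Ico_mem_nhds ht.1 ht.2)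
      rw [this.deriv]; ring
    have := h.flow t ht r hr0
    rw [e1, e2, (hrr t ht' r).deriv] at this
    linarith
  refine ⟨Ut, Ur, Urr, h1.continuousOn, h2.continuousOn, hcurve, hr, hrr, fun t ht r hr0 => ?_⟩
  rcases ht.1.eq_or_lt with rfl | ht0
  · have hm : MapsTo (fun τ : ℝ => (τ, r)) (Ico 0 T) (Ico 0 T ×ˢ univ) := fun τ hτ => ⟨hτ, mem_univ _⟩
    have lim : ∀ {G : ℝ × ℝ → ℝ}, ContinuousOn G (Ico 0 T ×ˢ univ) →
        Tendsto (fun τ => G (τ, r)) (𝓝[Ioo 0 T] 0) (𝓝 (G (0, r))) := fun hG =>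
      ((hG.comp (by fun_prop : Continuous fun τ : ℝ => (τ, r)).continuousOn hm) 0 ht).mono_left
        (nhdsWithin_mono _ Ioo_subset_Ico_self)
    have hu := lim h.smooth.continuousOn
    have : (𝓝[Ioo 0 T] (0 : ℝ)).NeBot := left_nhdsWithin_Ioo_neBot hT
    refine tendsto_nhds_unique_of_eventuallyEq (lim h1.continuousOn) (((lim k2.continuousOn).add
      ((lim h2.continuousOn).div_const r)).sub
      (((hg.smooth_nonlin.continuous.tendsto _).comp hu).div_const (r ^ 2))) ?_
    filter_upwards [self_mem_nhdsWithin] with τ hτ using hin τ hτ r hr0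
  · exact hin t ⟨ht0, ht.2⟩ r hr0

namespace Reduced
variable {g Q Q₀ q p V : ℝ → ℝ} (hR : Reduced g Q Q₀ q p V)
include hR

/-- Expansion of the stationary equation around Q: the zeroth order part vanishes because Q is
harmonic, the first order part is -H, and the rest is the quadratic remainder of f. -/
theorem laplacian_eq {W : ℝ → ℝ} (hW : SmoothEven W) {y : ℝ} (hy : 0 < y) :
    deriv (fun y => q y + LR W y) y + (q y + LR W y) / y - nonlin g (Q y + y * W y) / y ^ 2
      = -(y * HR V W y) - (nonlin g (Q y + y * W y) - nonlin g (Q y)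
        - deriv (nonlin g) (Q y) * (y * W y)) / y ^ 2 := by
  have h1 : HasDerivAt (fun y => q y + LR W y)
      (deriv q y + (deriv W y + (1 * deriv W y + y * deriv (deriv W) y))) y :=
    (hR.q_even.differentiable y).hasDerivAt.add ((hW.differentiable y).hasDerivAt.add
      ((hasDerivAt_id y).mul (hW.deriv.differentiable y).hasDerivAt))
  have h2 := hR.harmonic y hy
  have h3 : deriv q y = nonlin g (Q y) / y ^ 2 - q y / y := by linarith
  rw [h1.deriv, h3, HR_eq hW hy.ne', hR.V_eq y hy, LR]
  field_simp
  ring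

variable {χ : ℝ → ℝ} (hχ : IsCutoff χ) {L : ℕ}
  {F : ℕ → (Fin L → ℝ) → ℝ → ℝ} {F' : ℕ → Fin L → (Fin L → ℝ) → ℝ → ℝ}
  (hF : ∀ k, SymFamily Q χ k (F k) (F' k)) (h : ∀ k, ProfileRep g Q χ k (F k) (F' k))
include hF hχ

theorem continuousOn_alphaR' (j : Fin L) :
    ContinuousOn (fun z : (Fin L → ℝ) × ℝ => alphaR' q p F' j z.1 z.2) ({b | 0 < par b 1} ×ˢ univ) := by
  refine ((hR.smoothEven_TR _).continuous.comp continuous_snd).continuousOn.add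
    (continuousOn_finsetSum _ fun k hk => ?_)
  exact (((hF (k + 1)).sym' j).mono (m' := L + 2) (by have := Finset.mem_range.1 hk; omega)).continuousOn
    hR hχ (by omega)

theorem continuousOn_alphaR :
    ContinuousOn (fun z : (Fin L → ℝ) × ℝ => alphaR q p F z.1 z.2) ({b | 0 < par b 1} ×ˢ univ) :=
  continuousOn_finsetSum _ fun k hk =>
    (hR.sym_alphaR_term hF (Finset.mem_range.1 hk)).continuousOn hR hχ (by omega)

end Reduced

/-! ### The evolution equation of the remainder. -/

/-- The defect in the law of the scaling parameter. -/
noncomputable def modLam {L : ℕ} (T : ℝ) (b : ℝ → Fin L → ℝ) (lam : ℝ → ℝ) (t : ℝ) : ℝ :=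
  lam t * derivWithin lam (Ico 0 T) t + par (b t) 1

/-- The defect in the modulation equations. -/
noncomputable def modPar (Q χ : ℝ → ℝ) {L : ℕ} (T : ℝ) (b : ℝ → Fin L → ℝ) (lam : ℝ → ℝ) (j : Fin L)
    (t : ℝ) : ℝ :=
  lam t ^ 2 * derivWithin (fun τ => b τ j) (Ico 0 T) t + modR Q χ j (b t)

namespace Reduced
variable {g Q Q₀ q p V : ℝ → ℝ} (hR : Reduced g Q Q₀ q p V)
  {χ : ℝ → ℝ} (hχ : IsCutoff χ) {L : ℕ}
  {F : ℕ → (Fin L → ℝ) → ℝ → ℝ} {F' : ℕ → Fin L → (Fin L → ℝ) → ℝ → ℝ}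
  (hF : ∀ k, SymFamily Q χ k (F k) (F' k)) (h : ∀ k, ProfileRep g Q χ k (F k) (F' k))
include hR hF hχ h

/-- Insert u(t, λy) = Q + y(α + w) in the flow, then add and subtract the profile equation with b_s
replaced by its leading part. The bracket of `exists_profile_error` appears, and the modulation
defects multiply ΛQ and the parameter derivatives of the profile. -/
theorem exists_hasDerivWithinAt_rem (hg : IsTargetProfile g) {P : Matrix (Fin L) (Fin L) ℝ}
    {M K s₀ T : ℝ} {u : ℝ → ℝ → ℝ} {b : ℝ → Fin L → ℝ} {lam : ℝ → ℝ}
    (hT : IsTrapped g Q χ P M K s₀ T u b lam) (hT0 : 0 < T) (hb : ∀ t ∈ Ico 0 T, 0 < par (b t) 1) :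
    ContinuousOn (fun z : ℝ × ℝ => z.2 * remR Q₀ (alphaR q p F) u b lam z.1 z.2) (Ico 0 T ×ˢ univ) ∧
    ∃ E : ℝ → ℝ → ℝ, ContinuousOn (Function.uncurry E) (Ico 0 T ×ˢ univ) ∧
      (∀ t ∈ Ico 0 T, ∀ y, HasDerivWithinAt (fun τ => y * remR Q₀ (alphaR q p F) u b lam τ y)
        (E t y) (Ico 0 T) t) ∧
      ∀ t ∈ Ico 0 T, ∀ y, 0 < y → lam t ^ 2 * E t y = y * (
        -HR V (remR Q₀ (alphaR q p F) u b lam t) y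
        + modLam T b lam t * q y - ∑ j, modPar Q χ T b lam j t * alphaR' q p F' j (b t) y
        + (modLam T b lam t - par (b t) 1) * LR (remR Q₀ (alphaR q p F) u b lam t) y
        + modLam T b lam t * LR (alphaR q p F (b t)) y
        + (-par (b t) 1 * (q y + LR (alphaR q p F (b t)) y) - HR V (alphaR q p F (b t)) y
          + ∑ j : Fin L, modR Q χ j (b t) * alphaR' q p F' j (b t) y
          - (nonlin g (Q y + y * alphaR q p F (b t) y) - nonlin g (Q y)
            - deriv (nonlin g) (Q y) * (y * alphaR q p F (b t) y)) / y ^ 3)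
        - (nonlin g (Q y + y * (alphaR q p F (b t) y + remR Q₀ (alphaR q p F) u b lam t y))
            - nonlin g (Q y + y * alphaR q p F (b t) y)
            - deriv (nonlin g) (Q y) * (y * remR Q₀ (alphaR q p F) u b lam t y)) / y ^ 3) := by
  obtain ⟨Ut, Ur, Urr, h1, h2, h3, h4, h5, h6⟩ := hT.exists_partials hg hT0
  have hD := uniqueDiffOn_Ico (0 : ℝ) T
  have hlam : ∀ t ∈ Ico 0 T, HasDerivWithinAt lam (derivWithin lam (Ico 0 T) t) (Ico 0 T) t :=
    fun t ht => (hT.lam_smooth.differentiableOn (by simp) t ht).hasDerivWithinAt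
  have hlamc : ContinuousOn (derivWithin lam (Ico 0 T)) (Ico 0 T) :=
    hT.lam_smooth.continuousOn_derivWithin hD (by simp)
  have hbj : ∀ j, ContDiffOn ℝ 1 (fun τ => b τ j) (Ico 0 T) := fun j => contDiffOn_pi.1 hT.b_smooth j
  have hbd : ∀ t ∈ Ico 0 T, HasDerivWithinAt b (fun j => derivWithin (fun τ => b τ j) (Ico 0 T) t) (Ico 0 T) t :=
    fun t ht => hasDerivWithinAt_pi.2 fun j => ((hbj j).differentiableOn (by simp) t ht).hasDerivWithinAt
  have hbc : ∀ j, ContinuousOn (derivWithin (fun τ => b τ j) (Ico 0 T)) (Ico 0 T) := fun j =>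
    (hbj j).continuousOn_derivWithin hD (by simp)
  have hrem := fun t (ht : t ∈ Ico 0 T) =>
    eps_eq_of_smoothOdd (lam := lam) hR.Q₀_odd (hR.smoothEven_alphaR hF (b t)) (hT.smoothOdd ht)
  have hfst : ∀ {f : ℝ → ℝ}, ContinuousOn f (Ico 0 T) →
      ContinuousOn (fun z : ℝ × ℝ => f z.1) (Ico 0 T ×ˢ univ) := fun hf =>
    hf.comp continuousOn_fst fun z hz => hz.1
  have hlc := hfst hT.lam_smooth.continuousOn
  have hcurve : ContinuousOn (fun z : ℝ × ℝ => (z.1, lam z.1 * z.2)) (Ico 0 T ×ˢ univ) :=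
    continuousOn_fst.prodMk (hlc.mul continuousOn_snd)
  have hm : MapsTo (fun z : ℝ × ℝ => (z.1, lam z.1 * z.2)) (Ico 0 T ×ˢ univ) (Ico 0 T ×ˢ univ) :=
    fun z hz => ⟨hz.1, mem_univ _⟩
  have hbz : ContinuousOn (fun z : ℝ × ℝ => (b z.1, z.2)) (Ico 0 T ×ˢ univ) :=
    (hT.b_smooth.continuousOn.comp continuousOn_fst fun z hz => hz.1).prodMk continuousOn_snd
  have hbm : MapsTo (fun z : ℝ × ℝ => (b z.1, z.2)) (Ico 0 T ×ˢ univ) ({b | 0 < par b 1} ×ˢ univ) :=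
    fun z hz => ⟨hb z.1 hz.1, mem_univ _⟩
  refine ⟨?_, fun t y => Ut (t, lam t * y) + derivWithin lam (Ico 0 T) t * y * Ur (t, lam t * y)
    - y * ∑ j, alphaR' q p F' j (b t) y * derivWithin (fun τ => b τ j) (Ico 0 T) t, ?_, fun t ht y => ?_,
    fun t ht y hy => ?_⟩
  · refine (((hT.smooth.continuousOn.comp hcurve hm).sub
      (hR.Q₀_odd.smooth.continuous.comp continuous_snd).continuousOn).sub
      (continuousOn_snd.mul ((hR.continuousOn_alphaR hχ hF).comp hbz hbm))).congr fun z hz => ?_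
    exact ((hrem z.1 hz.1).2 z.2).symm
  · refine ((h1.comp hcurve hm).add (((hfst hlamc).mul continuousOn_snd).mul (h2.comp hcurve hm))).sub
      (continuousOn_snd.mul (continuousOn_finsetSum _ fun j _ => ContinuousOn.mul ?_ (hfst (hbc j))))
    exact (hR.continuousOn_alphaR' hχ hF j).comp hbz hbm
  · have k1 := h3 t ht (fun τ => lam τ * y) _ ((hlam t ht).mul_const y)
    have k2 := (hasFDerivAt_alphaR (q := q) (p := p) h (hb t ht) y).comp_hasDerivWithinAt t (hbd t ht)
    rw [linForm_apply] at k2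
    refine ((k1.sub_const (Q₀ y)).sub (k2.const_mul y)).congr_of_mem (fun τ hτ => ?_) ht
    exact ((hrem τ hτ).2 y).symm
  · set w := remR Q₀ (alphaR q p F) u b lam t
    set α := alphaR q p F (b t)
    have hw := (hrem t ht).1
    have hα := hR.smoothEven_alphaR hF (b t)
    have hl := hT.lam_pos t ht
    have hWs : SmoothEven fun y => α y + w y := hα.add hw
    have hv : ∀ y, u t (lam t * y) = Q₀ y + y * (α y + w y) := fun y => by
      have := (hrem t ht).2 y
      rw [mul_add]; linarith
    have hv1 : ∀ y, lam t * Ur (t, lam t * y) = q y + LR (fun y => α y + w y) y := fun y => by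
      have d1 : HasDerivAt (fun y => u t (lam t * y)) (Ur (t, lam t * y) * (lam t * 1)) y :=
        (h4 t ht (lam t * y)).comp y ((hasDerivAt_id y).const_mul (lam t))
      have d2 : HasDerivAt (fun y => Q₀ y + y * (α y + w y))
          (q y + (1 * (α y + w y) + y * deriv (fun y => α y + w y) y)) y :=
        (hR.hasDerivAt_Q₀ y).add ((hasDerivAt_id y).mul (hWs.differentiable y).hasDerivAt)
      have e : (fun y => u t (lam t * y)) = fun y => Q₀ y + y * (α y + w y) := funext hv
      rw [e] at d1
      have := d1.unique d2
      rw [LR]; linarith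
    have hv2 : lam t ^ 2 * Urr (t, lam t * y) = deriv (fun y => q y + LR (fun y => α y + w y) y) y := by
      have e : (fun y => q y + LR (fun y => α y + w y) y) = fun y => lam t * Ur (t, lam t * y) :=
        funext fun y => (hv1 y).symm
      have d1 : HasDerivAt (fun y => Ur (t, lam t * y)) (Urr (t, lam t * y) * (lam t * 1)) y :=
        (h5 t ht (lam t * y)).comp y ((hasDerivAt_id y).const_mul (lam t))
      rw [e, (d1.const_mul (lam t)).deriv]; ring
    have hlap := hR.laplacian_eq hWs hy
    have hpde := h6 t ht (lam t * y) (by positivity)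
    have hQ : Q₀ y = Q y := (hR.Q₀_eq y hy).symm
    rw [hv y, hQ] at hpde
    have hUt : lam t ^ 2 * Ut (t, lam t * y) = -(y * HR V (fun y => α y + w y) y)
        - (nonlin g (Q y + y * (α y + w y)) - nonlin g (Q y)
          - deriv (nonlin g) (Q y) * (y * (α y + w y))) / y ^ 2 := by
      rw [← hlap, ← hv2, hpde, ← hv1 y]
      field_simp
    rw [HR_add hα hw] at hUt
    have hv1' := hv1 y
    rw [LR_add hα hw] at hv1'
    have hsum : ∑ j, modPar Q χ T b lam j t * alphaR' q p F' j (b t) y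
        = lam t ^ 2 * ∑ j, alphaR' q p F' j (b t) y * derivWithin (fun τ => b τ j) (Ico 0 T) t
          + ∑ j : Fin L, modR Q χ j (b t) * alphaR' q p F' j (b t) y := by
      rw [Finset.mul_sum, ← Finset.sum_add_distrib]
      exact Finset.sum_congr rfl fun j _ => by rw [modPar]; ring
    beta_reduce
    rw [hsum, modLam]
    generalize ∑ j, alphaR' q p F' j (b t) y * derivWithin (fun τ => b τ j) (Ico 0 T) t = Z₁
    generalize ∑ j : Fin L, modR Q χ j (b t) * alphaR' q p F' j (b t) y = Z₂
    generalize derivWithin lam (Ico 0 T) t = l'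
    have e1 : lam t ^ 2 * (Ut (t, lam t * y) + l' * y * Ur (t, lam t * y) - y * Z₁)
        = lam t ^ 2 * Ut (t, lam t * y) + lam t * l' * y * (lam t * Ur (t, lam t * y)) - y * (lam t ^ 2 * Z₁) := by
      ring
    rw [e1, hUt, hv1']
    beta_reduce
    field_simp
    ring

end Reduced

/-! ### Testing the equation against a compactly supported direction. -/

theorem ParBound.abs {L : ℕ} {A : ℝ} {n : ℕ} {G : (Fin L → ℝ) → ℝ → ℝ} (h : ParBound A n G) :
    ParBound A n fun b y => |G b y| := by simpa only [ParBound, abs_abs] using h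

/-- Integration by parts, needed because coercivity bounds `w` but not its derivative. -/
theorem integral_LR_mul {w ψ : ℝ → ℝ} (hw : SmoothEven w) (hψ : SmoothEven ψ) {r : ℝ} (h0 : ψ r = 0) :
    ∫ y in (0 : ℝ)..r, LR w y * ψ y * y ^ 3
      = -∫ y in (0 : ℝ)..r, w y * (3 * ψ y + y * deriv ψ y) * y ^ 3 := by
  have c1 := hw.continuous
  have c2 := hψ.continuous
  have c3 := hw.deriv.smooth.continuous
  have c4 := hψ.deriv.smooth.continuous
  have hd : ∀ y ∈ uIcc 0 r, HasDerivAt (fun y => w y * ψ y * y ^ 4)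
      (LR w y * ψ y * y ^ 3 + w y * (3 * ψ y + y * deriv ψ y) * y ^ 3) y := fun y _ => by
    refine (((hw.differentiable y).hasDerivAt.mul (hψ.differentiable y).hasDerivAt).mul
      (hasDerivAt_pow 4 y)).congr_deriv ?_
    simp only [LR, Pi.mul_apply]
    push_cast
    ring
  have hLR : Continuous (LR w) := hw.LR.continuous
  have := intervalIntegral.integral_eq_sub_of_hasDerivAt hd
    ((by fun_prop : Continuous fun y => LR w y * ψ y * y ^ 3 + w y * (3 * ψ y + y * deriv ψ y) * y ^ 3).intervalIntegrable _ _)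
  rw [intervalIntegral.integral_add ((by fun_prop : Continuous fun y => LR w y * ψ y * y ^ 3).intervalIntegrable _ _)
    ((by fun_prop : Continuous fun y => w y * (3 * ψ y + y * deriv ψ y) * y ^ 3).intervalIntegrable _ _), h0] at this
  simp at this
  linarith

/-- The linear part is taken at Q and not at the profile Q + h, which costs the cross term |h||k|.
-/
theorem IsTargetProfile.exists_nonlin_diff_le {g : ℝ → ℝ} (hg : IsTargetProfile g) : ∃ C, 0 ≤ C ∧
    ∀ x h k, |nonlin g (x + (h + k)) - nonlin g (x + h) - deriv (nonlin g) x * k| ≤ C * (|k| ^ 2 + |h| * |k|) := by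
  obtain ⟨C, hC⟩ := hg.iteratedDeriv_nonlin_bounded 2
  have h0 : 0 ≤ C := (abs_nonneg _).trans (hC 0)
  refine ⟨C, h0, fun x h k => ?_⟩
  have h1 := abs_taylor_le 1 h0 hg.smooth_nonlin hC (x + h) k
  have h2 := abs_taylor_le 0 h0 (contDiff_infty_iff_deriv.1 hg.smooth_nonlin).2
    (by simpa only [← iteratedDeriv_succ'] using hC) x h
  simp [Finset.sum_range_succ] at h1 h2
  have e : nonlin g (x + (h + k)) - nonlin g (x + h) - deriv (nonlin g) x * k
      = (nonlin g (x + h + k) - (nonlin g (x + h) + deriv (nonlin g) (x + h) * k))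
        + (deriv (nonlin g) (x + h) - deriv (nonlin g) x) * k := by
    rw [← add_assoc]; ring
  rw [e]
  refine (abs_add_le _ _).trans ?_
  rw [abs_mul, mul_add]
  refine add_le_add (by simpa using h1) ?_
  calc _ ≤ C * |h| * |k| := by gcongr
    _ = _ := by ring

namespace Reduced
variable {g Q Q₀ q p V : ℝ → ℝ} (hR : Reduced g Q Q₀ q p V)
  {χ : ℝ → ℝ} (hχ : IsCutoff χ) {L : ℕ} {W : ℕ → ℝ → ℝ} (hW : TaylorData g Q W)
  {F : ℕ → (Fin L → ℝ) → ℝ → ℝ} {F' : ℕ → Fin L → (Fin L → ℝ) → ℝ → ℝ}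
  (hF : ∀ k, SymFamily Q χ k (F k) (F' k)) (h : ∀ k, ProfileRep g Q χ k (F k) (F' k))
include hR hF hχ h hW

set_option maxHeartbeats 1000000 in
-- Only three terms are kept exactly: Hε, the multiple of ΛQ and the leading parts T_j of the
-- parameter derivatives. Each of the others is a product of two small quantities or the profile
-- error, at the price of a power of the support radius r. The exponent depends on `m` but not on
-- the test function, so the lemma serves both for fixed r = 2M and for growing r = 3B.
theorem exists_testing_bound (hg : IsTargetProfile g) {A : ℝ} (hA : 0 ≤ A) (m : ℕ) : ∃ (C : ℝ) (κ : ℕ), 0 ≤ C ∧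
    ∀ (b : Fin L → ℝ) (w ψ G : ℝ → ℝ) (m₀ : ℝ) (mp : Fin L → ℝ) (r ρ η : ℝ), Admissible A b →
      SmoothEven w → SmoothEven ψ → (∀ y, r ≤ y → ψ y = 0) → 1 ≤ r → r < B0 (par b 1) / 4 →
      0 ≤ ρ → 0 ≤ η → (∀ y, 0 < y → y ≤ r → |w y| ≤ η * (1 + y) ^ m) →
      (∀ y, 0 ≤ y → y ≤ r → |ψ y| ≤ ρ ∧ |y * deriv ψ y| ≤ ρ) → ContinuousOn G (Icc 0 r) →
      (∀ y, 0 < y → y ≤ r → G y = y * (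
        -HR V w y + m₀ * q y - ∑ j, mp j * alphaR' q p F' j b y + (m₀ - par b 1) * LR w y
        + m₀ * LR (alphaR q p F b) y
        + (-par b 1 * (q y + LR (alphaR q p F b) y) - HR V (alphaR q p F b) y
          + ∑ j : Fin L, modR Q χ j b * alphaR' q p F' j b y
          - (nonlin g (Q y + y * alphaR q p F b y) - nonlin g (Q y)
            - deriv (nonlin g) (Q y) * (y * alphaR q p F b y)) / y ^ 3)
        - (nonlin g (Q y + y * (alphaR q p F b y + w y)) - nonlin g (Q y + y * alphaR q p F b y)
            - deriv (nonlin g) (Q y) * (y * w y)) / y ^ 3)) →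
      |(∫ y in (0 : ℝ)..r, G y * ψ y * y ^ 2) - (-(∫ y in (0 : ℝ)..r, w y * HR V ψ y * y ^ 3)
        + m₀ * (∫ y in (0 : ℝ)..r, q y * ψ y * y ^ 3)
        - ∑ j : Fin L, mp j * ∫ y in (0 : ℝ)..r, TR q p (j + 1) y * ψ y * y ^ 3)|
      ≤ C * (1 + r) ^ κ * ρ * ((|m₀| + ∑ j, |mp j| + par b 1) * η + (|m₀| + ∑ j, |mp j|) * par b 1
          + par b 1 ^ (L + 3) + η ^ 2) := by
  obtain ⟨C₁, k₁, hC₁, h₁⟩ := hR.parBound_alphaR hF hχ hA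
  obtain ⟨C₂, k₂, hC₂, h₂⟩ := hR.parBound_LR_alphaR hF hχ hA
  obtain ⟨C₃, k₃, hC₃, h₃⟩ := ParBound.sum Finset.univ fun j _ => (hR.parBound_alphaR' hF hχ hA j).abs
  obtain ⟨C₄, k₄, hC₄, h₄⟩ := hR.exists_profile_error hχ hW hF hg h hA
  obtain ⟨Cf, hCf, hf⟩ := hg.exists_nonlin_diff_le
  refine ⟨C₂ + C₃ + C₄ + Cf + Cf * C₁ + 4, 4 + 2 * m + k₁ + k₂ + k₃ + k₄, by positivity, ?_⟩
  intro b w ψ G m₀ mp r ρ η hb hw hψ hψ0 hr1 hrB hρ hη hwb hψb hG hGeq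
  have hr0 : 0 < r := by linarith
  have hb0 := hb.pos
  set μ := |m₀| + ∑ j, |mp j| with hμ
  have hμ1 : |m₀| ≤ μ := by have : 0 ≤ ∑ j, |mp j| := by positivity
                            linarith
  have hμ2 : ∑ j, |mp j| ≤ μ := by have := abs_nonneg m₀
                                   linarith
  have hμ0 : 0 ≤ μ := (abs_nonneg _).trans hμ1
  set X := 1 + r with hX
  have hX1 : 1 ≤ X := by linarith
  set κ := 4 + 2 * m + k₁ + k₂ + k₃ + k₄ with hκ
  have c1 := hw.continuous
  have c2 := hψ.continuous
  have c4 := hψ.deriv.smooth.continuous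
  have cL := hw.LR.continuous
  have cH := (hR.V_even.HR hw).continuous
  have cq := hR.q_even.continuous
  have cT := fun j => (hR.smoothEven_TR j).continuous
  have hψr := hψ0 r le_rfl
  have hψr' := hψ.deriv_eq_zero hψ0 r le_rfl
  have hGi : IntervalIntegrable (fun y => G y * ψ y * y ^ 2) volume 0 r := by
    refine ContinuousOn.intervalIntegrable ?_
    rw [uIcc_of_le hr0.le]
    exact (hG.mul c2.continuousOn).mul (by fun_prop)
  have i1 : IntervalIntegrable (fun y => HR V w y * ψ y * y ^ 3) volume 0 r :=
    (by fun_prop : Continuous fun y => HR V w y * ψ y * y ^ 3).intervalIntegrable _ _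
  have i2 : IntervalIntegrable (fun y => m₀ * (q y * ψ y * y ^ 3)) volume 0 r :=
    (by fun_prop : Continuous fun y => m₀ * (q y * ψ y * y ^ 3)).intervalIntegrable _ _
  have i3 : ∀ j ∈ (Finset.univ : Finset (Fin L)), IntervalIntegrable (fun y => mp j * (TR q p (j + 1) y * ψ y * y ^ 3)) volume 0 r :=
    fun j _ => (by have := cT (j + 1); fun_prop :
      Continuous fun y => mp j * (TR q p (j + 1) y * ψ y * y ^ 3)).intervalIntegrable _ _
  have i3' : IntervalIntegrable (fun y => ∑ j : Fin L, mp j * (TR q p (j + 1) y * ψ y * y ^ 3)) volume 0 r :=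
    (continuous_finsetSum _ fun j _ => (by have := cT (j + 1); fun_prop :
      Continuous fun y => mp j * (TR q p (j + 1) y * ψ y * y ^ 3))).intervalIntegrable _ _
  have i4 : IntervalIntegrable (fun y => (m₀ - par b 1) * (LR w y * ψ y * y ^ 3)) volume 0 r :=
    (by fun_prop : Continuous fun y => (m₀ - par b 1) * (LR w y * ψ y * y ^ 3)).intervalIntegrable _ _
  -- The terms with derivatives of `w` are kept under the integral, where both H and Λ are moved
  -- onto ψ.
  have hint : (∫ y in (0 : ℝ)..r, (G y * ψ y * y ^ 2 - (-(HR V w y * ψ y * y ^ 3) + m₀ * (q y * ψ y * y ^ 3)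
        - ∑ j : Fin L, mp j * (TR q p (j + 1) y * ψ y * y ^ 3) + (m₀ - par b 1) * (LR w y * ψ y * y ^ 3))))
      = (∫ y in (0 : ℝ)..r, G y * ψ y * y ^ 2) - (-(∫ y in (0 : ℝ)..r, w y * HR V ψ y * y ^ 3)
        + m₀ * (∫ y in (0 : ℝ)..r, q y * ψ y * y ^ 3)
        - ∑ j : Fin L, mp j * ∫ y in (0 : ℝ)..r, TR q p (j + 1) y * ψ y * y ^ 3)
        + (m₀ - par b 1) * ∫ y in (0 : ℝ)..r, w y * (3 * ψ y + y * deriv ψ y) * y ^ 3 := by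
    have j1 : IntervalIntegrable (fun y => -(HR V w y * ψ y * y ^ 3)) volume 0 r := i1.neg
    rw [intervalIntegral.integral_sub hGi (((j1.add i2).sub i3').add i4),
      intervalIntegral.integral_add ((j1.add i2).sub i3') i4,
      intervalIntegral.integral_sub (j1.add i2) i3', intervalIntegral.integral_add j1 i2,
      intervalIntegral.integral_neg, intervalIntegral.integral_finsetSum i3,
      hR.integral_HR_mul hw hψ hψr hψr', intervalIntegral.integral_const_mul,
      intervalIntegral.integral_const_mul, integral_LR_mul hw hψ hψr]
    simp only [intervalIntegral.integral_const_mul]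
    ring
  have hpow : ∀ {y : ℝ} (k : ℕ), 0 < y → y ≤ r → (1 + y) ^ k ≤ X ^ k := fun k hy hyr => by
    gcongr
    linarith
  have hup : ∀ k, k ≤ κ → X ^ k ≤ X ^ κ := fun k hk => pow_le_pow_right₀ hX1 hk
  -- Once those terms are subtracted, what remains contains no derivative of `w` and is bounded
  -- pointwise.
  have hsplit : ∀ y, 0 < y → y ≤ r → |G y * ψ y * y ^ 2 - (-(HR V w y * ψ y * y ^ 3) + m₀ * (q y * ψ y * y ^ 3)
        - ∑ j : Fin L, mp j * (TR q p (j + 1) y * ψ y * y ^ 3) + (m₀ - par b 1) * (LR w y * ψ y * y ^ 3))|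
      ≤ (C₂ + C₃ + C₄ + Cf + Cf * C₁) * (X ^ (3 + 2 * m + k₁ + k₂ + k₃ + k₄) * ρ * ((μ + par b 1) * η + μ * par b 1
          + par b 1 ^ (L + 3) + η ^ 2)) := by
    intro y hy hyr
    have hin : Inner b y := ⟨hb0, hy, hyr.trans_lt hrB⟩
    have a₁ := h₁ b hb y
    have a₂ := h₂ b hb y
    have a₃ := h₃ b hb y
    have a₄ := h₄ b y hb hin
    have aw := hwb y hy hyr
    have aψ := (hψb y hy.le hyr).1
    have af := hf (Q y) (y * alphaR q p F b y) (y * w y)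
    rw [← mul_add] at af
    rw [abs_of_pos hy, pow_one] at a₁ a₂ a₃
    beta_reduce at a₁ a₂ a₃
    rw [hGeq y hy hyr]
    set P₄ := -par b 1 * (q y + LR (alphaR q p F b) y) - HR V (alphaR q p F b) y
          + ∑ j : Fin L, modR Q χ j b * alphaR' q p F' j b y
          - (nonlin g (Q y + y * alphaR q p F b y) - nonlin g (Q y)
            - deriv (nonlin g) (Q y) * (y * alphaR q p F b y)) / y ^ 3
    set N := nonlin g (Q y + y * (alphaR q p F b y + w y)) - nonlin g (Q y + y * alphaR q p F b y)
            - deriv (nonlin g) (Q y) * (y * w y)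
    set P₂ := LR (alphaR q p F b) y
    set a := alphaR q p F b y
    have hsum : ∑ j : Fin L, mp j * (TR q p (j + 1) y * ψ y * y ^ 3)
        = (∑ j, mp j * alphaR' q p F' j b y) * ψ y * y ^ 3
          - (∑ j, mp j * (alphaR' q p F' j b y - TR q p (j + 1) y)) * ψ y * y ^ 3 := by
      simp only [mul_sub, Finset.sum_sub_distrib, Finset.sum_mul, sub_mul, sub_sub_cancel]
      exact Finset.sum_congr rfl fun j _ => by ring
    have hP₃ : |∑ j, mp j * (alphaR' q p F' j b y - TR q p (j + 1) y)|
        ≤ μ * (C₃ * par b 1 * (1 + y) ^ k₃) := by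
      refine (Finset.abs_sum_le_sum_abs _ _).trans ?_
      calc _ ≤ ∑ j, |mp j| * ∑ i, |alphaR' q p F' i b y - TR q p (i + 1) y| := by
            refine Finset.sum_le_sum fun j _ => ?_
            rw [abs_mul]
            gcongr
            exact Finset.single_le_sum (f := fun i : Fin L => |alphaR' q p F' i b y - TR q p (i + 1) y|)
              (fun _ _ => abs_nonneg _) (Finset.mem_univ j)
        _ ≤ _ := by
            rw [← Finset.sum_mul]
            gcongr
            exact (le_abs_self _).trans a₃
    rw [hsum]
    set P₃ := ∑ j, mp j * (alphaR' q p F' j b y - TR q p (j + 1) y)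
    generalize ∑ j, mp j * alphaR' q p F' j b y = Z
    have e : y * (-HR V w y + m₀ * q y - Z + (m₀ - par b 1) * LR w y + m₀ * P₂ + P₄ - N / y ^ 3) * ψ y * y ^ 2
        - (-(HR V w y * ψ y * y ^ 3) + m₀ * (q y * ψ y * y ^ 3) - (Z * ψ y * y ^ 3 - P₃ * ψ y * y ^ 3)
          + (m₀ - par b 1) * (LR w y * ψ y * y ^ 3))
        = (m₀ * P₂ + -P₃ + P₄) * y ^ 3 * ψ y + -N * ψ y := by
      field_simp
      ring
    rw [e]
    have hN : |N| ≤ Cf * (y ^ 2 * (|w y| ^ 2 + |a| * |w y|)) := by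
      refine af.trans (le_of_eq ?_)
      rw [abs_mul, abs_mul, abs_of_pos hy]; ring
    have hy3 : y ^ 3 ≤ X ^ 3 := by gcongr; linarith
    have hy2 : y ^ 2 ≤ X ^ 3 := (by gcongr; linarith : y ^ 2 ≤ X ^ 2).trans (pow_le_pow_right₀ hX1 (by norm_num))
    set κ' := 3 + 2 * m + k₁ + k₂ + k₃ + k₄
    have up : ∀ k, 3 + k ≤ κ' → X ^ 3 * (1 + y) ^ k ≤ X ^ κ' := fun k hk => by
      calc X ^ 3 * (1 + y) ^ k ≤ X ^ 3 * X ^ k := by gcongr; linarith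
        _ = X ^ (3 + k) := by rw [pow_add X]
        _ ≤ _ := pow_le_pow_right₀ hX1 hk
    set S := (μ + par b 1) * η + μ * par b 1 + par b 1 ^ (L + 3) + η ^ 2
    have hbη : 0 ≤ par b 1 * η := by positivity
    have hμη : 0 ≤ μ * η := by positivity
    have hμb : 0 ≤ μ * par b 1 := by positivity
    have hbL : 0 ≤ par b 1 ^ (L + 3) := by positivity
    have hη2 : 0 ≤ η ^ 2 := by positivity
    have t2 : |m₀ * P₂| * X ^ 3 ≤ C₂ * (X ^ κ' * S) := by
      rw [abs_mul]
      calc |m₀| * |P₂| * X ^ 3 ≤ μ * (C₂ * par b 1 * (1 + y) ^ k₂) * X ^ 3 := by gcongr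
        _ = C₂ * ((X ^ 3 * (1 + y) ^ k₂) * (μ * par b 1)) := by ring
        _ ≤ C₂ * (X ^ κ' * S) := by
          gcongr
          · exact up k₂ (by omega)
          · simp only [S]; linarith
    have t3 : |-P₃| * X ^ 3 ≤ C₃ * (X ^ κ' * S) := by
      rw [abs_neg]
      calc |P₃| * X ^ 3 ≤ μ * (C₃ * par b 1 * (1 + y) ^ k₃) * X ^ 3 := by gcongr
        _ = C₃ * ((X ^ 3 * (1 + y) ^ k₃) * (μ * par b 1)) := by ring
        _ ≤ C₃ * (X ^ κ' * S) := by
          gcongr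
          · exact up k₃ (by omega)
          · simp only [S]; linarith
    have t4 : |P₄| * X ^ 3 ≤ C₄ * (X ^ κ' * S) := by
      calc |P₄| * X ^ 3 ≤ (C₄ * par b 1 ^ (L + 3) * (1 + y) ^ k₄) * X ^ 3 := by gcongr
        _ = C₄ * ((X ^ 3 * (1 + y) ^ k₄) * par b 1 ^ (L + 3)) := by ring
        _ ≤ C₄ * (X ^ κ' * S) := by
          gcongr
          · exact up k₄ (by omega)
          · simp only [S]; linarith
    have t5 : |-N| ≤ (Cf + Cf * C₁) * (X ^ κ' * S) := by
      rw [abs_neg]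
      calc |N| ≤ Cf * (y ^ 2 * (|w y| ^ 2 + |a| * |w y|)) := hN
        _ ≤ Cf * (X ^ 3 * ((η * (1 + y) ^ m) ^ 2 + (C₁ * par b 1 * (1 + y) ^ k₁) * (η * (1 + y) ^ m))) := by
          gcongr
        _ = Cf * ((X ^ 3 * (1 + y) ^ (2 * m)) * η ^ 2)
            + Cf * C₁ * ((X ^ 3 * (1 + y) ^ (k₁ + m)) * (par b 1 * η)) := by
          rw [pow_add (1 + y), two_mul, pow_add (1 + y)]; ring
        _ ≤ Cf * (X ^ κ' * S) + Cf * C₁ * (X ^ κ' * S) := by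
          gcongr
          · exact up _ (by omega)
          · simp only [S]; linarith
          · exact up _ (by omega)
          · simp only [S]; linarith
        _ = _ := by ring
    refine (abs_add_le _ _).trans ?_
    rw [abs_mul, abs_mul, abs_mul, abs_of_pos (pow_pos hy 3)]
    calc _ ≤ (|m₀ * P₂| + |-P₃| + |P₄|) * X ^ 3 * ρ + |-N| * ρ := by
          gcongr
          exact abs_add_three _ _ _
      _ = (|m₀ * P₂| * X ^ 3 + |-P₃| * X ^ 3 + |P₄| * X ^ 3 + |-N|) * ρ := by ring
      _ ≤ (C₂ * (X ^ κ' * S) + C₃ * (X ^ κ' * S) + C₄ * (X ^ κ' * S) + (Cf + Cf * C₁) * (X ^ κ' * S)) * ρ := by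
          gcongr
      _ = _ := by ring
  set S := (μ + par b 1) * η + μ * par b 1 + par b 1 ^ (L + 3) + η ^ 2 with hS
  have hS0 : 0 ≤ S := by positivity
  have hI1 := intervalIntegral.norm_integral_le_of_norm_le_const (a := 0) (b := r)
    (f := fun y => G y * ψ y * y ^ 2 - (-(HR V w y * ψ y * y ^ 3) + m₀ * (q y * ψ y * y ^ 3)
        - ∑ j : Fin L, mp j * (TR q p (j + 1) y * ψ y * y ^ 3) + (m₀ - par b 1) * (LR w y * ψ y * y ^ 3)))
    fun y hy => by
      rw [uIoc_of_le hr0.le] at hy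
      exact hsplit y hy.1 hy.2
  have hI2 := intervalIntegral.norm_integral_le_of_norm_le_const (a := 0) (b := r)
    (f := fun y => w y * (3 * ψ y + y * deriv ψ y) * y ^ 3) (C := η * X ^ m * (4 * ρ) * X ^ 3)
    fun y hy => by
      rw [uIoc_of_le hr0.le] at hy
      have hψ2 := hψb y hy.1.le hy.2
      have hyX : y ≤ X := by linarith [hy.2]
      rw [Real.norm_eq_abs, abs_mul, abs_mul, abs_of_pos (pow_pos hy.1 3)]
      have e1 : |3 * ψ y + y * deriv ψ y| ≤ 4 * ρ := by
        refine (abs_add_le _ _).trans ?_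
        rw [abs_mul, abs_of_pos (show (0 : ℝ) < 3 by norm_num)]
        linarith [hψ2.1, hψ2.2]
      have e2 : |w y| ≤ η * X ^ m := (hwb y hy.1 hy.2).trans (mul_le_mul_of_nonneg_left (hpow m hy.1 hy.2) hη)
      have := hy.1
      gcongr
  rw [hint, Real.norm_eq_abs, sub_zero, abs_of_pos hr0] at hI1
  rw [Real.norm_eq_abs, sub_zero, abs_of_pos hr0] at hI2
  generalize (∫ y in (0 : ℝ)..r, w y * (3 * ψ y + y * deriv ψ y) * y ^ 3) = I₂ at *
  generalize (∫ y in (0 : ℝ)..r, G y * ψ y * y ^ 2) - (-(∫ y in (0 : ℝ)..r, w y * HR V ψ y * y ^ 3)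
        + m₀ * (∫ y in (0 : ℝ)..r, q y * ψ y * y ^ 3)
        - ∑ j : Fin L, mp j * ∫ y in (0 : ℝ)..r, TR q p (j + 1) y * ψ y * y ^ 3) = I₁ at *
  have hm : |m₀ - par b 1| ≤ μ + par b 1 := by
    refine (abs_sub _ _).trans ?_
    rw [abs_of_pos hb0]; linarith
  have hI3 : |(m₀ - par b 1) * I₂| ≤ 4 * (X ^ κ * ρ * S) := by
    rw [abs_mul]
    calc _ ≤ (μ + par b 1) * (η * X ^ m * (4 * ρ) * X ^ 3 * X) := by
          gcongr
          exact hI2.trans (by gcongr; linarith)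
      _ = 4 * (X ^ (m + 4) * ρ * ((μ + par b 1) * η)) := by rw [pow_add X]; ring
      _ ≤ 4 * (X ^ κ * ρ * S) := by
          have : (μ + par b 1) * η ≤ S := by
            have h1 : 0 ≤ μ * par b 1 := by positivity
            have h2 : 0 ≤ par b 1 ^ (L + 3) := by positivity
            have h3 : 0 ≤ η ^ 2 := by positivity
            rw [hS]; linarith
          gcongr
          omega
  have hI4 : |I₁ + (m₀ - par b 1) * I₂| ≤ (C₂ + C₃ + C₄ + Cf + Cf * C₁) * (X ^ κ * ρ * S) := by
    refine hI1.trans ?_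
    have : X ^ κ = X ^ (3 + 2 * m + k₁ + k₂ + k₃ + k₄) * X := by rw [← pow_succ]; congr 1; omega
    rw [this]
    calc _ ≤ (C₂ + C₃ + C₄ + Cf + Cf * C₁) * (X ^ (3 + 2 * m + k₁ + k₂ + k₃ + k₄) * ρ * S) * X := by
          gcongr; linarith
      _ = _ := by ring
  calc |I₁| = |(I₁ + (m₀ - par b 1) * I₂) + -((m₀ - par b 1) * I₂)| := by congr 1; ring
    _ ≤ |I₁ + (m₀ - par b 1) * I₂| + |(m₀ - par b 1) * I₂| := by
      refine (abs_add_le _ _).trans ?_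
      rw [abs_neg]
    _ ≤ (C₂ + C₃ + C₄ + Cf + Cf * C₁) * (X ^ κ * ρ * S) + 4 * (X ^ κ * ρ * S) := add_le_add hI4 hI3
    _ = _ := by ring

end Reduced

/-! ### Time derivatives of pairings and the logarithmic norm of the cut-off ΛQ. -/

/-- Differentiation of a pairing of time dependent functions. -/
theorem hasDerivWithinAt_integral_mul {D : Set ℝ} (hD : Convex ℝ D) {t : ℝ} (ht : t ∈ D)
    {e E f f' : ℝ → ℝ → ℝ} {r : ℝ}
    (he : ContinuousOn (Function.uncurry e) (D ×ˢ univ)) (hE : ContinuousOn (Function.uncurry E) (D ×ˢ univ))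
    (hf : ContinuousOn (Function.uncurry f) (D ×ˢ univ)) (hf' : ContinuousOn (Function.uncurry f') (D ×ˢ univ))
    (he' : ∀ t ∈ D, ∀ y, HasDerivWithinAt (fun τ => e τ y) (E t y) D t)
    (hff' : ∀ t ∈ D, ∀ y, HasDerivWithinAt (fun τ => f τ y) (f' t y) D t) :
    HasDerivWithinAt (fun τ => ∫ y in (0 : ℝ)..r, e τ y * f τ y * y ^ 2)
      ((∫ y in (0 : ℝ)..r, E t y * f t y * y ^ 2) + ∫ y in (0 : ℝ)..r, e t y * f' t y * y ^ 2) D t := by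
  have hs : ∀ {k : ℝ → ℝ → ℝ}, ContinuousOn (Function.uncurry k) (D ×ˢ univ) → ∀ t ∈ D, Continuous (k t) :=
    fun hk t ht => continuousOn_univ.1 (hk.comp (f := fun y => (t, y)) (by fun_prop) fun y _ => ⟨ht, mem_univ _⟩)
  have c1 := hs he
  have c2 := hs hf
  have c3 := hs hE t ht
  have c4 := hs hf' t ht
  have c5 := c1 t ht
  have c6 := c2 t ht
  have hsub : D ×ˢ uIcc 0 r ⊆ D ×ˢ (univ : Set ℝ) := prod_mono_right (subset_univ _)
  have key := hasDerivWithinAt_integral (F := fun τ y => e τ y * f τ y * y ^ 2)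
    (F' := fun τ y => E τ y * f τ y * y ^ 2 + e τ y * f' τ y * y ^ 2) hD ht (a := 0) (b := r)
    (fun τ hτ => by
      have := c1 τ hτ
      have := c2 τ hτ
      exact Continuous.continuousOn (by fun_prop))
    (fun τ hτ y _ => (((he' τ hτ y).mul (hff' τ hτ y)).mul_const (y ^ 2)).congr_deriv (by ring)) (by
      have hy : ContinuousOn (fun z : ℝ × ℝ => z.2 ^ 2) (D ×ˢ uIcc 0 r) := by fun_prop
      exact (((hE.mono hsub).mul (hf.mono hsub)).mul hy).add (((he.mono hsub).mul (hf'.mono hsub)).mul hy))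
  refine key.congr_deriv (intervalIntegral.integral_add ?_ ?_)
  · exact Continuous.intervalIntegrable (by fun_prop) _ _
  · exact Continuous.intervalIntegrable (by fun_prop) _ _

namespace Reduced
variable {g Q Q₀ q p V : ℝ → ℝ} (hR : Reduced g Q Q₀ q p V)
include hR

theorem exists_abs_q_sq_sub_le : ∃ D, 0 ≤ D ∧ ∀ y, 1 ≤ y → |q y * q y * y ^ 3 - 4 * (1 / y)| ≤ D / y ^ 2 := by
  obtain ⟨C, hC⟩ := hR.asymp
  obtain ⟨C', hC', h'⟩ := hR.exists_sq_mul_le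
  refine ⟨|C| * (C' + 2), by positivity, fun y hy => ?_⟩
  have hy0 : 0 < y := by linarith
  have h1 : |y ^ 2 * q y - 2| ≤ |C| / y := (hC y hy).trans (by gcongr; exact le_abs_self C)
  have hq := hR.q_pos y
  have h2 : |y ^ 2 * q y + 2| ≤ C' + 2 := by
    rw [abs_of_pos (by positivity)]; linarith [h' y hy0]
  have e : q y * q y * y ^ 3 - 4 * (1 / y) = (y ^ 2 * q y - 2) * (y ^ 2 * q y + 2) / y := by
    field_simp; ring
  rw [e, abs_div, abs_mul, abs_of_pos hy0, div_le_div_iff₀ hy0 (by positivity)]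
  calc |y ^ 2 * q y - 2| * |y ^ 2 * q y + 2| * y ^ 2 ≤ (|C| / y) * (C' + 2) * y ^ 2 := by gcongr
    _ = |C| * (C' + 2) * y := by field_simp

variable {χ : ℝ → ℝ} (hχ : IsCutoff χ)
include hχ

/-- The logarithmic divergence of the cut-off norm of `ΛQ`. -/
theorem exists_abs_integral_cut_sub_log_le : ∃ C, 0 ≤ C ∧ ∀ B, 1 ≤ B → ∀ r, 2 * B ≤ r →
    |(∫ y in (0 : ℝ)..r, q y * (evenCut χ B y * q y) * y ^ 3) - 4 * Real.log B| ≤ C := by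
  obtain ⟨D, hD, hD'⟩ := hR.exists_abs_q_sq_sub_le
  obtain ⟨C', hC', h'⟩ := hR.exists_sq_mul_le
  have cq := hR.q_even.continuous
  refine ⟨|∫ y in (0 : ℝ)..1, q y * q y * y ^ 3| + D + C' ^ 2, by positivity, fun B hB r hr => ?_⟩
  have hB0 : 0 < B := by linarith
  have cc := (hχ.evenCut_even B).continuous
  have hint : ∀ a b, IntervalIntegrable (fun y => q y * (evenCut χ B y * q y) * y ^ 3) volume a b := fun a b =>
    Continuous.intervalIntegrable (by fun_prop) _ _
  have s1 : ∫ y in (0 : ℝ)..1, q y * (evenCut χ B y * q y) * y ^ 3 = ∫ y in (0 : ℝ)..1, q y * q y * y ^ 3 := by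
    refine intervalIntegral.integral_congr fun y hy => ?_
    rw [uIcc_of_le zero_le_one] at hy
    simp only [hχ.evenCut_one hB0 (show |y| ≤ B by rw [abs_of_nonneg hy.1]; linarith [hy.2]), one_mul]
  -- The logarithm comes from this zone alone: the cut-off is 1, the integrand is 4/y + O(1/y²), and
  -- the correction is integrable uniformly in B.
  have s2 : |(∫ y in (1 : ℝ)..B, q y * (evenCut χ B y * q y) * y ^ 3) - 4 * Real.log B| ≤ D := by
    have hi4 : IntervalIntegrable (fun y : ℝ => 4 * (1 / y)) volume 1 B := by
      refine ContinuousOn.intervalIntegrable ?_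
      rw [uIcc_of_le hB]
      exact continuousOn_const.mul (continuousOn_const.div continuousOn_id fun y hy =>
        (one_pos.trans_le hy.1).ne')
    have e1 : 4 * Real.log B = ∫ y in (1 : ℝ)..B, 4 * (1 / y) := by
      rw [intervalIntegral.integral_const_mul, integral_one_div_of_pos one_pos hB0, div_one]
    have hF : ∀ y ∈ uIcc 1 B, HasDerivAt (fun y : ℝ => -D * y⁻¹) (D / y ^ 2) y := fun y hy => by
      rw [uIcc_of_le hB] at hy
      have hy0 : y ≠ 0 := by linarith [hy.1]
      exact ((hasDerivAt_inv hy0).const_mul (-D)).congr_deriv (by field_simp)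
    have hiD : IntervalIntegrable (fun y : ℝ => D / y ^ 2) volume 1 B := by
      refine ContinuousOn.intervalIntegrable ?_
      rw [uIcc_of_le hB]
      exact continuousOn_const.div (by fun_prop) fun y hy => by
        have : 0 < y := by linarith [hy.1]
        positivity
    rw [e1, ← intervalIntegral.integral_sub (hint _ _) hi4]
    have := intervalIntegral.norm_integral_le_of_norm_le (μ := volume) hB
      (f := fun y => q y * (evenCut χ B y * q y) * y ^ 3 - 4 * (1 / y)) (g := fun y => D / y ^ 2)
      (Eventually.of_forall fun y hy => by
        rw [hχ.evenCut_one hB0 (show |y| ≤ B by rw [abs_of_pos (by linarith [hy.1])]; exact hy.2), one_mul]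
        exact hD' y hy.1.le) hiD
    rw [intervalIntegral.integral_eq_sub_of_hasDerivAt hF hiD] at this
    refine this.trans ?_
    have : 0 ≤ D * B⁻¹ := by positivity
    simp only [inv_one, mul_one]
    linarith
  have s3 : |∫ y in B..(2 * B), q y * (evenCut χ B y * q y) * y ^ 3| ≤ C' ^ 2 := by
    have := intervalIntegral.norm_integral_le_of_norm_le_const (a := B) (b := 2 * B)
      (f := fun y => q y * (evenCut χ B y * q y) * y ^ 3) (C := C' ^ 2 / B) fun y hy => by
        rw [uIoc_of_le (by linarith)] at hy
        have hy0 : 0 < y := by linarith [hy.1]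
        have hq := hR.q_pos y
        have h1 := hχ.evenCut_nonneg B y
        have h2 := hχ.evenCut_le_one B y
        have h3 := h' y hy0
        rw [Real.norm_eq_abs, abs_of_nonneg (by positivity)]
        calc q y * (evenCut χ B y * q y) * y ^ 3 ≤ q y * (1 * q y) * y ^ 3 := by gcongr
          _ = (y ^ 2 * q y) ^ 2 / y := by field_simp
          _ ≤ C' ^ 2 / B := by
            have := hy.1.le
            gcongr
    rw [show 2 * B - B = B by ring, abs_of_pos hB0, div_mul_cancel₀ _ hB0.ne'] at this
    exact this
  have s4 : ∫ y in (2 * B)..r, q y * (evenCut χ B y * q y) * y ^ 3 = 0 := by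
    rw [← intervalIntegral.integral_zero (a := 2 * B) (b := r) (μ := volume)]
    refine intervalIntegral.integral_congr fun y hy => ?_
    rw [uIcc_of_le hr] at hy
    simp only [hχ.evenCut_zero hB0 hy.1]; ring
  have e := intervalIntegral.integral_add_adjacent_intervals (hint 0 1) (hint 1 B)
  have e' := intervalIntegral.integral_add_adjacent_intervals (hint 0 B) (hint B (2 * B))
  have e'' := intervalIntegral.integral_add_adjacent_intervals (hint 0 (2 * B)) (hint (2 * B) r)
  rw [← e'', ← e', ← e, s1, s4]
  rw [abs_le] at *
  have a1 := neg_abs_le (∫ y in (0 : ℝ)..1, q y * q y * y ^ 3)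
  have a2 := le_abs_self (∫ y in (0 : ℝ)..1, q y * q y * y ^ 3)
  constructor <;> linarith [s2.1, s2.2, s3.1, s3.2]

theorem integral_cut_sq_le {B r : ℝ} (hr : 0 ≤ r) :
    ∫ y in (0 : ℝ)..r, (evenCut χ B y * q y) ^ 2 * y ^ 3
      ≤ ∫ y in (0 : ℝ)..r, q y * (evenCut χ B y * q y) * y ^ 3 := by
  have cq := hR.q_even.continuous
  have cc := (hχ.evenCut_even B).continuous
  refine intervalIntegral.integral_mono_on hr (Continuous.intervalIntegrable (by fun_prop) _ _)
    (Continuous.intervalIntegrable (by fun_prop) _ _) fun y hy => ?_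
  have h1 := hχ.evenCut_nonneg B y
  have h2 := hχ.evenCut_le_one B y
  have hq := hR.q_pos y
  have hy0 := hy.1
  calc (evenCut χ B y * q y) ^ 2 * y ^ 3 = evenCut χ B y * (q y * (evenCut χ B y * q y) * y ^ 3) := by ring
    _ ≤ 1 * (q y * (evenCut χ B y * q y) * y ^ 3) := by gcongr
    _ = _ := one_mul _

end Reduced

/-! ### Control of the modulation defects. -/

/-- The right-hand side of the evolution equation of the remainder `y w`. -/
noncomputable def remRHS (g Q χ q p V : ℝ → ℝ) {L : ℕ} (F : ℕ → (Fin L → ℝ) → ℝ → ℝ)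
    (F' : ℕ → Fin L → (Fin L → ℝ) → ℝ → ℝ) (b : Fin L → ℝ) (w : ℝ → ℝ) (m₀ : ℝ) (mp : Fin L → ℝ) (y : ℝ) : ℝ :=
  y * (-HR V w y + m₀ * q y - ∑ j, mp j * alphaR' q p F' j b y + (m₀ - par b 1) * LR w y
        + m₀ * LR (alphaR q p F b) y
        + (-par b 1 * (q y + LR (alphaR q p F b) y) - HR V (alphaR q p F b) y
          + ∑ j : Fin L, modR Q χ j b * alphaR' q p F' j b y
          - (nonlin g (Q y + y * alphaR q p F b y) - nonlin g (Q y)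
            - deriv (nonlin g) (Q y) * (y * alphaR q p F b y)) / y ^ 3)
        - (nonlin g (Q y + y * (alphaR q p F b y + w y)) - nonlin g (Q y + y * alphaR q p F b y)
            - deriv (nonlin g) (Q y) * (y * w y)) / y ^ 3)

theorem exists_test_bound {ψ : ℝ → ℝ} (hψ : SmoothEven ψ) (r : ℝ) : ∃ ρ, 0 ≤ ρ ∧
    ∀ y, 0 ≤ y → y ≤ r → |ψ y| ≤ ρ ∧ |y * deriv ψ y| ≤ ρ := by
  have c1 := hψ.continuous
  have c2 := hψ.deriv.smooth.continuous
  obtain ⟨C₁, h₁⟩ := (isCompact_Icc (a := 0) (b := r)).exists_bound_of_continuousOn c1.continuousOn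
  obtain ⟨C₂, h₂⟩ := (isCompact_Icc (a := 0) (b := r)).exists_bound_of_continuousOn
    (by fun_prop : Continuous fun y => y * deriv ψ y).continuousOn
  exact ⟨max 0 (max C₁ C₂), le_max_left _ _, fun y h1 h2 =>
    ⟨(h₁ y ⟨h1, h2⟩).trans ((le_max_left _ _).trans (le_max_right _ _)),
      (h₂ y ⟨h1, h2⟩).trans ((le_max_right _ _).trans (le_max_right _ _))⟩⟩

namespace Reduced
variable {g Q Q₀ q p V : ℝ → ℝ} (hR : Reduced g Q Q₀ q p V)
  {χ : ℝ → ℝ} (hχ : IsCutoff χ) {L : ℕ} {W : ℕ → ℝ → ℝ} (hW : TaylorData g Q W)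
  {F : ℕ → (Fin L → ℝ) → ℝ → ℝ} {F' : ℕ → Fin L → (Fin L → ℝ) → ℝ → ℝ}
  (hF : ∀ k, SymFamily Q χ k (F k) (F' k)) (h : ∀ k, ProfileRep g Q χ k (F k) (F' k))
include hR hF hχ h hW

/-- The orthogonality conditions control the defects in the modulation equations. -/
theorem exists_modulation_bound (hg : IsTargetProfile g) {A : ℝ} (hA : 0 ≤ A) (m : ℕ) {M : ℝ} (hM : 1 ≤ M) :
    ∃ C β : ℝ, 0 ≤ C ∧ 0 < β ∧
    ∀ (b : Fin L → ℝ) (w G : ℝ → ℝ) (m₀ : ℝ) (mp : Fin L → ℝ) (η : ℝ), Admissible A b →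
      SmoothEven w → 2 * M < B0 (par b 1) / 4 → 0 ≤ η → η ≤ β → par b 1 ≤ β →
      (∀ y, 0 < y → y ≤ 2 * M → |w y| ≤ η * (1 + y) ^ m) → ContinuousOn G (Icc 0 (2 * M)) →
      (∀ y, 0 < y → y ≤ 2 * M → G y = remRHS g Q χ q p V F F' b w m₀ mp y) →
      (∀ k ≤ L, ∫ y in (0 : ℝ)..(2 * M), G y * (HR V)^[k] (PhiR g Q χ q V L M) y * y ^ 2 = 0) →
      |m₀| + ∑ j, |mp j| ≤ C * (η + par b 1 ^ (L + 3)) := by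
  obtain ⟨C, κ, hC, hT⟩ := hR.exists_testing_bound hχ hW hF h hg hA m
  have hM0 : 0 < M := by linarith
  set ψ : ℕ → ℝ → ℝ := fun k => (HR V)^[k] (PhiR g Q χ q V L M) with hψdef
  have hψ : ∀ k, SmoothEven (ψ k) := fun k => hR.smoothEven_HR_iter (hR.smoothEven_PhiR hχ L) k
  have hψ0 : ∀ k y, 2 * M ≤ y → ψ k y = 0 := fun k =>
    hR.HR_iter_eq_zero (hR.smoothEven_PhiR hχ L) (by linarith) (hR.PhiR_eq_zero hχ hM0 L) k
  choose ρ hρ0 hρ using fun k => exists_test_bound (hψ k) (2 * M)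
  choose ρ' hρ'0 hρ' using fun k => exists_test_bound (hR.V_even.HR (hψ k)) (2 * M)
  set a := ∫ y in (0 : ℝ)..(2 * M), evenCut χ M y * q y * q y * y ^ 3 with ha
  have ha0 : 0 < a := hR.integral_cut_pos hχ hM0
  set ρs := ∑ k ∈ Finset.range (L + 1), ρ k with hρs
  set D := ∑ k ∈ Finset.range (L + 1), (1 + 2 * M) ^ m * ρ' k * (2 * M) ^ 3 * (2 * M) with hD
  have hρs0 : 0 ≤ ρs := Finset.sum_nonneg fun k _ => hρ0 k
  have hD0 : 0 ≤ D := Finset.sum_nonneg fun k _ => by have := hρ'0 k; positivity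
  set R := C * (1 + 2 * M) ^ κ * ρs with hRdef
  have hR0 : 0 ≤ R := by positivity
  -- The smallness makes R(η + b_1) ≤ a/2, so the part of the error proportional to the defects
  -- themselves can be absorbed in the left-hand side.
  refine ⟨2 * (D + 2 * R) / a, min 1 (a / (4 * (R + 1))), by positivity, by positivity, ?_⟩
  intro b w G m₀ mp η hb hw hMB hη hηβ hbβ hwb hG hGeq horth
  set μ := |m₀| + ∑ j, |mp j| with hμ
  have hμ0 : 0 ≤ μ := by positivity
  have hb0 := hb.pos
  set Z := (μ + par b 1) * η + μ * par b 1 + par b 1 ^ (L + 3) + η ^ 2 with hZ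
  have hZ0 : 0 ≤ Z := by positivity
  have cw := hw.continuous
  have hbound : ∀ k ≤ L, |-(∫ y in (0 : ℝ)..(2 * M), w y * HR V (ψ k) y * y ^ 3)
      + m₀ * (∫ y in (0 : ℝ)..(2 * M), q y * ψ k y * y ^ 3)
      - ∑ j : Fin L, mp j * ∫ y in (0 : ℝ)..(2 * M), TR q p (j + 1) y * ψ k y * y ^ 3|
      ≤ C * (1 + 2 * M) ^ κ * ρ k * Z := fun k hk => by
    have := hT b w (ψ k) G m₀ mp (2 * M) (ρ k) η hb hw (hψ k) (hψ0 k) (by linarith) hMB (hρ0 k) hη hwb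
      (hρ k) hG hGeq
    rwa [horth k hk, zero_sub, abs_neg] at this
  have hI : ∀ k, |∫ y in (0 : ℝ)..(2 * M), w y * HR V (ψ k) y * y ^ 3|
      ≤ (1 + 2 * M) ^ m * ρ' k * (2 * M) ^ 3 * (2 * M) * η := fun k => by
    have := intervalIntegral.norm_integral_le_of_norm_le_const (a := 0) (b := 2 * M)
      (f := fun y => w y * HR V (ψ k) y * y ^ 3) (C := η * (1 + 2 * M) ^ m * ρ' k * (2 * M) ^ 3) fun y hy => by
        rw [uIoc_of_le (by linarith)] at hy
        have h1 := hwb y hy.1 hy.2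
        have h2 := (hρ' k y hy.1.le hy.2).1
        have hy0 := hy.1.le
        have hy2 := hy.2
        rw [Real.norm_eq_abs, abs_mul, abs_mul, abs_of_nonneg (by positivity : 0 ≤ y ^ 3)]
        calc |w y| * |HR V (ψ k) y| * y ^ 3 ≤ (η * (1 + y) ^ m) * ρ' k * y ^ 3 := by gcongr
          _ ≤ _ := by
            have := hρ'0 k
            gcongr
    rw [sub_zero, abs_of_pos (by linarith : (0:ℝ) < 2 * M), Real.norm_eq_abs] at this
    linarith
  have hq0 : TR q p 0 = q := by ext y; simp [TR]
  have hqψ : ∀ k, ∫ y in (0 : ℝ)..(2 * M), q y * ψ k y * y ^ 3 = if 0 = k then (-1) ^ k * a else 0 := fun k => by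
    have := hR.integral_TR_mul_HR_iter_PhiR hχ hM0 (L := L) (j := 0) (k := k) (Nat.zero_le _)
    rwa [hq0] at this
  have hTψ : ∀ k (j : Fin L), ∫ y in (0 : ℝ)..(2 * M), TR q p (j + 1) y * ψ k y * y ^ 3
      = if (j : ℕ) + 1 = k then (-1) ^ k * a else 0 := fun k j =>
    hR.integral_TR_mul_HR_iter_PhiR hχ hM0 (L := L) (j := j + 1) (k := k) (by omega)
  -- By duality the direction with k = 0 isolates the scaling defect, and the one with k = j the
  -- defect of b_j: the system is diagonal.
  have c0 : |m₀| * a ≤ (1 + 2 * M) ^ m * ρ' 0 * (2 * M) ^ 3 * (2 * M) * η + C * (1 + 2 * M) ^ κ * ρ 0 * Z := by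
    have := hbound 0 (Nat.zero_le _)
    simp only [hqψ, hTψ, Nat.add_eq_zero_iff, one_ne_zero, and_false, if_false, mul_zero,
      Finset.sum_const_zero, sub_zero, if_true, pow_zero, one_mul] at this
    have h2 := hI 0
    rw [← abs_of_pos ha0, ← abs_mul]
    rw [abs_le] at this h2
    rw [abs_le]
    constructor <;> linarith [this.1, this.2, h2.1, h2.2]
  have ci : ∀ i : Fin L, |mp i| * a ≤ (1 + 2 * M) ^ m * ρ' (i + 1) * (2 * M) ^ 3 * (2 * M) * η
      + C * (1 + 2 * M) ^ κ * ρ (i + 1) * Z := fun i => by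
    have := hbound (i + 1) i.2
    simp only [hqψ, hTψ, (Nat.succ_ne_zero _).symm, if_false, mul_zero, add_zero,
      Nat.add_right_cancel_iff, Fin.val_inj, mul_ite, Finset.sum_ite_eq', Finset.mem_univ, if_true] at this
    have h2 := hI (i + 1)
    have e : |mp i| * a = |mp i * ((-1) ^ ((i : ℕ) + 1) * a)| := by
      rw [abs_mul, abs_mul, abs_neg_one_pow, one_mul, abs_of_pos ha0]
    rw [e]
    rw [abs_le] at this h2
    rw [abs_le]
    constructor <;> linarith [this.1, this.2, h2.1, h2.2]
  have hsum : μ * a ≤ D * η + R * Z := by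
    have e : D * η + R * Z = ∑ k ∈ Finset.range (L + 1), ((1 + 2 * M) ^ m * ρ' k * (2 * M) ^ 3 * (2 * M) * η
        + C * (1 + 2 * M) ^ κ * ρ k * Z) := by
      rw [Finset.sum_add_distrib, hD, hRdef, hρs, Finset.sum_mul, Finset.mul_sum, Finset.sum_mul]
    rw [e, Finset.sum_range_succ', hμ, add_mul, Finset.sum_mul, add_comm]
    refine add_le_add ?_ c0
    rw [← Fin.sum_univ_eq_sum_range (fun k => (1 + 2 * M) ^ m * ρ' (k + 1) * (2 * M) ^ 3 * (2 * M) * η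
        + C * (1 + 2 * M) ^ κ * ρ (k + 1) * Z)]
    exact Finset.sum_le_sum fun i _ => ci i
  have hη1 : η ≤ 1 := hηβ.trans (min_le_left _ _)
  have hη2 : η ≤ a / (4 * (R + 1)) := hηβ.trans (min_le_right _ _)
  have hb1 : par b 1 ≤ 1 := hb.le_one
  have hb2 : par b 1 ≤ a / (4 * (R + 1)) := hbβ.trans (min_le_right _ _)
  have k1 : R * (η + par b 1) ≤ a / 2 := by
    calc R * (η + par b 1) ≤ (R + 1) * (a / (4 * (R + 1)) + a / (4 * (R + 1))) := by gcongr; linarith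
      _ = a / 2 := by field_simp; ring
  have k2 : Z ≤ μ * (η + par b 1) + (2 * η + par b 1 ^ (L + 3)) := by
    rw [hZ]; nlinarith
  have hpow : 0 ≤ par b 1 ^ (L + 3) := by positivity
  have k3 : μ * a ≤ D * η + R * (2 * η + par b 1 ^ (L + 3)) + μ * (a / 2) := by
    calc μ * a ≤ D * η + R * (μ * (η + par b 1) + (2 * η + par b 1 ^ (L + 3))) := hsum.trans (by gcongr)
      _ = D * η + R * (2 * η + par b 1 ^ (L + 3)) + μ * (R * (η + par b 1)) := by ring
      _ ≤ _ := by gcongr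
  rw [div_mul_eq_mul_div, le_div_iff₀ ha0]
  nlinarith [mul_nonneg hD0 hpow, mul_nonneg hR0 hpow]

end Reduced

/-! ### Pairings with the localized direction H^L(χ_B ΛQ). -/

theorem abs_integral_mul_cut_le {w Z : ℝ → ℝ} {η C r : ℝ} {m k : ℕ} (hr : 0 ≤ r) (hη : 0 ≤ η) (hC : 0 ≤ C)
    (hw : ∀ y, 0 < y → y ≤ r → |w y| ≤ η * (1 + y) ^ m) (hZ : ∀ y, |Z y| ≤ C * (1 + |y|) ^ k) :
    |∫ y in (0 : ℝ)..r, y * w y * Z y * y ^ 2| ≤ C * (1 + r) ^ (m + k + 4) * η := by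
  have := intervalIntegral.norm_integral_le_of_norm_le_const (a := 0) (b := r)
    (f := fun y => y * w y * Z y * y ^ 2) (C := η * C * (1 + r) ^ (m + k + 3)) fun y hy => by
      rw [uIoc_of_le hr] at hy
      have h1 := hw y hy.1 hy.2
      have h2 := hZ y
      have hy0 := hy.1.le
      have hy2 : y ≤ 1 + r := by linarith [hy.2]
      have hy3 : 1 + y ≤ 1 + r := by linarith [hy.2]
      rw [abs_of_nonneg hy0] at h2
      rw [Real.norm_eq_abs, abs_mul, abs_mul, abs_mul, abs_of_nonneg hy0, abs_of_nonneg (sq_nonneg y)]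
      calc y * |w y| * |Z y| * y ^ 2 ≤ (1 + r) * (η * (1 + r) ^ m) * (C * (1 + r) ^ k) * (1 + r) ^ 2 := by
            have : η * (1 + y) ^ m ≤ η * (1 + r) ^ m := by gcongr
            have : C * (1 + y) ^ k ≤ C * (1 + r) ^ k := by gcongr
            gcongr
            · exact h1.trans ‹_›
            · exact h2.trans ‹_›
        _ = η * C * (1 + r) ^ (m + k + 3) := by ring
  rw [sub_zero, abs_of_nonneg hr, Real.norm_eq_abs] at this
  refine this.trans ?_
  calc η * C * (1 + r) ^ (m + k + 3) * r ≤ η * C * (1 + r) ^ (m + k + 3) * (1 + r) := by gcongr; linarith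
    _ = _ := by ring

namespace Reduced
variable {g Q Q₀ q p V : ℝ → ℝ} (hR : Reduced g Q Q₀ q p V)
  {χ : ℝ → ℝ} (hχ : IsCutoff χ)
include hR hχ

theorem integral_TR_mul_HR_iter_cut {B r : ℝ} (hB : 0 < B) (hr : 2 * B ≤ r) {j k : ℕ} (hj : j ≤ k) :
    ∫ y in (0 : ℝ)..r, TR q p j y * (HR V)^[k] (fun y => evenCut χ B y * q y) y * y ^ 3
      = if j = k then (-1) ^ k * ∫ y in (0 : ℝ)..r, q y * (evenCut χ B y * q y) * y ^ 3 else 0 := by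
  rw [← hR.integral_HR_iter_mul (hR.smoothEven_TR j) (hR.smoothEven_cut_q hχ B) (by linarith)
    (fun y hy => cut_q_zero hχ hB (hr.trans hy)), hR.HR_iter_TR]
  rcases hj.eq_or_lt with rfl | hj
  · simp only [le_refl, if_true, Nat.sub_self, mul_assoc, intervalIntegral.integral_const_mul]
    simp [TR]
  · simp [hj.not_ge, hj.ne]

variable {L : ℕ} {W : ℕ → ℝ → ℝ} (hW : TaylorData g Q W)
  {F : ℕ → (Fin L → ℝ) → ℝ → ℝ} {F' : ℕ → Fin L → (Fin L → ℝ) → ℝ → ℝ}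
  (hF : ∀ k, SymFamily Q χ k (F k) (F' k)) (h : ∀ k, ProfileRep g Q χ k (F k) (F' k))

/-- The one term where polynomial losses would be fatal. All L+1 powers of H are put on `w`, and
Cauchy–Schwarz against χ_B ΛQ loses only the square root of a logarithm. -/
theorem abs_integral_mul_HR_cut_le {w : ℝ → ℝ} (hw : SmoothEven w) {C B r η : ℝ} (hB : 1 ≤ B) (hr : 2 * B ≤ r)
    (hη : 0 ≤ η)
    (hI : |(∫ y in (0 : ℝ)..r, q y * (evenCut χ B y * q y) * y ^ 3) - 4 * Real.log B| ≤ C) {k : ℕ}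
    (hE : ∫ y in (0 : ℝ)..r, (HR V)^[k + 1] w y ^ 2 * y ^ 3 ≤ η ^ 2) :
    |∫ y in (0 : ℝ)..r, w y * HR V ((HR V)^[k] (fun y => evenCut χ B y * q y)) y * y ^ 3|
      ≤ η * √(4 * Real.log B + C) := by
  have hB0 : 0 < B := by linarith
  rw [← Function.iterate_succ_apply' (HR V) k, ← hR.integral_HR_iter_mul hw (hR.smoothEven_cut_q hχ B) (by linarith)
    (fun y hy => cut_q_zero hχ hB0 (hr.trans hy))]
  refine (abs_integral_mul_le (θ := fun y => y ^ 3) (by linarith) (hR.smoothEven_HR_iter hw _).continuous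
    (hR.smoothEven_cut_q hχ B).continuous (by fun_prop) fun y hy => by have := hy.1; positivity).trans ?_
  refine mul_le_mul (Real.sqrt_le_iff.2 ⟨hη, hE⟩) (Real.sqrt_le_sqrt ?_) (Real.sqrt_nonneg _) hη
  refine (hR.integral_cut_sq_le hχ (by linarith)).trans ?_
  linarith [(abs_le.1 hI).2]

include hF h hW

/-- The pairings of the remainder and of its time derivative with the localized direction. -/
theorem exists_localized_bound (hg : IsTargetProfile g) (hL : 1 ≤ L) {A : ℝ} (hA : 0 ≤ A) (m : ℕ)
    {Z Z' : ℝ → ℝ → ℝ} (hZ : CutForm Z) (hZ' : CutForm Z')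
    (hZeq : ∀ B, 0 < B → (HR V)^[L] (fun y => evenCut χ B y * q y) = Z B) :
    ∃ (C : ℝ) (n : ℕ), 0 ≤ C ∧
    ∀ (b : Fin L → ℝ) (w G : ℝ → ℝ) (m₀ : ℝ) (mp : Fin L → ℝ) (B η η' : ℝ), Admissible A b →
      SmoothEven w → 1 ≤ B → 3 * B < B0 (par b 1) / 4 → 0 ≤ η → 0 ≤ η' →
      (∀ y, 0 < y → y ≤ 3 * B → |w y| ≤ η' * (1 + y) ^ m) → ContinuousOn G (Icc 0 (3 * B)) →
      (∀ y, 0 < y → y ≤ 3 * B → G y = remRHS g Q χ q p V F F' b w m₀ mp y) →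
      ∫ y in (0 : ℝ)..(3 * B), (HR V)^[L + 1] w y ^ 2 * y ^ 3 ≤ η ^ 2 →
      |∫ y in (0 : ℝ)..(3 * B), y * w y * Z B y * y ^ 2| ≤ C * (1 + 3 * B) ^ n * η' ∧
      |∫ y in (0 : ℝ)..(3 * B), y * w y * Z' B y * y ^ 2| ≤ C * (1 + 3 * B) ^ n * η' ∧
      ∃ I, |I - 4 * Real.log B| ≤ C ∧
        |(∫ y in (0 : ℝ)..(3 * B), G y * Z B y * y ^ 2) + (-1) ^ L * mp ⟨L - 1, by omega⟩ * I|
        ≤ η * √(4 * Real.log B + C) + C * (1 + 3 * B) ^ n * ((|m₀| + ∑ j, |mp j| + par b 1) * η'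
          + (|m₀| + ∑ j, |mp j|) * par b 1 + par b 1 ^ (L + 3) + η' ^ 2) := by
  obtain ⟨Ct, κ, hCt, hT⟩ := hR.exists_testing_bound hχ hW hF h hg hA m
  obtain ⟨C₁, k₁, hC₁, h₁⟩ := hZ.exists_bound
  obtain ⟨C₂, k₂, hC₂, h₂⟩ := hZ'.exists_bound
  obtain ⟨Z₃, hZ₃, hZ₃'⟩ := hZ.euler
  obtain ⟨C₃, k₃, hC₃, h₃⟩ := hZ₃.exists_bound
  obtain ⟨C₄, hC₄, h₄⟩ := hR.exists_abs_integral_cut_sub_log_le hχ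
  refine ⟨C₁ + C₂ + C₄ + Ct * (C₁ + C₃), m + k₁ + k₂ + k₃ + κ + 4, by positivity, ?_⟩
  set C := C₁ + C₂ + C₄ + Ct * (C₁ + C₃)
  intro b w G m₀ mp B η η' hb hw hB hBB hη hη' hwb hG hGeq hE
  have hB0 : 0 < B := by linarith
  set X := 1 + 3 * B with hX
  have hX1 : 1 ≤ X := by linarith
  have hCt3 : 0 ≤ Ct * (C₁ + C₃) := by positivity
  refine ⟨?_, ?_, ∫ y in (0 : ℝ)..(3 * B), q y * (evenCut χ B y * q y) * y ^ 3,
    (h₄ B hB _ (by linarith)).trans (by linarith), ?_⟩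
  · refine (abs_integral_mul_cut_le (by linarith) hη' hC₁ hwb (h₁ B hB)).trans ?_
    exact mul_le_mul_of_nonneg_right (mul_le_mul (by linarith) (pow_le_pow_right₀ hX1 (by omega))
      (by positivity) (by positivity)) hη'
  · refine (abs_integral_mul_cut_le (by linarith) hη' hC₂ hwb (h₂ B hB)).trans ?_
    exact mul_le_mul_of_nonneg_right (mul_le_mul (by linarith) (pow_le_pow_right₀ hX1 (by omega))
      (by positivity) (by positivity)) hη'
  · have hψ : SmoothEven (Z B) := hZ.smoothEven B
    -- The radius 3B exceeds the support radius 2B strictly; the margin keeps the interval fixed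
    -- while B varies with time.
    have t1 := hT b w (Z B) G m₀ mp (3 * B) ((C₁ + C₃) * X ^ (k₁ + k₃)) η' hb hw hψ
      (fun y hy => hZ.eq_zero hB0 (by linarith)) (by linarith) hBB (by positivity) hη' hwb
      (fun y hy hy2 => by
        have e1 := h₁ B hB y
        have e3 := h₃ B hB y
        rw [← hZ₃' B hB0 y] at e3
        rw [abs_of_nonneg hy] at e1 e3
        have hyX : 1 + y ≤ X := by linarith
        constructor
        · refine e1.trans ?_
          gcongr ?_ * ?_
          · linarith
          · exact (pow_le_pow_left₀ (by linarith) hyX _).trans (pow_le_pow_right₀ hX1 (by omega))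
        · refine e3.trans ?_
          gcongr ?_ * ?_
          · linarith
          · exact (pow_le_pow_left₀ (by linarith) hyX _).trans (pow_le_pow_right₀ hX1 (by omega))) hG hGeq
    have hq : ∫ y in (0 : ℝ)..(3 * B), q y * Z B y * y ^ 3 = 0 := by
      have := hR.integral_TR_mul_HR_iter_cut hχ hB0 (r := 3 * B) (by linarith) (j := 0) (k := L) (Nat.zero_le _)
      rw [hZeq B hB0, if_neg (by omega)] at this
      simpa [TR] using this
    -- H^L kills T_1, …, T_{L-1}, so only the defect of b_L, of zero-based index L-1, is seen.
    have hS : ∑ j : Fin L, mp j * ∫ y in (0 : ℝ)..(3 * B), TR q p (j + 1) y * Z B y * y ^ 3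
        = (-1) ^ L * mp ⟨L - 1, by omega⟩ * ∫ y in (0 : ℝ)..(3 * B), q y * (evenCut χ B y * q y) * y ^ 3 := by
      rw [Finset.sum_eq_single ⟨L - 1, by omega⟩]
      · have := hR.integral_TR_mul_HR_iter_cut hχ hB0 (r := 3 * B) (by linarith) (j := L - 1 + 1) (k := L) (by omega)
        rw [hZeq B hB0, if_pos (by omega)] at this
        rw [this]; ring
      · intro j _ hj
        have hj' : (j : ℕ) + 1 ≠ L := fun e => hj (Fin.ext (by simp; omega))
        have := hR.integral_TR_mul_HR_iter_cut hχ hB0 (r := 3 * B) (by linarith) (j := j + 1) (k := L) (by omega)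
        rw [hZeq B hB0, if_neg hj'] at this
        rw [this, mul_zero]
      · simp
    rw [hq, hS, mul_zero, add_zero] at t1
    have t2 := hR.abs_integral_mul_HR_cut_le hχ hw hB (by linarith) hη (h₄ B hB (3 * B) (by linarith)) hE
    rw [hZeq B hB0] at t2
    have t3 : η * √(4 * Real.log B + C₄) ≤ η * √(4 * Real.log B + C) := by gcongr; linarith
    have hb0 := hb.pos
    have t4 : Ct * X ^ κ * ((C₁ + C₃) * X ^ (k₁ + k₃)) ≤ C * X ^ (m + k₁ + k₂ + k₃ + κ + 4) := by
      calc _ = Ct * (C₁ + C₃) * X ^ (k₁ + k₃ + κ) := by ring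
        _ ≤ _ := mul_le_mul (by linarith) (pow_le_pow_right₀ hX1 (by omega)) (by positivity) (by positivity)
    have t5 := mul_le_mul_of_nonneg_right t4 (by positivity :
      0 ≤ (|m₀| + ∑ j, |mp j| + par b 1) * η' + (|m₀| + ∑ j, |mp j|) * par b 1 + par b 1 ^ (L + 3) + η' ^ 2)
    rw [abs_le] at *
    constructor <;> linarith [t1.1, t1.2, t2.1, t2.2]

end Reduced

/-! ### The corrected parameter and its time derivative. -/

theorem B0_rpow {β : ℝ} (hβ : 0 < β) (δ : ℝ) : B0 β ^ (2 * δ) = β ^ (-δ) := by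
  rw [B0, one_div, Real.inv_rpow (Real.sqrt_nonneg β), Real.sqrt_eq_rpow, ← Real.rpow_mul hβ.le,
    Real.rpow_neg hβ.le]
  congr 2; ring

namespace Reduced
variable {g Q Q₀ q p V : ℝ → ℝ} (hR : Reduced g Q Q₀ q p V)
  {χ : ℝ → ℝ} (hχ : IsCutoff χ) {L : ℕ}
  {F : ℕ → (Fin L → ℝ) → ℝ → ℝ} {F' : ℕ → Fin L → (Fin L → ℝ) → ℝ → ℝ}
  (hF : ∀ k, SymFamily Q χ k (F k) (F' k)) (h : ∀ k, ProfileRep g Q χ k (F k) (F' k))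
  {P : Matrix (Fin L) (Fin L) ℝ} {M K s₀ T : ℝ} {u : ℝ → ℝ → ℝ} {b : ℝ → Fin L → ℝ} {lam : ℝ → ℝ}
  (hT : IsTrapped g Q χ P M K s₀ T u b lam)
  {Z Z' : ℝ → ℝ → ℝ} (hZ : CutForm Z)
  (hZeq : ∀ B, 0 < B → (HR V)^[L] (fun y => evenCut χ B y * q y) = Z B) {δ : ℝ}
include hR hF hχ h hT hZeq

/-- Moving H^L from ε to the test function leaves a pairing of the remainder itself, which can be
differentiated in time without high derivatives of ε. -/
theorem bTilde_eq {t r : ℝ} (ht : t ∈ Ico 0 T) (hb : 0 < par (b t) 1) (hb' : par (b t) 1 ≤ Real.exp (-1))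
    (hr : 2 * par (b t) 1 ^ (-δ) ≤ r) (hrB : r < B0 (par (b t) 1) / 4) :
    bTilde g Q χ δ u b lam t = par (b t) L + (-1) ^ L *
      (∫ y in (0 : ℝ)..r, y * remR Q₀ (alphaR q p F) u b lam t y * Z (par (b t) 1 ^ (-δ)) y * y ^ 2)
        / (4 * δ * -Real.log (par (b t) 1)) := by
  have hB : 0 < par (b t) 1 ^ (-δ) := Real.rpow_pos_of_pos hb _
  have hr0 : 0 < r := by linarith
  have hlog : Real.log (par (b t) 1) ≤ -1 := (Real.log_le_iff_le_exp hb).2 hb'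
  have hw := (eps_eq_of_smoothOdd (lam := lam) hR.Q₀_odd (hR.smoothEven_alphaR hF (b t)) (hT.smoothOdd ht)).1
  rw [bTilde, B0_rpow hb, abs_of_neg (by linarith),
    pair_eq_integral hr0 (fun y hy hyr => hR.H_iter_eq hw (R := r) (fun z hz hzr =>
      hR.eps_eq hχ hF h hT ht ⟨hb, hz, hzr.trans hrB⟩ hb') L hy hyr)
    (fun y hy => hR.cut_Lam_eq hχ hB hy) (fun y hy => cut_q_zero hχ hB (hr.trans hy)),
    hR.integral_HR_iter_mul hw (hR.smoothEven_cut_q hχ _) hr0 (fun y hy => cut_q_zero hχ hB (hr.trans hy)),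
    hZeq _ hB]
  congr 3
  exact intervalIntegral.integral_congr fun y _ => by ring

include hZ in
theorem hasDerivWithinAt_bTilde (hL : 1 ≤ L) (hδ : 0 < δ) (hZ' : CutForm Z')
    (hZd : ∀ B, 0 < B → ∀ y, HasDerivAt (fun B => Z B y) (B⁻¹ * Z' B y) B)
    (hb : ∀ t ∈ Ico 0 T, 0 < par (b t) 1) (hb' : ∀ t ∈ Ico 0 T, par (b t) 1 ≤ Real.exp (-1))
    {E : ℝ → ℝ → ℝ} (he : ContinuousOn (fun z : ℝ × ℝ => z.2 * remR Q₀ (alphaR q p F) u b lam z.1 z.2)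
      (Ico 0 T ×ˢ univ)) (hE : ContinuousOn (Function.uncurry E) (Ico 0 T ×ˢ univ))
    (hed : ∀ t ∈ Ico 0 T, ∀ y, HasDerivWithinAt (fun τ => y * remR Q₀ (alphaR q p F) u b lam τ y)
        (E t y) (Ico 0 T) t) {t r : ℝ} (ht : t ∈ Ico 0 T)
    (hr : 2 * par (b t) 1 ^ (-δ) < r) (hrB : r < B0 (par (b t) 1) / 4) {b₁' : ℝ}
    (hb₁' : b₁' = derivWithin (fun τ => b τ ⟨0, by omega⟩) (Ico 0 T) t) :
    HasDerivWithinAt (bTilde g Q χ δ u b lam) (derivWithin (fun τ => b τ ⟨L - 1, by omega⟩) (Ico 0 T) t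
      + (-1) ^ L * (((∫ y in (0 : ℝ)..r, E t y * Z (par (b t) 1 ^ (-δ)) y * y ^ 2)
        + (∫ y in (0 : ℝ)..r, y * remR Q₀ (alphaR q p F) u b lam t y * Z' (par (b t) 1 ^ (-δ)) y * y ^ 2)
          * (-δ * b₁' / par (b t) 1)) / (4 * δ * -Real.log (par (b t) 1))
        + (∫ y in (0 : ℝ)..r, y * remR Q₀ (alphaR q p F) u b lam t y * Z (par (b t) 1 ^ (-δ)) y * y ^ 2)
          * b₁' / (par (b t) 1 * (4 * δ * Real.log (par (b t) 1) ^ 2)))) (Ico 0 T) t := by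
  set D := Ico 0 T
  have hD := uniqueDiffOn_Ico (0 : ℝ) T
  have hbj : ∀ j, ContDiffOn ℝ 1 (fun τ => b τ j) D := fun j => contDiffOn_pi.1 hT.b_smooth j
  have hpar : ∀ τ, par (b τ) 1 = b τ ⟨0, by omega⟩ := fun τ => par_succ (b τ) ⟨0, by omega⟩
  have hparL : ∀ τ, par (b τ) L = b τ ⟨L - 1, by omega⟩ := fun τ => by
    have := par_succ (b τ) ⟨L - 1, by omega⟩
    rwa [show ((⟨L - 1, by omega⟩ : Fin L) : ℕ) + 1 = L by simp; omega] at this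
  set β : ℝ → ℝ := fun τ => par (b τ) 1 with hβ
  have hβe : β = fun τ => b τ ⟨0, by omega⟩ := funext hpar
  set β' : ℝ → ℝ := derivWithin (fun τ => b τ ⟨0, by omega⟩) D with hβ'
  have hβd : ∀ τ ∈ D, HasDerivWithinAt β (β' τ) D τ := fun τ hτ => by
    rw [hβe]; exact ((hbj _).differentiableOn (by simp) τ hτ).hasDerivWithinAt
  have hβ'c : ContinuousOn β' D := (hbj _).continuousOn_derivWithin hD (by simp)
  have hβc : ContinuousOn β D := fun τ hτ => (hβd τ hτ).continuousWithinAt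
  have hLd : HasDerivWithinAt (fun τ => par (b τ) L) (derivWithin (fun τ => b τ ⟨L - 1, by omega⟩) D t) D t := by
    rw [funext hparL]; exact ((hbj _).differentiableOn (by simp) t ht).hasDerivWithinAt
  have hBd : ∀ τ ∈ D, HasDerivWithinAt (fun τ => β τ ^ (-δ)) (β' τ * -δ * β τ ^ (-δ - 1)) D τ := fun τ hτ =>
    (hβd τ hτ).rpow_const (Or.inl (hb τ hτ).ne')
  have hBpos : ∀ τ ∈ D, 0 < β τ ^ (-δ) := fun τ hτ => Real.rpow_pos_of_pos (hb τ hτ) _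
  have hBc : ContinuousOn (fun τ => β τ ^ (-δ)) D := fun τ hτ => (hBd τ hτ).continuousWithinAt
  have hfst : ∀ {f : ℝ → ℝ}, ContinuousOn f D → ContinuousOn (fun z : ℝ × ℝ => f z.1) (D ×ˢ univ) := fun hf =>
    hf.comp continuousOn_fst fun z hz => hz.1
  have hm : MapsTo (fun z : ℝ × ℝ => (β z.1 ^ (-δ), z.2)) (D ×ˢ univ) (Ioi 0 ×ˢ univ) :=
    fun z hz => ⟨hBpos _ hz.1, mem_univ _⟩
  have hBz : ContinuousOn (fun z : ℝ × ℝ => (β z.1 ^ (-δ), z.2)) (D ×ˢ univ) := (hfst hBc).prodMk continuousOn_snd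
  have hX := hasDerivWithinAt_integral_mul (convex_Ico 0 T) ht (r := r)
    (e := fun τ y => y * remR Q₀ (alphaR q p F) u b lam τ y) (E := E)
    (f := fun τ y => Z (β τ ^ (-δ)) y)
    (f' := fun τ y => (-δ * β' τ / β τ) * Z' (β τ ^ (-δ)) y) he hE (hZ.continuousOn.comp hBz hm)
    ((hfst ((continuousOn_const.mul hβ'c).div hβc fun τ hτ => (hb τ hτ).ne')).mul
      (hZ'.continuousOn.comp hBz hm)) hed (fun τ hτ y => by
        refine ((hZd _ (hBpos τ hτ) y).comp_hasDerivWithinAt τ (hBd τ hτ)).congr_deriv ?_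
        have hβ0 : 0 < β τ := hb τ hτ
        have hB0 := hBpos τ hτ
        rw [Real.rpow_sub hβ0, Real.rpow_one]
        field_simp)
  have hlog : HasDerivWithinAt (fun τ => 4 * δ * -Real.log (β τ)) (4 * δ * -(β' t / β t)) D t :=
    (((hβd t ht).log (hb t ht).ne').fun_neg).const_mul (4 * δ)
  have hlt : Real.log (β t) ≤ -1 := (Real.log_le_iff_le_exp (hb t ht)).2 (hb' t ht)
  have hne : 4 * δ * -Real.log (β t) ≠ 0 := by
    have : 0 < -Real.log (β t) := by linarith
    positivity
  have key := hLd.fun_add ((hX.const_mul ((-1) ^ L)).fun_div hlog hne)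
  -- The constraints on r are strict at t, so the same r is admissible at nearby times and the
  -- formula can be differentiated with a fixed interval.
  have ev : ∀ᶠ τ in 𝓝[D] t, bTilde g Q χ δ u b lam τ = par (b τ) L + (-1) ^ L *
      (∫ y in (0 : ℝ)..r, y * remR Q₀ (alphaR q p F) u b lam τ y * Z (β τ ^ (-δ)) y * y ^ 2)
        / (4 * δ * -Real.log (β τ)) := by
    have hB0c : ContinuousWithinAt (fun τ => B0 (β τ) / 4) D t := by
      simp only [B0]
      exact ((continuousWithinAt_const.div (hβc t ht).sqrt (Real.sqrt_pos.2 (hb t ht)).ne').div_const 4)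
    filter_upwards [self_mem_nhdsWithin, ((hBc t ht).const_mul 2).eventually_lt_const hr,
      hB0c.eventually_const_lt hrB] with τ hτ h1 h2
    exact hR.bTilde_eq hχ hF h hT hZeq hτ (hb τ hτ) (hb' τ hτ) h1.le h2
  refine (key.congr_of_eventuallyEq ev (ev.self_of_nhdsWithin ht)).congr_deriv ?_
  subst hb₁'
  have e2 : ∫ y in (0 : ℝ)..r, y * remR Q₀ (alphaR q p F) u b lam t y * ((-δ * β' t / β t) * Z' (β t ^ (-δ)) y) * y ^ 2
      = (∫ y in (0 : ℝ)..r, y * remR Q₀ (alphaR q p F) u b lam t y * Z' (β t ^ (-δ)) y * y ^ 2)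
        * (-δ * β' t / β t) := by
    rw [← intervalIntegral.integral_mul_const]
    exact intervalIntegral.integral_congr fun y _ => by ring
  rw [e2]
  have hl0 : Real.log (β t) ≠ 0 := by linarith
  have hβ0 : β t ≠ 0 := (hb t ht).ne'
  change _ + _ = _ + (-1) ^ L * ((_ + _ * (-δ * β' t / β t)) / (4 * δ * -Real.log (β t))
    + _ * β' t / (β t * (4 * δ * Real.log (β t) ^ 2)))
  field_simp
  ring

end Reduced

/-! ### Collecting the error terms. -/

set_option maxHeartbeats 1000000 in
/-- Bookkeeping of the error terms in the equation of `b̃_L`. -/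
theorem exists_error_bound {δ C₁ C₂ C₃ C₄ C₅ C₆ C₇ : ℝ} (hδ : 0 < δ) (h1 : 0 ≤ C₁) (h2 : 0 ≤ C₂) (h3 : 0 ≤ C₃)
    (h4 : 0 ≤ C₄) (h5 : 0 ≤ C₅) (h6 : 0 ≤ C₆) (h7 : 0 ≤ C₇) : ∃ C, 0 < C ∧
    ∀ (L : ℕ) (β N τ η μ mL X X₁ X₂ I s b' c : ℝ), 1 ≤ L → 0 < τ → τ ≤ 1 → τ ^ 4 = β → 1 ≤ N → β * N ≤ 1 → 0 ≤ η →
      η ≤ β * τ → |mL| ≤ μ → μ ≤ C₁ * (η + β ^ (L + 3)) → |X| ≤ C₂ * η / τ → |X₂| ≤ C₂ * η / τ →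
      |I - 4 * δ * N| ≤ C₃ → s ^ 2 = 1 → |s| = 1 →
      |X₁ + s * mL * I| ≤ η * √(4 * δ * N + C₃)
        + C₄ / τ * ((μ + β) * (C₇ * η) + μ * β + β ^ (L + 3) + (C₇ * η) ^ 2) →
      |b'| ≤ μ + C₅ * β ^ 2 → |c| ≤ C₆ →
      |mL + s * ((X₁ + X₂ * (-δ * b' / β)) / (4 * δ * N) + X * b' / (β * (4 * δ * N ^ 2)))
        + c * β * (s * X / (4 * δ * N))| ≤ C / √N * (η + β ^ (L + 1) / N) := by
  set G := C₇ * C₁ + C₇ + C₁ + 1 + C₇ ^ 2 with hG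
  have hG0 : 0 ≤ G := by positivity
  set Y := C₁ * C₃ + C₄ * G + δ * (C₂ * (2 * C₁ + C₅)) + C₂ * (2 * C₁ + C₅) + C₆ * C₂ with hY
  have hY0 : 0 ≤ Y := by positivity
  -- `Y` collects the errors that carry no logarithm, and the root comes from Cauchy–Schwarz; the
  -- added 1 only ensures positivity.
  refine ⟨(Y + √(4 * δ + C₃) + 1) / (4 * δ), by positivity, ?_⟩
  intro L β N τ η μ mL X X₁ X₂ I s b' c hL hτ hτ1 hτβ hN hβN hη hηβ hmL hμ hX hX₂ hI hs hs' hX₁ hb' hc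
  have hβ : 0 < β := by rw [← hτβ]; positivity
  have hβτ : β ≤ τ := by
    rw [← hτβ]; exact pow_le_of_le_one hτ.le hτ1 (by norm_num)
  have hβ1 : β ≤ 1 := hβτ.trans hτ1
  have hN0 : 0 < N := by linarith
  have hμ0 : 0 ≤ μ := (abs_nonneg _).trans hmL
  have hηβ' : η ≤ β := hηβ.trans (mul_le_of_le_one_right hβ.le hτ1)
  -- The power L+2 splits the available L+3: the spare β pays for the loss 1/τ, and one of the
  -- remaining powers beats the logarithm, as β N ≤ 1.
  set S := η + β ^ (L + 2) with hS
  have hS0 : 0 ≤ S := by positivity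
  have hp1 : β ^ (L + 3) = β ^ (L + 2) * β := by ring
  have hμS : μ ≤ C₁ * S := hμ.trans (by
    have : β ^ (L + 3) ≤ β ^ (L + 2) := by rw [hp1]; exact mul_le_of_le_one_right (by positivity) hβ1
    gcongr
    linarith)
  have hST : S ≤ η + β ^ (L + 1) / N := by
    have : β ^ (L + 2) ≤ β ^ (L + 1) / N := by
      rw [le_div_iff₀ hN0, pow_succ β (L + 1), mul_assoc]
      exact mul_le_of_le_one_right (by positivity) hβN
    linarith
  set κ := 1 / (4 * δ * N) with hκ
  have hκ0 : 0 < κ := by positivity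
  -- The cancellation: s X₁ contains -mL I by s² = 1, so mL appears only through mL (4δN - I),
  -- bounded without the logarithm.
  have hdecomp : mL + s * ((X₁ + X₂ * (-δ * b' / β)) / (4 * δ * N) + X * b' / (β * (4 * δ * N ^ 2)))
        + c * β * (s * X / (4 * δ * N))
      = κ * (mL * (4 * δ * N - I) + s * (X₁ + s * mL * I) + s * (-δ) * (X₂ * (b' / β))
        + s * (X * (b' / β)) / N + c * β * s * X) := by
    rw [hκ]; field_simp; linear_combination -(mL * I * β * N) * hs
  -- The motion of the cut-off and of the logarithm gains this factor τ, which compensates the 1/τ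
  -- in the bounds on X and X₂.
  have hbβ : |b' / β| ≤ (2 * C₁ + C₅) * τ := by
    rw [abs_div, abs_of_pos hβ, div_le_iff₀ hβ]
    have e1 : β ^ (L + 3) ≤ β * τ := by
      calc β ^ (L + 3) ≤ β ^ 2 := pow_le_pow_of_le_one hβ.le hβ1 (by omega)
        _ = β * β := sq β
        _ ≤ β * τ := by gcongr
    calc |b'| ≤ C₁ * (η + β ^ (L + 3)) + C₅ * (β * β) := by rw [← sq]; exact hb'.trans (by gcongr)
      _ ≤ C₁ * (β * τ + β * τ) + C₅ * (β * τ) := by gcongr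
      _ = _ := by ring
  have hXb : ∀ x, |x| ≤ C₂ * η / τ → |x * (b' / β)| ≤ C₂ * (2 * C₁ + C₅) * S := fun x hx => by
    rw [abs_mul]
    calc |x| * |b' / β| ≤ C₂ * η / τ * ((2 * C₁ + C₅) * τ) := by gcongr
      _ = C₂ * (2 * C₁ + C₅) * η := by field_simp
      _ ≤ _ := by
        have : 0 ≤ β ^ (L + 2) := by positivity
        gcongr; linarith
  have hR : C₄ / τ * ((μ + β) * (C₇ * η) + μ * β + β ^ (L + 3) + (C₇ * η) ^ 2) ≤ C₄ * G * S := by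
    have hpow : 0 ≤ β ^ (L + 2) := by positivity
    have e : (μ + β) * (C₇ * η) + μ * β + β ^ (L + 3) + (C₇ * η) ^ 2 ≤ G * (β * S) := by
      have a1 : μ * η ≤ C₁ * (β * S) := by
        calc μ * η ≤ (C₁ * S) * β := by gcongr
          _ = _ := by ring
      have a2 : μ * β ≤ C₁ * (β * S) := by
        calc μ * β ≤ (C₁ * S) * β := by gcongr
          _ = _ := by ring
      have a3 : β * η ≤ β * S := by gcongr; linarith
      have a4 : β ^ (L + 3) ≤ β * S := by
        rw [hp1, mul_comm]; gcongr; linarith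
      have a5 : η * η ≤ β * S := by
        calc η * η ≤ β * η := by gcongr
          _ ≤ _ := a3
      rw [hG]
      linarith [mul_le_mul_of_nonneg_left a1 h7, mul_le_mul_of_nonneg_left a3 h7,
        mul_le_mul_of_nonneg_left a5 (sq_nonneg C₇)]
    calc _ ≤ C₄ / τ * (G * (β * S)) := by gcongr
      _ ≤ C₄ / τ * (G * (τ * S)) := by gcongr
      _ = _ := by field_simp
  have hmI : |mL * (4 * δ * N - I)| ≤ C₁ * C₃ * S := by
    rw [abs_mul, abs_sub_comm]
    calc |mL| * |I - 4 * δ * N| ≤ (C₁ * S) * C₃ := by gcongr; exact hmL.trans hμS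
      _ = _ := by ring
  have hcX : |c * β * s * X| ≤ C₆ * C₂ * S := by
    rw [abs_mul, abs_mul, abs_mul, hs', mul_one, abs_of_pos hβ]
    calc |c| * β * |X| ≤ C₆ * τ * (C₂ * η / τ) := by gcongr
      _ = C₆ * C₂ * η := by field_simp
      _ ≤ _ := by
        have : 0 ≤ β ^ (L + 2) := by positivity
        gcongr; linarith
  have htot : |mL * (4 * δ * N - I) + s * (X₁ + s * mL * I) + s * (-δ) * (X₂ * (b' / β))
        + s * (X * (b' / β)) / N + c * β * s * X| ≤ Y * S + η * √(4 * δ * N + C₃) := by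
    have q1 : |s * (X₁ + s * mL * I)| ≤ η * √(4 * δ * N + C₃) + C₄ * G * S := by
      rw [abs_mul, hs', one_mul]; linarith
    have q2 : |s * (-δ) * (X₂ * (b' / β))| ≤ δ * (C₂ * (2 * C₁ + C₅)) * S := by
      rw [abs_mul, abs_mul, hs', one_mul, abs_neg, abs_of_pos hδ, mul_assoc δ]
      gcongr; exact hXb _ hX₂
    have q3 : |s * (X * (b' / β)) / N| ≤ C₂ * (2 * C₁ + C₅) * S := by
      rw [abs_div, abs_mul, hs', one_mul, abs_of_pos hN0]
      exact (div_le_self (abs_nonneg _) hN).trans (hXb _ hX)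
    rw [hY]
    rw [abs_le] at *
    constructor <;> linarith [hmI.1, hmI.2, q1.1, q1.2, q2.1, q2.2, q3.1, q3.2, hcX.1, hcX.2]
  have hsN := Real.sqrt_pos.2 hN0
  have hsq : √N * √N = N := Real.mul_self_sqrt hN0.le
  have hsN1 : 1 ≤ √N := Real.one_le_sqrt.2 hN
  have hroot : √(4 * δ * N + C₃) ≤ √(4 * δ + C₃) * √N := by
    rw [← Real.sqrt_mul (by positivity)]
    apply Real.sqrt_le_sqrt
    nlinarith
  set U := η + β ^ (L + 1) / N
  have hU : 0 ≤ U := hS0.trans hST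
  have hηU : η ≤ U := by
    have : 0 ≤ β ^ (L + 1) / N := by positivity
    linarith
  have hκN : κ * √N = 1 / (4 * δ) / √N := by
    rw [hκ, eq_div_iff hsN.ne', mul_assoc, hsq]; field_simp
  rw [hdecomp, abs_mul, abs_of_pos hκ0]
  calc κ * _ ≤ κ * (Y * U * √N + U * (√(4 * δ + C₃) * √N)) := by
        have : Y * S ≤ Y * U * √N := by
          calc Y * S ≤ Y * U := by gcongr
            _ ≤ Y * U * √N := le_mul_of_one_le_right (by positivity) hsN1
        have : η * √(4 * δ * N + C₃) ≤ U * (√(4 * δ + C₃) * √N) := by gcongr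
        gcongr
        linarith
    _ = (Y + √(4 * δ + C₃)) * U * (κ * √N) := by ring
    _ = (Y + √(4 * δ + C₃)) / (4 * δ) / √N * U := by rw [hκN]; ring
    _ ≤ _ := by
        gcongr ?_ / _ / _ * _
        linarith

/-! ### Choice of constants and conclusion. -/

theorem rpow_quarter {β : ℝ} (hβ : 0 < β) : (β ^ ((1 : ℝ) / 4)) ^ 4 = β := by
  rw [← Real.rpow_natCast, ← Real.rpow_mul hβ.le]; norm_num

theorem rpow_neg_pow_le {β δ : ℝ} (hβ : 0 < β) (hβ1 : β ≤ 1) {n : ℕ} (h : δ * n ≤ 1 / 4) :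
    (β ^ (-δ)) ^ n ≤ 1 / β ^ ((1 : ℝ) / 4) := by
  rw [← Real.rpow_natCast, ← Real.rpow_mul hβ.le, one_div, ← Real.rpow_neg hβ.le]
  exact Real.rpow_le_rpow_of_exponent_ge hβ hβ1 (by linarith)

theorem mul_neg_log_le_one {β : ℝ} (hβ : 0 < β) : β * -Real.log β ≤ 1 := by
  have h1 := Real.log_le_sub_one_of_pos (inv_pos.2 hβ)
  rw [Real.log_inv] at h1
  calc β * -Real.log β ≤ β * (β⁻¹ - 1) := by gcongr
    _ = 1 - β := by field_simp
    _ ≤ 1 := by linarith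

theorem IsTrapped.sqrt_energy_le {g Q χ : ℝ → ℝ} {L : ℕ} {P : Matrix (Fin L) (Fin L) ℝ} {M K s₀ T : ℝ}
    {u : ℝ → ℝ → ℝ} {b : ℝ → Fin L → ℝ} {lam : ℝ → ℝ} (h : IsTrapped g Q χ P M K s₀ T u b lam) (hK : 0 < K)
    {t : ℝ} (ht : t ∈ Ico 0 T) (hb : 0 < par (b t) 1) (hlog : Real.log (par (b t) 1) ≤ -1) :
    √(energy g Q (L + 1) (eps g Q χ u b lam t)).toReal ≤ √K * par (b t) 1 ^ (L + 1) := by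
  refine Real.sqrt_le_iff.2 ⟨by positivity, ?_⟩
  refine (ENNReal.toReal_le_of_le_ofReal (by positivity) (h.bound_high t ht)).trans ?_
  rw [mul_pow, Real.sq_sqrt hK.le, ← pow_mul, show (L + 1) * 2 = 2 * L + 2 by ring]
  gcongr
  exact div_le_self (by positivity) (by nlinarith)

namespace Reduced
variable {g Q Q₀ q p V : ℝ → ℝ} (hR : Reduced g Q Q₀ q p V)
  {χ : ℝ → ℝ} (hχ : IsCutoff χ) {L : ℕ}
  {F : ℕ → (Fin L → ℝ) → ℝ → ℝ} {F' : ℕ → Fin L → (Fin L → ℝ) → ℝ → ℝ}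
  (hF : ∀ k, SymFamily Q χ k (F k) (F' k)) (h : ∀ k, ProfileRep g Q χ k (F k) (F' k))
include hR hF hχ h

/-- The directions do not depend on time, so the orthogonality relations of the remainder may be
differentiated under the integral. -/
theorem integral_deriv_remR_mul_eq_zero {P : Matrix (Fin L) (Fin L) ℝ} {M K s₀ T : ℝ} {u : ℝ → ℝ → ℝ}
    {b : ℝ → Fin L → ℝ} {lam : ℝ → ℝ} (hT : IsTrapped g Q χ P M K s₀ T u b lam) (hM : 0 < M)
    (hb : ∀ t ∈ Ico 0 T, 0 < par (b t) 1) (hb' : ∀ t ∈ Ico 0 T, par (b t) 1 ≤ Real.exp (-1))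
    (hMB : ∀ t ∈ Ico 0 T, 2 * M < B0 (par (b t) 1) / 4)
    {E : ℝ → ℝ → ℝ} (he : ContinuousOn (fun z : ℝ × ℝ => z.2 * remR Q₀ (alphaR q p F) u b lam z.1 z.2)
      (Ico 0 T ×ˢ univ)) (hE : ContinuousOn (Function.uncurry E) (Ico 0 T ×ˢ univ))
    (hed : ∀ t ∈ Ico 0 T, ∀ y, HasDerivWithinAt (fun τ => y * remR Q₀ (alphaR q p F) u b lam τ y)
        (E t y) (Ico 0 T) t) {t : ℝ} (ht : t ∈ Ico 0 T) {k : ℕ} (hk : k ≤ L) :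
    ∫ y in (0 : ℝ)..(2 * M), E t y * (HR V)^[k] (PhiR g Q χ q V L M) y * y ^ 2 = 0 := by
  have hψ := (hR.smoothEven_HR_iter (hR.smoothEven_PhiR hχ (M := M) L) k).continuous
  have h1 := hasDerivWithinAt_integral_mul (convex_Ico 0 T) ht (r := 2 * M)
    (e := fun τ y => y * remR Q₀ (alphaR q p F) u b lam τ y) (E := E)
    (f := fun _ y => (HR V)^[k] (PhiR g Q χ q V L M) y) (f' := fun _ _ => 0) he hE
    (hψ.comp continuous_snd).continuousOn continuousOn_const hed fun τ _ y => hasDerivWithinAt_const _ _ _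
  have h2 : HasDerivWithinAt (fun τ => ∫ y in (0 : ℝ)..(2 * M), y * remR Q₀ (alphaR q p F) u b lam τ y
      * (HR V)^[k] (PhiR g Q χ q V L M) y * y ^ 2) 0 (Ico 0 T) t := by
    refine (hasDerivWithinAt_const t (Ico 0 T) (0 : ℝ)).congr_of_mem (fun τ hτ => ?_) ht
    refine Eq.trans ?_ (hR.integral_remR_mul_eq_zero hχ hF h hT hτ (hb τ hτ) (hb' τ hτ) hM (hMB τ hτ) hk)
    exact intervalIntegral.integral_congr fun y _ => by ring
  have := (uniqueDiffOn_Ico (0 : ℝ) T t ht).eq_deriv _ h1 h2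
  simpa using this

end Reduced
end HeatFlow

open HeatFlow

set_option maxHeartbeats 2000000 in
/-- Improved control of `b_L`. Renormalized time satisfies `ds / dt = 1 / λ²`, so the derivative
in `s` is `λ²` times the derivative in `t`. -/
theorem lemma3p3 (L : ℕ) (hL : 1 ≤ L) (g Q χ : ℝ → ℝ)
    (hg : HeatFlow.IsTargetProfile g) (hQ : HeatFlow.IsGroundState g Q)
    (hχ : HeatFlow.IsCutoff χ)
    (P : Matrix (Fin L) (Fin L) ℝ) (hP : HeatFlow.Diagonalizes P) :
    ∃ δ₀ > (0 : ℝ), ∃ M₀ > (0 : ℝ), ∃ C₀ > (0 : ℝ),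
      ∀ δ : ℝ, 0 < δ → δ < δ₀ → ∀ M : ℝ, M₀ ≤ M → ∃ C > (0 : ℝ),
        ∀ K : ℝ, 0 < K → ∃ σ > (1 : ℝ), ∀ s₀ : ℝ, σ ≤ s₀ →
          ∀ (T : ℝ) (u : ℝ → ℝ → ℝ) (b : ℝ → Fin L → ℝ) (lam : ℝ → ℝ),
            HeatFlow.IsTrapped g Q χ P M K s₀ T u b lam →
            ∀ t ∈ Set.Ico 0 T,
              |HeatFlow.bTilde g Q χ δ u b lam t - HeatFlow.par (b t) L|
                  ≤ C₀ * HeatFlow.par (b t) 1 ^ ((L : ℝ) + 1 / 2) ∧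
              DifferentiableWithinAt ℝ (HeatFlow.bTilde g Q χ δ u b lam) (Set.Ico 0 T) t ∧
              |lam t ^ 2 * derivWithin (HeatFlow.bTilde g Q χ δ u b lam) (Set.Ico 0 T) t
                  + (2 * (L : ℝ) - 1 + HeatFlow.cb Q χ (HeatFlow.par (b t) 1))
                    * HeatFlow.par (b t) 1 * HeatFlow.bTilde g Q χ δ u b lam t|
                ≤ C / √|Real.log (HeatFlow.par (b t) 1)| *
                    (√(HeatFlow.energy g Q (L + 1) (HeatFlow.eps g Q χ u b lam t)).toReal
                      + HeatFlow.par (b t) 1 ^ (L + 1) / |Real.log (HeatFlow.par (b t) 1)|) := by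
  obtain ⟨Q₀, q, p, V, hR⟩ := hQ.exists_reduced hg
  obtain ⟨W, hW⟩ := hR.exists_taylorData
  choose F F' hFh using fun i => hR.exists_profileRep hχ hW (L := L) i
  have hF := fun i => (hFh i).1
  have h := fun i => (hFh i).2
  obtain ⟨A, hA0, hA⟩ := exists_admissible hL hP
  obtain ⟨m, hm⟩ := hR.exists_abs_remR_le hχ hF h hL
  obtain ⟨Z, hZ, hZeq⟩ := hR.exists_cutForm hχ L
  obtain ⟨Z', hZ', hZd⟩ := hZ.exists_hasDerivAt
  obtain ⟨Cl, n, hCl, hloc⟩ := hR.exists_localized_bound hχ hW hF h hg hL hA0 m hZ hZ' hZeq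
  obtain ⟨c₀, hc₀, hcut⟩ := hR.exists_cutInt_zero_ge hχ
  obtain ⟨C₅, hC₅, hmod⟩ := (coef_modR Q χ (L := L) (m := 2) 0 le_rfl).exists_bound hR hχ hA0
  -- With this δ₀ every polynomial loss of degree at most n + 1 in B costs a multiple of b_1^(-1/4).
  -- The exponent `n` was obtained before M, as the quantifiers require.
  refine ⟨1 / (4 * (n + 1)), by positivity, 1, one_pos, 1, one_pos, fun δ hδ hδ₀ M hM => ?_⟩
  have hM0 : 0 < M := by linarith
  have hδn : δ * (n + 1) < 1 / 4 := by
    rw [lt_div_iff₀ (by positivity)] at hδ₀; linarith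
  have hδ1 : δ * (1 : ℕ) ≤ 1 / 4 := by
    have : 0 ≤ δ * n := by positivity
    push_cast; linarith
  obtain ⟨Cw, hCw, hw⟩ := hm M hM0
  obtain ⟨Cm, βm, hCm, hβm, hmb⟩ := hR.exists_modulation_bound hχ hW hF h hg hA0 m hM
  set C₂ := Cl * 4 ^ n * Cw with hC₂
  obtain ⟨C, hC, herr⟩ := exists_error_bound (C₁ := Cm * (Cw + 1)) (C₂ := C₂) (C₃ := Cl) (C₄ := Cl * 4 ^ n)
    (C₅ := C₅) (C₆ := 2 * L + 1 + 4 * c₀⁻¹) (C₇ := Cw) hδ (by positivity) (by positivity) hCl (by positivity) hC₅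
    (by positivity) hCw
  refine ⟨C, hC, fun K hK => ?_⟩
  -- Upper bound for b_1^(1/4). In order, the entries ensure 3B < B_0/4, the inclusion of y ≤ 2M in
  -- the inner region, the smallness needed for the modulation bound, η ≤ b_1 b_1^(1/4), and the
  -- constant 1 in the first claim. K enters only here, so C does not depend on it.
  set τ₀ : ℝ := min (1 / 13) (min (1 / (8 * M + 1)) (min (βm / (Cw + 1)) (min (1 / (√K + 1))
    (4 * δ / (C₂ * √K + 1))))) with hτ₀
  have hτ₀0 : 0 < τ₀ := by
    have : 0 < C₂ * √K + 1 := by positivity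
    positivity
  obtain ⟨σ, hσ, hadm⟩ := hA (τ₀ ^ 4) (by positivity)
  refine ⟨σ, hσ, fun s₀ hs₀ T u b lam hT t ht => ?_⟩
  have hD := hadm g Q χ M K s₀ T u b lam hs₀ hT
  have hT0 : 0 < T := ht.1.trans_lt ht.2
  have q1 : τ₀ ≤ 1 / 13 := min_le_left _ _
  have q2 : τ₀ ≤ 1 / (8 * M + 1) := (min_le_right _ _).trans (min_le_left _ _)
  have q3 : τ₀ ≤ βm / (Cw + 1) := (min_le_right _ _).trans ((min_le_right _ _).trans (min_le_left _ _))
  have q4 : τ₀ ≤ 1 / (√K + 1) := (min_le_right _ _).trans ((min_le_right _ _).trans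
    ((min_le_right _ _).trans (min_le_left _ _)))
  have q5 : τ₀ ≤ 4 * δ / (C₂ * √K + 1) := (min_le_right _ _).trans ((min_le_right _ _).trans
    ((min_le_right _ _).trans (min_le_right _ _)))
  have hb : ∀ t ∈ Ico 0 T, 0 < par (b t) 1 := fun t ht => (hD t ht).1.pos
  have hb' : ∀ t ∈ Ico 0 T, par (b t) 1 ≤ Real.exp (-1) := fun t ht => by
    refine (hD t ht).2.trans ?_
    have h1 : τ₀ ^ 4 ≤ (1 / 13) ^ 4 := by gcongr
    have h2 := Real.add_one_le_exp (-1 / 2 : ℝ)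
    have h3 : Real.exp (-1) = Real.exp (-1 / 2) * Real.exp (-1 / 2) := by rw [← Real.exp_add]; norm_num
    nlinarith
  have hMB : ∀ t ∈ Ico 0 T, 8 * M + 1 ≤ B0 (par (b t) 1) := fun t ht => by
    refine le_B0 (hb t ht) (by positivity) ((hD t ht).2.trans ?_)
    calc τ₀ ^ 4 ≤ τ₀ ^ 2 := pow_le_pow_of_le_one hτ₀0.le (by linarith) (by norm_num)
      _ ≤ _ := by gcongr
  have hMB' : ∀ t ∈ Ico 0 T, 2 * M < B0 (par (b t) 1) / 4 := fun t ht => by linarith [hMB t ht]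
  obtain ⟨he, E, hE, hed, hEeq⟩ := hR.exists_hasDerivWithinAt_rem hχ hF h hg hT hT0 hb
  set β := par (b t) 1 with hβdef
  have hβ : 0 < β := hb t ht
  have hβ1 : β ≤ 1 := (hD t ht).1.le_one
  set τ := β ^ ((1 : ℝ) / 4) with hτ
  have hτ0 : 0 < τ := Real.rpow_pos_of_pos hβ _
  have hτβ : τ ^ 4 = β := rpow_quarter hβ
  have hττ₀ : τ ≤ τ₀ := by
    rw [← pow_le_pow_iff_left₀ hτ0.le hτ₀0.le (by norm_num : 4 ≠ 0), hτβ]; exact (hD t ht).2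
  have hτ1 : τ ≤ 1 := by linarith
  have hβτ : β ≤ τ := by rw [← hτβ]; exact pow_le_of_le_one hτ0.le hτ1 (by norm_num)
  set N := -Real.log β with hN
  have hlog : Real.log β ≤ -1 := (Real.log_le_iff_le_exp hβ).2 (hb' t ht)
  have hN1 : 1 ≤ N := by rw [hN]; linarith
  have hβN : β * N ≤ 1 := mul_neg_log_le_one hβ
  have habs : |Real.log β| = N := abs_of_neg (by linarith)
  set η := √(energy g Q (L + 1) (eps g Q χ u b lam t)).toReal with hη
  have hη0 : 0 ≤ η := Real.sqrt_nonneg _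
  have hηK : η ≤ √K * β ^ (L + 1) := hT.sqrt_energy_le hK ht hβ hlog
  have hKτ : √K * τ ≤ 1 := by
    calc √K * τ ≤ (√K + 1) * (1 / (√K + 1)) := by gcongr <;> linarith
      _ = 1 := by field_simp
  have hηβ : η ≤ β * τ := by
    calc η ≤ √K * β ^ (L + 1) := hηK
      _ ≤ √K * β ^ 2 := by
        have := pow_le_pow_of_le_one hβ.le hβ1 (show 2 ≤ L + 1 by omega)
        gcongr
      _ = (√K * τ) * (β * τ * τ ^ 2) := by
        have : β ^ 2 = β * τ ^ 4 := by rw [hτβ]; ring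
        rw [this]; ring
      _ ≤ 1 * (β * τ * 1) := by
        have := pow_le_one₀ (n := 2) hτ0.le hτ1
        gcongr
      _ = β * τ := by ring
  set B := β ^ (-δ) with hB
  have hB1 : 1 ≤ B := Real.one_le_rpow_of_pos_of_le_one_of_nonpos hβ hβ1 (by linarith)
  have hBτ : B ≤ 1 / τ := by
    have := rpow_neg_pow_le hβ hβ1 hδ1
    rwa [pow_one] at this
  have hBn : (1 + 3 * B) ^ n ≤ 4 ^ n / τ := by
    have := rpow_neg_pow_le hβ hβ1 (n := n) (by linarith : δ * n ≤ 1 / 4)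
    calc (1 + 3 * B) ^ n ≤ (4 * B) ^ n := by gcongr; linarith
      _ = 4 ^ n * B ^ n := mul_pow _ _ _
      _ ≤ 4 ^ n * (1 / τ) := by gcongr
      _ = _ := by ring
  have hBB : 3 * B < B0 β / 4 := by
    have h1 : 13 / τ ≤ B0 β := by
      refine le_B0 hβ (by positivity) ?_
      have h2 : τ ≤ 1 / 13 := hττ₀.trans q1
      calc β = τ ^ 2 * τ ^ 2 := by rw [← hτβ]; ring
        _ ≤ (1 / 13) ^ 2 * τ ^ 2 := by gcongr
        _ = (1 / (13 / τ)) ^ 2 := by field_simp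
    have h2 : 12 * B < 13 / τ := by
      calc 12 * B ≤ 12 * (1 / τ) := by gcongr
        _ < 13 / τ := by
          rw [mul_one_div]; gcongr; norm_num
    linarith
  have hwt : SmoothEven (remR Q₀ (alphaR q p F) u b lam t) :=
    (eps_eq_of_smoothOdd (lam := lam) hR.Q₀_odd (hR.smoothEven_alphaR hF (b t)) (hT.smoothOdd ht)).1
  have hwb := hw P K s₀ T u b lam hT t ht hβ (hb' t ht) (by linarith [hMB t ht]) (hMB' t ht)
  have hEc : Continuous (E t) := continuousOn_univ.1
    (hE.comp (f := fun y => (t, y)) (by fun_prop) fun y _ => ⟨ht, mem_univ _⟩)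
  have hGc : Continuous fun y => lam t ^ 2 * E t y := by fun_prop
  have hGeq : ∀ y, 0 < y → lam t ^ 2 * E t y = remRHS g Q χ q p V F F' (b t)
      (remR Q₀ (alphaR q p F) u b lam t) (modLam T b lam t) (fun j => modPar Q χ T b lam j t) y := hEeq t ht
  have hlin : ∀ r (ψ : ℝ → ℝ), ∫ y in (0 : ℝ)..r, lam t ^ 2 * E t y * ψ y * y ^ 2
      = lam t ^ 2 * ∫ y in (0 : ℝ)..r, E t y * ψ y * y ^ 2 := fun r ψ => by
    rw [← intervalIntegral.integral_const_mul]
    exact intervalIntegral.integral_congr fun y _ => by ring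
  set mp : Fin L → ℝ := fun j => modPar Q χ T b lam j t with hmp
  set μ := |modLam T b lam t| + ∑ j, |mp j| with hμ
  have hβm' : τ * (Cw + 1) ≤ βm := by
    have := hττ₀.trans q3
    rwa [le_div_iff₀ (by positivity)] at this
  have hμb : μ ≤ Cm * (Cw + 1) * (η + β ^ (L + 3)) := by
    have h1 := hmb (b t) _ (fun y => lam t ^ 2 * E t y) (modLam T b lam t) mp (Cw * η) (hD t ht).1 hwt (hMB' t ht)
      (by positivity) (by nlinarith) (by nlinarith)
      (fun y hy hyM => hwb y ⟨hβ, hy, hyM.trans_lt (hMB' t ht)⟩) hGc.continuousOn (fun y hy _ => hGeq y hy)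
      (fun k hk => by
        rw [hlin, hR.integral_deriv_remR_mul_eq_zero hχ hF h hT hM0 hb hb' hMB' he hE hed ht hk, mul_zero])
    refine h1.trans ?_
    rw [mul_assoc]
    have : 0 ≤ Cw * β ^ (L + 3) := by positivity
    gcongr
    linarith
  obtain ⟨hX, hX₂, I, hI, hX₁⟩ := hloc (b t) _ (fun y => lam t ^ 2 * E t y) (modLam T b lam t) mp B η (Cw * η)
    (hD t ht).1 hwt hB1 hBB hη0 (by positivity)
    (fun y hy hyM => hwb y ⟨hβ, hy, hyM.trans_lt hBB⟩) hGc.continuousOn (fun y hy _ => hGeq y hy) (by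
      rw [hη, Real.sq_sqrt ENNReal.toReal_nonneg]
      exact hR.integral_sq_le_energy hwt (by linarith)
        (fun y hy hyB => hR.eps_eq hχ hF h hT ht ⟨hβ, hy, hyB.trans hBB⟩ (hb' t ht)) _
        ((hT.bound_high t ht).trans_lt ENNReal.ofReal_lt_top).ne)
  have hlogB : Real.log B = δ * N := by rw [hB, Real.log_rpow hβ, hN]; ring
  rw [hlogB, ← mul_assoc] at hI hX₁
  have hgrow : Cl * (1 + 3 * B) ^ n ≤ Cl * 4 ^ n / τ := by
    rw [mul_div_assoc]; gcongr
  have hX' := hX.trans (mul_le_mul_of_nonneg_right hgrow (by positivity))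
  have hX₂' := hX₂.trans (mul_le_mul_of_nonneg_right hgrow (by positivity))
  rw [show Cl * 4 ^ n / τ * (Cw * η) = C₂ * η / τ by rw [hC₂]; ring] at hX' hX₂'
  have hX₁' := hX₁.trans (add_le_add_right (mul_le_mul_of_nonneg_right hgrow (by positivity)) _)
  rw [hlin] at hX₁'
  have hbt := hR.bTilde_eq hχ hF h hT hZeq ht hβ (hb' t ht) (δ := δ) (by linarith : 2 * B ≤ 3 * B) hBB
  have hder := hR.hasDerivWithinAt_bTilde hχ hF h hT hZ hZeq hL hδ hZ' hZd hb hb' he hE hed ht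
    (by linarith : 2 * B < 3 * B) hBB rfl
  set X := ∫ y in (0 : ℝ)..(3 * B), y * remR Q₀ (alphaR q p F) u b lam t y * Z B y * y ^ 2
  set X₂ := ∫ y in (0 : ℝ)..(3 * B), y * remR Q₀ (alphaR q p F) u b lam t y * Z' B y * y ^ 2
  set X₁ := ∫ y in (0 : ℝ)..(3 * B), E t y * Z B y * y ^ 2
  set b₁' := derivWithin (fun τ => b τ ⟨0, by omega⟩) (Ico 0 T) t
  set bL' := derivWithin (fun τ => b τ ⟨L - 1, by omega⟩) (Ico 0 T) t
  refine ⟨?_, hder.differentiableWithinAt, ?_⟩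
  · rw [hbt, add_sub_cancel_left, one_mul, abs_div, abs_mul, abs_neg_one_pow, one_mul,
      abs_of_pos (by positivity : 0 < 4 * δ * N), div_le_iff₀ (by positivity)]
    -- With τ = b_1^(1/4), the pairing is of order √K b_1^(L+1)/τ = √K τ · b_1^L τ²; the spare τ
    -- absorbs √K and 1/δ.
    have hp : β ^ ((L : ℝ) + 1 / 2) = β ^ L * τ ^ 2 := by
      rw [Real.rpow_add hβ, Real.rpow_natCast, hτ, ← Real.rpow_natCast (β ^ ((1 : ℝ) / 4)),
        ← Real.rpow_mul hβ.le]
      norm_num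
    have hq : C₂ * √K * τ ≤ 4 * δ := by
      have := hττ₀.trans q5
      rw [le_div_iff₀ (by positivity)] at this
      linarith
    calc |X| ≤ C₂ * η / τ := hX'
      _ ≤ C₂ * (√K * β ^ (L + 1)) / τ := by gcongr
      _ = C₂ * √K * τ * (β ^ L * τ ^ 2) := by
        rw [pow_succ, ← hτβ]; field_simp
      _ ≤ 4 * δ * (β ^ L * τ ^ 2) := by gcongr
      _ ≤ 4 * δ * (β ^ L * τ ^ 2) * N := le_mul_of_one_le_right (by positivity) hN1
      _ = _ := by rw [hp]; ring
  · rw [hder.derivWithin (uniqueDiffOn_Ico (0 : ℝ) T t ht), hbt, habs, cb_eq hβ]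
    have hmL : |mp ⟨L - 1, by omega⟩| ≤ μ := by
      have := Finset.single_le_sum (f := fun j => |mp j|) (fun j _ => abs_nonneg _)
        (Finset.mem_univ (⟨L - 1, by omega⟩ : Fin L))
      have := abs_nonneg (modLam T b lam t)
      linarith
    have hm0 : |mp ⟨0, by omega⟩| ≤ μ := by
      have := Finset.single_le_sum (f := fun j => |mp j|) (fun j _ => abs_nonneg _)
        (Finset.mem_univ (⟨0, by omega⟩ : Fin L))
      have := abs_nonneg (modLam T b lam t)
      linarith
    -- (b_1)_s is its own modulation defect minus a leading part of weight 2.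
    have hbd : |lam t ^ 2 * b₁'| ≤ μ + C₅ * β ^ 2 := by
      have e : lam t ^ 2 * b₁' = mp ⟨0, by omega⟩ - modR Q χ 0 (b t) := by
        rw [hmp]; simp only [modPar]; ring
      have h2 := hmod (b t) (hD t ht).1
      norm_num at h2
      rw [e]
      exact (abs_sub _ _).trans (add_le_add hm0 (by exact_mod_cast h2))
    have hcbd : |2 * (L : ℝ) - 1 + 4 * (cutInt Q χ 0 β)⁻¹| ≤ 2 * L + 1 + 4 * c₀⁻¹ := by
      have h1 := hcut β hβ hβ1
      have h2 : (cutInt Q χ 0 β)⁻¹ ≤ c₀⁻¹ := inv_anti₀ hc₀ h1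
      have h3 : 0 < (cutInt Q χ 0 β)⁻¹ := inv_pos.2 (hc₀.trans_le h1)
      have hL' : (1 : ℝ) ≤ L := by exact_mod_cast hL
      rw [abs_of_pos (by linarith)]
      linarith
    -- The equation of b_L has no forcing from b_{L+1}, which is zero; its defect is therefore the
    -- left-hand side of the claim before correction.
    have hmLe : mp ⟨L - 1, by omega⟩ = lam t ^ 2 * bL'
        + (2 * (L : ℝ) - 1 + 4 * (cutInt Q χ 0 β)⁻¹) * β * par (b t) L := by
      rw [hmp]; simp only [modPar, modR]
      rw [show L - 1 + 1 = L by omega, show L - 1 + 2 = L + 1 by omega, par_of_lt (b t) (Nat.lt_succ_self L),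
        Nat.cast_sub hL]
      push_cast
      ring
    refine le_trans (le_of_eq ?_) (herr L β N τ η μ (mp ⟨L - 1, by omega⟩) X (lam t ^ 2 * X₁) X₂ I ((-1) ^ L)
      (lam t ^ 2 * b₁') (2 * (L : ℝ) - 1 + 4 * (cutInt Q χ 0 β)⁻¹) hL hτ0 hτ1 hτβ hN1 hβN hη0 hηβ hmL hμb hX' hX₂' hI
      (by rw [← pow_mul, mul_comm, pow_mul]; norm_num) (abs_neg_one_pow L) hX₁' hbd hcbd)
    congr 1
    rw [hmLe, show Real.log β ^ 2 = N ^ 2 by rw [hN, neg_sq]]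
    ring
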